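/- Let $\mathbb K$ be an algebraically closed field of characteristic zero and let $n\ge 2$. Let $B=(B_{ab})_{0\le a,b\le n-1}$ be the Cartan matrix of $A(n-1,0)$: $B_{00}=0$, $B_{aa}=2$ for $a\ge 1$, $B_{ab}=-1$ if $|a-b|=1$, and $B_{ab}=0$ otherwise. Let $\widetilde W(A_{n-1})$ be the Lie superalgebra over $\mathbb K$ with even generators $e_i,f_i$ ($1\le i\le n-1$) and $h_a$ ($0\le a\le n-1$), odd generators $e_0$ and $f_{0a}$ ($a=0,2,3,\dots,n-1$), and the following relations, in which indices run over all values for which the generators involved are defined (so $f_a$ requires $a\neq0$ and $f_{0a}$ requires $a\neq 1$) unless restricted further: $$[h_a,e_b]=B_{ab}e_b,\qquad [h_a,f_b]=-B_{ab}f_b,\qquad [e_a,f_b]=\delta_{ab}h_b,$$ $$(\mathrm{ad}\,e_a)^{1-B_{ab}}(e_b)=0\ \ (a\neq b\text{ or }a=b=0),\qquad (\mathrm{ad}\,f_a)^{1-B_{ab}}(f_b)=0\ \ (a\neq b),$$ $$[e_0,f_{0a}]=h_a,\qquad [h_a,f_{0b}]=-B_{a0}f_{0b},\qquad [e_1,f_{0a}]=0,$$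 $$[e_a,[e_a,f_{0b}]]=[f_a,[f_a,f_{0b}]]=0,\qquad [e_i,[f_j,f_{0a}]]=\delta_{ij}B_{aj}f_{0j}\ \ (i,j\ge 2).$$ Grade $\widetilde W(A_{n-1})$ over $\mathbb Z$ by giving $e_0$ level $1$, each $f_{0a}$ level $-1$ and every other generator level $0$; its local part is the sum of the levels $-1,0,1$. Then: (1) Among the ($\mathbb Z_2$-graded) ideals of $\widetilde W(A_{n-1})$ that intersect the local part trivially there is a largest one, $J$, and $W(A_{n-1}):=\widetilde W(A_{n-1})/J$ is isomorphic, as a Lie superalgebra, to the Cartan type superalgebra $W(n)=\mathrm{der}\,\Lambda(n)$, the Lie superalgebra spanned by the even and odd superderivations of the Grassmann algebra $\Lambda(n)$ on $n$ odd generators. (2) The ideal $J$ is generated by the elements $[f_{0a},f_{0b}]$ ($a,b\in\{0,2,3,\dots,n-1\}$), $[f_{0i},[f_{0j},f_1]]$ and $[f_{02}-f_{00},[f_{0j},f_1]]$ ($i,j=3,\dots,n-1$). (3) Consequently $W(n)$ is isomorphic to the Lie superalgebra with the above generators and relations together with the relations $[f_{0a},f_{0b}]=[f_{0i},[f_{0j},f_1]]=[f_{02}-f_{00},[f_{0j},f_1]]=0$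 (with the index ranges of (2)). -/

import Mathlib

noncomputable section

universe u v w

/-- The sign `(-1)^{ij}` for parities `i, j`. -/
def superSign (K : Type u) [Field K] (i j : ZMod 2) : K := (-1) ^ (i * j).val

/-- A Lie superalgebra over a field `K` (of characteristic different from 2 and 3). -/
structure LieSuperalgebra (K : Type u) [Field K] where
  carrier : Type v
  [addCommGroup : AddCommGroup carrier]
  [module : Module K carrier]
  bracket : carrier →ₗ[K] carrier →ₗ[K] carrier
  /-- `part 0` is the even part, `part 1` is the odd part. -/
  part : ZMod 2 → Submodule K carrier
  isCompl : IsCompl (part 0) (part 1)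
  bracket_mem : ∀ i j, ∀ x ∈ part i, ∀ y ∈ part j, bracket x y ∈ part (i + j)
  skew : ∀ i j, ∀ x ∈ part i, ∀ y ∈ part j,
    bracket x y = -(superSign K i j • bracket y x)
  jacobi : ∀ i j, ∀ x ∈ part i, ∀ y ∈ part j, ∀ z,
    bracket x (bracket y z) =
      bracket (bracket x y) z + superSign K i j • bracket y (bracket x z)

/-- The bracket on a quotient by a two-sided ideal of a (not necessarily associative) product. -/
def quotientBracket {K : Type u} [Field K] {V : Type v} [AddCommGroup V] [Module K V]
    (b : V →ₗ[K] V →ₗ[K] V) (I : Submodule K V)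
    (hl : ∀ x, ∀ y ∈ I, b x y ∈ I) (hr : ∀ x ∈ I, ∀ y, b x y ∈ I) :
    (V ⧸ I) →ₗ[K] (V ⧸ I) →ₗ[K] (V ⧸ I) :=
  I.liftQ ((Submodule.mapQLinear I I).comp
      (b.codRestrict (Submodule.compatibleMaps I I) (fun x y hy => hl x y hy))) (by
    intro x hx
    rw [LinearMap.mem_ker]
    refine Submodule.linearMap_qext _ (LinearMap.ext fun y => ?_)
    exact (Submodule.Quotient.mk_eq_zero I).2 (hr x hx y))

theorem quotientBracket_mk {K : Type u} [Field K] {V : Type v} [AddCommGroup V] [Module K V]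
    (b : V →ₗ[K] V →ₗ[K] V) (I : Submodule K V)
    (hl : ∀ x, ∀ y ∈ I, b x y ∈ I) (hr : ∀ x ∈ I, ∀ y, b x y ∈ I) (x y : V) :
    quotientBracket b I hl hr (I.mkQ x) (I.mkQ y) = I.mkQ (b x y) := rfl

namespace LieSuperalgebra

attribute [instance] LieSuperalgebra.addCommGroup LieSuperalgebra.module

variable {K : Type u} [Field K]

instance (L : LieSuperalgebra.{u, v} K) : Bracket L.carrier L.carrier :=
  ⟨fun x y => L.bracket x y⟩

/-- An isomorphism of Lie superalgebras: an even bijective linear map preserving the bracket. -/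
structure Iso (L : LieSuperalgebra.{u, v} K) (M : LieSuperalgebra.{u, w} K) where
  toLinearEquiv : L.carrier ≃ₗ[K] M.carrier
  map_bracket : ∀ x y : L.carrier, toLinearEquiv ⁅x, y⁆ = ⁅toLinearEquiv x, toLinearEquiv y⁆
  map_part : ∀ i, ∀ x ∈ L.part i, toLinearEquiv x ∈ M.part i

/-- An ideal of a Lie superalgebra: a `ℤ/2`-graded subspace stable under brackets. By
super-antisymmetry a graded left ideal is two-sided. -/
structure Ideal (L : LieSuperalgebra.{u, v} K) where
  toSubmodule : Submodule K L.carrier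
  bracket_mem : ∀ x : L.carrier, ∀ y ∈ toSubmodule, ⁅x, y⁆ ∈ toSubmodule
  graded : ∀ x ∈ L.part 0, ∀ y ∈ L.part 1, x + y ∈ toSubmodule →
    x ∈ toSubmodule ∧ y ∈ toSubmodule

variable {L : LieSuperalgebra.{u, v} K}

theorem Ideal.toSubmodule_injective :
    Function.Injective (Ideal.toSubmodule : L.Ideal → Submodule K L.carrier) := by
  rintro ⟨I, _, _⟩ ⟨J, _, _⟩ h
  cases h
  rfl

/-- Ideals are ordered by inclusion. -/
instance : PartialOrder L.Ideal := PartialOrder.lift _ Ideal.toSubmodule_injective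

theorem exists_add (x : L.carrier) : ∃ y ∈ L.part 0, ∃ z ∈ L.part 1, y + z = x :=
  Submodule.mem_sup.1 (L.isCompl.sup_eq_top ▸ Submodule.mem_top)

theorem Ideal.bracket_mem_left (I : L.Ideal) (x : L.carrier) (hx : x ∈ I.toSubmodule)
    (y : L.carrier) : L.bracket x y ∈ I.toSubmodule := by
  have key : ∀ i j, ∀ x ∈ L.part i, ∀ y ∈ L.part j, x ∈ I.toSubmodule →
      L.bracket x y ∈ I.toSubmodule := by
    intro i j x hx y hy hI
    rw [L.skew i j x hx y hy]
    exact neg_mem (Submodule.smul_mem _ _ (I.bracket_mem y x hI))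
  obtain ⟨x0, hx0, x1, hx1, rfl⟩ := exists_add x
  obtain ⟨y0, hy0, y1, hy1, rfl⟩ := exists_add y
  obtain ⟨h0, h1⟩ := I.graded x0 hx0 x1 hx1 hx
  simp only [map_add, LinearMap.add_apply]
  exact add_mem (add_mem (key _ _ _ hx0 _ hy0 h0) (key _ _ _ hx1 _ hy0 h1))
    (add_mem (key _ _ _ hx0 _ hy1 h0) (key _ _ _ hx1 _ hy1 h1))

/-- The ideal generated by a set of elements. -/
def idealSpan (L : LieSuperalgebra.{u, v} K) (S : Set L.carrier) : L.Ideal where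
  toSubmodule := sInf {N | ∃ I : L.Ideal, S ⊆ I.toSubmodule ∧ N = I.toSubmodule}
  bracket_mem x y hy := by
    rw [Submodule.mem_sInf] at hy ⊢
    rintro _ ⟨I, hI, rfl⟩
    exact I.bracket_mem x y (hy _ ⟨I, hI, rfl⟩)
  graded x hx y hy h := by
    simp only [Submodule.mem_sInf] at h ⊢
    constructor
    · rintro _ ⟨I, hI, rfl⟩
      exact (I.graded x hx y hy (h _ ⟨I, hI, rfl⟩)).1
    · rintro _ ⟨I, hI, rfl⟩
      exact (I.graded x hx y hy (h _ ⟨I, hI, rfl⟩)).2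

/-- The quotient of a Lie superalgebra by an ideal. -/
def quotient (L : LieSuperalgebra.{u, v} K) (I : L.Ideal) : LieSuperalgebra.{u, v} K where
  carrier := L.carrier ⧸ I.toSubmodule
  bracket := quotientBracket L.bracket I.toSubmodule I.bracket_mem I.bracket_mem_left
  part i := (L.part i).map I.toSubmodule.mkQ
  isCompl := by
    constructor
    · rw [Submodule.disjoint_def]
      rintro _ ⟨x, hx, rfl⟩ ⟨y, hy, hxy⟩
      have h : x + -y ∈ I.toSubmodule := by
        rw [← sub_eq_add_neg]
        exact (Submodule.Quotient.eq _).1 hxy.symm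
      exact (Submodule.Quotient.mk_eq_zero _).2 (I.graded x hx (-y) (neg_mem hy) h).1
    · rw [codisjoint_iff, ← Submodule.map_sup, L.isCompl.sup_eq_top, Submodule.map_top,
        Submodule.range_mkQ]
  bracket_mem := by
    rintro i j _ ⟨x, hx, rfl⟩ _ ⟨y, hy, rfl⟩
    exact ⟨_, L.bracket_mem i j x hx y hy, rfl⟩
  skew := by
    rintro i j _ ⟨x, hx, rfl⟩ _ ⟨y, hy, rfl⟩
    rw [quotientBracket_mk, quotientBracket_mk, L.skew i j x hx y hy, map_neg, map_smul]
  jacobi := by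
    rintro i j _ ⟨x, hx, rfl⟩ _ ⟨y, hy, rfl⟩ z
    obtain ⟨z, rfl⟩ := I.toSubmodule.mkQ_surjective z
    simp only [quotientBracket_mk]
    rw [L.jacobi i j x hx y hy z, map_add, map_smul]

/-- The projection onto the quotient. -/
def quotientMap (L : LieSuperalgebra.{u, v} K) (I : L.Ideal) :
    L.carrier →ₗ[K] (L.quotient I).carrier := I.toSubmodule.mkQ

end LieSuperalgebra

/-! ### Derivation superalgebras -/

section Der

variable {K : Type u} [Field K] {A : Type v} [Ring A] [Algebra K A]

/-- The derivations of parity `i` of a superalgebra `A` with `ℤ/2`-grading `G`: linear maps of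
parity `i` that satisfy the super Leibniz rule. -/
def superDer (G : ZMod 2 → Submodule K A) (i : ZMod 2) : Submodule K (Module.End K A) where
  carrier := {d | (∀ j, ∀ x ∈ G j, d x ∈ G (i + j)) ∧
    ∀ j, ∀ x ∈ G j, ∀ y, d (x * y) = d x * y + superSign K i j • (x * d y)}
  zero_mem' := by simp
  add_mem' := by
    rintro c d ⟨hc, hc'⟩ ⟨hd, hd'⟩
    refine ⟨fun j x hx => add_mem (hc j x hx) (hd j x hx), fun j x hx y => ?_⟩
    simp only [LinearMap.add_apply, hc' j x hx y, hd' j x hx y, add_mul, mul_add, smul_add]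
    abel
  smul_mem' := by
    rintro r d ⟨hd, hd'⟩
    refine ⟨fun j x hx => Submodule.smul_mem _ _ (hd j x hx), fun j x hx y => ?_⟩
    simp only [LinearMap.smul_apply, hd' j x hx y, smul_add, smul_mul_assoc, mul_smul_comm]
    rw [smul_comm]

theorem superSign_zero_left (i : ZMod 2) : superSign K 0 i = 1 := by simp [superSign]

theorem superSign_zero_right (i : ZMod 2) : superSign K i 0 = 1 := by simp [superSign]

theorem superSign_one_one : superSign K 1 1 = -1 := by
  have : ((1 : ZMod 2) * 1).val = 1 := by decide
  rw [superSign, this, pow_one]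

theorem superSign_comm (i j : ZMod 2) : superSign K i j = superSign K j i := by
  rw [superSign, superSign, mul_comm]

theorem superSign_mul_self (i j : ZMod 2) : superSign K i j * superSign K i j = 1 := by
  rw [superSign, ← mul_pow]
  simp

theorem superSign_add_left (i j k : ZMod 2) :
    superSign K (i + j) k = superSign K i k * superSign K j k := by
  have h11 : (1 : ZMod 2) + 1 = 0 := by decide
  have h : ∀ a : ZMod 2, a = 0 ∨ a = 1 := by decide
  rcases h i with rfl | rfl <;> rcases h j with rfl | rfl <;> rcases h k with rfl | rfl <;>
    simp [superSign_zero_left, superSign_zero_right, superSign_one_one, h11]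

theorem superSign_add_right (i j k : ZMod 2) :
    superSign K i (j + k) = superSign K i j * superSign K i k := by
  rw [superSign_comm, superSign_add_left, superSign_comm j, superSign_comm k]

theorem superDer_bracket_mem (G : ZMod 2 → Submodule K A) (i j k : ZMod 2) (hk : i + j = k)
    {c d : Module.End K A} (hc : c ∈ superDer G i) (hd : d ∈ superDer G j) :
    c * d - superSign K i j • (d * c) ∈ superDer G k := by
  subst hk
  obtain ⟨hc, hc'⟩ := hc
  obtain ⟨hd, hd'⟩ := hd
  refine ⟨fun l x hx => ?_, fun l x hx y => ?_⟩
  · refine sub_mem ?_ (Submodule.smul_mem _ _ ?_)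
    · rw [add_assoc]
      exact hc _ _ (hd _ _ hx)
    · rw [add_comm i j, add_assoc]
      exact hd _ _ (hc _ _ hx)
  · simp only [LinearMap.sub_apply, LinearMap.smul_apply, Module.End.mul_apply,
      hc' l x hx y, hd' l x hx y, map_add, map_smul, hc' (j + l) _ (hd l x hx) y,
      hd' (i + l) _ (hc l x hx) y, hc' l x hx (d y), hd' l x hx (c y),
      superSign_add_left, superSign_add_right, sub_mul, mul_sub, smul_mul_assoc, mul_smul_comm]
    rw [superSign_comm j i]
    have h := superSign_mul_self (K := K) i j
    simp only [smul_add, smul_sub, smul_smul]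
    have e1 : superSign K i j * (superSign K i j * superSign K j l) = superSign K j l := by
      rw [← mul_assoc, h, one_mul]
    rw [e1]
    module

/-- The bracket `c ∘ d - (-1)^{ij} d ∘ c` of derivations of parities `i` and `j`. -/
def superDerBracket (G : ZMod 2 → Submodule K A) (i j k : ZMod 2) (hk : i + j = k) :
    superDer G i →ₗ[K] superDer G j →ₗ[K] superDer G k :=
  LinearMap.mk₂ K
    (fun c d => ⟨c.1 * d.1 - superSign K i j • (d.1 * c.1),
      superDer_bracket_mem G i j k hk c.2 d.2⟩)
    (by intro a b c; ext1; simp only [Submodule.coe_add, add_mul, mul_add, smul_add]; abel)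
    (by intro r b c; ext1; simp only [Submodule.coe_smul, smul_mul_assoc, mul_smul_comm]; module)
    (by intro a b c; ext1; simp only [Submodule.coe_add, add_mul, mul_add, smul_add]; abel)
    (by intro r b c; ext1; simp only [Submodule.coe_smul, smul_mul_assoc, mul_smul_comm]; module)

@[simp]
theorem superDerBracket_coe (G : ZMod 2 → Submodule K A) (i j k : ZMod 2) (hk : i + j = k)
    (c : superDer G i) (d : superDer G j) :
    (superDerBracket G i j k hk c d : Module.End K A) =
      c.1 * d.1 - superSign K i j • (d.1 * c.1) := rfl

/-- The bracket on `(der A)₀ ⊕ (der A)₁`. -/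
def derBracket (G : ZMod 2 → Submodule K A) :
    (superDer G 0 × superDer G 1) →ₗ[K] (superDer G 0 × superDer G 1) →ₗ[K]
      (superDer G 0 × superDer G 1) :=
  LinearMap.mk₂ K
    (fun c d =>
      (superDerBracket G 0 0 0 (by decide) c.1 d.1 + superDerBracket G 1 1 0 (by decide) c.2 d.2,
        superDerBracket G 0 1 1 (by decide) c.1 d.2 + superDerBracket G 1 0 1 (by decide) c.2 d.1))
    (by
      intro a b c
      simp only [Prod.fst_add, Prod.snd_add, map_add, LinearMap.add_apply, Prod.mk_add_mk]
      congr 1 <;> abel)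
    (by
      intro r b c
      simp only [Prod.smul_fst, Prod.smul_snd, map_smul, LinearMap.smul_apply, Prod.smul_mk,
        smul_add])
    (by
      intro a b c
      simp only [Prod.fst_add, Prod.snd_add, map_add, Prod.mk_add_mk]
      congr 1 <;> abel)
    (by
      intro r b c
      simp only [Prod.smul_fst, Prod.smul_snd, map_smul, Prod.smul_mk, smul_add])

theorem derBracket_fst (G : ZMod 2 → Submodule K A) (c d : superDer G 0 × superDer G 1) :
    ((derBracket G c d).1 : Module.End K A) =
      (c.1.1 * d.1.1 - d.1.1 * c.1.1) + (c.2.1 * d.2.1 + d.2.1 * c.2.1) := by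
  change (superDerBracket G 0 0 0 _ c.1 d.1 : Module.End K A) +
    (superDerBracket G 1 1 0 _ c.2 d.2 : Module.End K A) = _
  rw [superDerBracket_coe, superDerBracket_coe, superSign_zero_left, superSign_one_one]
  module

theorem derBracket_snd (G : ZMod 2 → Submodule K A) (c d : superDer G 0 × superDer G 1) :
    ((derBracket G c d).2 : Module.End K A) =
      (c.1.1 * d.2.1 - d.2.1 * c.1.1) + (c.2.1 * d.1.1 - d.1.1 * c.2.1) := by
  change (superDerBracket G 0 1 1 _ c.1 d.2 : Module.End K A) +
    (superDerBracket G 1 0 1 _ c.2 d.1 : Module.End K A) = _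
  rw [superDerBracket_coe, superDerBracket_coe, superSign_zero_left, superSign_zero_right,
    one_smul, one_smul]

/-- The even part `(der A)₀` and the odd part `(der A)₁` of the derivation algebra. -/
def derPart (G : ZMod 2 → Submodule K A) (i : ZMod 2) :
    Submodule K (superDer G 0 × superDer G 1) :=
  if i = 0 then LinearMap.ker (LinearMap.snd K (superDer G 0) (superDer G 1))
    else LinearMap.ker (LinearMap.fst K (superDer G 0) (superDer G 1))

theorem mem_derPart_zero (G : ZMod 2 → Submodule K A) (c : superDer G 0 × superDer G 1) :
    c ∈ derPart G 0 ↔ (c.2 : Module.End K A) = 0 := by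
  simp [derPart]

theorem mem_derPart_one (G : ZMod 2 → Submodule K A) (c : superDer G 0 × superDer G 1) :
    c ∈ derPart G 1 ↔ (c.1 : Module.End K A) = 0 := by
  simp [derPart]

/-- The derivation algebra `der A = (der A)₀ ⊕ (der A)₁` of a superalgebra, with the
supercommutator as bracket. -/
def derSuperalgebra (G : ZMod 2 → Submodule K A) : LieSuperalgebra.{u, v} K where
  carrier := superDer G 0 × superDer G 1
  bracket := derBracket G
  part := derPart G
  isCompl := by
    constructor
    · rw [Submodule.disjoint_def]
      intro x h0 h1
      rw [mem_derPart_zero] at h0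
      rw [mem_derPart_one] at h1
      exact Prod.ext (Subtype.ext h1) (Subtype.ext h0)
    · rw [codisjoint_iff, eq_top_iff]
      rintro x -
      refine Submodule.mem_sup.2 ⟨(x.1, 0), ?_, (0, x.2), ?_, by simp⟩
      · rw [mem_derPart_zero]
        rfl
      · rw [mem_derPart_one]
        rfl
  bracket_mem := by
    have h : ∀ a : ZMod 2, a = 0 ∨ a = 1 := by decide
    have h11 : (1 : ZMod 2) + 1 = 0 := by decide
    intro i j x hx y hy
    rcases h i with rfl | rfl <;> rcases h j with rfl | rfl <;>
    · simp only [h11, add_zero, zero_add, mem_derPart_zero, mem_derPart_one] at hx hy ⊢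
      simp only [derBracket_fst, derBracket_snd, hx, hy, mul_zero, zero_mul, sub_zero, add_zero]
  skew := by
    have h : ∀ a : ZMod 2, a = 0 ∨ a = 1 := by decide
    intro i j x hx y hy
    rcases h i with rfl | rfl <;> rcases h j with rfl | rfl <;>
    · simp only [mem_derPart_zero, mem_derPart_one] at hx hy
      simp only [superSign_zero_left, superSign_zero_right, superSign_one_one, one_smul,
        neg_smul]
      refine Prod.ext (Subtype.ext ?_) (Subtype.ext ?_) <;>
      · simp only [Prod.fst_neg, Prod.snd_neg, Submodule.coe_neg, derBracket_fst, derBracket_snd,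
          hx, hy, mul_zero, zero_mul, sub_zero, add_zero]
        try abel
  jacobi := by
    have h : ∀ a : ZMod 2, a = 0 ∨ a = 1 := by decide
    intro i j x hx y hy z
    rcases h i with rfl | rfl <;> rcases h j with rfl | rfl <;>
    · simp only [mem_derPart_zero, mem_derPart_one] at hx hy
      simp only [superSign_zero_left, superSign_zero_right, superSign_one_one, one_smul,
        neg_smul]
      refine Prod.ext (Subtype.ext ?_) (Subtype.ext ?_) <;>
      · simp only [Prod.fst_neg, Prod.snd_neg, Prod.fst_add, Prod.snd_add, Submodule.coe_add,
          Submodule.coe_neg, derBracket_fst, derBracket_snd, hx, hy, mul_zero, zero_mul, sub_zero,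
          add_zero, zero_add, mul_sub, sub_mul, mul_add, add_mul, mul_assoc]
        try abel

end Der

/-- The Cartan type Lie superalgebra `W(n) = der Λ(n)`, where `Λ(n)` is the exterior algebra of
`Kⁿ` with its even/odd grading. -/
def cartanW (K : Type u) [Field K] (n : ℕ) : LieSuperalgebra.{u, u} K :=
  derSuperalgebra (A := ExteriorAlgebra K (Fin n → K))
    (CliffordAlgebra.evenOdd (0 : QuadraticForm K (Fin n → K)))

/-! ### Free Lie superalgebras -/

section Free

variable (K : Type u) [Field K] {X : Type v}

/-- The degree of a nonassociative word, for given degrees of the letters. -/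
def wordDegree {M : Type*} [Add M] (d : X → M) : FreeMagma X → M
  | FreeMagma.of x => d x
  | FreeMagma.mul a b => wordDegree d a + wordDegree d b

/-- The span of the words of degree `m` in the free nonassociative algebra. -/
def wordPart {M : Type*} [Add M] (d : X → M) (m : M) :
    Submodule K (FreeNonUnitalNonAssocAlgebra K X) :=
  Submodule.span K (MonoidAlgebra.ofMagma K (FreeMagma X) '' {a | wordDegree d a = m})

/-- The two-sided ideal of the free nonassociative algebra on the `ℤ/2`-graded set `X` generated by
super-antisymmetry and the super Jacobi identity for all homogeneous elements. -/
def freeLieSuperIdeal (p : X → ZMod 2) : Submodule K (FreeNonUnitalNonAssocAlgebra K X) :=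
  sInf {I | (∀ x, ∀ y ∈ I, x * y ∈ I) ∧ (∀ x ∈ I, ∀ y, x * y ∈ I) ∧
    (∀ i j, ∀ x ∈ wordPart K p i, ∀ y ∈ wordPart K p j,
      x * y + superSign K i j • (y * x) ∈ I) ∧
    (∀ i j k, ∀ x ∈ wordPart K p i, ∀ y ∈ wordPart K p j, ∀ z ∈ wordPart K p k,
      x * (y * z) - ((x * y) * z + superSign K i j • (y * (x * z))) ∈ I)}

variable {K}

theorem wordPart_mul {M : Type*} [Add M] (d : X → M) (i j : M)
    {x y : FreeNonUnitalNonAssocAlgebra K X} (hx : x ∈ wordPart K d i) (hy : y ∈ wordPart K d j) :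
    x * y ∈ wordPart K d (i + j) := by
  induction hx using Submodule.span_induction with
  | mem x hx =>
    obtain ⟨a, ha, rfl⟩ := hx
    induction hy using Submodule.span_induction with
    | mem y hy =>
      obtain ⟨b, hb, rfl⟩ := hy
      refine Submodule.subset_span ⟨a * b, ?_, map_mul _ _ _⟩
      rw [Set.mem_ofPred_eq] at ha hb ⊢
      rw [← ha, ← hb]
      rfl
    | zero => simp
    | add y z _ _ h1 h2 => rw [mul_add]; exact add_mem h1 h2
    | smul r y _ h => rw [mul_smul_comm]; exact Submodule.smul_mem _ _ h
  | zero => simp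
  | add y z _ _ h1 h2 => rw [add_mul]; exact add_mem h1 h2
  | smul r y _ h => rw [smul_mul_assoc]; exact Submodule.smul_mem _ _ h

theorem wordPart_isCompl (p : X → ZMod 2) : IsCompl (wordPart K p 0) (wordPart K p 1) := by
  have h : ∀ a : ZMod 2, a = 0 ∨ a = 1 := by decide
  constructor
  · have key : ∀ i, ∀ x ∈ wordPart K p i, ∀ a, wordDegree p a ≠ i → x.coeff a = 0 := by
      intro i x hx a ha
      induction hx using Submodule.span_induction with
      | mem x hx =>
        obtain ⟨b, hb, rfl⟩ := hx
        rw [Set.mem_ofPred_eq] at hb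
        have : b ≠ a := fun hab => ha (hab ▸ hb)
        simp [MonoidAlgebra.ofMagma, this]
      | zero => simp
      | add y z _ _ h1 h2 => simp [h1, h2]
      | smul r y _ h => simp [h]
    rw [Submodule.disjoint_def]
    intro x h0 h1
    ext a
    rcases h (wordDegree p a) with ha | ha
    · exact key 1 x h1 a (by rw [ha]; decide)
    · exact key 0 x h0 a (by rw [ha]; decide)
  · rw [codisjoint_iff, eq_top_iff]
    rintro x -
    induction x using MonoidAlgebra.induction_linear with
    | zero => simp
    | add f g hf hg => exact add_mem hf hg
    | single a r =>
      have hs : (MonoidAlgebra.single a r : MonoidAlgebra K (FreeMagma X)) =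
          r • MonoidAlgebra.ofMagma K (FreeMagma X) a := by
        simp [MonoidAlgebra.ofMagma]
      rw [hs]
      refine Submodule.smul_mem _ _ ?_
      rcases h (wordDegree p a) with ha | ha
      · exact Submodule.mem_sup_left (Submodule.subset_span ⟨a, ha, rfl⟩)
      · exact Submodule.mem_sup_right (Submodule.subset_span ⟨a, ha, rfl⟩)

theorem freeLieSuperIdeal_mul_mem (p : X → ZMod 2) (x : FreeNonUnitalNonAssocAlgebra K X)
    (y : FreeNonUnitalNonAssocAlgebra K X) (hy : y ∈ freeLieSuperIdeal K p) :
    x * y ∈ freeLieSuperIdeal K p := by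
  rw [freeLieSuperIdeal, Submodule.mem_sInf] at hy ⊢
  exact fun I hI => hI.1 x y (hy I hI)

theorem freeLieSuperIdeal_mem_mul (p : X → ZMod 2) (x : FreeNonUnitalNonAssocAlgebra K X)
    (hx : x ∈ freeLieSuperIdeal K p) (y : FreeNonUnitalNonAssocAlgebra K X) :
    x * y ∈ freeLieSuperIdeal K p := by
  rw [freeLieSuperIdeal, Submodule.mem_sInf] at hx ⊢
  exact fun I hI => hI.2.1 x (hx I hI) y

theorem freeLieSuperIdeal_skew (p : X → ZMod 2) (i j : ZMod 2)
    (x : FreeNonUnitalNonAssocAlgebra K X) (hx : x ∈ wordPart K p i)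
    (y : FreeNonUnitalNonAssocAlgebra K X) (hy : y ∈ wordPart K p j) :
    x * y + superSign K i j • (y * x) ∈ freeLieSuperIdeal K p := by
  rw [freeLieSuperIdeal, Submodule.mem_sInf]
  exact fun I hI => hI.2.2.1 i j x hx y hy

theorem freeLieSuperIdeal_jacobi (p : X → ZMod 2) (i j : ZMod 2)
    (x : FreeNonUnitalNonAssocAlgebra K X) (hx : x ∈ wordPart K p i)
    (y : FreeNonUnitalNonAssocAlgebra K X) (hy : y ∈ wordPart K p j)
    (z : FreeNonUnitalNonAssocAlgebra K X) :
    x * (y * z) - ((x * y) * z + superSign K i j • (y * (x * z))) ∈ freeLieSuperIdeal K p := by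
  have key : ∀ k, ∀ z ∈ wordPart K p k,
      x * (y * z) - ((x * y) * z + superSign K i j • (y * (x * z))) ∈ freeLieSuperIdeal K p := by
    intro k z hz
    rw [freeLieSuperIdeal, Submodule.mem_sInf]
    exact fun I hI => hI.2.2.2 i j k x hx y hy z hz
  obtain ⟨z0, h0, z1, h1, rfl⟩ : ∃ z0 ∈ wordPart K p 0, ∃ z1 ∈ wordPart K p 1, z0 + z1 = z :=
    Submodule.mem_sup.1 ((wordPart_isCompl (K := K) p).sup_eq_top ▸ Submodule.mem_top)
  have := add_mem (key 0 z0 h0) (key 1 z1 h1)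
  convert this using 1
  simp only [mul_add, smul_add]
  abel

/-- The ideal of super Lie identities is graded. -/
theorem freeLieSuperIdeal_graded (p : X → ZMod 2) (x : FreeNonUnitalNonAssocAlgebra K X)
    (hx : x ∈ wordPart K p 0) (y : FreeNonUnitalNonAssocAlgebra K X) (hy : y ∈ wordPart K p 1)
    (h : x + y ∈ freeLieSuperIdeal K p) : x ∈ freeLieSuperIdeal K p := by
  set I := freeLieSuperIdeal K p with hI
  set N : Submodule K (FreeNonUnitalNonAssocAlgebra K X) :=
    (I ⊓ wordPart K p 0) ⊔ (I ⊓ wordPart K p 1) with hN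
  have hc := wordPart_isCompl (K := K) p
  have hcase : ∀ a : ZMod 2, a = 0 ∨ a = 1 := by decide
  have hin : ∀ i, ∀ z ∈ I, z ∈ wordPart K p i → z ∈ N := by
    intro i z hz hz'
    rcases hcase i with rfl | rfl
    · exact Submodule.mem_sup_left ⟨hz, hz'⟩
    · exact Submodule.mem_sup_right ⟨hz, hz'⟩
  have hdec : ∀ z, ∃ z0 ∈ wordPart K p 0, ∃ z1 ∈ wordPart K p 1, z0 + z1 = z := fun z =>
    Submodule.mem_sup.1 (hc.sup_eq_top ▸ Submodule.mem_top)
  have hle : I ≤ N := by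
    refine sInf_le ⟨?_, ?_, ?_, ?_⟩
    · intro a b hb
      obtain ⟨b0, ⟨hb0, hb0'⟩, b1, ⟨hb1, hb1'⟩, rfl⟩ := Submodule.mem_sup.1 hb
      obtain ⟨a0, ha0, a1, ha1, rfl⟩ := hdec a
      simp only [mul_add, add_mul]
      refine add_mem (add_mem ?_ ?_) (add_mem ?_ ?_)
      · exact hin _ _ (freeLieSuperIdeal_mul_mem p _ _ hb0) (wordPart_mul p _ _ ha0 hb0')
      · exact hin _ _ (freeLieSuperIdeal_mul_mem p _ _ hb0) (wordPart_mul p _ _ ha1 hb0')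
      · exact hin _ _ (freeLieSuperIdeal_mul_mem p _ _ hb1) (wordPart_mul p _ _ ha0 hb1')
      · exact hin _ _ (freeLieSuperIdeal_mul_mem p _ _ hb1) (wordPart_mul p _ _ ha1 hb1')
    · intro b hb a
      obtain ⟨b0, ⟨hb0, hb0'⟩, b1, ⟨hb1, hb1'⟩, rfl⟩ := Submodule.mem_sup.1 hb
      obtain ⟨a0, ha0, a1, ha1, rfl⟩ := hdec a
      simp only [mul_add, add_mul]
      refine add_mem (add_mem ?_ ?_) (add_mem ?_ ?_)
      · exact hin _ _ (freeLieSuperIdeal_mem_mul p _ hb0 _) (wordPart_mul p _ _ hb0' ha0)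
      · exact hin _ _ (freeLieSuperIdeal_mem_mul p _ hb1 _) (wordPart_mul p _ _ hb1' ha0)
      · exact hin _ _ (freeLieSuperIdeal_mem_mul p _ hb0 _) (wordPart_mul p _ _ hb0' ha1)
      · exact hin _ _ (freeLieSuperIdeal_mem_mul p _ hb1 _) (wordPart_mul p _ _ hb1' ha1)
    · intro i j a ha b hb
      refine hin (i + j) _ (freeLieSuperIdeal_skew p i j a ha b hb)
        (add_mem (wordPart_mul p _ _ ha hb) (Submodule.smul_mem _ _ ?_))
      rw [add_comm]
      exact wordPart_mul p _ _ hb ha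
    · intro i j k a ha b hb c hc
      refine hin (i + (j + k)) _ (freeLieSuperIdeal_jacobi p i j a ha b hb c)
        (sub_mem (wordPart_mul p _ _ ha (wordPart_mul p _ _ hb hc))
          (add_mem ?_ (Submodule.smul_mem _ _ ?_)))
      · rw [← add_assoc]
        exact wordPart_mul p _ _ (wordPart_mul p _ _ ha hb) hc
      · rw [add_left_comm]
        exact wordPart_mul p _ _ hb (wordPart_mul p _ _ ha hc)
  obtain ⟨x', ⟨hx', hx''⟩, y', ⟨-, hy'⟩, he⟩ := Submodule.mem_sup.1 (hle h)
  have h1 : x' - x = y - y' := by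
    rw [sub_eq_sub_iff_add_eq_add, he, add_comm]
  have h2 : x' - x = 0 :=
    Submodule.disjoint_def.1 hc.disjoint _ (sub_mem hx'' hx) (h1 ▸ sub_mem hy hy')
  rw [← sub_eq_zero.1 h2]
  exact hx'

variable (K) in
/-- The free Lie superalgebra on a set `X` of generators with parities `p`. -/
def freeLieSuperalgebra (p : X → ZMod 2) : LieSuperalgebra.{u, max u v} K where
  carrier := FreeNonUnitalNonAssocAlgebra K X ⧸ freeLieSuperIdeal K p
  bracket := quotientBracket (LinearMap.mul K (FreeNonUnitalNonAssocAlgebra K X))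
    (freeLieSuperIdeal K p)
    (fun x y hy => by rw [LinearMap.mul_apply']; exact freeLieSuperIdeal_mul_mem p x y hy)
    (fun x hx y => by rw [LinearMap.mul_apply']; exact freeLieSuperIdeal_mem_mul p x hx y)
  part i := (wordPart K p i).map (freeLieSuperIdeal K p).mkQ
  isCompl := by
    constructor
    · rw [Submodule.disjoint_def]
      rintro _ ⟨x, hx, rfl⟩ ⟨y, hy, hxy⟩
      have h : x + -y ∈ freeLieSuperIdeal K p := by
        rw [← sub_eq_add_neg]
        exact (Submodule.Quotient.eq _).1 hxy.symm
      exact (Submodule.Quotient.mk_eq_zero _).2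
        (freeLieSuperIdeal_graded p x hx (-y) (neg_mem hy) h)
    · rw [codisjoint_iff, ← Submodule.map_sup, (wordPart_isCompl p).sup_eq_top, Submodule.map_top,
        Submodule.range_mkQ]
  bracket_mem := by
    rintro i j _ ⟨x, hx, rfl⟩ _ ⟨y, hy, rfl⟩
    exact ⟨_, wordPart_mul p i j hx hy, rfl⟩
  skew := by
    rintro i j _ ⟨x, hx, rfl⟩ _ ⟨y, hy, rfl⟩
    rw [quotientBracket_mk, quotientBracket_mk, LinearMap.mul_apply', LinearMap.mul_apply',
      ← map_smul, ← map_neg]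
    refine (Submodule.Quotient.eq _).2 ?_
    rw [sub_neg_eq_add]
    exact freeLieSuperIdeal_skew p i j x hx y hy
  jacobi := by
    rintro i j _ ⟨x, hx, rfl⟩ _ ⟨y, hy, rfl⟩ z
    obtain ⟨z, rfl⟩ := (freeLieSuperIdeal K p).mkQ_surjective z
    simp only [quotientBracket_mk, LinearMap.mul_apply']
    rw [← map_smul, ← map_add]
    exact (Submodule.Quotient.eq _).2 (freeLieSuperIdeal_jacobi p i j x hx y hy z)

variable (K) in
/-- The generators of the free Lie superalgebra. -/
def freeLieSuperalgebra.of (p : X → ZMod 2) (x : X) : (freeLieSuperalgebra K p).carrier :=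
  (freeLieSuperIdeal K p).mkQ (FreeNonUnitalNonAssocAlgebra.of K x)

variable (K) in
/-- The span of the iterated brackets of degree `k` in generators of degrees `d`. -/
def freeLieSuperalgebra.level (p : X → ZMod 2) (d : X → ℤ) (k : ℤ) :
    Submodule K (freeLieSuperalgebra K p).carrier :=
  (wordPart K d k).map (freeLieSuperIdeal K p).mkQ

end Free

/-! ### The Lie superalgebra `W̃` of a Cartan matrix -/

/-- The generators `e_a`, `f_i` (`i ≠ 0`), `h_a` and `f_{0a}` (`a ≠ 1`), with `a, i` in
`{0, 1, …, n - 1}`. -/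
inductive WGen (n : ℕ) : Type
  | e (a : Fin n) : WGen n
  | f (i : Fin n) (hi : i.val ≠ 0) : WGen n
  | h (a : Fin n) : WGen n
  | f0 (a : Fin n) (ha : a.val ≠ 1) : WGen n

namespace WGen

variable {n : ℕ}

/-- The odd generators are `e_0` and the `f_{0a}`. -/
def parity : WGen n → ZMod 2
  | e a => if a.val = 0 then 1 else 0
  | f _ _ => 0
  | h _ => 0
  | f0 _ _ => 1

/-- `e_0` has level `1`, the `f_{0a}` have level `-1`, all other generators have level `0`. -/
def level : WGen n → ℤ
  | e a => if a.val = 0 then 1 else 0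
  | f _ _ => 0
  | h _ => 0
  | f0 _ _ => -1

end WGen

section W

variable (K : Type u) [Field K] {n : ℕ}

/-- The free Lie superalgebra on the generators `e_a, f_i, h_a, f_{0a}`. -/
def freeW (n : ℕ) : LieSuperalgebra.{u, u} K := freeLieSuperalgebra K (WGen.parity (n := n))

/-- The generator `e_a`. -/
def eGen (a : Fin n) : (freeW K n).carrier := freeLieSuperalgebra.of K WGen.parity (.e a)

/-- The generator `f_i`, `i ≠ 0`. -/
def fGen (i : Fin n) (hi : i.val ≠ 0) : (freeW K n).carrier :=
  freeLieSuperalgebra.of K WGen.parity (.f i hi)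

/-- The generator `h_a`. -/
def hGen (a : Fin n) : (freeW K n).carrier := freeLieSuperalgebra.of K WGen.parity (.h a)

/-- The generator `f_{0a}`, `a ≠ 1`. -/
def f0Gen (a : Fin n) (ha : a.val ≠ 1) : (freeW K n).carrier :=
  freeLieSuperalgebra.of K WGen.parity (.f0 a ha)

/-- The defining relations of `W̃`: `WTildeRel K B x` says that `x = 0` is one of them. The first
six are the Chevalley–Serre relations of the Cartan matrix `B` (without those that contain
`f_0`). The Serre relations `(ad e_a)^{1 - B_{ab}} e_b = 0` are imposed where the exponent
is positive, i.e. for `a ≠ b` and for `a = b = 0` when `B` is the Cartan matrix of `A(n-1,0)`. -/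
inductive WTildeRel (B : Matrix (Fin n) (Fin n) ℤ) : (freeW K n).carrier → Prop
  | h_e (a b : Fin n) : WTildeRel B (⁅hGen K a, eGen K b⁆ - B a b • eGen K b)
  | h_f (a b : Fin n) (hb : b.val ≠ 0) : WTildeRel B (⁅hGen K a, fGen K b hb⁆ + B a b • fGen K b hb)
  | e_f_eq (b : Fin n) (hb : b.val ≠ 0) : WTildeRel B (⁅eGen K b, fGen K b hb⁆ - hGen K b)
  | e_f_ne (a b : Fin n) (hb : b.val ≠ 0) (hab : a ≠ b) : WTildeRel B ⁅eGen K a, fGen K b hb⁆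
  | serre_e (a b : Fin n) (hab : B a b ≤ 0) :
      WTildeRel B ((fun x => ⁅eGen K a, x⁆)^[(1 - B a b).toNat] (eGen K b))
  | serre_f (a b : Fin n) (ha : a.val ≠ 0) (hb : b.val ≠ 0) (hab : B a b ≤ 0) :
      WTildeRel B ((fun x => ⁅fGen K a ha, x⁆)^[(1 - B a b).toNat] (fGen K b hb))
  | e0_f0 (z a : Fin n) (ha : a.val ≠ 1) (hz : z.val = 0) :
      WTildeRel B (⁅eGen K z, f0Gen K a ha⁆ - hGen K a)
  | h_f0 (z a b : Fin n) (hb : b.val ≠ 1) (hz : z.val = 0) :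
      WTildeRel B (⁅hGen K a, f0Gen K b hb⁆ + B a z • f0Gen K b hb)
  | e1_f0 (o a : Fin n) (ha : a.val ≠ 1) (ho : o.val = 1) : WTildeRel B ⁅eGen K o, f0Gen K a ha⁆
  | e_e_f0 (a b : Fin n) (hb : b.val ≠ 1) : WTildeRel B ⁅eGen K a, ⁅eGen K a, f0Gen K b hb⁆⁆
  | f_f_f0 (a b : Fin n) (ha : a.val ≠ 0) (hb : b.val ≠ 1) :
      WTildeRel B ⁅fGen K a ha, ⁅fGen K a ha, f0Gen K b hb⁆⁆
  | e_f_f0_eq (j a : Fin n) (hj : j.val ≠ 0) (ha : a.val ≠ 1) (hj' : j.val ≠ 1) (hj2 : 2 ≤ j.val) :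
      WTildeRel B (⁅eGen K j, ⁅fGen K j hj, f0Gen K a ha⁆⁆ - B a j • f0Gen K j hj')
  | e_f_f0_ne (i j a : Fin n) (hj : j.val ≠ 0) (ha : a.val ≠ 1) (hi2 : 2 ≤ i.val)
      (hj2 : 2 ≤ j.val) (hij : i ≠ j) :
      WTildeRel B ⁅eGen K i, ⁅fGen K j hj, f0Gen K a ha⁆⁆

/-- The additional relations: `[f_{0a}, f_{0b}] = 0`, and, for `i, j = 3, …, n - 1`,
`[f_{0i}, [f_{0j}, f_1]] = 0` and `[f_{02} - f_{00}, [f_{0j}, f_1]] = 0`. -/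
inductive JRel : (freeW K n).carrier → Prop
  | f0_f0 (a b : Fin n) (ha : a.val ≠ 1) (hb : b.val ≠ 1) : JRel ⁅f0Gen K a ha, f0Gen K b hb⁆
  | f0_f0_f1 (i j o : Fin n) (hi : i.val ≠ 1) (hj : j.val ≠ 1) (ho : o.val ≠ 0)
      (hi3 : 3 ≤ i.val) (hj3 : 3 ≤ j.val) (ho1 : o.val = 1) :
      JRel ⁅f0Gen K i hi, ⁅f0Gen K j hj, fGen K o ho⁆⁆
  | f02_f00 (t z j o : Fin n) (ht : t.val ≠ 1) (hz : z.val ≠ 1) (hj : j.val ≠ 1) (ho : o.val ≠ 0)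
      (ht2 : t.val = 2) (hz0 : z.val = 0) (hj3 : 3 ≤ j.val) (ho1 : o.val = 1) :
      JRel ⁅f0Gen K t ht - f0Gen K z hz, ⁅f0Gen K j hj, fGen K o ho⁆⁆

/-- The Lie superalgebra on the generators `e_a, f_i, h_a, f_{0a}` with relations `R`. -/
def presentedW (R : Set (freeW K n).carrier) : LieSuperalgebra.{u, u} K :=
  (freeW K n).quotient ((freeW K n).idealSpan R)

/-- The Cartan matrix of `A(n-1,0)`, with rows and columns numbered `0, …, n - 1`. -/
def cartanMatrixA (n : ℕ) : Matrix (Fin n) (Fin n) ℤ := fun a b =>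
  if a = b then (if a.val = 0 then 0 else 2)
  else if a.val + 1 = b.val ∨ b.val + 1 = a.val then -1 else 0

/-- The Lie superalgebra `W̃(A_{n-1})`. -/
def WTilde (n : ℕ) : LieSuperalgebra.{u, u} K :=
  presentedW K {x : (freeW K n).carrier | WTildeRel K (cartanMatrixA n) x}

/-- The projection of the free Lie superalgebra onto `W̃(A_{n-1})`. -/
def toWTilde (n : ℕ) : (freeW K n).carrier →ₗ[K] (WTilde K n).carrier :=
  (freeW K n).quotientMap _

/-- The subspace of `W̃(A_{n-1})` at level `k`. -/
def WTildeLevel (n : ℕ) (k : ℤ) : Submodule K (WTilde K n).carrier :=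
  (freeLieSuperalgebra.level K (WGen.parity (n := n)) WGen.level k).map (toWTilde K n)

/-- The local part of `W̃(A_{n-1})`: the sum of the levels `-1`, `0` and `1`. -/
def WTildeLocal (n : ℕ) : Submodule K (WTilde K n).carrier :=
  WTildeLevel K n (-1) ⊔ WTildeLevel K n 0 ⊔ WTildeLevel K n 1

end W

end

/-! Put n = m + 2, let θ_0, …, θ_{n-1} generate Λ(n), write E_ab = θ_a ∂_b and let 𝓔 = ∑ E_ll. The
assignment e_0 ↦ ∂_0, e_i ↦ E_{i-1,i}, f_i ↦ E_{i,i-1}, h_0 ↦ ∑_{l≥1} E_ll, h_i ↦ E_{i-1,i-1} -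
E_ii, f_{00} ↦ ∑_{l≥1} θ_0 E_ll, f_{0i} ↦ θ_0 (E_{i-1,i-1} - E_ii) respects all relations, those of
`JRel` included, and its image is all of W(n) because the characteristic is zero. What remains is to
control the kernel of this map φ, on W̃ and on its quotients by further relations. These algebras
are treated uniformly as a `WSys`. Inside the proof levels are counted by degree in W(n), so `lev k`
corresponds to level -k of the statement.

Local part. The h_a act diagonalisably and the e_i, f_i (i ≥ 1) locally nilpotently, so the algebra
is a weight module for gl_n. Levels 0, -1 and 1 are built by raising and lowering from the h_a, from
e_0 and from the f_{0a} respectively. If φ had a kernel there, this kernel, being stable under gl_n,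
would contain a vector of extremal weight. Bounds on the sums of the last entries of a weight
(`tail`) confine such a vector to the span of the h_a, to the line of e_0, or to a small module `M1`
over the f_{0a}, where injectivity is checked directly (`gl_ker`, `V1_ker`, `M1_ker`, `M_ker`).
Hence ker φ meets the local part trivially.

Maximality. W(n) is transitive: an element of nonnegative level that commutes with all ∂_j is zero
(`eq_zero_of_D`). By induction on the level, an ideal that misses the local part is mapped to zero,
so ker φ is the largest such ideal (`le_ker`, `isGreatest_ker`).

Generation of the kernel. It suffices that φ is injective at every level once the relations of
`JRel` hold (`inj_all`). Since φ is injective at level one, brackets can be compared through a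
weight-preserving section σ, with β(x, y) = [σx, σy]. At level two one wants β(θ_0 E_ab, x) = β(θ_0
𝓔, [E_ab, x]) for x free of θ_0 and ∂_0, together with a companion identity for x = θ_0 θ_c ∂_0. The
deviations form a gl_{n-1}-equivariant tensor subject to linear symmetries, and the additional
relations are just enough to force it to vanish (`tensor_eq_zero`). A highest weight vector of level
two then lies in β(θ_0 𝓔, x) with x free of the index 0, and bracketing with ∂_0 recovers x.

Higher levels go by induction. Bracketing with θ_i 𝓔 is, up to the degree, multiplication by θ_i.
Comparing θ_i E_ll with θ_i 𝓔 on brackets shows that level q + 2 is spanned by elements β(θ_i 𝓔, w)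
with w free of the index i (`lev_le_eulSpan`). Such an element depends only on θ_i w, up to scalars,
so it can be reconstructed from its image in W(n) (`recon_φ`). -/

noncomputable section

universe u v w

/-! ### Homomorphisms and brackets -/

namespace LieSuperalgebra

variable {K : Type u} [Field K]

/-- An even linear map preserving brackets. -/
structure Hom (L : LieSuperalgebra.{u, v} K) (M : LieSuperalgebra.{u, w} K) where
  toLin : L.carrier →ₗ[K] M.carrier
  map_bracket : ∀ x y : L.carrier, toLin ⁅x, y⁆ = ⁅toLin x, toLin y⁆
  map_part : ∀ i, ∀ x ∈ L.part i, toLin x ∈ M.part i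

section Bracket

variable {L : LieSuperalgebra.{u, v} K}

theorem br_def (x y : L.carrier) : ⁅x, y⁆ = L.bracket x y := rfl

@[simp] theorem br_add (x y z : L.carrier) : ⁅x, y + z⁆ = ⁅x, y⁆ + ⁅x, z⁆ :=
  map_add (L.bracket x) y z

@[simp] theorem add_br (x y z : L.carrier) : ⁅x + y, z⁆ = ⁅x, z⁆ + ⁅y, z⁆ := by
  simp [br_def]

@[simp] theorem br_sub (x y z : L.carrier) : ⁅x, y - z⁆ = ⁅x, y⁆ - ⁅x, z⁆ :=
  map_sub (L.bracket x) y z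

@[simp] theorem sub_br (x y z : L.carrier) : ⁅x - y, z⁆ = ⁅x, z⁆ - ⁅y, z⁆ := by
  simp [br_def]

@[simp] theorem br_neg (x y : L.carrier) : ⁅x, -y⁆ = -⁅x, y⁆ := map_neg (L.bracket x) y

@[simp] theorem neg_br (x y : L.carrier) : ⁅-x, y⁆ = -⁅x, y⁆ := by simp [br_def]

@[simp] theorem br_zero (x : L.carrier) : ⁅x, (0 : L.carrier)⁆ = 0 := map_zero (L.bracket x)

@[simp] theorem zero_br (x : L.carrier) : ⁅(0 : L.carrier), x⁆ = 0 := by simp [br_def]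

@[simp] theorem br_smul (r : K) (x y : L.carrier) : ⁅x, r • y⁆ = r • ⁅x, y⁆ :=
  map_smul (L.bracket x) r y

@[simp] theorem smul_br (r : K) (x y : L.carrier) : ⁅r • x, y⁆ = r • ⁅x, y⁆ := by simp [br_def]

theorem br_sum {ι : Type*} (s : Finset ι) (x : L.carrier) (y : ι → L.carrier) :
    ⁅x, ∑ i ∈ s, y i⁆ = ∑ i ∈ s, ⁅x, y i⁆ := map_sum (L.bracket x) y s

theorem sum_br {ι : Type*} (s : Finset ι) (x : ι → L.carrier) (y : L.carrier) :
    ⁅∑ i ∈ s, x i, y⁆ = ∑ i ∈ s, ⁅x i, y⁆ := by simp [br_def]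

theorem br_mem_part {i j : ZMod 2} {x y : L.carrier} (hx : x ∈ L.part i) (hy : y ∈ L.part j) :
    ⁅x, y⁆ ∈ L.part (i + j) := L.bracket_mem i j x hx y hy

theorem br_skew_even {x : L.carrier} (hx : x ∈ L.part 0) (y : L.carrier) : ⁅x, y⁆ = -⁅y, x⁆ := by
  obtain ⟨y0, h0, y1, h1, rfl⟩ := exists_add y
  have e0 := L.skew 0 0 x hx y0 h0
  have e1 := L.skew 0 1 x hx y1 h1
  rw [superSign_zero_left, one_smul] at e0 e1
  rw [br_add, add_br, neg_add]
  exact congrArg₂ _ e0 e1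

theorem br_skew_even' {y : L.carrier} (hy : y ∈ L.part 0) (x : L.carrier) : ⁅x, y⁆ = -⁅y, x⁆ := by
  rw [br_skew_even hy, neg_neg]

theorem br_comm_odd {x y : L.carrier} (hx : x ∈ L.part 1) (hy : y ∈ L.part 1) :
    ⁅x, y⁆ = ⁅y, x⁆ := by
  have e := L.skew 1 1 x hx y hy
  rw [superSign_one_one, neg_smul, one_smul, neg_neg] at e
  exact e

theorem br_skew {i j : ZMod 2} {x y : L.carrier} (hx : x ∈ L.part i) (hy : y ∈ L.part j) :
    ⁅x, y⁆ = -(superSign K i j • ⁅y, x⁆) := L.skew i j x hx y hy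

theorem br_br {i j : ZMod 2} {x y : L.carrier} (hx : x ∈ L.part i) (hy : y ∈ L.part j)
    (z : L.carrier) : ⁅x, ⁅y, z⁆⁆ = ⁅⁅x, y⁆, z⁆ + superSign K i j • ⁅y, ⁅x, z⁆⁆ :=
  L.jacobi i j x hx y hy z

theorem br_br_even {x : L.carrier} (hx : x ∈ L.part 0) (y z : L.carrier) :
    ⁅x, ⁅y, z⁆⁆ = ⁅⁅x, y⁆, z⁆ + ⁅y, ⁅x, z⁆⁆ := by
  obtain ⟨y0, h0, y1, h1, rfl⟩ := exists_add y
  have e0 := br_br hx h0 z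
  have e1 := br_br hx h1 z
  rw [superSign_zero_left, one_smul] at e0 e1
  simp only [br_add, add_br, e0, e1]
  abel

theorem br_br_even' {y : L.carrier} (hy : y ∈ L.part 0) (x z : L.carrier) :
    ⁅x, ⁅y, z⁆⁆ = ⁅⁅x, y⁆, z⁆ + ⁅y, ⁅x, z⁆⁆ := by
  rw [br_br_even hy x z, br_skew_even hy x, neg_br]
  abel

theorem br_br_odd {x y : L.carrier} (hx : x ∈ L.part 1) (hy : y ∈ L.part 1) (z : L.carrier) :
    ⁅x, ⁅y, z⁆⁆ = ⁅⁅x, y⁆, z⁆ - ⁅y, ⁅x, z⁆⁆ := by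
  rw [br_br hx hy z, superSign_one_one, neg_smul, one_smul, sub_eq_add_neg]

end Bracket

/-- The kernel of a homomorphism. -/
def Hom.ker {L : LieSuperalgebra.{u, v} K} {M : LieSuperalgebra.{u, w} K} (φ : L.Hom M) :
    L.Ideal where
  toSubmodule := LinearMap.ker φ.toLin
  bracket_mem x y hy := by
    rw [LinearMap.mem_ker] at hy ⊢
    rw [φ.map_bracket, hy, br_zero]
  graded x hx y hy h := by
    rw [LinearMap.mem_ker, map_add] at h
    have h0 : φ.toLin x = 0 := by
      refine Submodule.disjoint_def.1 M.isCompl.disjoint _ (φ.map_part 0 x hx) ?_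
      rw [eq_neg_of_add_eq_zero_left h]
      exact neg_mem (φ.map_part 1 y hy)
    exact ⟨h0, by rwa [h0, zero_add] at h⟩

/-- The projection onto a quotient as a homomorphism. -/
def quotientHom (L : LieSuperalgebra.{u, v} K) (I : L.Ideal) : L.Hom (L.quotient I) where
  toLin := L.quotientMap I
  map_bracket _ _ := rfl
  map_part _ x hx := ⟨x, hx, rfl⟩

theorem quotientHom_surjective (L : LieSuperalgebra.{u, v} K) (I : L.Ideal) :
    Function.Surjective (L.quotientHom I).toLin := I.toSubmodule.mkQ_surjective

theorem quotientHom_eq_zero (L : LieSuperalgebra.{u, v} K) (I : L.Ideal) {x : L.carrier} :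
    (L.quotientHom I).toLin x = 0 ↔ x ∈ I.toSubmodule := Submodule.Quotient.mk_eq_zero _

theorem subset_idealSpan (L : LieSuperalgebra.{u, v} K) (S : Set L.carrier) :
    S ⊆ (L.idealSpan S).toSubmodule := by
  intro x hx
  refine Submodule.mem_sInf.2 ?_
  rintro _ ⟨I, hI, rfl⟩
  exact hI hx

theorem idealSpan_le (L : LieSuperalgebra.{u, v} K) {S : Set L.carrier} {I : L.Ideal}
    (h : S ⊆ I.toSubmodule) : L.idealSpan S ≤ I :=
  sInf_le (a := I.toSubmodule) ⟨I, h, rfl⟩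

/-- A homomorphism that vanishes on an ideal factors through the quotient. -/
def quotientLift {L : LieSuperalgebra.{u, v} K} {M : LieSuperalgebra.{u, w} K} (I : L.Ideal)
    (φ : L.Hom M) (h : I ≤ φ.ker) : (L.quotient I).Hom M where
  toLin := I.toSubmodule.liftQ φ.toLin h
  map_bracket := by
    intro x y
    obtain ⟨x, rfl⟩ := I.toSubmodule.mkQ_surjective x
    obtain ⟨y, rfl⟩ := I.toSubmodule.mkQ_surjective y
    exact φ.map_bracket x y
  map_part := by
    rintro i _ ⟨x, hx, rfl⟩
    exact φ.map_part i x hx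

theorem quotientLift_apply {L : LieSuperalgebra.{u, v} K} {M : LieSuperalgebra.{u, w} K}
    (I : L.Ideal) (φ : L.Hom M) (h : I ≤ φ.ker) (x : L.carrier) :
    (quotientLift I φ h).toLin ((L.quotientHom I).toLin x) = φ.toLin x := rfl

/-- Composition of homomorphisms. -/
def Hom.comp {L M N : LieSuperalgebra.{u, v} K} (ψ : M.Hom N) (φ : L.Hom M) : L.Hom N where
  toLin := ψ.toLin ∘ₗ φ.toLin
  map_bracket x y := by simp [φ.map_bracket, ψ.map_bracket]
  map_part i x hx := ψ.map_part i _ (φ.map_part i x hx)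

/-- A bijective homomorphism is an isomorphism. -/
def Hom.toIso {L : LieSuperalgebra.{u, v} K} {M : LieSuperalgebra.{u, w} K} (φ : L.Hom M)
    (h : Function.Bijective φ.toLin) : L.Iso M where
  toLinearEquiv := LinearEquiv.ofBijective φ.toLin h
  map_bracket := φ.map_bracket
  map_part := φ.map_part

/-- The underlying space of a Lie superalgebra, with the bracket as a product. -/
def AsAlg (L : LieSuperalgebra.{u, v} K) : Type v := L.carrier

instance (L : LieSuperalgebra.{u, v} K) : AddCommGroup L.AsAlg := L.addCommGroup

instance (L : LieSuperalgebra.{u, v} K) : Module K L.AsAlg := L.module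

instance (L : LieSuperalgebra.{u, v} K) : NonUnitalNonAssocRing L.AsAlg :=
  { (inferInstance : AddCommGroup L.AsAlg) with
    mul := fun x y => L.bracket x y
    left_distrib := fun x y z => map_add (L.bracket x) y z
    right_distrib := fun x y z => LinearMap.map_add₂ L.bracket x y z
    zero_mul := fun x => LinearMap.map_zero₂ L.bracket x
    mul_zero := fun x => map_zero (L.bracket x) }

instance (L : LieSuperalgebra.{u, v} K) : IsScalarTower K L.AsAlg L.AsAlg :=
  ⟨fun r x y => LinearMap.map_smul₂ L.bracket r x y⟩

instance (L : LieSuperalgebra.{u, v} K) : SMulCommClass K L.AsAlg L.AsAlg :=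
  ⟨fun r x y => (map_smul (L.bracket x) r y).symm⟩

end LieSuperalgebra

/-! ### The universal property of the free Lie superalgebra -/

section Lift

open LieSuperalgebra

variable {K : Type u} [Field K] {X : Type v}

/-- The extension of a map on generators to the free nonassociative algebra. -/
def freeAlgLift (L : LieSuperalgebra.{u, w} K) (g : X → L.carrier) :
    FreeNonUnitalNonAssocAlgebra K X →ₙₐ[K] L.AsAlg :=
  FreeNonUnitalNonAssocAlgebra.lift K (A := L.AsAlg) g

theorem freeAlgLift_wordPart (L : LieSuperalgebra.{u, w} K) (p : X → ZMod 2)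
    (g : X → L.carrier) (hg : ∀ x, g x ∈ L.part (p x)) (i : ZMod 2)
    (x : FreeNonUnitalNonAssocAlgebra K X) (hx : x ∈ wordPart K p i) :
    (freeAlgLift L g x : L.carrier) ∈ L.part i := by
  have key : ∀ a : FreeMagma X,
      (freeAlgLift L g (MonoidAlgebra.ofMagma K (FreeMagma X) a) : L.carrier) ∈
        L.part (wordDegree p a) := by
    intro a
    induction a with
    | ih1 x =>
      have : freeAlgLift L g (MonoidAlgebra.ofMagma K (FreeMagma X) (FreeMagma.of x)) = g x :=
        FreeNonUnitalNonAssocAlgebra.lift_of_apply K (A := L.AsAlg) g x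
      rw [this]
      exact hg x
    | ih2 a b ha hb =>
      rw [map_mul, map_mul]
      exact L.bracket_mem _ _ _ ha _ hb
  induction hx using Submodule.span_induction with
  | mem x hx =>
    obtain ⟨a, ha, rfl⟩ := hx
    rw [← show wordDegree p a = i from ha]
    exact key a
  | zero => rw [map_zero]; exact zero_mem (L.part i)
  | add y z _ _ h1 h2 => rw [map_add]; exact add_mem (S := Submodule K L.carrier) h1 h2
  | smul r y _ h => rw [map_smul]; exact Submodule.smul_mem (L.part i) r h

theorem freeLieSuperIdeal_le_ker (L : LieSuperalgebra.{u, w} K) (p : X → ZMod 2)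
    (g : X → L.carrier) (hg : ∀ x, g x ∈ L.part (p x)) :
    freeLieSuperIdeal K p ≤ LinearMap.ker (freeAlgLift L g : _ →ₗ[K] L.AsAlg) := by
  refine sInf_le ⟨?_, ?_, ?_, ?_⟩
  · intro x y hy
    have hy' : freeAlgLift L g y = 0 := hy
    change freeAlgLift L g (x * y) = 0
    rw [map_mul, hy', mul_zero]
  · intro x hx y
    have hx' : freeAlgLift L g x = 0 := hx
    change freeAlgLift L g (x * y) = 0
    rw [map_mul, hx', zero_mul]
  · intro i j x hx y hy
    change freeAlgLift L g (x * y + superSign K i j • (y * x)) = 0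
    rw [map_add, map_smul, map_mul, map_mul]
    have := L.skew i j _ (freeAlgLift_wordPart L p g hg i x hx) _
      (freeAlgLift_wordPart L p g hg j y hy)
    exact eq_neg_iff_add_eq_zero.1 this
  · intro i j k x hx y hy z hz
    change freeAlgLift L g (x * (y * z) - ((x * y) * z + superSign K i j • (y * (x * z)))) = 0
    simp only [map_sub, map_add, map_smul, map_mul]
    have := L.jacobi i j _ (freeAlgLift_wordPart L p g hg i x hx) _
      (freeAlgLift_wordPart L p g hg j y hy) (freeAlgLift L g z)
    exact sub_eq_zero.2 this

/-- The universal property of the free Lie superalgebra. -/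
def freeLift (L : LieSuperalgebra.{u, w} K) (p : X → ZMod 2) (g : X → L.carrier)
    (hg : ∀ x, g x ∈ L.part (p x)) : (freeLieSuperalgebra K p).Hom L where
  toLin := (freeLieSuperIdeal K p).liftQ (freeAlgLift L g : _ →ₗ[K] L.AsAlg)
    (freeLieSuperIdeal_le_ker L p g hg)
  map_bracket := by
    intro x y
    obtain ⟨x, rfl⟩ := (freeLieSuperIdeal K p).mkQ_surjective x
    obtain ⟨y, rfl⟩ := (freeLieSuperIdeal K p).mkQ_surjective y
    exact map_mul (freeAlgLift L g) x y
  map_part := by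
    rintro i _ ⟨x, hx, rfl⟩
    exact freeAlgLift_wordPart L p g hg i x hx

theorem freeLift_of (L : LieSuperalgebra.{u, w} K) (p : X → ZMod 2) (g : X → L.carrier)
    (hg : ∀ x, g x ∈ L.part (p x)) (x : X) :
    (freeLift L p g hg).toLin (freeLieSuperalgebra.of K p x) = g x :=
  FreeNonUnitalNonAssocAlgebra.lift_of_apply K (A := L.AsAlg) g x

theorem freeLieSuperalgebra.of_mem_part (p : X → ZMod 2) (x : X) :
    freeLieSuperalgebra.of K p x ∈ (freeLieSuperalgebra K p).part (p x) :=
  ⟨_, Submodule.subset_span ⟨FreeMagma.of x, rfl, rfl⟩, rfl⟩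

/-- Left-normed brackets of generators span the free Lie superalgebra. -/
theorem freeLieSuperalgebra.eq_top (p : X → ZMod 2)
    (N : Submodule K (freeLieSuperalgebra K p).carrier)
    (hN : ∀ x, freeLieSuperalgebra.of K p x ∈ N)
    (hb : ∀ x, ∀ y ∈ N, ⁅freeLieSuperalgebra.of K p x, y⁆ ∈ N) : N = ⊤ := by
  -- The second half of the conjunction makes the induction close: by the Jacobi identity the
  -- adjoint action of a product is a combination of compositions of the adjoint actions of its
  -- factors.
  have key : ∀ a : FreeMagma X,
      (freeLieSuperIdeal K p).mkQ (MonoidAlgebra.ofMagma K (FreeMagma X) a) ∈ N ∧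
      ∀ y ∈ N, (freeLieSuperalgebra K p).bracket
        ((freeLieSuperIdeal K p).mkQ (MonoidAlgebra.ofMagma K (FreeMagma X) a)) y ∈ N := by
    intro a
    induction a with
    | ih1 x => exact ⟨hN x, hb x⟩
    | ih2 a b ha hb =>
      have hpart : ∀ c : FreeMagma X,
          (freeLieSuperIdeal K p).mkQ (MonoidAlgebra.ofMagma K (FreeMagma X) c) ∈
            (freeLieSuperalgebra K p).part (wordDegree p c) :=
        fun c => ⟨_, Submodule.subset_span ⟨c, rfl, rfl⟩, rfl⟩
      have e : (freeLieSuperIdeal K p).mkQ (MonoidAlgebra.ofMagma K (FreeMagma X)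
          (a * b)) = (freeLieSuperalgebra K p).bracket
          ((freeLieSuperIdeal K p).mkQ (MonoidAlgebra.ofMagma K (FreeMagma X) a))
          ((freeLieSuperIdeal K p).mkQ (MonoidAlgebra.ofMagma K (FreeMagma X) b)) :=
        congrArg _ (map_mul (MonoidAlgebra.ofMagma K (FreeMagma X)) a b)
      rw [e]
      refine ⟨ha.2 _ hb.1, fun y hy => ?_⟩
      have j := (freeLieSuperalgebra K p).jacobi _ _ _ (hpart a) _ (hpart b) y
      rw [eq_sub_of_add_eq j.symm]
      exact sub_mem (ha.2 _ (hb.2 _ hy)) (Submodule.smul_mem _ _ (hb.2 _ (ha.2 _ hy)))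
  rw [eq_top_iff]
  rintro x -
  obtain ⟨x, rfl⟩ := (freeLieSuperIdeal K p).mkQ_surjective x
  induction x using MonoidAlgebra.induction_linear with
  | zero => rw [map_zero]; exact zero_mem N
  | add f g hf hg => rw [map_add]; exact add_mem (S := Submodule K _) hf hg
  | single a r =>
    have hs : (MonoidAlgebra.single a r : MonoidAlgebra K (FreeMagma X)) =
        r • MonoidAlgebra.ofMagma K (FreeMagma X) a := by
      simp [MonoidAlgebra.ofMagma]
    rw [hs]
    erw [map_smul]
    exact Submodule.smul_mem _ _ (key a).1

end Lift

/-! ### The Grassmann algebra and its derivations -/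

namespace Grassmann

variable {K : Type u} [Field K] {n : ℕ}

variable (K n) in
/-- The Grassmann algebra on `n` generators. -/
abbrev Lam : Type u := ExteriorAlgebra K (Fin n → K)

variable (K n) in
/-- The even and the odd part of the Grassmann algebra. -/
abbrev par (i : ZMod 2) : Submodule K (Lam K n) :=
  CliffordAlgebra.evenOdd (0 : QuadraticForm K (Fin n → K)) i

/-- The generators of the Grassmann algebra. -/
def th (i : Fin n) : Lam K n := ExteriorAlgebra.ι K (Pi.single i 1)

/-- The partial derivatives of the Grassmann algebra. -/
def pd (i : Fin n) : Lam K n →ₗ[K] Lam K n :=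
  CliffordAlgebra.contractLeft (Q := (0 : QuadraticForm K (Fin n → K))) (LinearMap.proj i)

theorem pd_ι_mul (i : Fin n) (m : Fin n → K) (x : Lam K n) :
    pd i (ExteriorAlgebra.ι K m * x) = m i • x - ExteriorAlgebra.ι K m * pd i x :=
  CliffordAlgebra.contractLeft_ι_mul (Q := (0 : QuadraticForm K (Fin n → K))) _ m x

theorem pd_algebraMap (i : Fin n) (r : K) : pd i (algebraMap K (Lam K n) r) = 0 :=
  CliffordAlgebra.contractLeft_algebraMap _ _ _

@[simp] theorem pd_one (i : Fin n) : pd i (1 : Lam K n) = 0 :=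
  CliffordAlgebra.contractLeft_one _ _

theorem pd_th_mul (i j : Fin n) (x : Lam K n) :
    pd i (th j * x) = (if i = j then x else 0) - th j * pd i x := by
  rw [th, pd_ι_mul, Pi.single_apply]
  split_ifs <;> simp

theorem pd_th_mul_self (i : Fin n) (x : Lam K n) : pd i (th i * x) = x - th i * pd i x := by
  rw [pd_th_mul, if_pos rfl]

theorem pd_th_mul_ne {i j : Fin n} (h : i ≠ j) (x : Lam K n) :
    pd i (th j * x) = -(th j * pd i x) := by
  rw [pd_th_mul, if_neg h, zero_sub]

theorem pd_th (i j : Fin n) : pd i (th j : Lam K n) = if i = j then 1 else 0 := by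
  have := pd_th_mul (K := K) i j 1
  simpa using this

theorem pd_pd_comm (i j : Fin n) (x : Lam K n) : pd i (pd j x) = -pd j (pd i x) :=
  CliffordAlgebra.contractLeft_comm _ _ _

@[simp] theorem pd_pd_self (i : Fin n) (x : Lam K n) : pd i (pd i x) = 0 :=
  CliffordAlgebra.contractLeft_contractLeft _ _

@[simp] theorem th_mul_self (i : Fin n) : (th i : Lam K n) * th i = 0 :=
  ExteriorAlgebra.ι_sq_zero _

theorem th_mul_comm (i j : Fin n) : (th i : Lam K n) * th j = -(th j * th i) :=
  eq_neg_of_add_eq_zero_left (ExteriorAlgebra.ι_add_mul_swap _ _)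

@[simp] theorem th_mul_self_mul (i : Fin n) (x : Lam K n) : th i * (th i * x) = 0 := by
  rw [← mul_assoc, th_mul_self, zero_mul]

theorem th_mul_left_comm (i j : Fin n) (x : Lam K n) : th i * (th j * x) = -(th j * (th i * x)) := by
  rw [← mul_assoc, th_mul_comm, neg_mul, mul_assoc]

theorem th_mem (i : Fin n) : (th i : Lam K n) ∈ par K n 1 :=
  CliffordAlgebra.ι_mem_evenOdd_one _ _

theorem one_mem_par : (1 : Lam K n) ∈ par K n 0 := SetLike.one_mem_graded _

theorem mul_mem_par {i j : ZMod 2} {x y : Lam K n} (hx : x ∈ par K n i) (hy : y ∈ par K n j) :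
    x * y ∈ par K n (i + j) := SetLike.mul_mem_graded hx hy

theorem ι_eq_sum (m : Fin n → K) : ExteriorAlgebra.ι K m = ∑ i, m i • (th i : Lam K n) := by
  have h : m = ∑ i, m i • (Pi.single i (1 : K) : Fin n → K) := by
    ext j; simp [Finset.sum_apply, Pi.single_apply]
  conv_lhs => rw [h]
  simp [th]

/-- Induction for the Grassmann algebra by multiplication with generators. -/
theorem lam_induction {P : Lam K n → Prop} (h1 : P 1) (hs : ∀ (r : K) x, P x → P (r • x))
    (ha : ∀ x y, P x → P y → P (x + y)) (hm : ∀ i x, P x → P (th i * x)) (x : Lam K n) : P x := by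
  have h0 : P 0 := by simpa using hs 0 1 h1
  induction x using CliffordAlgebra.left_induction with
  | algebraMap r => rw [Algebra.algebraMap_eq_smul_one]; exact hs r 1 h1
  | add x y hx hy => exact ha x y hx hy
  | ι_mul x m hx =>
    change P (ExteriorAlgebra.ι K m * x)
    rw [ι_eq_sum, Finset.sum_mul]
    refine Finset.sum_induction _ P ha h0 fun i _ => ?_
    rw [smul_mul_assoc]
    exact hs _ _ (hm i x hx)

theorem pd_mem {p : ZMod 2} (i : Fin n) {x : Lam K n} (hx : x ∈ par K n p) :
    pd i x ∈ par K n (1 + p) := by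
  have h2 : ∀ q : ZMod 2, 1 + (1 + q) = q := by decide
  induction x, hx using CliffordAlgebra.evenOdd_induction with
  | range_ι_pow v hv =>
    have hp : ∀ a : ZMod 2, a = 0 ∨ a = 1 := by decide
    rcases hp p with rfl | rfl
    · have hv' : v ∈ (1 : Submodule K (Lam K n)) := by simpa using hv
      obtain ⟨r, rfl⟩ := Submodule.mem_one.1 hv'
      rw [pd_algebraMap]
      exact zero_mem _
    · have hv' : v ∈ LinearMap.range (CliffordAlgebra.ι (0 : QuadraticForm K (Fin n → K))) := by
        have : (1 : ZMod 2).val = 1 := rfl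
        rwa [this, pow_one] at hv
      obtain ⟨m, rfl⟩ := hv'
      have := pd_ι_mul i m (1 : Lam K n)
      rw [mul_one, pd_one, mul_zero, sub_zero] at this
      erw [this]
      have h11 : (1 : ZMod 2) + 1 = 0 := by decide
      rw [h11]
      exact Submodule.smul_mem _ _ one_mem_par
  | add x y _ _ hx hy => rw [map_add]; exact add_mem hx hy
  | ι_mul_ι_mul a b x hx ih =>
    have e : pd i (CliffordAlgebra.ι (0 : QuadraticForm K (Fin n → K)) a *
        CliffordAlgebra.ι (0 : QuadraticForm K (Fin n → K)) b * x) =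
        a i • (ExteriorAlgebra.ι K b * x) - ExteriorAlgebra.ι K a *
          (b i • x - ExteriorAlgebra.ι K b * pd i x) := by
      rw [mul_assoc]
      erw [pd_ι_mul, pd_ι_mul]
    rw [e]
    have hι : ∀ c, (ExteriorAlgebra.ι K c : Lam K n) ∈ par K n 1 :=
      fun c => CliffordAlgebra.ι_mem_evenOdd_one _ _
    refine sub_mem (Submodule.smul_mem _ _ (mul_mem_par (hι b) hx))
      (mul_mem_par (hι a) (sub_mem (Submodule.smul_mem _ _ ?_) ?_))
    · exact hx
    · have := mul_mem_par (hι b) ih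
      rwa [h2] at this

/-- The parity automorphism of the Grassmann algebra. -/
def inv : Lam K n →ₐ[K] Lam K n :=
  CliffordAlgebra.involute (Q := (0 : QuadraticForm K (Fin n → K)))

theorem inv_th (i : Fin n) : inv (th i : Lam K n) = -th i := CliffordAlgebra.involute_ι _

theorem inv_eq {p : ZMod 2} {x : Lam K n} (hx : x ∈ par K n p) : inv x = superSign K 1 p • x := by
  have hp : ∀ a : ZMod 2, a = 0 ∨ a = 1 := by decide
  rcases hp p with rfl | rfl
  · rw [superSign_zero_right, one_smul]
    exact CliffordAlgebra.involute_eq_of_mem_even hx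
  · rw [superSign_one_one, neg_smul, one_smul]
    exact CliffordAlgebra.involute_eq_of_mem_odd hx

theorem pd_mul (i : Fin n) (x y : Lam K n) : pd i (x * y) = pd i x * y + inv x * pd i y := by
  induction x using lam_induction with
  | h1 => simp
  | hs r x h => simp only [smul_mul_assoc, map_smul, h, smul_add]
  | ha x y hx hy => simp only [add_mul, map_add, hx, hy]; abel
  | hm j x h =>
    rw [mul_assoc, pd_th_mul, pd_th_mul, h, map_mul, inv_th]
    split_ifs <;> noncomm_ring

theorem th_mul (i : Fin n) (x : Lam K n) : th i * x = inv x * th i := by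
  induction x using lam_induction with
  | h1 => simp
  | hs r x h => simp only [smul_mul_assoc, mul_smul_comm, map_smul, h]
  | ha x y hx hy => simp only [add_mul, mul_add, map_add, hx, hy]
  | hm j x h => rw [th_mul_left_comm, h, map_mul, inv_th]; noncomm_ring

theorem mul_comm_super {p q : ZMod 2} {x y : Lam K n} (hx : x ∈ par K n p) (hy : y ∈ par K n q) :
    x * y = superSign K p q • (y * x) := by
  have hp : ∀ a : ZMod 2, a = 0 ∨ a = 1 := by decide
  have h0 : ∀ z ∈ par K n 0, ∀ x : Lam K n, x * z = z * x := by
    intro z hz x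
    induction x using lam_induction with
    | h1 => simp
    | hs r x h => simp only [smul_mul_assoc, mul_smul_comm, h]
    | ha x y hx hy => simp only [add_mul, mul_add, hx, hy]
    | hm j x h =>
      rw [mul_assoc, h, ← mul_assoc, th_mul, inv_eq hz, superSign_zero_right, one_smul, mul_assoc]
  have h1 : ∀ z ∈ par K n 1, ∀ x : Lam K n, x * z = z * inv x := by
    intro z hz x
    induction x using lam_induction with
    | h1 => simp
    | hs r x h => simp only [smul_mul_assoc, mul_smul_comm, map_smul, h]
    | ha x y hx hy => simp only [add_mul, mul_add, map_add, hx, hy]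
    | hm j x h =>
      rw [mul_assoc, h, ← mul_assoc, th_mul, inv_eq hz, superSign_one_one, map_mul, inv_th]
      simp only [neg_smul, one_smul]
      noncomm_ring
  rcases hp q with rfl | rfl
  · rw [superSign_zero_right, one_smul, h0 y hy]
  · rw [h1 y hy, inv_eq hx, mul_smul_comm, superSign_comm]

/-! #### Monomials -/

/-- `v` is a multiple of the monomial `∏_{l ∈ S} θ_l`. -/
structure IsMon (S : Finset (Fin n)) (v : Lam K n) : Prop where
  mem : v ∈ par K n (S.card : ZMod 2)
  on : ∀ l ∈ S, th l * pd l v = v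
  off : ∀ l, l ∉ S → pd l v = 0

theorem IsMon.one : IsMon ∅ (1 : Lam K n) :=
  ⟨by simpa using one_mem_par, by simp, by simp⟩

theorem IsMon.th_mul_eq_zero {S : Finset (Fin n)} {v : Lam K n} (h : IsMon S v) {l : Fin n}
    (hl : l ∈ S) : th l * v = 0 := by
  rw [← h.on l hl, th_mul_self_mul]

theorem IsMon.th_mul {S : Finset (Fin n)} {v : Lam K n} (h : IsMon S v) {l : Fin n}
    (hl : l ∉ S) : IsMon (insert l S) (th l * v) := by
  refine ⟨?_, ?_, ?_⟩
  · rw [Finset.card_insert_of_notMem hl, Nat.cast_succ, add_comm]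
    exact mul_mem_par (th_mem l) h.mem
  · intro k hk
    rcases eq_or_ne k l with rfl | hkl
    · rw [pd_th_mul_self, h.off k hl, mul_zero, sub_zero]
    · rw [pd_th_mul_ne hkl, mul_neg, th_mul_left_comm, neg_neg,
        h.on k (Finset.mem_of_mem_insert_of_ne hk hkl)]
  · intro k hk
    rw [Finset.mem_insert, not_or] at hk
    rw [pd_th_mul_ne hk.1, h.off k hk.2, mul_zero, neg_zero]

theorem IsMon.pd {S : Finset (Fin n)} {v : Lam K n} (h : IsMon S v) {l : Fin n}
    (hl : l ∈ S) : IsMon (S.erase l) (pd l v) := by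
  refine ⟨?_, ?_, ?_⟩
  · have hc : (S.card : ZMod 2) = (S.erase l).card + 1 := by
      rw [← Finset.card_erase_add_one hl, Nat.cast_succ]
    have := pd_mem l h.mem
    have h2 : ∀ q : ZMod 2, 1 + (q + 1) = q := by decide
    rwa [hc, h2] at this
  · intro k hk
    rw [Finset.mem_erase] at hk
    have := congrArg (Grassmann.pd l) (h.on k hk.2)
    rw [pd_th_mul_ne hk.1.symm, pd_pd_comm, mul_neg, neg_neg] at this
    exact this
  · intro k hk
    rcases eq_or_ne k l with rfl | hkl
    · rw [pd_pd_self]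
    · rw [pd_pd_comm, h.off k (fun hS => hk (Finset.mem_erase.2 ⟨hkl, hS⟩)), map_zero, neg_zero]

theorem IsMon.th {l : Fin n} : IsMon {l} (th l : Lam K n) := by
  simpa using IsMon.one.th_mul (K := K) (Finset.notMem_empty l)

theorem IsMon.th_th {a b : Fin n} (h : a ≠ b) : IsMon {a, b} (Grassmann.th a * Grassmann.th b : Lam K n) :=
  IsMon.th.th_mul (by simpa using h)

theorem lam_eq_span : Submodule.span K {v : Lam K n | ∃ S, IsMon S v} = ⊤ := by
  rw [eq_top_iff]
  rintro x -
  induction x using lam_induction with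
  | h1 => exact Submodule.subset_span ⟨_, IsMon.one⟩
  | hs r x h => exact Submodule.smul_mem _ _ h
  | ha x y hx hy => exact add_mem hx hy
  | hm i x h =>
    induction h using Submodule.span_induction with
    | mem x hx =>
      obtain ⟨S, hS⟩ := hx
      by_cases hi : i ∈ S
      · rw [hS.th_mul_eq_zero hi]; exact zero_mem _
      · exact Submodule.subset_span ⟨_, hS.th_mul hi⟩
    | zero => rw [mul_zero]; exact zero_mem _
    | add x y _ _ hx hy => rw [mul_add]; exact add_mem hx hy
    | smul r x _ hx => rw [mul_smul_comm]; exact Submodule.smul_mem _ _ hx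

theorem IsMon.sum_th_pd {S : Finset (Fin n)} {v : Lam K n} (h : IsMon S v) :
    ∑ l, Grassmann.th l * Grassmann.pd l v = (S.card : K) • v := by
  rw [← Finset.sum_subset (Finset.subset_univ S), Finset.sum_congr rfl h.on, Finset.sum_const,
    Nat.cast_smul_eq_nsmul]
  intro l _ hl
  rw [h.off l hl, mul_zero]

/-! #### Derivations -/

/-- The operator `w ∂_j`. -/
def dop (w : Lam K n) (j : Fin n) : Module.End K (Lam K n) := LinearMap.mulLeft K w ∘ₗ pd j

theorem dop_apply (w : Lam K n) (j : Fin n) (x : Lam K n) : dop w j x = w * pd j x := rfl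

theorem dop_mem {p : ZMod 2} {w : Lam K n} (hw : w ∈ par K n p) (j : Fin n) :
    dop w j ∈ superDer (par K n) (p + 1) := by
  refine ⟨fun q x hx => ?_, fun q x hx y => ?_⟩
  · rw [dop_apply, add_assoc]
    exact mul_mem_par hw (pd_mem j hx)
  · rw [dop_apply, dop_apply, dop_apply, pd_mul, inv_eq hx, mul_add, ← mul_assoc, smul_mul_assoc,
      mul_smul_comm, ← mul_assoc, mul_comm_super hw hx, smul_mul_assoc, smul_smul, mul_assoc,
      superSign_add_left, mul_comm (superSign K 1 q), mul_assoc x]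

theorem superDer_eq_zero {p : ZMod 2} {c : Module.End K (Lam K n)}
    (hc : c ∈ superDer (par K n) p) (h : ∀ l, c (th l) = 0) : c = 0 := by
  have h1 : c 1 = 0 := by
    have := hc.2 0 1 one_mem_par 1
    rw [superSign_zero_right, one_smul, mul_one, mul_one, one_mul] at this
    exact left_eq_add.1 this
  refine LinearMap.ext fun x => ?_
  rw [LinearMap.zero_apply]
  induction x using lam_induction with
  | h1 => exact h1
  | hs r x h => rw [map_smul, h, smul_zero]
  | ha x y hx hy => rw [map_add, hx, hy, add_zero]
  | hm i x hx => rw [hc.2 1 _ (th_mem i), h, hx, zero_mul, mul_zero, smul_zero, add_zero]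

/-- The projection of the Grassmann algebra onto its part of parity `p`. -/
def parProj (p : ZMod 2) : Lam K n →ₗ[K] Lam K n := GradedAlgebra.proj (par K n) p

theorem parProj_mem (p : ZMod 2) (w : Lam K n) : parProj p w ∈ par K n p :=
  SetLike.coe_mem _

theorem parProj_same {p : ZMod 2} {w : Lam K n} (hw : w ∈ par K n p) : parProj p w = w :=
  DirectSum.decompose_of_mem_same _ hw

theorem parProj_ne {p q : ZMod 2} {w : Lam K n} (hw : w ∈ par K n p) (h : p ≠ q) :
    parProj q w = 0 := DirectSum.decompose_of_mem_ne _ hw h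

theorem exists_par (w : Lam K n) : ∃ a ∈ par K n 0, ∃ b ∈ par K n 1, a + b = w :=
  Submodule.mem_sup.1 ((CliffordAlgebra.evenOdd_isCompl
    (0 : QuadraticForm K (Fin n → K))).sup_eq_top ▸ Submodule.mem_top)

theorem par_disjoint {w : Lam K n} (h0 : w ∈ par K n 0) (h1 : w ∈ par K n 1) : w = 0 :=
  Submodule.disjoint_def.1 (CliffordAlgebra.evenOdd_isCompl
    (0 : QuadraticForm K (Fin n → K))).disjoint _ h0 h1

theorem parProj_add (w : Lam K n) : parProj 0 w + parProj 1 w = w := by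
  obtain ⟨a, ha, b, hb, rfl⟩ := exists_par w
  rw [map_add, map_add, parProj_same ha, parProj_ne hb (by decide), parProj_ne ha (by decide),
    parProj_same hb, add_zero, zero_add]

/-- The derivation `w ∂_j`. -/
def der (j : Fin n) : Lam K n →ₗ[K] (cartanW K n).carrier where
  toFun w := (⟨dop (parProj 1 w) j, dop_mem (p := 1) (parProj_mem 1 w) j⟩,
    ⟨dop (parProj 0 w) j, dop_mem (p := 0) (parProj_mem 0 w) j⟩)
  map_add' x y := by
    refine Prod.ext (Subtype.ext ?_) (Subtype.ext ?_) <;>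
    · refine LinearMap.ext fun z => ?_
      simp [dop_apply, map_add, add_mul]
      rfl
  map_smul' r x := by
    refine Prod.ext (Subtype.ext ?_) (Subtype.ext ?_) <;>
    · refine LinearMap.ext fun z => ?_
      simp [dop_apply, map_smul]
      rfl

/-- The even component of an element of `W(n)`, as an operator. -/
def evOpr (c : (cartanW K n).carrier) : Module.End K (Lam K n) :=
  (show superDer (par K n) 0 × superDer (par K n) 1 from c).1.1

/-- The odd component of an element of `W(n)`, as an operator. -/
def odOpr (c : (cartanW K n).carrier) : Module.End K (Lam K n) :=
  (show superDer (par K n) 0 × superDer (par K n) 1 from c).2.1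

/-- The operator on the Grassmann algebra underlying an element of `W(n)`. -/
def opr : (cartanW K n).carrier →ₗ[K] Module.End K (Lam K n) where
  toFun c := evOpr c + odOpr c
  map_add' _ _ := add_add_add_comm _ _ _ _
  map_smul' _ _ := (smul_add _ _ _).symm

theorem opr_apply (c : (cartanW K n).carrier) (x : Lam K n) : opr c x = evOpr c x + odOpr c x := rfl

theorem evOpr_bracket (c d : (cartanW K n).carrier) : evOpr ⁅c, d⁆ =
    (evOpr c * evOpr d - evOpr d * evOpr c) + (odOpr c * odOpr d + odOpr d * odOpr c) :=
  derBracket_fst _ c d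

theorem odOpr_bracket (c d : (cartanW K n).carrier) : odOpr ⁅c, d⁆ =
    (evOpr c * odOpr d - odOpr d * evOpr c) + (odOpr c * evOpr d - evOpr d * odOpr c) :=
  derBracket_snd _ c d

theorem odOpr_eq_zero {c : (cartanW K n).carrier} (hc : c ∈ (cartanW K n).part 0) : odOpr c = 0 :=
  (mem_derPart_zero _ _).1 hc

theorem evOpr_eq_zero {c : (cartanW K n).carrier} (hc : c ∈ (cartanW K n).part 1) : evOpr c = 0 :=
  (mem_derPart_one _ _).1 hc

theorem opr_der (w : Lam K n) (j : Fin n) (x : Lam K n) : opr (der j w) x = w * pd j x := by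
  change parProj 1 w * pd j x + parProj 0 w * pd j x = _
  rw [← add_mul, add_comm, parProj_add]

theorem der_mem_part {p : ZMod 2} {w : Lam K n} (hw : w ∈ par K n p) (j : Fin n) :
    der j w ∈ (cartanW K n).part (1 + p) := by
  have hp : ∀ a : ZMod 2, a = 0 ∨ a = 1 := by decide
  have hz : ∀ j : Fin n, dop (0 : Lam K n) j = 0 := fun j => LinearMap.ext fun x => zero_mul _
  rcases hp p with rfl | rfl
  · refine (mem_derPart_one _ _).2 ?_
    change dop (parProj 1 w) j = 0
    rw [parProj_ne hw (by decide), hz]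
  · refine (mem_derPart_zero _ _).2 ?_
    change dop (parProj 0 w) j = 0
    rw [parProj_ne hw (by decide), hz]

/-- An element of `W(n)` is determined by its values on the generators. -/
theorem cartanW_ext {c d : (cartanW K n).carrier} (h : ∀ l, opr c (th l) = opr d (th l)) :
    c = d := by
  rw [← sub_eq_zero]
  have h' : ∀ l, opr (c - d) (th l) = 0 := fun l => by rw [map_sub, LinearMap.sub_apply, h, sub_self]
  generalize c - d = e at h'
  have h11 : (1 : ZMod 2) + 1 = 0 := by decide
  -- The even and the odd component send `th l` to elements of opposite parity, so a vanishing sum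
  -- forces both to vanish.
  have key : ∀ l, e.1.1 (th l) = 0 ∧ e.2.1 (th l) = 0 := by
    intro l
    have hl : e.1.1 (th l) + e.2.1 (th l) = 0 := h' l
    have m1 : e.1.1 (th l) ∈ par K n 1 := e.1.2.1 1 _ (th_mem l)
    have m0 : e.2.1 (th l) ∈ par K n 0 := by
      have := e.2.2.1 1 _ (th_mem l)
      rwa [h11] at this
    have z : e.1.1 (th l) = 0 := by
      refine par_disjoint ?_ m1
      rw [eq_neg_of_add_eq_zero_left hl]
      exact neg_mem m0
    exact ⟨z, by rwa [z, zero_add] at hl⟩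
  exact Prod.ext (Subtype.ext (superDer_eq_zero e.1.2 fun l => (key l).1))
    (Subtype.ext (superDer_eq_zero e.2.2 fun l => (key l).2))

theorem opr_bracket {p q : ZMod 2} {c d : (cartanW K n).carrier} (hc : c ∈ (cartanW K n).part p)
    (hd : d ∈ (cartanW K n).part q) (x : Lam K n) :
    opr ⁅c, d⁆ x = opr c (opr d x) - superSign K p q • opr d (opr c x) := by
  have hp : ∀ a : ZMod 2, a = 0 ∨ a = 1 := by decide
  rw [opr_apply ⁅c, d⁆, evOpr_bracket, odOpr_bracket]
  simp only [opr_apply]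
  rcases hp p with rfl | rfl <;> rcases hp q with rfl | rfl
  · simp [odOpr_eq_zero hc, odOpr_eq_zero hd, superSign_zero_left]
  · simp [odOpr_eq_zero hc, evOpr_eq_zero hd, superSign_zero_left]
  · simp [evOpr_eq_zero hc, odOpr_eq_zero hd, superSign_zero_right]
  · simp [evOpr_eq_zero hc, evOpr_eq_zero hd, superSign_one_one]

/-- It is enough to compare values on the generators; there the second-order terms drop out because
∂_j θ_l is a constant. -/
theorem der_bracket {p q : ZMod 2} {w z : Lam K n} (hw : w ∈ par K n p) (hz : z ∈ par K n q)
    (i j : Fin n) :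
    ⁅der i w, der j z⁆ =
      der j (w * pd i z) - superSign K (1 + p) (1 + q) • der i (z * pd j w) := by
  refine cartanW_ext fun l => ?_
  rw [opr_bracket (der_mem_part hw i) (der_mem_part hz j), map_sub, map_smul]
  simp only [LinearMap.sub_apply, LinearMap.smul_apply, opr_der, pd_th]
  split_ifs <;> simp

/-- Every element of `W(n)` is `∑ w_j ∂_j`. -/
theorem eq_sum_der (c : (cartanW K n).carrier) : c = ∑ j, der j (opr c (th j)) := by
  refine cartanW_ext fun l => ?_
  rw [map_sum, LinearMap.sum_apply]
  simp [opr_der, pd_th]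

theorem cartanW_eq_span :
    Submodule.span K {x : (cartanW K n).carrier | ∃ S v j, IsMon S v ∧ x = der j v} = ⊤ := by
  rw [eq_top_iff]
  rintro x -
  rw [eq_sum_der x]
  refine Submodule.sum_mem _ fun j _ => ?_
  have : opr x (th j) ∈ Submodule.span K {v : Lam K n | ∃ S, IsMon S v} :=
    lam_eq_span (K := K) ▸ Submodule.mem_top
  generalize opr x (th j) = y at this
  induction this using Submodule.span_induction with
  | mem v hv => obtain ⟨S, hS⟩ := hv; exact Submodule.subset_span ⟨S, v, j, hS, rfl⟩
  | zero => rw [map_zero]; exact zero_mem _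
  | add x y _ _ hx hy => rw [map_add]; exact add_mem hx hy
  | smul r x _ hx => rw [map_smul]; exact Submodule.smul_mem _ _ hx

theorem der_injective {j : Fin n} {v : Lam K n} (h : der j v = 0) : v = 0 := by
  have := opr_der v j (th j)
  rw [h, pd_th, if_pos rfl, mul_one] at this
  simpa using this.symm

end Grassmann

namespace Grassmann

open LieSuperalgebra

/-! ### Brackets in `W(n)` -/

section Brackets

variable {K : Type u} [Field K] {n : ℕ}

variable (K) in
/-- The derivation `θ_a ∂_b`. -/
def E (a b : Fin n) : (cartanW K n).carrier := der b (th a)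

variable (K) in
/-- The derivation `θ_a θ_b ∂_c`. -/
def T (a b c : Fin n) : (cartanW K n).carrier := der c (th a * th b)

variable (K) in
/-- The derivation `∂_a`. -/
def D (a : Fin n) : (cartanW K n).carrier := der a 1

theorem E_mem (a b : Fin n) : (E K a b : (cartanW K n).carrier) ∈ (cartanW K n).part 0 :=
  der_mem_part (p := 1) (th_mem a) b

theorem D_mem (a : Fin n) : (D K a : (cartanW K n).carrier) ∈ (cartanW K n).part 1 :=
  der_mem_part (p := 0) one_mem_par a

theorem th_th_mem (a b : Fin n) : (th a * th b : Lam K n) ∈ par K n 0 :=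
  (show (1 : ZMod 2) + 1 = 0 by decide) ▸ mul_mem_par (th_mem (K := K) a) (th_mem b)

theorem T_mem (a b c : Fin n) : (T K a b c : (cartanW K n).carrier) ∈ (cartanW K n).part 1 :=
  der_mem_part (p := 0) (th_th_mem a b) c

theorem E_der (a b j : Fin n) (v : Lam K n) :
    ⁅E K a b, der j v⁆ = der j (th a * pd b v) - if j = a then der b v else 0 := by
  have key : ∀ q, ∀ v ∈ par K n q,
      ⁅E K a b, der j v⁆ = der j (th a * pd b v) - if j = a then der b v else 0 := by
    intro q v hv
    rw [E, der_bracket (th_mem a) hv, show (1 : ZMod 2) + 1 = 0 by decide, superSign_zero_left,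
      one_smul, pd_th]
    split_ifs <;> simp
  obtain ⟨x, hx, y, hy, rfl⟩ := exists_par v
  rw [map_add, br_add, key _ x hx, key _ y hy]
  split_ifs <;> simp [mul_add] <;> abel

theorem D_der (i j : Fin n) (v : Lam K n) : ⁅D K i, der j v⁆ = der j (pd i v) := by
  have key : ∀ q, ∀ v ∈ par K n q, ⁅D K i, der j v⁆ = der j (pd i v) := by
    intro q v hv
    rw [D, der_bracket one_mem_par hv, pd_one, mul_zero, map_zero, smul_zero, sub_zero, one_mul]
  obtain ⟨x, hx, y, hy, rfl⟩ := exists_par v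
  rw [map_add, br_add, key _ x hx, key _ y hy, map_add, map_add]

theorem der_der_even {w v : Lam K n} (hw : w ∈ par K n 0) (hv : v ∈ par K n 0) (i j : Fin n) :
    ⁅der i w, der j v⁆ = der j (w * pd i v) + der i (v * pd j w) := by
  rw [der_bracket hw hv, add_zero, superSign_one_one, neg_smul, one_smul, sub_neg_eq_add]

theorem E_E (a b c d : Fin n) : (⁅E K a b, E K c d⁆ : (cartanW K n).carrier) =
    (if b = c then E K a d else 0) - if d = a then E K c b else 0 := by
  rw [E.eq_def K c d, E_der, pd_th]
  split_ifs <;> simp [E]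

theorem E_D (a b c : Fin n) :
    (⁅E K a b, D K c⁆ : (cartanW K n).carrier) = -if c = a then D K b else 0 := by
  rw [D, E_der]
  simp [D]

theorem D_E (a b c : Fin n) :
    (⁅D K a, E K b c⁆ : (cartanW K n).carrier) = if a = b then D K c else 0 := by
  rw [E, D_der, pd_th]
  split_ifs <;> simp [D]

theorem D_D (a b : Fin n) : (⁅D K a, D K b⁆ : (cartanW K n).carrier) = 0 := by
  rw [D.eq_def K b, D_der, pd_one, map_zero]

theorem pd_th_th (l a b : Fin n) : pd l (th a * th b : Lam K n) =
    (if l = a then th b else 0) - if l = b then th a else 0 := by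
  rw [pd_th_mul, pd_th]
  split_ifs <;> simp

theorem T_swap (a b c : Fin n) : (T K a b c : (cartanW K n).carrier) = -T K b a c := by
  rw [T, T, th_mul_comm, map_neg]

@[simp] theorem T_self (a c : Fin n) : (T K a a c : (cartanW K n).carrier) = 0 := by
  rw [T, th_mul_self, map_zero]

theorem D_T (l a b c : Fin n) : (⁅D K l, T K a b c⁆ : (cartanW K n).carrier) =
    (if l = a then E K b c else 0) - if l = b then E K a c else 0 := by
  rw [T, D_der, pd_th_th]
  split_ifs <;> simp [E]

theorem E_T (p q a b c : Fin n) : (⁅E K p q, T K a b c⁆ : (cartanW K n).carrier) =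
    (if q = a then T K p b c else 0) + (if q = b then T K a p c else 0) -
      if c = p then T K a b q else 0 := by
  rw [T, E_der, pd_th_th, T_swap a p]
  split_ifs <;> simp [T, mul_add, sub_eq_add_neg]

/-- The weight of `w ∂_j` for a monomial `w` in the generators with indices in `S`. -/
def monWt (S : Finset (Fin n)) (j : Fin n) : Fin n → ℤ :=
  fun l => (if l ∈ S then 1 else 0) - if l = j then 1 else 0

theorem E_mon {S : Finset (Fin n)} {v : Lam K n} (h : IsMon S v) (l j : Fin n) :
    ⁅E K l l, der j v⁆ = (monWt S j l : K) • der j v := by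
  rw [E_der, monWt]
  by_cases hl : l ∈ S
  · rw [h.on l hl, if_pos hl]
    rcases eq_or_ne l j with rfl | e
    · simp
    · simp [e, e.symm]
  · rw [h.off l hl, if_neg hl, mul_zero, map_zero]
    rcases eq_or_ne l j with rfl | e
    · simp
    · simp [e, e.symm]

end Brackets

/-! ### Weights -/

section Weights

variable {m : ℕ}

/-- The value of the weight `μ` on the Cartan element `h_a`. -/
def hpair (μ : Fin (m + 2) → ℤ) (a : Fin (m + 2)) : ℤ :=
  Fin.cases (∑ i : Fin (m + 1), μ i.succ) (fun i => μ i.castSucc - μ i.succ) a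

@[simp] theorem hpair_zero (μ : Fin (m + 2) → ℤ) : hpair μ 0 = ∑ i : Fin (m + 1), μ i.succ := rfl

@[simp] theorem hpair_succ (μ : Fin (m + 2) → ℤ) (i : Fin (m + 1)) :
    hpair μ i.succ = μ i.castSucc - μ i.succ := rfl

theorem hpair_add (μ ν : Fin (m + 2) → ℤ) (a : Fin (m + 2)) :
    hpair (μ + ν) a = hpair μ a + hpair ν a := by
  refine Fin.cases ?_ (fun i => ?_) a
  · simp [Finset.sum_add_distrib]
  · simp; ring

theorem hpair_neg (μ : Fin (m + 2) → ℤ) (a : Fin (m + 2)) : hpair (-μ) a = -hpair μ a := by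
  refine Fin.cases ?_ (fun i => ?_) a
  · simp
  · simp; ring

/-- The simple roots. -/
def sroot (a : Fin (m + 2)) : Fin (m + 2) → ℤ :=
  Fin.cases (-Pi.single 0 1) (fun i => Pi.single i.castSucc 1 - Pi.single i.succ 1) a

@[simp] theorem sroot_zero : (sroot 0 : Fin (m + 2) → ℤ) = -Pi.single 0 1 := rfl

@[simp] theorem sroot_succ (i : Fin (m + 1)) :
    sroot i.succ = Pi.single i.castSucc 1 - Pi.single i.succ 1 := rfl

theorem cartan_zero_zero : cartanMatrixA (m + 2) 0 0 = 0 := by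
  simp only [cartanMatrixA, if_true, Fin.val_zero]

theorem cartan_zero_succ (i : Fin (m + 1)) :
    cartanMatrixA (m + 2) 0 i.succ = if i = 0 then -1 else 0 := by
  simp only [cartanMatrixA, Fin.ext_iff, Fin.val_zero, Fin.val_succ]
  split_ifs <;> first | omega | simp_all

theorem cartan_succ_zero (i : Fin (m + 1)) :
    cartanMatrixA (m + 2) i.succ 0 = if i = 0 then -1 else 0 := by
  simp only [cartanMatrixA, Fin.ext_iff, Fin.val_zero, Fin.val_succ]
  split_ifs <;> first | omega | simp_all

theorem cartan_succ_succ (i j : Fin (m + 1)) : cartanMatrixA (m + 2) i.succ j.succ =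
    if i = j then 2 else if i.val + 1 = j.val ∨ j.val + 1 = i.val then -1 else 0 := by
  simp only [cartanMatrixA, Fin.ext_iff, Fin.val_zero, Fin.val_succ]
  split_ifs <;> first | omega | simp_all

/-- This lets every relation with some h_a on the left be read off from the weight of the other
factor. -/
theorem hpair_sroot (a b : Fin (m + 2)) : hpair (sroot b) a = cartanMatrixA (m + 2) a b := by
  refine Fin.cases ?_ (fun i => ?_) a <;> refine Fin.cases ?_ (fun j => ?_) b
  · simp [cartan_zero_zero]
  · rw [cartan_zero_succ, hpair_zero, sroot_succ]
    simp only [Pi.sub_apply, Finset.sum_sub_distrib, Pi.single_apply, Fin.succ_inj,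
      Finset.sum_ite_eq', Finset.mem_univ, if_true]
    rcases Fin.eq_zero_or_eq_succ j with rfl | ⟨k, rfl⟩
    · have : ∀ x : Fin (m + 1), x.succ ≠ (0 : Fin (m + 1)).castSucc := fun x => by
        rw [Fin.castSucc_zero]; exact Fin.succ_ne_zero x
      simp only [this, if_false, Finset.sum_const_zero, if_true, zero_sub]
    · have : ∀ x : Fin (m + 1), (x.succ = k.succ.castSucc) ↔ x = k.castSucc := by
        intro x
        simp only [Fin.ext_iff, Fin.val_succ, Fin.val_castSucc, Nat.add_right_cancel_iff]
      simp only [this, Finset.sum_ite_eq', Finset.mem_univ, if_true, Fin.succ_ne_zero, if_false,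
        sub_self]
  · rw [cartan_succ_zero, hpair_succ, sroot_zero]
    simp only [Pi.neg_apply, Pi.single_apply, Fin.ext_iff, Fin.val_castSucc, Fin.val_succ,
      Fin.val_zero]
    split_ifs <;> first | omega | simp_all
  · rw [cartan_succ_succ, hpair_succ, sroot_succ]
    simp only [Pi.sub_apply, Pi.single_apply, Fin.ext_iff, Fin.val_castSucc, Fin.val_succ]
    split_ifs <;> first | omega | simp_all

theorem hpair_single_zero (a : Fin (m + 2)) :
    hpair (Pi.single 0 1) a = -cartanMatrixA (m + 2) a 0 := by
  rw [← hpair_sroot, ← hpair_neg, sroot_zero, neg_neg]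

end Weights

/-! ### The standard generators of `W(n)` -/

section Std

variable {K : Type u} [Field K] {m : ℕ}

variable (K) in
/-- The generator `e_a` of `W(n)`. -/
def eW (a : Fin (m + 2)) : (cartanW K (m + 2)).carrier :=
  Fin.cases (D K 0) (fun i => E K i.castSucc i.succ) a

variable (K) in
/-- The generator `f_a` of `W(n)` for `a ≠ 0`. -/
def fW (a : Fin (m + 2)) : (cartanW K (m + 2)).carrier :=
  Fin.cases 0 (fun i => E K i.succ i.castSucc) a

variable (K) in
/-- The generator `h_a` of `W(n)`. -/
def hW (a : Fin (m + 2)) : (cartanW K (m + 2)).carrier :=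
  Fin.cases (∑ i : Fin (m + 1), E K i.succ i.succ) (fun i => E K i.castSucc i.castSucc - E K i.succ i.succ) a

variable (K) in
/-- The generator `f_{0a}` of `W(n)` for `a ≠ 1`. -/
def gW (a : Fin (m + 2)) : (cartanW K (m + 2)).carrier :=
  Fin.cases (∑ i : Fin (m + 1), T K 0 i.succ i.succ)
    (fun i => T K 0 i.castSucc i.castSucc - T K 0 i.succ i.succ) a

@[simp] theorem eW_zero : (eW K 0 : (cartanW K (m + 2)).carrier) = D K 0 := rfl
@[simp] theorem eW_succ (i : Fin (m + 1)) :
    (eW K i.succ : (cartanW K (m + 2)).carrier) = E K i.castSucc i.succ := rfl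
@[simp] theorem fW_succ (i : Fin (m + 1)) :
    (fW K i.succ : (cartanW K (m + 2)).carrier) = E K i.succ i.castSucc := rfl
@[simp] theorem hW_zero : (hW K 0 : (cartanW K (m + 2)).carrier) =
    ∑ i : Fin (m + 1), E K i.succ i.succ := rfl
@[simp] theorem hW_succ (i : Fin (m + 1)) : (hW K i.succ : (cartanW K (m + 2)).carrier) =
    E K i.castSucc i.castSucc - E K i.succ i.succ := rfl
@[simp] theorem gW_zero : (gW K 0 : (cartanW K (m + 2)).carrier) =
    ∑ i : Fin (m + 1), T K 0 i.succ i.succ := rfl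
@[simp] theorem gW_succ (i : Fin (m + 1)) : (gW K i.succ : (cartanW K (m + 2)).carrier) =
    T K 0 i.castSucc i.castSucc - T K 0 i.succ i.succ := rfl

theorem hW_bracket {x : (cartanW K (m + 2)).carrier} {μ : Fin (m + 2) → ℤ}
    (h : ∀ l, ⁅E K l l, x⁆ = (μ l : K) • x) (a : Fin (m + 2)) :
    ⁅hW K a, x⁆ = (hpair μ a : K) • x := by
  refine Fin.cases ?_ (fun i => ?_) a
  · rw [hW_zero, sum_br, hpair_zero, Int.cast_sum, Finset.sum_smul]
    exact Finset.sum_congr rfl fun i _ => h _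
  · rw [hW_succ, sub_br, h, h, hpair_succ, Int.cast_sub, sub_smul]

theorem hW_mon {S : Finset (Fin (m + 2))} {v : Lam K (m + 2)} (h : IsMon S v) (a j : Fin (m + 2)) :
    ⁅hW K a, der j v⁆ = (hpair (monWt S j) a : K) • der j v :=
  hW_bracket (fun l => E_mon h l j) a

theorem hW_eW (a b : Fin (m + 2)) :
    (⁅hW K a, eW K b⁆ : (cartanW K (m + 2)).carrier) = cartanMatrixA (m + 2) a b • eW K b := by
  rw [← hpair_sroot, ← Int.cast_smul_eq_zsmul K]
  refine Fin.cases ?_ (fun i => ?_) b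
  · have e : sroot (0 : Fin (m + 2)) = monWt ∅ 0 := by
      ext l; simp [monWt, Pi.single_apply]
    rw [e]
    exact hW_mon IsMon.one a 0
  · have e : sroot i.succ = monWt {i.castSucc} i.succ := by
      ext l; simp [monWt, Pi.single_apply]
    rw [e]
    exact hW_mon IsMon.th a i.succ

theorem hW_fW (a b : Fin (m + 2)) (hb : b ≠ 0) :
    (⁅hW K a, fW K b⁆ : (cartanW K (m + 2)).carrier) = -(cartanMatrixA (m + 2) a b • fW K b) := by
  rw [← hpair_sroot, ← neg_smul, ← hpair_neg, ← Int.cast_smul_eq_zsmul K]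
  obtain ⟨i, rfl⟩ := Fin.exists_succ_eq.2 hb
  have e : -sroot i.succ = monWt {i.succ} i.castSucc := by
    ext l; simp [monWt, Pi.single_apply]
  rw [e]
  exact hW_mon IsMon.th a i.castSucc

/-- For p, q ≠ 0 the element E_pq does not touch θ_0, so it acts on θ_0 E_ll as on E_ll, with [E_pq,
E_ll] = (δ_ql - δ_pl) E_pq. -/
theorem E_gW (p q a : Fin (m + 2)) (hp : p ≠ 0) (hq : q ≠ 0) (hpq : p ≠ q) :
    (⁅E K p q, gW K a⁆ : (cartanW K (m + 2)).carrier) =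
      (hpair (Pi.single q 1 - Pi.single p 1) a : K) • T K 0 p q := by
  have key : ∀ l : Fin (m + 2), (⁅E K p q, T K 0 l l⁆ : (cartanW K (m + 2)).carrier) =
      (((Pi.single q 1 - Pi.single p 1 : Fin (m + 2) → ℤ) l : ℤ) : K) • T K 0 p q := by
    intro l
    rw [E_T, if_neg hq]
    simp only [Pi.sub_apply, Pi.single_apply]
    rcases eq_or_ne q l with rfl | h1
    · simp [hpq.symm]
    · rcases eq_or_ne l p with rfl | h2
      · simp [hpq, h1]
      · simp [h1, h2, h1.symm]
  refine Fin.cases ?_ (fun i => ?_) a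
  · rw [gW_zero, br_sum, hpair_zero, Int.cast_sum, Finset.sum_smul]
    exact Finset.sum_congr rfl fun i _ => key _
  · rw [gW_succ, br_sub, key, key, hpair_succ, Int.cast_sub, sub_smul]

/-- `gW K a` for `a ≠ 1` is a combination of the `θ_0 θ_l ∂_l` with `l ≥ 1`. -/
theorem gW_mem_span (a : Fin (m + 2)) :
    (gW K a : (cartanW K (m + 2)).carrier) ∈
      Submodule.span K (Set.range fun l : Fin (m + 1) => T K 0 l.succ l.succ) := by
  have key : ∀ l : Fin (m + 1), T K 0 l.succ l.succ ∈
      Submodule.span K (Set.range fun l : Fin (m + 1) => T K 0 l.succ l.succ) :=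
    fun l => Submodule.subset_span ⟨l, rfl⟩
  refine Fin.cases ?_ (fun i => ?_) a
  · rw [gW_zero]
    exact Submodule.sum_mem _ fun i _ => key i
  · rw [gW_succ]
    refine sub_mem ?_ (key i)
    rcases Fin.eq_zero_or_eq_succ i with rfl | ⟨j, rfl⟩
    · rw [Fin.castSucc_zero, T_self]; exact zero_mem _
    · rw [← Fin.succ_castSucc]; exact key _

/-- Reduces linear statements about the f_{0a} to the elements θ_0 E_ll. It also covers the surplus
index a = 1, where the formula defining `gW` gives -θ_0 E_11. -/
theorem gW_induction (N : Submodule K (cartanW K (m + 2)).carrier)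
    (h : ∀ l : Fin (m + 1), T K 0 l.succ l.succ ∈ N) (a : Fin (m + 2)) : gW K a ∈ N :=
  (Submodule.span_le.2 (by rintro _ ⟨l, rfl⟩; exact h l)) (gW_mem_span a)

/-! ### The defining relations hold in `W(n)` -/

theorem eW_fW_self (i : Fin (m + 1)) : ⁅eW K i.succ, fW K i.succ⁆ = hW K i.succ := by
  rw [eW_succ, fW_succ, hW_succ, E_E, if_pos rfl, if_pos rfl]

theorem eW_fW_ne (a : Fin (m + 2)) (j : Fin (m + 1)) (h : a ≠ j.succ) :
    ⁅eW K a, fW K j.succ⁆ = 0 := by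
  revert h
  refine Fin.cases ?_ (fun i => ?_) a
  · intro _
    rw [eW_zero, fW_succ, D_E, if_neg (Fin.succ_ne_zero j).symm]
  · intro h
    have h' : i ≠ j := fun e => h (by rw [e])
    rw [eW_succ, fW_succ, E_E, if_neg (by simpa using h'), if_neg (by simpa using h'.symm), sub_zero]

theorem castSucc_ne_succ {k : ℕ} (i : Fin k) : i.castSucc ≠ i.succ :=
  (Fin.castSucc_lt_succ (i := i)).ne

theorem cartan_cases (a b : Fin (m + 2)) (h : cartanMatrixA (m + 2) a b ≤ 0) :
    cartanMatrixA (m + 2) a b = 0 ∨ cartanMatrixA (m + 2) a b = -1 := by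
  unfold cartanMatrixA at h ⊢
  split_ifs at h ⊢ <;> simp_all

/-- The Cartan entries to which a Serre relation applies are 0 or -1, so the exponent is 1 or 2. -/
theorem iterate_bracket_eq_zero {L : LieSuperalgebra.{u, v} K} {x y : L.carrier} {B : ℤ}
    (hB : B = 0 ∨ B = -1) (h0 : B = 0 → ⁅x, y⁆ = 0) (h1 : ⁅x, ⁅x, y⁆⁆ = 0) :
    (fun z => ⁅x, z⁆)^[(1 - B).toNat] y = 0 := by
  rcases hB with rfl | rfl
  · exact h0 rfl
  · exact h1

theorem serre_eW (a b : Fin (m + 2)) (h : cartanMatrixA (m + 2) a b ≤ 0) :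
    (fun x => ⁅eW K a, x⁆)^[(1 - cartanMatrixA (m + 2) a b).toNat] (eW K b) = 0 := by
  refine iterate_bracket_eq_zero (cartan_cases a b h) ?_ ?_
  · revert h
    refine Fin.cases ?_ (fun i => ?_) a <;> refine Fin.cases ?_ (fun j => ?_) b
    · intro _ _; rw [eW_zero, D_D]
    · intro _ h
      rw [cartan_zero_succ] at h
      rw [eW_zero, eW_succ, D_E, if_neg]
      intro e
      rw [if_pos (by simpa [eq_comm] using e)] at h
      exact absurd h (by decide)
    · intro _ h
      rw [cartan_succ_zero] at h
      rw [eW_zero, eW_succ, E_D, if_neg, neg_zero]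
      intro e
      rw [if_pos (by simpa [eq_comm] using e)] at h
      exact absurd h (by decide)
    · intro _ h
      rw [cartan_succ_succ] at h
      rw [eW_succ, eW_succ, E_E, if_neg, if_neg, sub_zero]
      · intro e; simp only [Fin.ext_iff, Fin.val_castSucc, Fin.val_succ] at e h
        split_ifs at h <;> omega
      · intro e; simp only [Fin.ext_iff, Fin.val_castSucc, Fin.val_succ] at e h
        split_ifs at h <;> omega
  · revert h
    refine Fin.cases ?_ (fun i => ?_) a <;> refine Fin.cases ?_ (fun j => ?_) b
    · intro _; rw [eW_zero, D_D, br_zero]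
    · intro _
      rw [eW_zero, eW_succ, D_E]
      split_ifs <;> simp [D_D]
    · intro _
      rw [eW_zero, eW_succ, E_D]
      split_ifs <;> simp [E_D, (castSucc_ne_succ i).symm]
    · intro h
      rw [cartan_succ_succ] at h
      have hij : i ≠ j := by rintro rfl; simp at h
      have h1 : j.succ ≠ i.succ := by simpa using hij.symm
      have h2 : j.castSucc ≠ i.castSucc := by simpa using hij.symm
      rw [eW_succ, eW_succ, E_E, br_sub]
      split_ifs with h3 h4
      · simp only [Fin.ext_iff, Fin.val_castSucc, Fin.val_succ] at h3 h4
        omega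
      all_goals simp [E_E, (castSucc_ne_succ i).symm, *]

theorem serre_fW (i j : Fin (m + 1)) (h : cartanMatrixA (m + 2) i.succ j.succ ≤ 0) :
    (fun x => ⁅fW K i.succ, x⁆)^[(1 - cartanMatrixA (m + 2) i.succ j.succ).toNat]
      (fW K j.succ) = 0 := by
  refine iterate_bracket_eq_zero (cartan_cases _ _ h) ?_ ?_
  · intro h
    rw [cartan_succ_succ] at h
    rw [fW_succ, fW_succ, E_E, if_neg, if_neg, sub_zero]
    · intro e; simp only [Fin.ext_iff, Fin.val_castSucc, Fin.val_succ] at e h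
      split_ifs at h <;> omega
    · intro e; simp only [Fin.ext_iff, Fin.val_castSucc, Fin.val_succ] at e h
      split_ifs at h <;> omega
  · rw [cartan_succ_succ] at h
    have hij : i ≠ j := by rintro rfl; simp at h
    have h1 : j.succ ≠ i.succ := by simpa using hij.symm
    have h2 : j.castSucc ≠ i.castSucc := by simpa using hij.symm
    rw [fW_succ, fW_succ, E_E, br_sub]
    split_ifs with h3 h4
    · simp only [Fin.ext_iff, Fin.val_castSucc, Fin.val_succ] at h3 h4
      omega
    all_goals simp [E_E, castSucc_ne_succ i, *]

theorem D_gW (a : Fin (m + 2)) (ha : a ≠ 1) : ⁅eW K (0 : Fin (m + 2)), gW K a⁆ = hW K a := by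
  have key : ∀ l : Fin (m + 1), ⁅D K (0 : Fin (m + 2)), T K 0 l.succ l.succ⁆ = E K l.succ l.succ := fun l => by
    rw [D_T, if_pos rfl, if_neg (Fin.succ_ne_zero l).symm, sub_zero]
  revert ha
  refine Fin.cases ?_ (fun i => ?_) a
  · intro _
    rw [eW_zero, gW_zero, hW_zero, br_sum]
    exact Finset.sum_congr rfl fun i _ => key i
  · intro ha
    rcases Fin.eq_zero_or_eq_succ i with rfl | ⟨j, rfl⟩
    · exact absurd rfl ha
    · rw [eW_zero, gW_succ, hW_succ, br_sub, ← Fin.succ_castSucc, key, key]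

theorem hW_gW (a b : Fin (m + 2)) :
    ⁅hW K a, gW K b⁆ = -(cartanMatrixA (m + 2) a 0 • gW K b) := by
  rw [← neg_smul, ← hpair_single_zero, ← Int.cast_smul_eq_zsmul K, ← sub_eq_zero]
  have := gW_induction (K := K) (LinearMap.ker ((cartanW K (m + 2)).bracket (hW K a) -
    (hpair (Pi.single 0 1) a : K) • LinearMap.id)) (fun l => ?_) b
  · exact this
  · have hne : (0 : Fin (m + 2)) ≠ l.succ := (Fin.succ_ne_zero l).symm
    have e : (Pi.single 0 1 : Fin (m + 2) → ℤ) = monWt {0, l.succ} l.succ := by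
      ext k
      simp only [monWt, Pi.single_apply, Finset.mem_insert, Finset.mem_singleton]
      rcases eq_or_ne k 0 with rfl | h
      · simp [hne]
      · simp [h]
    rw [LinearMap.mem_ker, e]
    exact sub_eq_zero.2 (hW_mon (IsMon.th_th hne) a l.succ)

theorem E_gW_one (a : Fin (m + 2)) : ⁅eW K (0 : Fin (m + 1)).succ, gW K a⁆ = 0 := by
  refine gW_induction (LinearMap.ker ((cartanW K (m + 2)).bracket (eW K (0 : Fin (m + 1)).succ))) (fun l => ?_) a
  rw [LinearMap.mem_ker]
  change ⁅E K (0 : Fin (m + 1)).castSucc (0 : Fin (m + 1)).succ, T K 0 l.succ l.succ⁆ = 0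
  rw [E_T, Fin.castSucc_zero, if_neg (Fin.succ_ne_zero _), if_neg (Fin.succ_ne_zero _), T_self]
  split_ifs <;> simp

/-- Only h_1 involves E_00, the one diagonal element that does not commute with ∂_0. -/
theorem hW_D (a : Fin (m + 2)) (ha : a ≠ 1) : ⁅D K (0 : Fin (m + 2)), hW K a⁆ = 0 := by
  have key : ∀ l : Fin (m + 1), ⁅D K (0 : Fin (m + 2)), E K l.succ l.succ⁆ = 0 := fun l => by
    rw [D_E, if_neg (Fin.succ_ne_zero l).symm]
  revert ha
  refine Fin.cases ?_ (fun i => ?_) a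
  · intro _
    rw [hW_zero, br_sum]
    exact Finset.sum_eq_zero fun i _ => key i
  · intro ha
    rcases Fin.eq_zero_or_eq_succ i with rfl | ⟨j, rfl⟩
    · exact absurd rfl ha
    · rw [hW_succ, br_sub, ← Fin.succ_castSucc, key, key, sub_zero]

theorem E_E_gW (a b : Fin (m + 2)) (hb : b ≠ 1) : ⁅eW K a, ⁅eW K a, gW K b⁆⁆ = 0 := by
  refine Fin.cases ?_ (fun i => ?_) a
  · rw [D_gW b hb, eW_zero, hW_D b hb]
  · rcases Fin.eq_zero_or_eq_succ i with rfl | ⟨j, rfl⟩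
    · rw [E_gW_one, br_zero]
    · rw [eW_succ, ← Fin.succ_castSucc, E_gW _ _ _ (Fin.succ_ne_zero _) (Fin.succ_ne_zero _)
        (by simpa using castSucc_ne_succ j), br_smul, E_T]
      simp [(castSucc_ne_succ j).symm, Fin.succ_ne_zero]

theorem E_one_zero_T (l : Fin (m + 1)) : ⁅fW K (0 : Fin (m + 1)).succ, T K 0 l.succ l.succ⁆ =
    T K 1 l.succ l.succ - if l = 0 then T K 0 1 0 else 0 := by
  rw [fW_succ, Fin.castSucc_zero, E_T, if_pos rfl, if_neg (Fin.succ_ne_zero l).symm, add_zero,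
    Fin.succ_zero_eq_one]
  congr 1
  rcases eq_or_ne l 0 with rfl | h
  · simp
  · rw [if_neg h, if_neg]
    intro e
    exact h (Fin.succ_injective _ (by simpa using e))

theorem f_f_gW (i : Fin (m + 1)) (b : Fin (m + 2)) : ⁅fW K i.succ, ⁅fW K i.succ, gW K b⁆⁆ = 0 := by
  rcases Fin.eq_zero_or_eq_succ i with rfl | ⟨j, rfl⟩
  · refine gW_induction (LinearMap.ker ((cartanW K (m + 2)).bracket (fW K (0 : Fin (m + 1)).succ) ∘ₗ
      (cartanW K (m + 2)).bracket (fW K (0 : Fin (m + 1)).succ))) (fun l => ?_) b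
    rw [LinearMap.mem_ker]
    change ⁅fW K (0 : Fin (m + 1)).succ, ⁅fW K (0 : Fin (m + 1)).succ, T K 0 l.succ l.succ⁆⁆ = 0
    rw [E_one_zero_T, fW_succ, Fin.castSucc_zero, br_sub, E_T, Fin.succ_zero_eq_one]
    rcases eq_or_ne l 0 with rfl | h
    · simp [E_T]
    · have h' : l.succ ≠ 1 := fun e => h (Fin.succ_injective _ (by simpa using e))
      simp [h, h', (Fin.succ_ne_zero l).symm]
  · rw [fW_succ, ← Fin.succ_castSucc, E_gW _ _ _ (Fin.succ_ne_zero _) (Fin.succ_ne_zero _)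
        (by simpa using (castSucc_ne_succ j).symm), br_smul, E_T]
    simp [castSucc_ne_succ j, (Fin.succ_ne_zero _)]

theorem e_f_gW (i j : Fin m) (a : Fin (m + 2)) :
    ⁅eW K i.succ.succ, ⁅fW K j.succ.succ, gW K a⁆⁆ =
      if i = j then cartanMatrixA (m + 2) a j.succ.succ • gW K j.succ.succ else 0 := by
  rw [fW_succ, ← Fin.succ_castSucc, E_gW _ _ _ (Fin.succ_ne_zero _) (Fin.succ_ne_zero _)
        (by simpa using (castSucc_ne_succ j).symm), br_smul, eW_succ, E_T]
  have e : (Pi.single j.castSucc.succ 1 - Pi.single j.succ.succ 1 : Fin (m + 2) → ℤ) =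
      sroot j.succ.succ := by
    rw [sroot_succ, Fin.succ_castSucc]
  rw [e, hpair_sroot]
  rcases eq_or_ne i j with rfl | h
  · simp [Fin.succ_ne_zero, ← Fin.succ_castSucc, Int.cast_smul_eq_zsmul]
  · rw [if_neg h]
    have h1 : ¬ i.succ.succ = j.succ.succ := by simpa using h
    have h2 : ¬ j.castSucc.succ = i.succ.castSucc := by
      rw [← Fin.succ_castSucc]; simpa using h.symm
    rw [if_neg (Fin.succ_ne_zero _), if_neg h1, if_neg h2]
    simp

theorem T_T_self (k l : Fin (m + 1)) : ⁅T K (0 : Fin (m + 2)) k.succ k.succ, T K 0 l.succ l.succ⁆ = 0 := by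
  rw [T, T, der_der_even (th_th_mem _ _) (th_th_mem _ _), pd_th_th, pd_th_th,
    if_neg (Fin.succ_ne_zero _), if_neg (Fin.succ_ne_zero _)]
  have h : ∀ a b : Fin (m + 2), (th a * th b * th a : Lam K (m + 2)) = 0 := fun a b => by
    rw [mul_assoc, th_mul_comm b a, mul_neg, th_mul_self_mul, neg_zero]
  split_ifs <;> simp [h]

theorem gW_gW (a b : Fin (m + 2)) : ⁅gW K a, gW K b⁆ = 0 := by
  have h1 : ∀ k : Fin (m + 1), ⁅T K (0 : Fin (m + 2)) k.succ k.succ, gW K b⁆ = 0 := fun k =>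
    gW_induction (LinearMap.ker ((cartanW K (m + 2)).bracket (T K 0 k.succ k.succ)))
      (fun l => T_T_self k l) b
  exact gW_induction (LinearMap.ker ((cartanW K (m + 2)).bracket.flip (gW K b))) h1 a

/-- For k = l the two contributions θ_0 θ_k θ_1 ∂_k and θ_1 θ_k θ_0 ∂_k cancel; for k ≠ l both
derivatives vanish. The relations of `JRel` that contain f_1 rest on this. -/
theorem T_T_one (k l : Fin m) :
    ⁅T K (0 : Fin (m + 2)) k.succ.succ k.succ.succ, T K 1 l.succ.succ l.succ.succ⁆ = 0 := by
  have h0 : ∀ k : Fin m, k.succ.succ ≠ (0 : Fin (m + 2)) := fun k => Fin.succ_ne_zero _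
  have h1 : ∀ k : Fin m, k.succ.succ ≠ (1 : Fin (m + 2)) := fun k e => by
    rw [← Fin.succ_zero_eq_one, Fin.succ_inj] at e
    exact Fin.succ_ne_zero _ e
  rw [T, T, der_der_even (th_th_mem _ _) (th_th_mem _ _), pd_th_th, pd_th_th,
    if_neg (h0 _), if_neg (h1 _)]
  rcases eq_or_ne k l with rfl | h
  · simp only [if_true, zero_sub, mul_neg, ← map_add]
    rw [mul_assoc, th_mul_comm _ 1, mul_neg, th_mul_left_comm, mul_assoc, th_mul_comm _ 0, mul_neg,
      neg_neg, neg_neg, neg_add_cancel, map_zero]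
  · have h' : ¬ k.succ.succ = l.succ.succ := by simpa using h
    rw [if_neg h', if_neg (fun e => h' e.symm)]
    simp

/-! ### The homomorphism onto `W(n)` -/

variable (K) in
/-- The generators of `W(n)`. -/
def genW : WGen (m + 2) → (cartanW K (m + 2)).carrier
  | .e a => eW K a
  | .f i _ => fW K i
  | .h a => hW K a
  | .f0 a _ => gW K a

theorem genW_mem (x : WGen (m + 2)) : genW K x ∈ (cartanW K (m + 2)).part x.parity := by
  cases x with
  | e a =>
    refine Fin.cases ?_ (fun i => ?_) a
    · exact D_mem _
    · exact E_mem _ _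
  | f i hi =>
    obtain ⟨j, rfl⟩ := Fin.exists_succ_eq.2 (fun h => hi (by rw [h]; rfl) : i ≠ 0)
    exact E_mem _ _
  | h a =>
    refine Fin.cases ?_ (fun i => ?_) a
    · change hW K 0 ∈ (cartanW K (m + 2)).part 0
      rw [hW_zero]
      exact Submodule.sum_mem _ fun i _ => E_mem _ _
    · exact sub_mem (E_mem _ _) (E_mem _ _)
  | f0 a ha => exact gW_induction ((cartanW K (m + 2)).part 1) (fun l => T_mem _ _ _) a

variable (K m) in
/-- The homomorphism from the free Lie superalgebra to `W(n)`. -/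
def freeToW : (freeW K (m + 2)).Hom (cartanW K (m + 2)) :=
  freeLift (cartanW K (m + 2)) WGen.parity (genW K) genW_mem

theorem freeToW_of (x : WGen (m + 2)) :
    (freeToW K m).toLin (freeLieSuperalgebra.of K WGen.parity x) = genW K x :=
  freeLift_of _ _ _ _ _

theorem freeToW_e (a : Fin (m + 2)) : (freeToW K m).toLin (eGen K a) = eW K a := freeToW_of _
theorem freeToW_f (a : Fin (m + 2)) (h) : (freeToW K m).toLin (fGen K a h) = fW K a := freeToW_of _
theorem freeToW_h (a : Fin (m + 2)) : (freeToW K m).toLin (hGen K a) = hW K a := freeToW_of _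
theorem freeToW_f0 (a : Fin (m + 2)) (h) : (freeToW K m).toLin (f0Gen K a h) = gW K a :=
  freeToW_of _

theorem map_iterate_bracket {L M : LieSuperalgebra.{u, u} K} (φ : L.Hom M) (x y : L.carrier)
    (k : ℕ) : φ.toLin ((fun z => ⁅x, z⁆)^[k] y) = (fun z => ⁅φ.toLin x, z⁆)^[k] (φ.toLin y) := by
  induction k with
  | zero => rfl
  | succ k ih => rw [Function.iterate_succ_apply', Function.iterate_succ_apply', φ.map_bracket, ih]

theorem exists_succ_of_val_ne {a : Fin (m + 2)} (h : a.val ≠ 0) : ∃ i : Fin (m + 1), i.succ = a :=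
  Fin.exists_succ_eq.2 fun e => h (by rw [e]; rfl)

theorem exists_succ_succ_of_le {a : Fin (m + 2)} (h : 2 ≤ a.val) : ∃ i : Fin m, i.succ.succ = a :=
  ⟨⟨a.val - 2, by omega⟩, Fin.ext (by simp only [Fin.val_succ]; omega)⟩

theorem ne_one_of_val {a : Fin (m + 2)} (h : a.val ≠ 1) : a ≠ 1 := fun e => h (by rw [e]; rfl)

theorem freeToW_rel {x : (freeW K (m + 2)).carrier}
    (hx : WTildeRel K (cartanMatrixA (m + 2)) x) : (freeToW K m).toLin x = 0 := by
  cases hx with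
  | h_e a b =>
    rw [map_sub, Hom.map_bracket, map_zsmul, freeToW_h, freeToW_e, hW_eW, sub_self]
  | h_f a b hb =>
    rw [map_add, Hom.map_bracket, map_zsmul, freeToW_h, freeToW_f,
      hW_fW _ _ (fun h => hb (by rw [h]; rfl)), neg_add_cancel]
  | e_f_eq b hb =>
    obtain ⟨i, rfl⟩ := exists_succ_of_val_ne hb
    rw [map_sub, Hom.map_bracket, freeToW_h, freeToW_f, freeToW_e, eW_fW_self, sub_self]
  | e_f_ne a b hb hab =>
    obtain ⟨i, rfl⟩ := exists_succ_of_val_ne hb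
    rw [Hom.map_bracket, freeToW_f, freeToW_e, eW_fW_ne _ _ hab]
  | serre_e a b hab =>
    rw [map_iterate_bracket, freeToW_e, freeToW_e, serre_eW _ _ hab]
  | serre_f a b ha hb hab =>
    obtain ⟨i, rfl⟩ := exists_succ_of_val_ne ha
    obtain ⟨j, rfl⟩ := exists_succ_of_val_ne hb
    rw [map_iterate_bracket, freeToW_f, freeToW_f, serre_fW _ _ hab]
  | e0_f0 z a ha hz =>
    obtain rfl : z = 0 := Fin.ext hz
    rw [map_sub, Hom.map_bracket, freeToW_e, freeToW_f0, freeToW_h, D_gW _ (ne_one_of_val ha),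
      sub_self]
  | h_f0 z a b hb hz =>
    obtain rfl : z = 0 := Fin.ext hz
    rw [map_add, Hom.map_bracket, map_zsmul, freeToW_h, freeToW_f0, hW_gW, neg_add_cancel]
  | e1_f0 o a ha ho =>
    obtain rfl : o = Fin.succ 0 := Fin.ext ho
    rw [Hom.map_bracket, freeToW_e, freeToW_f0, E_gW_one]
  | e_e_f0 a b hb =>
    rw [Hom.map_bracket, Hom.map_bracket, freeToW_e, freeToW_f0, E_E_gW _ _ (ne_one_of_val hb)]
  | f_f_f0 a b ha hb =>
    obtain ⟨i, rfl⟩ := exists_succ_of_val_ne ha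
    rw [Hom.map_bracket, Hom.map_bracket, freeToW_f, freeToW_f0, f_f_gW]
  | e_f_f0_eq j a hj ha hj' hj2 =>
    obtain ⟨j, rfl⟩ := exists_succ_succ_of_le hj2
    rw [map_sub, Hom.map_bracket, Hom.map_bracket, map_zsmul, freeToW_f, freeToW_f0, freeToW_f0,
      freeToW_e, e_f_gW, if_pos rfl, sub_self]
  | e_f_f0_ne i j a hj ha hi2 hj2 hij =>
    obtain ⟨i, rfl⟩ := exists_succ_succ_of_le hi2
    obtain ⟨j, rfl⟩ := exists_succ_succ_of_le hj2
    rw [Hom.map_bracket, Hom.map_bracket, freeToW_f, freeToW_f0, freeToW_e, e_f_gW,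
      if_neg (fun h => hij (by rw [h]))]

theorem T_T_one_ne (k : Fin (m + 1)) (hk : k ≠ 0) (y : (cartanW K (m + 2)).carrier)
    (hy : y ∈ Submodule.span K (Set.range fun l : Fin m => T K 1 l.succ.succ l.succ.succ)) :
    ⁅T K (0 : Fin (m + 2)) k.succ k.succ, y⁆ = 0 := by
  obtain ⟨k, rfl⟩ := Fin.exists_succ_eq.2 hk
  induction hy using Submodule.span_induction with
  | mem x h => obtain ⟨l, rfl⟩ := h; exact T_T_one k l
  | zero => exact br_zero _
  | add x y _ _ hx hy => rw [br_add, hx, hy, add_zero]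
  | smul c x _ hx => rw [br_smul, hx, smul_zero]

/-- For a ≥ 3 the element f_{0a} does not contain θ_0 E_11, the only θ_0 E_ll (l ≥ 1) on which ad
f_1 produces a term other than θ_1 E_ll. -/
theorem gW_fW_mem (a : Fin (m + 2)) (ha : 3 ≤ a.val) :
    ⁅gW K a, fW K (0 : Fin (m + 1)).succ⁆ ∈
      Submodule.span K (Set.range fun l : Fin m => T K (1 : Fin (m + 2)) l.succ.succ l.succ.succ) := by
  have e : a = Fin.succ (Fin.succ ⟨a.val - 2, by omega⟩) :=
    Fin.ext (by simp only [Fin.val_succ]; omega)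
  have e' : Fin.castSucc (Fin.succ (⟨a.val - 2, by omega⟩ : Fin m)) =
      Fin.succ (Fin.succ ⟨a.val - 3, by omega⟩) :=
    Fin.ext (by simp only [Fin.val_succ, Fin.val_castSucc]; omega)
  have h := gW_induction (K := K) _ (fun l => T_mem (K := K) (0 : Fin (m + 2)) l.succ l.succ) a
  have h' : fW K (0 : Fin (m + 1)).succ ∈ (cartanW K (m + 2)).part 0 := E_mem _ _
  rw [br_skew h h', superSign_zero_right, one_smul, neg_mem_iff]
  have hg : gW K a = T K 0 (Fin.succ (Fin.succ ⟨a.val - 3, by omega⟩)) (Fin.succ (Fin.succ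
      ⟨a.val - 3, by omega⟩)) - T K 0 (Fin.succ (Fin.succ ⟨a.val - 2, by omega⟩))
      (Fin.succ (Fin.succ ⟨a.val - 2, by omega⟩)) := by
    conv_lhs => rw [e, gW_succ, e']
  rw [hg, br_sub, E_one_zero_T, E_one_zero_T, if_neg (Fin.succ_ne_zero _), if_neg (Fin.succ_ne_zero _),
    sub_zero, sub_zero]
  exact sub_mem (Submodule.subset_span ⟨_, rfl⟩) (Submodule.subset_span ⟨_, rfl⟩)

theorem freeToW_jrel {x : (freeW K (m + 2)).carrier} (hx : JRel K x) :
    (freeToW K m).toLin x = 0 := by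
  cases hx with
  | f0_f0 a b ha hb => rw [Hom.map_bracket, freeToW_f0, freeToW_f0, gW_gW]
  | f0_f0_f1 i j o hi hj ho hi3 hj3 ho1 =>
    obtain rfl : o = Fin.succ 0 := Fin.ext ho1
    rw [Hom.map_bracket, Hom.map_bracket, freeToW_f0, freeToW_f0, freeToW_f]
    have e : i = Fin.succ (Fin.succ ⟨i.val - 2, by omega⟩) :=
      Fin.ext (by simp only [Fin.val_succ]; omega)
    have e' : Fin.castSucc (Fin.succ (⟨i.val - 2, by omega⟩ : Fin m)) =
        Fin.succ (Fin.succ ⟨i.val - 3, by omega⟩) :=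
      Fin.ext (by simp only [Fin.val_succ, Fin.val_castSucc]; omega)
    conv_lhs => rw [e, gW_succ, e', sub_br]
    rw [T_T_one_ne _ (Fin.succ_ne_zero _) _ (gW_fW_mem j hj3),
      T_T_one_ne _ (Fin.succ_ne_zero _) _ (gW_fW_mem j hj3), sub_zero]
  | f02_f00 t z j o ht hz hj ho ht2 hz0 hj3 ho1 =>
    obtain rfl : o = Fin.succ 0 := Fin.ext ho1
    obtain rfl : z = 0 := Fin.ext hz0
    rw [Hom.map_bracket, Hom.map_bracket, map_sub, freeToW_f0, freeToW_f0, freeToW_f0, freeToW_f]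
    obtain ⟨k, rfl⟩ : ∃ k, m = k + 1 := ⟨m - 1, by omega⟩
    obtain rfl : t = Fin.succ (Fin.succ 0) := Fin.ext ht2
    -- In f_{02} - f_{00} the summand θ_0 E_11 cancels; what remains involves only θ_0 E_ll with l ≥
    -- 2.
    rw [gW_succ, gW_zero, Fin.sum_univ_succ, ← Fin.succ_castSucc, Fin.castSucc_zero, sub_br,
      sub_br, add_br, T_T_one_ne _ (Fin.succ_ne_zero _) _ (gW_fW_mem j hj3), sum_br,
      Finset.sum_eq_zero fun l _ => T_T_one_ne _ (Fin.succ_ne_zero _) _ (gW_fW_mem j hj3)]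
    simp

end Std

end Grassmann

/-! ### Extremal weight arguments for weight modules over gl_n -/

section

open Grassmann

/-! ### Closures under families of operators -/

section Clos

variable {K : Type u} [Field K] {V : Type v} [AddCommGroup V] [Module K V]

/-- The smallest submodule that contains `N` and is stable under the operators in `A`. -/
def clos (A : Set (V →ₗ[K] V)) (N : Submodule K V) : Submodule K V :=
  sInf {P | N ≤ P ∧ ∀ T ∈ A, ∀ x ∈ P, T x ∈ P}

theorem le_clos (A : Set (V →ₗ[K] V)) (N : Submodule K V) : N ≤ clos A N :=
  le_sInf fun _ hP => hP.1

theorem clos_step {A : Set (V →ₗ[K] V)} {N : Submodule K V} {T : V →ₗ[K] V} (hT : T ∈ A) {x : V}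
    (hx : x ∈ clos A N) : T x ∈ clos A N := by
  rw [clos, Submodule.mem_sInf] at hx ⊢
  exact fun P hP => hP.2 T hT x (hx P hP)

theorem clos_le {A : Set (V →ₗ[K] V)} {N P : Submodule K V} (h : N ≤ P)
    (hA : ∀ T ∈ A, ∀ x ∈ P, T x ∈ P) : clos A N ≤ P := sInf_le ⟨h, hA⟩

theorem clos_induction {A : Set (V →ₗ[K] V)} {N : Submodule K V} {p : V → Prop}
    (mem : ∀ x ∈ N, p x) (add : ∀ x y, p x → p y → p (x + y))
    (smul : ∀ (c : K) x, p x → p (c • x))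
    (step : ∀ T ∈ A, ∀ x ∈ clos A N, p x → p (T x)) {x : V} (hx : x ∈ clos A N) : p x := by
  let P : Submodule K V :=
    { carrier := {x | x ∈ clos A N ∧ p x}
      zero_mem' := ⟨zero_mem _, mem 0 (zero_mem _)⟩
      add_mem' := fun ha hb => ⟨add_mem ha.1 hb.1, add _ _ ha.2 hb.2⟩
      smul_mem' := fun c _ ha => ⟨Submodule.smul_mem _ _ ha.1, smul c _ ha.2⟩ }
  have : clos A N ≤ P := clos_le (fun x hx => ⟨le_clos A N hx, mem x hx⟩)
    fun T hT x hx => ⟨clos_step hT hx.1, step T hT x hx.1 hx.2⟩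
  exact (this hx).2

theorem clos_le_sup {A : Set (V →ₗ[K] V)} {N : Submodule K V} :
    clos A N ≤ N ⊔ ⨆ T ∈ A, (clos A N).map T := by
  refine clos_le le_sup_left fun T hT x hx => ?_
  refine Submodule.mem_sup_right (Submodule.mem_iSup_of_mem T (Submodule.mem_iSup_of_mem hT ?_))
  refine ⟨x, ?_, rfl⟩
  have : N ⊔ ⨆ T ∈ A, (clos A N).map T ≤ clos A N := by
    refine sup_le (le_clos A N) (iSup₂_le fun T hT => ?_)
    rintro _ ⟨y, hy, rfl⟩
    exact clos_step hT hy
  exact this hx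

/-- Elements of the closure are, up to `N`, sums of images of the operators. -/
theorem clos_cases {A : Set (V →ₗ[K] V)} {N : Submodule K V} {p : V → Prop}
    (zero : p 0) (add : ∀ x y, p x → p y → p (x + y))
    (step : ∀ T ∈ A, ∀ x ∈ clos A N, p (T x)) {x : V} (hx : x ∈ clos A N) :
    ∃ t ∈ N, ∃ y, p y ∧ x = t + y := by
  obtain ⟨t, ht, y, hy, rfl⟩ := Submodule.mem_sup.1 (clos_le_sup hx)
  refine ⟨t, ht, y, ?_, rfl⟩
  rw [iSup_subtype'] at hy
  clear hx
  induction hy using Submodule.iSup_induction' with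
  | mem T y h => obtain ⟨z, hz, rfl⟩ := h; exact step _ T.2 z hz
  | zero => exact zero
  | add a b _ _ ha hb => exact add _ _ ha hb

end Clos

/-! ### Tail sums of weights -/

section Tail

variable {m : ℕ}

/-- The sum of the entries of `μ` with index at least `j`. -/
def tail (μ : Fin (m + 2) → ℤ) (j : ℕ) : ℤ := ∑ l, if j ≤ l.val then μ l else 0

/-- The root of `e_i`. -/
def root (i : Fin (m + 1)) : Fin (m + 2) → ℤ := Pi.single i.castSucc 1 - Pi.single i.succ 1

theorem tail_add (μ ν : Fin (m + 2) → ℤ) (j : ℕ) : tail (μ + ν) j = tail μ j + tail ν j := by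
  simp only [tail, ← Finset.sum_add_distrib]
  exact Finset.sum_congr rfl fun l _ => by split_ifs <;> simp

theorem tail_neg (μ : Fin (m + 2) → ℤ) (j : ℕ) : tail (-μ) j = -tail μ j := by
  simp only [tail, ← Finset.sum_neg_distrib]
  exact Finset.sum_congr rfl fun l _ => by split_ifs <;> simp

theorem tail_sub (μ ν : Fin (m + 2) → ℤ) (j : ℕ) : tail (μ - ν) j = tail μ j - tail ν j := by
  rw [sub_eq_add_neg, tail_add, tail_neg, sub_eq_add_neg]

theorem tail_single (a : Fin (m + 2)) (c : ℤ) (j : ℕ) :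
    tail (Pi.single a c) j = if j ≤ a.val then c else 0 := by
  rw [tail, Finset.sum_eq_single a]
  · simp
  · intro b _ hb
    simp [hb]
  · simp

/-- A raising operator lowers exactly one tail sum, the one starting at i + 1, by one. Tail sums are
thus the coordinates in which moves along simple roots are counted. -/
theorem tail_root (i : Fin (m + 1)) (j : ℕ) : tail (root i) j = if j = i.val + 1 then -1 else 0 := by
  rw [root, tail_sub, tail_single, tail_single, Fin.val_castSucc, Fin.val_succ]
  split_ifs <;> omega

theorem tail_zero (μ : Fin (m + 2) → ℤ) : tail μ 0 = ∑ l, μ l := by simp [tail]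

theorem tail_eq_zero {μ : Fin (m + 2) → ℤ} {j : ℕ} (h : ∀ l : Fin (m + 2), j ≤ l.val → μ l = 0) :
    tail μ j = 0 :=
  Finset.sum_eq_zero fun l _ => by
    split_ifs with hl
    · exact h l hl
    · rfl

theorem tail_eq_add (μ : Fin (m + 2) → ℤ) (l : Fin (m + 2)) :
    tail μ l.val = μ l + tail μ (l.val + 1) := by
  have : ∀ k : Fin (m + 2), (if l.val ≤ k.val then μ k else 0) =
      (if k = l then μ k else 0) + if l.val + 1 ≤ k.val then μ k else 0 := by
    intro k
    rcases lt_trichotomy l k with h | h | h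
    · have h' := Fin.lt_def.1 h
      rw [if_pos h'.le, if_neg h.ne', if_pos (by omega), zero_add]
    · subst h; simp
    · have h' := Fin.lt_def.1 h
      rw [if_neg (by omega), if_neg h.ne, if_neg (by omega), zero_add]
  rw [tail, Finset.sum_congr rfl fun k _ => this k, Finset.sum_add_distrib, Finset.sum_ite_eq']
  simp [tail]

theorem root_castSucc (i : Fin (m + 1)) : root i i.castSucc = 1 := by
  simp [root, castSucc_ne_succ]

theorem root_succ (i : Fin (m + 1)) : root i i.succ = -1 := by
  simp [root, (castSucc_ne_succ i).symm]

theorem root_of_lt {i : Fin (m + 1)} {l : Fin (m + 2)} (h : l.val < i.val) : root i l = 0 := by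
  have h1 : l ≠ i.castSucc := fun e => by simp [e] at h
  have h2 : l ≠ i.succ := fun e => by simp [e] at h
  simp [root, h1, h2]

/-- An antidominant weight whose tail sums are nonpositive and bounded below by `-1` vanishes
beyond the first index. -/
theorem eq_zero_of_antidominant {μ : Fin (m + 2) → ℤ} {s : ℕ}
    (h1 : ∀ i : Fin (m + 1), s ≤ i.val → μ i.castSucc ≤ μ i.succ) (h2 : -1 ≤ tail μ s)
    (h3 : ∀ j, s < j → tail μ j ≤ 0) (l : Fin (m + 2)) (hl : s < l.val) : μ l = 0 := by
  have mono : ∀ d : ℕ, ∀ a b : Fin (m + 2), s ≤ a.val → a.val + d = b.val → μ a ≤ μ b := by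
    intro d
    induction d with
    | zero =>
      intro a b _ h
      rw [Fin.ext (by omega : a.val = b.val)]
    | succ d ih =>
      intro a b ha h
      have hb : d + a.val < m + 1 := by omega
      refine (ih a (Fin.castSucc ⟨d + a.val, hb⟩) ha ?_).trans
        ((h1 ⟨d + a.val, hb⟩ ?_).trans_eq (congrArg μ (Fin.ext ?_)))
      · simp only [Fin.val_castSucc]; omega
      · simp only; omega
      · simp only [Fin.val_succ]; omega
  have hlast : μ (Fin.last (m + 1)) ≤ 0 := by
    have := h3 (m + 1) (by omega)
    have e := tail_eq_add μ (Fin.last (m + 1))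
    rw [Fin.val_last, tail_eq_zero (j := m + 1 + 1) (fun l hl => by omega)] at e
    omega
  have hneg : ∀ a : Fin (m + 2), s ≤ a.val → μ a ≤ 0 := fun a ha =>
    (mono (m + 1 - a.val) a (Fin.last _) ha (by simp only [Fin.val_last]; omega)).trans hlast
  -- The entries from index s on increase and are nonpositive. If one of them beyond s is negative,
  -- so is the one at s, and two negative entries make the tail sum at most -2.
  by_contra hne
  have hlt : μ l < 0 := lt_of_le_of_ne (hneg l hl.le) hne
  let s' : Fin (m + 2) := ⟨s, by omega⟩
  have hs : μ s' ≤ μ l := mono (l.val - s) s' l le_rfl (by simp only [s']; omega)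
  have hss : s' ≠ l := fun e => by rw [← e] at hl; simp [s'] at hl
  have : tail μ s ≤ ∑ a ∈ {s', l}, μ a := by
    rw [tail, ← Finset.sum_filter, ← sub_nonneg, ← neg_sub, neg_nonneg, sub_nonpos]
    have hsub : ({s', l} : Finset (Fin (m + 2))) ⊆ Finset.univ.filter fun a => s ≤ a.val := by
      intro a ha
      simp only [Finset.mem_insert, Finset.mem_singleton] at ha
      rcases ha with rfl | rfl <;> simp [s', hl.le]
    rw [← Finset.sum_sdiff hsub]
    have : ∑ a ∈ (Finset.univ.filter fun a : Fin (m + 2) => s ≤ a.val) \ {s', l}, μ a ≤ 0 :=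
      Finset.sum_nonpos fun a ha => hneg a (by simp at ha; exact ha.1)
    linarith
  rw [Finset.sum_pair hss] at this
  omega

end Tail

/-! ### Weight modules for `sl_n` -/

/-- A module with a weight decomposition and locally nilpotent raising and lowering operators. -/
structure SlMod (K : Type u) [Field K] (V : Type v) [AddCommGroup V] [Module K V] (m : ℕ) where
  wt : (Fin (m + 2) → ℤ) → Submodule K V
  proj : (Fin (m + 2) → ℤ) → V →ₗ[K] V
  proj_mem : ∀ μ x, proj μ x ∈ wt μ
  proj_self : ∀ μ, ∀ x ∈ wt μ, proj μ x = x
  proj_ne : ∀ μ ν, μ ≠ ν → ∀ x ∈ wt ν, proj μ x = 0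
  mem_span_proj : ∀ x, x ∈ Submodule.span K (Set.range fun μ => proj μ x)
  up : Fin (m + 1) → V →ₗ[K] V
  dn : Fin (m + 1) → V →ₗ[K] V
  up_mem : ∀ i μ, ∀ x ∈ wt μ, up i x ∈ wt (μ + root i)
  dn_mem : ∀ i μ, ∀ x ∈ wt μ, dn i x ∈ wt (μ - root i)
  comm : ∀ i j, i ≠ j → ∀ x, up i (dn j x) = dn j (up i x)
  up_dn : ∀ i μ, ∀ x ∈ wt μ,
    up i (dn i x) = dn i (up i x) + ((μ i.castSucc - μ i.succ : ℤ) : K) • x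
  up_nil : ∀ i x, ∃ k, (up i ^ k) x = 0
  dn_nil : ∀ i x, ∃ k, (dn i ^ k) x = 0

namespace SlMod

variable {K : Type u} [Field K] {V : Type v} [AddCommGroup V] [Module K V] {m : ℕ}
  (S : SlMod K V m)

/-- Interchange raising and lowering operators and negate all weights. -/
def mirror : SlMod K V m where
  wt μ := S.wt (-μ)
  proj μ := S.proj (-μ)
  proj_mem _ _ := S.proj_mem _ _
  proj_self _ := S.proj_self _
  proj_ne _ _ h := S.proj_ne _ _ fun e => h (neg_injective e)
  mem_span_proj x := by
    have : (Set.range fun μ => S.proj (-μ) x) = Set.range fun μ => S.proj μ x :=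
      (Equiv.neg (Fin (m + 2) → ℤ)).surjective.range_comp fun μ => S.proj μ x
    rw [this]
    exact S.mem_span_proj x
  up := S.dn
  dn := S.up
  up_mem i μ x hx := by
    rw [neg_add, ← sub_eq_add_neg]
    exact S.dn_mem i _ x hx
  dn_mem i μ x hx := by
    rw [neg_sub, sub_eq_neg_add]
    exact S.up_mem i _ x hx
  comm i j h x := (S.comm j i h.symm x).symm
  up_dn i μ x hx := by
    rw [S.up_dn i _ x hx, add_assoc, ← add_smul]
    simp
  up_nil := S.dn_nil
  dn_nil := S.up_nil

theorem eq_zero_of_proj {x : V} (h : ∀ μ, S.proj μ x = 0) : x = 0 := by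
  have := S.mem_span_proj x
  simp only [h] at this
  have h0 : Submodule.span K (Set.range fun _ : Fin (m + 2) → ℤ => (0 : V)) = ⊥ := by simp
  rwa [h0, Submodule.mem_bot] at this

/-- A submodule that contains the weight components of its elements. -/
def Graded (N : Submodule K V) : Prop := ∀ μ, ∀ x ∈ N, S.proj μ x ∈ N

variable {S}

theorem Graded.inf {N P : Submodule K V} (hN : S.Graded N) (hP : S.Graded P) : S.Graded (N ⊓ P) :=
  fun μ x hx => ⟨hN μ x hx.1, hP μ x hx.2⟩

theorem Graded.mirror {N : Submodule K V} (hN : S.Graded N) : S.mirror.Graded N :=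
  fun μ x hx => hN (-μ) x hx

theorem Graded.induction {N : Submodule K V} (hN : S.Graded N) {p : V → Prop} (zero : p 0)
    (mem : ∀ μ, ∀ x ∈ N, x ∈ S.wt μ → p x) (add : ∀ x y, p x → p y → p (x + y))
    (smul : ∀ (c : K) x, p x → p (c • x)) {x : V} (hx : x ∈ N) : p x := by
  have key : ∀ y ∈ Submodule.span K (Set.range fun μ => S.proj μ x), p y := by
    intro y hy
    induction hy using Submodule.span_induction with
    | mem y h => obtain ⟨μ, rfl⟩ := h; exact mem μ _ (hN μ x hx) (S.proj_mem μ x)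
    | zero => exact zero
    | add y z _ _ hy hz => exact add _ _ hy hz
    | smul c y _ hy => exact smul _ _ hy
  exact key x (S.mem_span_proj x)

theorem graded_top : S.Graded ⊤ := fun _ _ _ => trivial

theorem Graded.eq_bot {N : Submodule K V} (hN : S.Graded N)
    (h : ∀ μ, ∀ x ∈ N, x ∈ S.wt μ → x = 0) : N = ⊥ := by
  rw [eq_bot_iff]
  intro x hx
  exact S.eq_zero_of_proj fun μ => h μ _ (hN μ x hx) (S.proj_mem μ x)

theorem graded_of_le_wt {N : Submodule K V} {μ : Fin (m + 2) → ℤ} (h : N ≤ S.wt μ) :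
    S.Graded N := by
  intro ν x hx
  rcases eq_or_ne ν μ with rfl | hne
  · rwa [S.proj_self _ x (h hx)]
  · rw [S.proj_ne _ _ hne x (h hx)]
    exact zero_mem _

theorem Graded.sup {N P : Submodule K V} (hN : S.Graded N) (hP : S.Graded P) :
    S.Graded (N ⊔ P) := by
  intro μ x hx
  obtain ⟨y, hy, z, hz, rfl⟩ := Submodule.mem_sup.1 hx
  rw [map_add]
  exact Submodule.add_mem_sup (hN μ y hy) (hP μ z hz)

/-- Homogeneous operators commute with the projections up to a shift. -/
theorem proj_apply {T : V →ₗ[K] V} {α : Fin (m + 2) → ℤ}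
    (hT : ∀ μ, ∀ x ∈ S.wt μ, T x ∈ S.wt (μ + α)) (μ : Fin (m + 2) → ℤ) (x : V) :
    S.proj μ (T x) = T (S.proj (μ - α) x) := by
  refine (graded_top (S := S)).induction (p := fun x => S.proj μ (T x) = T (S.proj (μ - α) x))
    (by simp) ?_ ?_ ?_ (Submodule.mem_top (x := x))
  · intro ν y _ hy
    rcases eq_or_ne (μ - α) ν with rfl | h
    · rw [S.proj_self _ y hy]
      refine S.proj_self _ _ ?_
      have := hT _ y hy
      rwa [sub_add_cancel] at this
    · rw [S.proj_ne _ _ h y hy, map_zero]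
      exact S.proj_ne _ _ (fun e => h (by rw [e, add_sub_cancel_right])) _ (hT _ y hy)
  · intro y z hy hz; simp only [map_add, hy, hz]
  · intro c y hy; simp only [map_smul, hy]

theorem proj_up (i : Fin (m + 1)) (μ : Fin (m + 2) → ℤ) (x : V) :
    S.proj μ (S.up i x) = S.up i (S.proj (μ - root i) x) := proj_apply (S.up_mem i) μ x

theorem proj_dn (i : Fin (m + 1)) (μ : Fin (m + 2) → ℤ) (x : V) :
    S.proj μ (S.dn i x) = S.dn i (S.proj (μ + root i) x) := by
  have := proj_apply (S := S) (T := S.dn i) (α := -root i)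
    (fun μ x hx => by rw [← sub_eq_add_neg]; exact S.dn_mem i μ x hx) μ x
  rwa [sub_neg_eq_add] at this

theorem graded_clos {A : Set (V →ₗ[K] V)} {N : Submodule K V} (hN : S.Graded N)
    (hA : ∀ T ∈ A, ∃ α, ∀ μ, ∀ x ∈ S.wt μ, T x ∈ S.wt (μ + α)) : S.Graded (clos A N) := by
  intro μ x hx
  revert μ
  refine clos_induction (p := fun x => ∀ μ, S.proj μ x ∈ clos A N) ?_ ?_ ?_ ?_ hx
  · exact fun y hy μ => le_clos A N (hN μ y hy)
  · intro y z hy hz μ; rw [map_add]; exact add_mem (hy μ) (hz μ)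
  · intro c y hy μ; rw [map_smul]; exact Submodule.smul_mem _ _ (hy μ)
  · intro T hT y _ hy μ
    obtain ⟨α, hα⟩ := hA T hT
    rw [proj_apply hα]
    exact clos_step hT (hy _)

/-- The sl_2 string over a lowest weight vector: lowering e^{k+1} x returns e^k x with the
coefficient -(k+1)(λ+k), where λ is the weight of x on [e, f]. -/
theorem dn_up_pow (i : Fin (m + 1)) {μ : Fin (m + 2) → ℤ} {x : V} (hx : x ∈ S.wt μ)
    (h : S.dn i x = 0) (k : ℕ) : (S.up i ^ k) x ∈ S.wt (μ + k • root i) ∧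
    S.dn i ((S.up i ^ (k + 1)) x) =
      -((k + 1 : K) * (((μ i.castSucc - μ i.succ : ℤ) : K) + k)) • (S.up i ^ k) x := by
  induction k with
  | zero =>
    refine ⟨by simpa using hx, ?_⟩
    have := S.up_dn i μ x hx
    rw [h, map_zero] at this
    rw [pow_one, pow_zero, Module.End.one_apply, eq_neg_of_add_eq_zero_left this.symm, ← neg_smul]
    congr 1
    push_cast
    ring
  | succ k ih =>
    obtain ⟨hk, ih⟩ := ih
    have hk' : (S.up i ^ (k + 1)) x ∈ S.wt (μ + (k + 1) • root i) := by
      rw [pow_succ', Module.End.mul_apply, succ_nsmul, ← add_assoc]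
      exact S.up_mem i _ _ hk
    refine ⟨hk', ?_⟩
    have := S.up_dn i _ _ hk'
    rw [ih, map_smul, ← Module.End.mul_apply, ← pow_succ'] at this
    rw [pow_succ', Module.End.mul_apply, eq_sub_of_add_eq this.symm]
    simp only [Pi.add_apply, Pi.smul_apply, root_castSucc, root_succ, ← sub_smul]
    congr 1
    push_cast
    simp only [nsmul_eq_mul]
    push_cast
    ring

variable [CharZero K]

/-- A nonzero vector killed by a lowering operator has nonpositive weight. -/
theorem le_of_dn_eq_zero (i : Fin (m + 1)) {μ : Fin (m + 2) → ℤ} {x : V} (hx : x ∈ S.wt μ)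
    (h : S.dn i x = 0) (hne : x ≠ 0) : μ i.castSucc ≤ μ i.succ := by
  by_contra hlt
  -- If the weight λ is positive, the coefficients (k+1)(λ+k) never vanish in characteristic zero,
  -- so the string never ends, against local nilpotency.
  have key : ∀ k : ℕ, (S.up i ^ k) x ≠ 0 := by
    intro k
    induction k with
    | zero => simpa using hne
    | succ k ih =>
      intro h0
      have := (dn_up_pow i hx h k).2
      rw [h0, map_zero] at this
      refine smul_ne_zero ?_ ih this.symm
      rw [neg_ne_zero]
      refine mul_ne_zero (by exact_mod_cast Nat.succ_ne_zero k) ?_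
      have : (μ i.castSucc - μ i.succ : ℤ) + (k : ℤ) ≠ 0 := by omega
      exact_mod_cast this
  obtain ⟨k, hk⟩ := S.up_nil i x
  exact key k hk

theorem le_of_up_eq_zero (i : Fin (m + 1)) {μ : Fin (m + 2) → ℤ} {x : V} (hx : x ∈ S.wt μ)
    (h : S.up i x = 0) (hne : x ≠ 0) : μ i.succ ≤ μ i.castSucc := by
  have := le_of_dn_eq_zero (S := S.mirror) i (μ := -μ) (x := x) (by simpa [SlMod.mirror] using hx) h hne
  simpa using this

/-- The lowest weight principle: a graded submodule whose weights have nonpositive tail sums and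
that is stable under lowering operators is generated by its vectors of extreme weight. -/
theorem eq_bot_of_lowest {N : Submodule K V} (hN : S.Graded N) (s : ℕ)
    (h1 : ∀ μ, ∀ x ∈ N, x ∈ S.wt μ → x ≠ 0 → -1 ≤ tail μ s ∧ ∀ j, s < j → tail μ j ≤ 0)
    (h2 : ∀ i : Fin (m + 1), s ≤ i.val → ∀ μ, ∀ x ∈ N, x ∈ S.wt μ → 
      ¬ (∀ l : Fin (m + 2), s < l.val → μ l = 0) → S.dn i x ∈ N)
    (h3 : ∀ μ : Fin (m + 2) → ℤ, (∀ l : Fin (m + 2), s < l.val → μ l = 0) →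
      ∀ x ∈ N, x ∈ S.wt μ → x = 0) : N = ⊥ := by
  -- Induction on minus the sum of the tail sums beyond s. This is nonnegative on N and drops by one
  -- under each lowering operator used, so by induction x is killed by all of these. Its weight is
  -- then antidominant from s on, hence zero beyond s.
  have key : ∀ k : ℕ, ∀ μ, ∀ x ∈ N, x ∈ S.wt μ →
      -∑ j ∈ Finset.Ioc s (m + 1), tail μ j < k → x = 0 := by
    intro k
    induction k with
    | zero =>
      intro μ x hx hμ hk
      by_contra hne
      have := Finset.sum_nonpos (s := Finset.Ioc s (m + 1)) (f := tail μ) fun j hj =>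
        (h1 μ x hx hμ hne).2 j (Finset.mem_Ioc.1 hj).1
      simp at hk
      omega
    | succ k ih =>
      intro μ x hx hμ hk
      by_cases hb : ∀ l : Fin (m + 2), s < l.val → μ l = 0
      · exact h3 μ hb x hx hμ
      by_contra hne
      refine hb (eq_zero_of_antidominant (fun i hi => ?_) (h1 μ x hx hμ hne).1
        (h1 μ x hx hμ hne).2)
      refine le_of_dn_eq_zero i hμ (ih (μ - root i) _ (h2 i hi μ x hx hμ hb) (S.dn_mem i μ x hμ) ?_)
        hne
      simp only [tail_sub, Finset.sum_sub_distrib, tail_root]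
      rw [Finset.sum_ite_eq' (Finset.Ioc s (m + 1)) (i.val + 1), if_pos]
      · push_cast at hk
        omega
      · rw [Finset.mem_Ioc]
        omega
  refine hN.eq_bot fun μ x hx hμ => ?_
  exact key (-∑ j ∈ Finset.Ioc s (m + 1), tail μ j + 1).toNat μ x hx hμ (by omega)

/-- The highest weight principle. -/
theorem eq_bot_of_highest {N : Submodule K V} (hN : S.Graded N) (B : ℤ)
    (h1 : ∀ μ, ∀ x ∈ N, x ∈ S.wt μ → x ≠ 0 → B ≤ ∑ j ∈ Finset.range (m + 2), tail μ j)
    (h2 : ∀ i, ∀ x ∈ N, S.up i x ∈ N)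
    (h3 : ∀ μ : Fin (m + 2) → ℤ, (∀ i : Fin (m + 1), μ i.succ ≤ μ i.castSucc) →
      ∀ x ∈ N, x ∈ S.wt μ → x = 0) : N = ⊥ := by
  -- Induction on the sum of all tail sums: it is bounded below by B on N and drops by one under
  -- each raising operator, so x is killed by all of these and its weight is dominant.
  have key : ∀ k : ℕ, ∀ μ, ∀ x ∈ N, x ∈ S.wt μ →
      ∑ j ∈ Finset.range (m + 2), tail μ j < B + k → x = 0 := by
    intro k
    induction k with
    | zero =>
      intro μ x hx hμ hk
      by_contra hne
      have := h1 μ x hx hμ hne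
      simp at hk
      omega
    | succ k ih =>
      intro μ x hx hμ hk
      by_contra hne
      refine hne (h3 μ (fun i => ?_) x hx hμ)
      refine le_of_up_eq_zero i hμ (ih (μ + root i) _ (h2 i x hx) (S.up_mem i μ x hμ) ?_) hne
      simp only [tail_add, Finset.sum_add_distrib, tail_root]
      rw [Finset.sum_ite_eq' (Finset.range (m + 2)) (i.val + 1), if_pos]
      · push_cast at hk
        omega
      · rw [Finset.mem_range]
        omega
  refine hN.eq_bot fun μ x hx hμ => ?_
  exact key (∑ j ∈ Finset.range (m + 2), tail μ j + 1 - B).toNat μ x hx hμ (by omega)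

end SlMod

end

section

open Grassmann

namespace SlMod

variable {K : Type u} [Field K] {V : Type v} [AddCommGroup V] [Module K V] {m : ℕ}
  (S : SlMod K V m)

/-! ### Modules generated by a weight space -/

/-- The raising operators with index at least `s`. -/
def ups (s : ℕ) : Set (V →ₗ[K] V) := {T | ∃ i : Fin (m + 1), s ≤ i.val ∧ T = S.up i}

/-- The closure of `T₀` under the raising operators with index at least `s`. -/
def cone (s : ℕ) (T₀ : Submodule K V) : Submodule K V := clos (S.ups s) T₀

/-- The weights that can occur in a cone. -/
def ConeWt (s : ℕ) (μ₀ μ : Fin (m + 2) → ℤ) : Prop :=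
  (∀ l : Fin (m + 2), l.val < s → μ l = μ₀ l) ∧ tail μ s = tail μ₀ s ∧ ∀ j, s < j → tail μ j ≤ 0

variable {S} {s : ℕ} {T₀ : Submodule K V} {μ₀ : Fin (m + 2) → ℤ}

theorem mem_ups {i : Fin (m + 1)} (hi : s ≤ i.val) : S.up i ∈ S.ups s := ⟨i, hi, rfl⟩

theorem le_cone : T₀ ≤ S.cone s T₀ := le_clos _ _

theorem up_mem_cone {i : Fin (m + 1)} (hi : s ≤ i.val) {x : V} (hx : x ∈ S.cone s T₀) :
    S.up i x ∈ S.cone s T₀ := clos_step (mem_ups hi) hx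

theorem graded_cone (hT : S.Graded T₀) : S.Graded (S.cone s T₀) :=
  graded_clos hT (by rintro _ ⟨i, -, rfl⟩; exact ⟨root i, S.up_mem i⟩)

theorem Graded.up_dn_sub_mem {N : Submodule K V} (hN : S.Graded N) (i : Fin (m + 1)) {x : V}
    (hx : x ∈ N) : S.up i (S.dn i x) - S.dn i (S.up i x) ∈ N := by
  refine hN.induction (p := fun x => S.up i (S.dn i x) - S.dn i (S.up i x) ∈ N) (by simp) ?_ ?_ ?_ hx
  · intro μ x hx hμ
    rw [S.up_dn i μ x hμ, add_sub_cancel_left]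
    exact Submodule.smul_mem _ _ hx
  · intro x y hx hy
    simp only [map_add]
    rw [add_sub_add_comm]
    exact add_mem hx hy
  · intro c x hx
    simp only [map_smul]
    rw [← smul_sub]
    exact Submodule.smul_mem _ _ hx

/-- Lowering `T₀` itself may leave the cone, so stability is asserted only for elements that have
been raised. The hypothesis on `T₀` starts the induction, and lowering operators are then commuted
past raising ones. -/
theorem dn_up_mem_cone (hT : S.Graded T₀)
    (hst : ∀ i j : Fin (m + 1), s ≤ i.val → s ≤ j.val → ∀ t ∈ T₀, S.dn j (S.up i t) ∈ T₀)
    {i j : Fin (m + 1)} (hi : s ≤ i.val) (hj : s ≤ j.val) {x : V} (hx : x ∈ S.cone s T₀) :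
    S.dn j (S.up i x) ∈ S.cone s T₀ := by
  revert i j
  refine clos_induction (p := fun x => ∀ {i j : Fin (m + 1)}, s ≤ i.val → s ≤ j.val →
    S.dn j (S.up i x) ∈ S.cone s T₀) ?_ ?_ ?_ ?_ hx
  · exact fun x hx i j hi hj => le_cone (hst i j hi hj x hx)
  · intro x y hx hy i j hi hj
    simp only [map_add]
    exact add_mem (hx hi hj) (hy hi hj)
  · intro c x hx i j hi hj
    simp only [map_smul]
    exact Submodule.smul_mem _ _ (hx hi hj)
  · rintro _ ⟨l, hl, rfl⟩ x hx' hx i j hi hj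
    rcases eq_or_ne i j with rfl | hne
    · have h := (graded_cone (s := s) hT).up_dn_sub_mem i (up_mem_cone hl hx')
      have h' := sub_mem (up_mem_cone hi (hx hl hi)) h
      rwa [sub_sub_cancel] at h'
    · rw [← S.comm i j hne]
      exact up_mem_cone hi (hx hl hj)

theorem ConeWt.up {μ : Fin (m + 2) → ℤ} (h : ConeWt s μ₀ μ) {i : Fin (m + 1)} (hi : s ≤ i.val) :
    ConeWt s μ₀ (μ + root i) := by
  refine ⟨fun l hl => ?_, ?_, fun j hj => ?_⟩
  · rw [Pi.add_apply, h.1 l hl, root_of_lt (by omega), add_zero]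
  · rw [tail_add, h.2.1, tail_root, if_neg (by omega), add_zero]
  · rw [tail_add, tail_root]
    have := h.2.2 j hj
    split_ifs <;> omega

theorem coneWt_self (hμ : ∀ l : Fin (m + 2), s < l.val → μ₀ l = 0) : ConeWt s μ₀ μ₀ :=
  ⟨fun _ _ => rfl, rfl, fun _ hj => (tail_eq_zero fun l hl => hμ l (by omega)).le⟩

/-- The only weight of a cone without entries beyond s is that of `T₀`; so the extremal weight space
in `eq_bot_of_lowest` is `T₀`. -/
theorem ConeWt.eq {μ : Fin (m + 2) → ℤ} (h : ConeWt s μ₀ μ)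
    (hμ : ∀ l : Fin (m + 2), s < l.val → μ₀ l = 0)
    (hμ' : ∀ l : Fin (m + 2), s < l.val → μ l = 0) : μ = μ₀ := by
  ext l
  rcases lt_trichotomy l.val s with hl | hl | hl
  · exact h.1 l hl
  · have h1 := tail_eq_add μ l
    have h2 := tail_eq_add μ₀ l
    rw [tail_eq_zero (j := l.val + 1) fun k hk => hμ' k (by omega)] at h1
    rw [tail_eq_zero (j := l.val + 1) fun k hk => hμ k (by omega)] at h2
    have := h.2.1
    rw [← hl] at this
    omega
  · rw [hμ l hl, hμ' l hl]

theorem proj_cone (hT : T₀ ≤ S.wt μ₀) (hμ : ∀ l : Fin (m + 2), s < l.val → μ₀ l = 0) {x : V}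
    (hx : x ∈ S.cone s T₀) {μ : Fin (m + 2) → ℤ} (h : ¬ ConeWt s μ₀ μ) : S.proj μ x = 0 := by
  revert μ
  refine clos_induction (p := fun x => ∀ {μ}, ¬ ConeWt s μ₀ μ → S.proj μ x = 0) ?_ ?_ ?_ ?_ hx
  · intro x hx μ h
    exact S.proj_ne _ _ (fun e => h (by rw [e]; exact coneWt_self hμ)) x (hT hx)
  · intro x y hx hy μ h; rw [map_add, hx h, hy h, add_zero]
  · intro c x hx μ h; rw [map_smul, hx h, smul_zero]
  · rintro _ ⟨i, hi, rfl⟩ x - hx μ h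
    rw [proj_up, hx, map_zero]
    exact fun h' => h (by simpa using h'.up hi)

theorem coneWt_of_ne (hT : T₀ ≤ S.wt μ₀) (hμ : ∀ l : Fin (m + 2), s < l.val → μ₀ l = 0) {x : V}
    (hx : x ∈ S.cone s T₀) {μ : Fin (m + 2) → ℤ} (hxμ : x ∈ S.wt μ) (hne : x ≠ 0) :
    ConeWt s μ₀ μ := by
  by_contra h
  exact hne (by rw [← S.proj_self μ x hxμ, proj_cone hT hμ hx h])

theorem proj_cone_mem (hT : T₀ ≤ S.wt μ₀) (hμ : ∀ l : Fin (m + 2), s < l.val → μ₀ l = 0) {x : V}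
    (hx : x ∈ S.cone s T₀) : S.proj μ₀ x ∈ T₀ := by
  refine clos_induction (p := fun x => S.proj μ₀ x ∈ T₀) ?_ ?_ ?_ ?_ hx
  · intro x hx
    rwa [S.proj_self _ _ (hT hx)]
  · intro x y hx hy; rw [map_add]; exact add_mem hx hy
  · intro c x hx; rw [map_smul]; exact Submodule.smul_mem _ _ hx
  · rintro _ ⟨i, hi, rfl⟩ x hx -
    rw [proj_up, proj_cone hT hμ hx, map_zero]
    · exact zero_mem _
    · intro h
      have := h.2.2 (i.val + 1) (by omega)
      rw [tail_sub, tail_root, if_pos rfl, tail_eq_zero fun l hl => hμ l (by omega)] at this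
      omega

/-- Away from the weight of `T₀`, an element of the cone is the weight component of a sum of raised
elements, and these may be lowered. -/
theorem dn_mem_cone (hT : T₀ ≤ S.wt μ₀)
    (hst : ∀ i j : Fin (m + 1), s ≤ i.val → s ≤ j.val → ∀ t ∈ T₀, S.dn j (S.up i t) ∈ T₀)
    {j : Fin (m + 1)} (hj : s ≤ j.val) {μ : Fin (m + 2) → ℤ} (hμμ : μ ≠ μ₀) {x : V}
    (hx : x ∈ S.cone s T₀) (hxμ : x ∈ S.wt μ) : S.dn j x ∈ S.cone s T₀ := by
  have hg := graded_of_le_wt hT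
  obtain ⟨t, ht, y, hy, rfl⟩ := clos_cases (p := fun y => S.dn j y ∈ S.cone s T₀)
    (by simp) (fun x y hx hy => by rw [map_add]; exact add_mem hx hy)
    (by rintro _ ⟨i, hi, rfl⟩ x hx; exact dn_up_mem_cone hg hst hi hj hx) hx
  have e : S.proj μ (t + y) = S.proj μ y := by
    rw [map_add, S.proj_ne _ _ hμμ t (hT ht), zero_add]
  rw [S.proj_self _ _ hxμ] at e
  rw [e, show μ = (μ - root j) + root j by rw [sub_add_cancel], ← proj_dn]
  exact graded_cone hg _ _ hy

variable [CharZero K]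

/-- The lowest weight principle applied to the intersection: a vector of extremal weight in the cone
lies in `T₀`, where it meets `P` only in zero. -/
theorem cone_inf_eq_bot (hT : T₀ ≤ S.wt μ₀) (hμ : ∀ l : Fin (m + 2), s < l.val → μ₀ l = 0)
    (h0 : -1 ≤ tail μ₀ s)
    (hst : ∀ i j : Fin (m + 1), s ≤ i.val → s ≤ j.val → ∀ t ∈ T₀, S.dn j (S.up i t) ∈ T₀)
    {P : Submodule K V} (hP : S.Graded P) (hP' : ∀ i, ∀ x ∈ P, S.dn i x ∈ P)
    (hPT : ∀ x ∈ T₀, x ∈ P → x = 0) : S.cone s T₀ ⊓ P = ⊥ := by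
  refine eq_bot_of_lowest ((graded_cone (graded_of_le_wt hT)).inf hP) s ?_ ?_ ?_
  · intro μ x hx hxμ hne
    have h := coneWt_of_ne hT hμ hx.1 hxμ hne
    exact ⟨h.2.1 ▸ h0, h.2.2⟩
  · intro i hi μ x hx hxμ hb
    exact ⟨dn_mem_cone hT hst hi (fun e => hb (by rw [e]; exact hμ)) hx.1 hxμ, hP' i x hx.2⟩
  · intro μ hb x hx hxμ
    by_contra hne
    obtain rfl := (coneWt_of_ne hT hμ hx.1 hxμ hne).eq hμ hb
    have := proj_cone_mem hT hμ hx.1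
    rw [S.proj_self _ _ hxμ] at this
    exact hne (hPT x this hx.2)

/-- A homogeneous operator commuting with the lowering operators kills a cone if it kills its
lowest weight space. -/
theorem cone_killed (hT : T₀ ≤ S.wt μ₀) (hμ : ∀ l : Fin (m + 2), s < l.val → μ₀ l = 0)
    (hst : ∀ i j : Fin (m + 1), s ≤ i.val → s ≤ j.val → ∀ t ∈ T₀, S.dn j (S.up i t) ∈ T₀)
    {Z : V →ₗ[K] V} {α : Fin (m + 2) → ℤ} (hZ : ∀ μ, ∀ x ∈ S.wt μ, Z x ∈ S.wt (μ + α))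
    (hα : ∀ l : Fin (m + 2), s < l.val → α l = 0) (h0 : -1 ≤ tail μ₀ s + tail α s)
    (hcomm : ∀ i : Fin (m + 1), s ≤ i.val → ∀ x, Z (S.dn i x) = S.dn i (Z x))
    (hZT : ∀ x ∈ T₀, Z x = 0) {x : V} (hx : x ∈ S.cone s T₀) : Z x = 0 := by
  have hg : S.Graded (S.cone s T₀) := graded_cone (graded_of_le_wt hT)
  have hα' : ∀ j, s < j → tail α j = 0 := fun j hj => tail_eq_zero fun l hl => hα l (by omega)
  have hmem : ∀ μ, ∀ y ∈ (S.cone s T₀).map Z, y ∈ S.wt μ →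
      ∃ x ∈ S.cone s T₀, x ∈ S.wt (μ - α) ∧ Z x = y := by
    rintro μ _ ⟨x, hx, rfl⟩ hy
    exact ⟨_, hg (μ - α) x hx, S.proj_mem _ _, by rw [← proj_apply hZ, S.proj_self _ _ hy]⟩
  -- The image of the cone satisfies the hypotheses of the lowest weight principle, with weights
  -- shifted by α; its extremal weight space is the image of `T₀`.
  have : (S.cone s T₀).map Z = ⊥ := by
    refine eq_bot_of_lowest (S := S) (s := s) ?_ ?_ ?_ ?_
    · rintro μ _ ⟨x, hx, rfl⟩
      rw [proj_apply hZ]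
      exact ⟨_, hg _ x hx, rfl⟩
    · intro μ y hy hyμ hne
      obtain ⟨x, hx, hxμ, rfl⟩ := hmem μ y hy hyμ
      have h := coneWt_of_ne hT hμ hx hxμ (by rintro rfl; simp at hne)
      have e := h.2.1
      rw [tail_sub] at e
      refine ⟨by omega, fun j hj => ?_⟩
      have := h.2.2 j hj
      rw [tail_sub, hα' j hj] at this
      omega
    · intro i hi μ y hy hyμ hb
      obtain ⟨x, hx, hxμ, rfl⟩ := hmem μ y hy hyμ
      refine ⟨S.dn i x, dn_mem_cone hT hst hi ?_ hx hxμ, hcomm i hi x⟩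
      intro e
      refine hb fun l hl => ?_
      have := congrFun e l
      rw [Pi.sub_apply, hα l hl, hμ l hl] at this
      omega
    · intro μ hb y hy hyμ
      obtain ⟨x, hx, hxμ, rfl⟩ := hmem μ y hy hyμ
      by_contra hne
      have h := coneWt_of_ne hT hμ hx hxμ (by rintro rfl; simp at hne)
      have e := h.eq hμ (fun l hl => by rw [Pi.sub_apply, hb l hl, hα l hl, sub_zero])
      have := proj_cone_mem hT hμ hx
      rw [← e, S.proj_self _ _ hxμ] at this
      exact hne (hZT x this)
  have h : Z x ∈ (S.cone s T₀).map Z := ⟨x, hx, rfl⟩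
  rwa [this, Submodule.mem_bot] at h

variable (S) in
/-- The submodule generated by `T₀` under raising and lowering operators. -/
def bicone (s : ℕ) (T₀ : Submodule K V) : Submodule K V := S.cone s T₀ ⊔ S.mirror.cone s T₀

theorem bicone_mirror : S.mirror.bicone s T₀ = S.bicone s T₀ := sup_comm _ _

theorem graded_bicone (hT : S.Graded T₀) : S.Graded (S.bicone s T₀) := by
  refine (graded_cone hT).sup ?_
  have := (graded_cone (S := S.mirror) (s := s) hT.mirror)
  intro μ x hx
  have := this (-μ) x hx
  simpa [SlMod.mirror] using this

theorem up_mem_bicone (hT : S.Graded T₀)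
    (hst : ∀ i j : Fin (m + 1), s ≤ i.val → s ≤ j.val → ∀ t ∈ T₀, S.up j (S.dn i t) ∈ T₀)
    {i : Fin (m + 1)} (hi : s ≤ i.val) {x : V} (hx : x ∈ S.bicone s T₀) :
    S.up i x ∈ S.bicone s T₀ := by
  obtain ⟨a, ha, b, hb, rfl⟩ := Submodule.mem_sup.1 hx
  obtain ⟨t, ht, y, hy, rfl⟩ := clos_cases (p := fun y => S.up i y ∈ S.mirror.cone s T₀)
    (by simp) (fun x y hx hy => by rw [map_add]; exact add_mem hx hy)
    (by rintro _ ⟨j, hj, rfl⟩ x hx; exact dn_up_mem_cone (S := S.mirror) hT.mirror hst hj hi hx) hb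
  rw [map_add, map_add]
  exact add_mem (Submodule.mem_sup_left (up_mem_cone hi ha))
    (add_mem (Submodule.mem_sup_left (up_mem_cone hi (le_cone ht))) (Submodule.mem_sup_right hy))

theorem dn_mem_bicone (hT : S.Graded T₀)
    (hst : ∀ i j : Fin (m + 1), s ≤ i.val → s ≤ j.val → ∀ t ∈ T₀, S.dn j (S.up i t) ∈ T₀)
    {i : Fin (m + 1)} (hi : s ≤ i.val) {x : V} (hx : x ∈ S.bicone s T₀) :
    S.dn i x ∈ S.bicone s T₀ := by
  rw [← bicone_mirror] at hx ⊢
  exact up_mem_bicone (S := S.mirror) hT.mirror hst hi hx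

/-- A weight vector with nonzero components in both cones has tail sums beyond s that are at once
nonpositive and nonnegative. Its weight is then that of `T₀`, and both components lie in `T₀`. The
remaining weight vectors lie in a single cone. -/
theorem bicone_inf_eq_bot (hT : T₀ ≤ S.wt μ₀) (hμ : ∀ l : Fin (m + 2), s < l.val → μ₀ l = 0)
    (h0 : tail μ₀ s = 0)
    (hst : ∀ i j : Fin (m + 1), s ≤ i.val → s ≤ j.val → ∀ t ∈ T₀, S.dn j (S.up i t) ∈ T₀)
    (hst' : ∀ i j : Fin (m + 1), s ≤ i.val → s ≤ j.val → ∀ t ∈ T₀, S.up j (S.dn i t) ∈ T₀)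
    {P : Submodule K V} (hP : S.Graded P) (hP' : ∀ i, ∀ x ∈ P, S.dn i x ∈ P)
    (hP'' : ∀ i, ∀ x ∈ P, S.up i x ∈ P)
    (hPT : ∀ x ∈ T₀, x ∈ P → x = 0) : S.bicone s T₀ ⊓ P = ⊥ := by
  have hTm : T₀ ≤ S.mirror.wt (-μ₀) := by simpa [SlMod.mirror] using hT
  have hμm : ∀ l : Fin (m + 2), s < l.val → (-μ₀) l = 0 := fun l hl => by simp [hμ l hl]
  have h1 := cone_inf_eq_bot hT hμ (by omega) hst hP hP' hPT
  have h2 := cone_inf_eq_bot (S := S.mirror) hTm hμm (by rw [tail_neg]; omega) hst'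
    hP.mirror hP'' hPT
  refine ((graded_bicone (graded_of_le_wt hT)).inf hP).eq_bot fun μ x hx hxμ => ?_
  obtain ⟨a, ha, b, hb, hab⟩ := Submodule.mem_sup.1 hx.1
  have e : S.proj μ a + S.proj μ b = x := by rw [← map_add, hab, S.proj_self _ _ hxμ]
  have hpa : S.proj μ a ∈ S.cone s T₀ := graded_cone (graded_of_le_wt hT) μ a ha
  have hpb : S.proj μ b ∈ S.mirror.cone s T₀ := by
    have := graded_cone (S := S.mirror) (s := s) (graded_of_le_wt hTm) (-μ) b hb
    simpa [SlMod.mirror] using this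
  by_cases ca : S.proj μ a = 0
  · rw [ca, zero_add] at e
    rw [e] at hpb
    exact (Submodule.mem_bot K).1 (h2 ▸ ⟨hpb, hx.2⟩)
  by_cases cb : S.proj μ b = 0
  · rw [cb, add_zero] at e
    rw [e] at hpa
    exact (Submodule.mem_bot K).1 (h1 ▸ ⟨hpa, hx.2⟩)
  have wa := coneWt_of_ne hT hμ hpa (S.proj_mem _ _) ca
  have wb := coneWt_of_ne (S := S.mirror) hTm hμm hpb (μ := -μ)
    (by simpa [SlMod.mirror] using S.proj_mem μ b) cb
  have t0 : ∀ j, s < j → tail μ j = 0 := fun j hj => by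
    have e1 := wa.2.2 j hj
    have e2 := wb.2.2 j hj
    rw [tail_neg] at e2
    omega
  have hμμ : ∀ l : Fin (m + 2), s < l.val → μ l = 0 := fun l hl => by
    have := tail_eq_add μ l
    rw [t0 _ hl, t0 _ (by omega)] at this
    omega
  obtain rfl := wa.eq hμ hμμ
  have m1 := proj_cone_mem hT hμ ha
  have m2 := proj_cone_mem (S := S.mirror) hTm hμm hb
  have m3 : S.proj μ b ∈ T₀ := by simpa [SlMod.mirror] using m2
  exact hPT x (e ▸ add_mem m1 m3) hx.2

end SlMod

end

/-! ### Algebras with the generators and relations of W̃ -/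

section

open Grassmann LieSuperalgebra

/-- A Lie superalgebra with generators that satisfy the relations of `W̃(A_{m+1})`, together with
a homomorphism to `W(m+2)` that maps them to the standard generators. -/
structure WSys (K : Type u) [Field K] (m : ℕ) (L : LieSuperalgebra.{u, u} K) where
  φ : L.Hom (cartanW K (m + 2))
  e0 : L.carrier
  -- Indices are shifted here: `e i` and `f i` stand for e_{i+1} and f_{i+1}, with e_0 kept apart as
  -- `e0`. The family `g` ranges over all indices, with the nonexistent f_{01} replaced by 0.
  e : Fin (m + 1) → L.carrier
  f : Fin (m + 1) → L.carrier
  h : Fin (m + 2) → L.carrier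
  g : Fin (m + 2) → L.carrier
  e0_mem : e0 ∈ L.part 1
  e_mem : ∀ i, e i ∈ L.part 0
  f_mem : ∀ i, f i ∈ L.part 0
  h_mem : ∀ a, h a ∈ L.part 0
  g_mem : ∀ a, g a ∈ L.part 1
  h_e0 : ∀ a, ⁅h a, e0⁆ = (hpair (sroot 0) a : K) • e0
  h_e : ∀ a i, ⁅h a, e i⁆ = (hpair (root i) a : K) • e i
  h_f : ∀ a i, ⁅h a, f i⁆ = (hpair (-root i) a : K) • f i
  h_g : ∀ a b, ⁅h a, g b⁆ = (hpair (Pi.single 0 1) a : K) • g b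
  e_f : ∀ i, ⁅e i, f i⁆ = h i.succ
  e_f_ne : ∀ i j, i ≠ j → ⁅e i, f j⁆ = 0
  e0_f : ∀ i, ⁅e0, f i⁆ = 0
  e0_e0 : ⁅e0, e0⁆ = 0
  e_e0 : ∀ i, i ≠ 0 → ⁅e i, e0⁆ = 0
  e_e_e0 : ∀ i, ⁅e i, ⁅e i, e0⁆⁆ = 0
  e_e_e : ∀ i j, i ≠ j → ⁅e i, ⁅e i, e j⁆⁆ = 0
  f_f_f : ∀ i j, i ≠ j → ⁅f i, ⁅f i, f j⁆⁆ = 0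
  g_one : g 1 = 0
  e0_g : ∀ a, a ≠ 1 → ⁅e0, g a⁆ = h a
  e_g : ∀ a, ⁅e 0, g a⁆ = 0
  e_e_g : ∀ i a, ⁅e i, ⁅e i, g a⁆⁆ = 0
  f_f_g : ∀ i a, ⁅f i, ⁅f i, g a⁆⁆ = 0
  e_f_g : ∀ i j a, 0 < i.val → 0 < j.val → ⁅e i, ⁅f j, g a⁆⁆ ∈ Submodule.span K (Set.range g)
  gen : ∀ N : Submodule K L.carrier, e0 ∈ N → (∀ i, e i ∈ N) → (∀ i, f i ∈ N) → (∀ a, h a ∈ N) →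
    (∀ a, g a ∈ N) → (∀ x ∈ N, ⁅e0, x⁆ ∈ N) → (∀ i, ∀ x ∈ N, ⁅e i, x⁆ ∈ N) →
    (∀ i, ∀ x ∈ N, ⁅f i, x⁆ ∈ N) → (∀ a, ∀ x ∈ N, ⁅h a, x⁆ ∈ N) → (∀ a, ∀ x ∈ N, ⁅g a, x⁆ ∈ N) →
    N = ⊤
  φ_e0 : φ.toLin e0 = D K 0
  φ_e : ∀ i, φ.toLin (e i) = E K i.castSucc i.succ
  φ_f : ∀ i, φ.toLin (f i) = E K i.succ i.castSucc
  φ_h : ∀ a, φ.toLin (h a) = hW K a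
  φ_g : ∀ a, a ≠ 1 → φ.toLin (g a) = gW K a

namespace WSys

variable {K : Type u} [Field K] {m : ℕ} {L : LieSuperalgebra.{u, u} K} (S : WSys K m L)

/-! ### Weight spaces -/

/-- The weight space of `μ`. -/
def wt (μ : Fin (m + 2) → ℤ) : Submodule K L.carrier where
  carrier := {x | x ∈ L.part ((∑ l, μ l : ℤ) : ZMod 2) ∧ ∀ a, ⁅S.h a, x⁆ = (hpair μ a : K) • x}
  zero_mem' := ⟨zero_mem _, by simp⟩
  add_mem' hx hy := ⟨add_mem hx.1 hy.1, fun a => by rw [br_add, hx.2, hy.2, smul_add]⟩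
  smul_mem' c x hx := ⟨Submodule.smul_mem _ _ hx.1, fun a => by rw [br_smul, hx.2, smul_comm]⟩

theorem bracket_mem_wt {μ ν : Fin (m + 2) → ℤ} {x y : L.carrier} (hx : x ∈ S.wt μ)
    (hy : y ∈ S.wt ν) : ⁅x, y⁆ ∈ S.wt (μ + ν) := by
  refine ⟨?_, fun a => ?_⟩
  · have := br_mem_part hx.1 hy.1
    simpa [Finset.sum_add_distrib] using this
  · rw [br_br_even (S.h_mem a), hx.2, hy.2, smul_br, br_smul, ← add_smul, hpair_add, Int.cast_add]

theorem e0_wt : S.e0 ∈ S.wt (sroot 0) := by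
  refine ⟨?_, S.h_e0⟩
  have : ((∑ l, (sroot 0 : Fin (m + 2) → ℤ) l : ℤ) : ZMod 2) = 1 := by
    simp [Finset.sum_neg_distrib]
  rw [this]
  exact S.e0_mem

theorem sum_root (i : Fin (m + 1)) : ∑ l, root i l = 0 := by
  rw [← tail_zero, tail_root, if_neg (by omega)]

theorem e_wt (i : Fin (m + 1)) : S.e i ∈ S.wt (root i) := by
  refine ⟨?_, fun a => S.h_e a i⟩
  rw [sum_root, Int.cast_zero]
  exact S.e_mem i

theorem f_wt (i : Fin (m + 1)) : S.f i ∈ S.wt (-root i) := by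
  refine ⟨?_, fun a => S.h_f a i⟩
  simp only [Pi.neg_apply, Finset.sum_neg_distrib, sum_root, neg_zero, Int.cast_zero]
  exact S.f_mem i

theorem g_wt (a : Fin (m + 2)) : S.g a ∈ S.wt (Pi.single 0 1) := by
  refine ⟨?_, fun b => S.h_g b a⟩
  simp only [Finset.sum_pi_single', Finset.mem_univ, if_true, Int.cast_one]
  exact S.g_mem a

/-- That the h_a commute is not a defining relation. It follows because h_0 = [e_0, f_{00}] and h_i
= [e_i, f_i] are brackets of vectors of opposite weights. -/
theorem h_wt (a : Fin (m + 2)) : S.h a ∈ S.wt 0 := by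
  refine Fin.cases ?_ (fun i => ?_) a
  · rw [← S.e0_g 0 (Fin.zero_ne_one)]
    have := S.bracket_mem_wt S.e0_wt (S.g_wt 0)
    rwa [sroot_zero, neg_add_cancel] at this
  · rw [← S.e_f i]
    have := S.bracket_mem_wt (S.e_wt i) (S.f_wt i)
    rwa [add_neg_cancel] at this

/-- If all pairings agree, the pairings with h_i, i ≥ 1, make the difference a constant vector c,
and h_0 gives (n-1)c = 0. -/
theorem exists_hpair_ne {μ ν : Fin (m + 2) → ℤ} (h : μ ≠ ν) : ∃ a, hpair μ a ≠ hpair ν a := by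
  by_contra hc
  push Not at hc
  have hs : ∀ i : Fin (m + 1), (μ - ν) i.succ = (μ - ν) i.castSucc := fun i => by
    have := hc i.succ
    rw [hpair_succ, hpair_succ] at this
    simp only [Pi.sub_apply]
    omega
  have hall : ∀ l : Fin (m + 2), (μ - ν) l = (μ - ν) 0 := fun l => by
    induction l using Fin.induction with
    | zero => rfl
    | succ i ih => rw [hs, ih]
  have h0 := hc 0
  rw [hpair_zero, hpair_zero, ← sub_eq_zero, ← Finset.sum_sub_distrib,
    Finset.sum_congr rfl fun i _ => show μ (Fin.succ i) - ν (Fin.succ i) = (μ - ν) 0 from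
      hall i.succ] at h0
  simp only [Finset.sum_const, Finset.card_univ, Fintype.card_fin, nsmul_eq_mul, mul_eq_zero] at h0
  have h1 : (μ - ν) 0 = 0 := h0.resolve_left (by positivity)
  exact h (sub_eq_zero.1 (funext fun l => (hall l).trans h1))

variable [CharZero K]

/-- The weight components of an element of a submodule stable under the Cartan elements lie in
that submodule. -/
theorem mem_of_sum_mem {N : Submodule K L.carrier} (hN : ∀ a, ∀ x ∈ N, ⁅S.h a, x⁆ ∈ N)
    (μ : Fin (m + 2) → ℤ) (T : Finset (Fin (m + 2) → ℤ)) (hμ : μ ∉ T) :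
    ∀ y : (Fin (m + 2) → ℤ) → L.carrier, (∀ ν, y ν ∈ S.wt ν) → y μ + ∑ ν ∈ T, y ν ∈ N →
      y μ ∈ N := by
  classical
  induction T using Finset.induction_on with
  | empty => intro y _ h; simpa using h
  | insert ν T hν ih =>
    intro y hy h
    rw [Finset.mem_insert, not_or] at hμ
    obtain ⟨a, ha⟩ := exists_hpair_ne hμ.1
    let c : (Fin (m + 2) → ℤ) → K := fun κ => (hpair κ a : K) - (hpair ν a : K)
    have h1 := sub_mem (hN a _ h) (Submodule.smul_mem N (hpair ν a : K) h)
    rw [Finset.sum_insert hν] at h1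
    -- Applying ad h_a minus its eigenvalue on ν removes the component of weight ν and multiplies
    -- that of weight μ by a nonzero scalar.
    have h2 : c μ • y μ + ∑ κ ∈ T, c κ • y κ ∈ N := by
      convert h1 using 1
      rw [br_add, br_add, br_sum, (hy μ).2, (hy ν).2,
        Finset.sum_congr rfl fun κ _ => (hy κ).2 a]
      simp only [c, sub_smul, Finset.sum_sub_distrib, smul_add, Finset.smul_sum]
      abel
    have h3 := ih hμ.2 (fun κ => c κ • y κ) (fun κ => Submodule.smul_mem _ _ (hy κ)) h2
    refine (Submodule.smul_mem_iff N ?_).1 h3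
    rw [sub_ne_zero]
    exact_mod_cast ha

theorem iSup_wt : ⨆ μ, S.wt μ = ⊤ := by
  have key : ∀ {α : Fin (m + 2) → ℤ} {y : L.carrier}, y ∈ S.wt α → ∀ x ∈ ⨆ μ, S.wt μ,
      ⁅y, x⁆ ∈ ⨆ μ, S.wt μ := by
    intro α y hy x hx
    induction hx using Submodule.iSup_induction' with
    | mem μ x hx => exact Submodule.mem_iSup_of_mem (α + μ) (S.bracket_mem_wt hy hx)
    | zero => simp
    | add a b _ _ ha hb => rw [br_add]; exact add_mem ha hb
  have sub : ∀ {α : Fin (m + 2) → ℤ} {y : L.carrier}, y ∈ S.wt α → y ∈ ⨆ μ, S.wt μ :=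
    fun hy => Submodule.mem_iSup_of_mem _ hy
  exact S.gen _ (sub S.e0_wt) (fun i => sub (S.e_wt i)) (fun i => sub (S.f_wt i))
    (fun a => sub (S.h_wt a)) (fun a => sub (S.g_wt a)) (key S.e0_wt) (fun i => key (S.e_wt i))
    (fun i => key (S.f_wt i)) (fun a => key (S.h_wt a)) (fun a => key (S.g_wt a))

open DirectSum in
theorem bijective_coe : Function.Bijective (DirectSum.coeLinearMap S.wt) := by
  classical
  constructor
  · rw [← LinearMap.ker_eq_bot, eq_bot_iff]
    intro y hy
    rw [LinearMap.mem_ker] at hy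
    have hsum : ∑ μ ∈ DFinsupp.support y, (y μ : L.carrier) = 0 := by
      rw [← hy, DirectSum.coeLinearMap_eq_dfinsuppSum]
      rfl
    rw [Submodule.mem_bot]
    refine DFinsupp.ext fun μ => Subtype.ext ?_
    by_cases hμ : μ ∈ DFinsupp.support y
    · have := S.mem_of_sum_mem (N := ⊥) (by simp) μ ((DFinsupp.support y).erase μ)
        (Finset.notMem_erase _ _) (fun ν => (y ν : L.carrier)) (fun ν => (y ν).2)
        (by rw [Finset.add_sum_erase _ (fun ν => (y ν : L.carrier)) hμ, hsum]; exact zero_mem _)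
      simpa using this
    · simpa using hμ
  · rw [← LinearMap.range_eq_top, DirectSum.range_coeLinearMap, iSup_wt]

/-- The weight decomposition. -/
def decomp : (DirectSum _ fun μ => S.wt μ) ≃ₗ[K] L.carrier :=
  LinearEquiv.ofBijective (DirectSum.coeLinearMap S.wt) S.bijective_coe

/-- The projection onto a weight space. -/
def proj (μ : Fin (m + 2) → ℤ) : L.carrier →ₗ[K] L.carrier :=
  (S.wt μ).subtype ∘ₗ DirectSum.component K _ _ μ ∘ₗ S.decomp.symm.toLinearMap

theorem decomp_symm {μ : Fin (m + 2) → ℤ} {x : L.carrier} (hx : x ∈ S.wt μ) :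
    S.decomp.symm x = DirectSum.lof K _ (fun μ => S.wt μ) μ ⟨x, hx⟩ := by
  rw [LinearEquiv.symm_apply_eq]
  exact (DirectSum.coeLinearMap_lof S.wt μ ⟨x, hx⟩).symm

theorem sum_proj (x : L.carrier) : ∃ T : Finset (Fin (m + 2) → ℤ),
    (∀ μ ∉ T, S.proj μ x = 0) ∧ ∑ μ ∈ T, S.proj μ x = x := by
  classical
  refine ⟨DFinsupp.support (S.decomp.symm x), fun μ hμ => ?_, ?_⟩
  · rw [DFinsupp.notMem_support_iff] at hμ
    exact congrArg Subtype.val hμ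
  · conv_rhs => rw [← S.decomp.apply_symm_apply x]
    exact (DirectSum.coeLinearMap_eq_dfinsuppSum S.wt _).symm

/-! ### Nilpotency -/

theorem pow_bracket_eq_zero {x : L.carrier} (hx : x ∈ L.part 0) (k : ℕ) :
    ∀ (a b : ℕ) (y z : L.carrier), (L.bracket x ^ a) y = 0 → (L.bracket x ^ b) z = 0 → a + b ≤ k →
      (L.bracket x ^ k) ⁅y, z⁆ = 0 := by
  induction k with
  | zero =>
    intro a b y z ha _ hk
    obtain rfl : a = 0 := by omega
    rw [pow_zero, Module.End.one_apply] at ha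
    rw [ha, zero_br, map_zero]
  | succ k ih =>
    intro a b y z ha hb hk
    rcases a with _ | a
    · rw [pow_zero, Module.End.one_apply] at ha
      rw [ha, zero_br, map_zero]
    rcases b with _ | b
    · rw [pow_zero, Module.End.one_apply] at hb
      rw [hb, br_zero, map_zero]
    rw [pow_succ, Module.End.mul_apply, ← br_def, br_br_even hx, map_add,
      ih a (b + 1) _ _ (by rwa [pow_succ, Module.End.mul_apply] at ha) hb (by omega),
      ih (a + 1) b _ _ ha (by rwa [pow_succ, Module.End.mul_apply] at hb) (by omega), add_zero]

theorem pow_eq_zero_of_le {x y : L.carrier} {a b : ℕ} (hab : a ≤ b)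
    (h : (L.bracket x ^ a) y = 0) : (L.bracket x ^ b) y = 0 := by
  rw [← Nat.sub_add_cancel hab, pow_add, Module.End.mul_apply, h, map_zero]

/-- An even element that acts nilpotently on the generators acts locally nilpotently. -/
theorem exists_pow_eq_zero {x : L.carrier} (hx : x ∈ L.part 0)
    (h0 : ⁅x, ⁅x, S.e0⁆⁆ = 0) (he : ∀ i, ⁅x, ⁅x, ⁅x, S.e i⁆⁆⁆ = 0)
    (hf : ∀ i, ⁅x, ⁅x, ⁅x, S.f i⁆⁆⁆ = 0) (hh : ∀ a, ⁅x, ⁅x, S.h a⁆⁆ = 0)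
    (hg : ∀ a, ⁅x, ⁅x, S.g a⁆⁆ = 0) (y : L.carrier) : ∃ k, (L.bracket x ^ k) y = 0 := by
  let N : Submodule K L.carrier :=
    { carrier := {y | ∃ k, (L.bracket x ^ k) y = 0}
      zero_mem' := ⟨0, map_zero _⟩
      add_mem' := by
        rintro y z ⟨a, ha⟩ ⟨b, hb⟩
        refine ⟨a + b, ?_⟩
        rw [map_add, pow_eq_zero_of_le (by omega) ha, pow_eq_zero_of_le (by omega) hb, add_zero]
      smul_mem' := by
        rintro c y ⟨a, ha⟩
        exact ⟨a, by rw [map_smul, ha, smul_zero]⟩ }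
  have hN : ∀ y ∈ N, ∀ z ∈ N, ⁅y, z⁆ ∈ N := by
    rintro y ⟨a, ha⟩ z ⟨b, hb⟩
    exact ⟨a + b, pow_bracket_eq_zero hx _ a b y z ha hb le_rfl⟩
  have m0 : S.e0 ∈ N := ⟨2, h0⟩
  have me : ∀ i, S.e i ∈ N := fun i => ⟨3, he i⟩
  have mf : ∀ i, S.f i ∈ N := fun i => ⟨3, hf i⟩
  have mh : ∀ a, S.h a ∈ N := fun a => ⟨2, hh a⟩
  have mg : ∀ a, S.g a ∈ N := fun a => ⟨2, hg a⟩
  have : N = ⊤ := S.gen N m0 me mf mh mg (hN _ m0) (fun i => hN _ (me i)) (fun i => hN _ (mf i))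
    (fun i => hN _ (mh i)) (fun i => hN _ (mg i))
  exact (this ▸ Submodule.mem_top : y ∈ N)

theorem even_br_self {x : L.carrier} (hx : x ∈ L.part 0) : ⁅x, x⁆ = 0 := by
  have h := br_skew_even hx x
  have h2 : (2 : K) • ⁅x, x⁆ = 0 := by rw [two_smul]; nth_rewrite 1 [h]; exact neg_add_cancel _
  exact (smul_eq_zero.1 h2).resolve_left two_ne_zero

theorem e_h (i : Fin (m + 1)) (a : Fin (m + 2)) : ⁅S.e i, S.h a⁆ = -(hpair (root i) a : K) • S.e i := by
  rw [br_skew_even (S.e_mem i), S.h_e, neg_smul]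

theorem f_h (i : Fin (m + 1)) (a : Fin (m + 2)) : ⁅S.f i, S.h a⁆ = (hpair (root i) a : K) • S.f i := by
  rw [br_skew_even (S.f_mem i), S.h_f, hpair_neg, Int.cast_neg, neg_smul, neg_neg]

theorem f_e (i j : Fin (m + 1)) : ⁅S.f i, S.e j⁆ = -⁅S.e j, S.f i⁆ := br_skew_even (S.f_mem i) _

theorem f_e0 (i : Fin (m + 1)) : ⁅S.f i, S.e0⁆ = 0 := by
  rw [br_skew_even (S.f_mem i), S.e0_f, neg_zero]

/-- The structure of a weight module on the whole algebra. -/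
def toSl : SlMod K L.carrier m where
  wt := S.wt
  proj := S.proj
  proj_mem μ x := Submodule.coe_mem _
  proj_self μ x hx := by
    rw [proj, LinearMap.comp_apply, LinearMap.comp_apply, LinearEquiv.coe_coe, S.decomp_symm hx,
      DirectSum.component.lof_self]
    rfl
  proj_ne μ ν h x hx := by
    rw [proj, LinearMap.comp_apply, LinearMap.comp_apply, LinearEquiv.coe_coe, S.decomp_symm hx,
      DirectSum.component.of, dif_neg h.symm, map_zero]
  mem_span_proj x := by
    obtain ⟨T, -, hT⟩ := S.sum_proj x
    have h : ∑ μ ∈ T, S.proj μ x ∈ Submodule.span K (Set.range fun μ => S.proj μ x) :=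
      Submodule.sum_mem _ fun μ _ => Submodule.subset_span ⟨μ, rfl⟩
    rwa [hT] at h
  up i := L.bracket (S.e i)
  dn i := L.bracket (S.f i)
  up_mem i μ x hx := by
    rw [add_comm]
    exact S.bracket_mem_wt (S.e_wt i) hx
  dn_mem i μ x hx := by
    rw [sub_eq_neg_add]
    exact S.bracket_mem_wt (S.f_wt i) hx
  comm i j h x := by
    rw [← br_def, ← br_def, br_br_even (S.e_mem i), S.e_f_ne i j h, zero_br, zero_add]
    rfl
  up_dn i μ x hx := by
    rw [← br_def, ← br_def, br_br_even (S.e_mem i), S.e_f i, hx.2, hpair_succ, add_comm]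
    rfl
  up_nil i := by
    refine S.exists_pow_eq_zero (S.e_mem i) (S.e_e_e0 i) ?_ ?_ ?_ (S.e_e_g i)
    · intro j
      rcases eq_or_ne i j with rfl | h
      · rw [even_br_self (S.e_mem i), br_zero, br_zero]
      · rw [S.e_e_e i j h, br_zero]
    · intro j
      rcases eq_or_ne i j with rfl | h
      · rw [S.e_f, S.e_h, br_smul, even_br_self (S.e_mem i), smul_zero]
      · rw [S.e_f_ne i j h, br_zero, br_zero]
    · intro a
      rw [S.e_h, br_smul, even_br_self (S.e_mem i), smul_zero]
  dn_nil i := by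
    refine S.exists_pow_eq_zero (S.f_mem i) ?_ ?_ ?_ ?_ (S.f_f_g i)
    · rw [S.f_e0, br_zero]
    · intro j
      rcases eq_or_ne j i with rfl | h
      · rw [S.f_e, S.e_f, br_neg, S.f_h, br_neg, br_smul, even_br_self (S.f_mem _), smul_zero,
          neg_zero]
      · rw [S.f_e, S.e_f_ne j i h, neg_zero, br_zero, br_zero]
    · intro j
      rcases eq_or_ne i j with rfl | h
      · rw [even_br_self (S.f_mem i), br_zero, br_zero]
      · rw [S.f_f_f i j h, br_zero]
    · intro a
      rw [S.f_h, br_smul, even_br_self (S.f_mem i), smul_zero]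

theorem graded_of_stable {N : Submodule K L.carrier} (hN : ∀ a, ∀ x ∈ N, ⁅S.h a, x⁆ ∈ N) :
    S.toSl.Graded N := by
  classical
  intro μ x hx
  obtain ⟨T, hT, hs⟩ := S.sum_proj x
  by_cases hμ : μ ∈ T
  · refine S.mem_of_sum_mem hN μ (T.erase μ) (Finset.notMem_erase _ _) (fun ν => S.proj ν x)
      (fun ν => S.toSl.proj_mem ν x) ?_
    rw [Finset.add_sum_erase _ (fun ν => S.proj ν x) hμ, hs]
    exact hx
  · change S.proj μ x ∈ N
    rw [hT μ hμ]
    exact zero_mem _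

/-- The kernel of the homomorphism to `W(n)`. -/
abbrev kerφ : Submodule K L.carrier := LinearMap.ker S.φ.toLin

theorem br_mem_ker (x : L.carrier) {y : L.carrier} (hy : y ∈ S.kerφ) : ⁅x, y⁆ ∈ S.kerφ :=
  S.φ.ker.bracket_mem x y hy

theorem graded_ker : S.toSl.Graded S.kerφ := S.graded_of_stable fun _ _ hx => S.br_mem_ker _ hx

theorem bracket_shift {α : Fin (m + 2) → ℤ} {y : L.carrier} (hy : y ∈ S.wt α) :
    ∀ μ, ∀ x ∈ S.toSl.wt μ, L.bracket y x ∈ S.toSl.wt (μ + α) := by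
  intro μ x hx
  rw [add_comm]
  exact S.bracket_mem_wt hy hx

end WSys

end

section

open LieSuperalgebra

namespace Grassmann

/-! ### Constants of the Grassmann algebra -/

section Const

variable {K : Type u} [Field K] {n : ℕ}

/-- The projection that removes the monomials divisible by `θ_l`. -/
def rem (l : Fin n) : Lam K n →ₗ[K] Lam K n := LinearMap.id - LinearMap.mulLeft K (th l) ∘ₗ pd l

theorem rem_apply (l : Fin n) (x : Lam K n) : rem l x = x - th l * pd l x := rfl

theorem rem_th_mul (l i : Fin n) (x : Lam K n) :
    rem l (th i * x) = if l = i then 0 else th i * rem l x := by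
  rw [rem_apply, rem_apply, pd_th_mul]
  split_ifs with h
  · subst h
    rw [mul_sub, th_mul_self_mul, sub_zero, sub_self]
  · rw [zero_sub, mul_neg, th_mul_left_comm, neg_neg, mul_sub]

theorem foldr_rem_th_mul (L : List (Fin n)) (i : Fin n) (x : Lam K n) :
    L.foldr (fun l y => rem l y) (th i * x) =
      if i ∈ L then 0 else th i * L.foldr (fun l y => rem l y) x := by
  induction L with
  | nil => simp
  | cons l L ih =>
    rw [List.foldr_cons, ih, List.foldr_cons]
    by_cases hi : i ∈ L
    · simp [hi]
    · rw [if_neg hi, rem_th_mul]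
      rcases eq_or_ne l i with rfl | h
      · simp
      · simp [hi, h, h.symm]

/-- The composite of the projections id - θ_l ∂_l over all l annihilates every product θ_i x and
fixes 1, so its values are scalars; it also fixes v when all partial derivatives of v vanish. -/
theorem exists_smul_one {v : Lam K n} (h : ∀ l, pd l v = 0) : ∃ c : K, v = c • 1 := by
  have key : ∀ x : Lam K n, ∃ c : K, (List.finRange n).foldr (fun l y => rem l y) x = c • 1 := by
    have hlin : ∀ (L : List (Fin n)) (x : Lam K n), L.foldr (fun l y => rem l y) x =
        (L.foldr (fun l T => rem l ∘ₗ T) (LinearMap.id : Lam K n →ₗ[K] Lam K n)) x := by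
      intro L x
      induction L with
      | nil => rfl
      | cons l L ih => rw [List.foldr_cons, ih, List.foldr_cons]; rfl
    intro x
    induction x using lam_induction with
    | h1 =>
      refine ⟨1, ?_⟩
      rw [one_smul]
      generalize List.finRange n = L
      induction L with
      | nil => rfl
      | cons l L ih => rw [List.foldr_cons, ih, rem_apply, pd_one, mul_zero, sub_zero]
    | hs r x hx =>
      obtain ⟨c, hc⟩ := hx
      refine ⟨r * c, ?_⟩
      rw [hlin] at hc ⊢
      rw [map_smul, hc, smul_smul]
    | ha x y hx hy =>
      obtain ⟨c, hc⟩ := hx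
      obtain ⟨d, hd⟩ := hy
      refine ⟨c + d, ?_⟩
      rw [hlin] at hc hd ⊢
      rw [map_add, hc, hd, add_smul]
    | hm i x _ => exact ⟨0, by rw [foldr_rem_th_mul, if_pos (List.mem_finRange i), zero_smul]⟩
  obtain ⟨c, hc⟩ := key v
  refine ⟨c, ?_⟩
  rw [← hc]
  generalize List.finRange n = L
  induction L with
  | nil => rfl
  | cons l L ih => rw [List.foldr_cons, ← ih, rem_apply, h, mul_zero, sub_zero]

variable (K) in
/-- The derivation `θ_i ∑_l θ_l ∂_l`. -/
def eul (i : Fin n) : (cartanW K n).carrier := ∑ l, T K i l l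

/-- The element θ_i 𝓔 acts on monomials without ∂_i as multiplication by θ_i, up to the level as a
factor. This is the tool for passing from one level to the next. -/
theorem eul_der {S : Finset (Fin n)} {v : Lam K n} (h : IsMon S v) {i j : Fin n} (hij : j ≠ i) :
    ⁅eul K i, der j v⁆ = ((S.card : K) - 1) • der j (th i * v) := by
  have key : ∀ l, ⁅T K i l l, der j v⁆ = der j (th i * (th l * pd l v)) -
      if l = j then der j (th i * v) else 0 := by
    intro l
    rw [T, der_bracket (th_th_mem i l) h.mem, pd_th_th, if_neg hij, zero_sub, add_zero, mul_assoc]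
    congr 1
    rcases eq_or_ne j l with rfl | hl
    · rw [if_pos rfl, if_pos rfl, mul_neg, map_neg, mul_comm_super h.mem (th_mem i), map_smul,
        smul_neg, smul_smul, superSign_comm _ 1, ← superSign_add_right, add_assoc,
        show ∀ a : ZMod 2, a + a = 0 by decide, add_zero, superSign_one_one, neg_smul, one_smul,
        neg_neg]
    · rw [if_neg hl, if_neg hl.symm, neg_zero, mul_zero, map_zero, smul_zero]
  rw [eul, sum_br, Finset.sum_congr rfl fun l _ => key l, Finset.sum_sub_distrib, ← map_sum,
    ← Finset.mul_sum, h.sum_th_pd, mul_smul_comm, map_smul]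
  simp [sub_smul]

theorem D_ne_zero (j : Fin n) : (D K j : (cartanW K n).carrier) ≠ 0 := fun h =>
  one_ne_zero (der_injective h)

end Const

/-! ### Generation of `W(n)` -/

section Gen

variable {K : Type u} [Field K] [CharZero K] {m : ℕ}

theorem E_sub_mem_span (l : Fin (m + 2)) :
    E K (0 : Fin (m + 2)) 0 - E K l l ∈ Submodule.span K (Set.range (hW K (m := m))) := by
  induction l using Fin.induction with
  | zero => rw [sub_self]; exact zero_mem _
  | succ i ih =>
    have := add_mem ih (Submodule.subset_span ⟨i.succ, rfl⟩)
    rwa [hW_succ, sub_add_sub_cancel] at this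

/-- The sum of h_0 and of all E_00 - E_ll with l ≥ 1 is (n-1) E_00, and n - 1 is invertible. -/
theorem E_mem_span (l : Fin (m + 2)) :
    E K l l ∈ Submodule.span K (Set.range (hW K (m := m))) := by
  have h0 : E K (0 : Fin (m + 2)) 0 ∈ Submodule.span K (Set.range (hW K (m := m))) := by
    have h1 : hW K 0 + ∑ i : Fin (m + 1), (E K (0 : Fin (m + 2)) 0 - E K i.succ i.succ) ∈
        Submodule.span K (Set.range (hW K (m := m))) :=
      add_mem (Submodule.subset_span ⟨0, rfl⟩) (Submodule.sum_mem _ fun i _ => E_sub_mem_span _)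
    rw [Finset.sum_sub_distrib, hW_zero, add_sub_cancel, Finset.sum_const, Finset.card_univ,
      Fintype.card_fin, ← Nat.cast_smul_eq_nsmul K] at h1
    exact (Submodule.smul_mem_iff _ (by exact_mod_cast Nat.succ_ne_zero m)).1 h1
  have := sub_mem h0 (E_sub_mem_span (K := K) l)
  rwa [sub_sub_cancel] at this

theorem linearIndependent_E :
    LinearIndependent K fun l : Fin (m + 2) => (E K l l : (cartanW K (m + 2)).carrier) := by
  rw [Fintype.linearIndependent_iff]
  intro c hc k
  have h : ⁅∑ l, c l • E K l l, D K k⁆ = 0 := by rw [hc, zero_br]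
  rw [sum_br, Finset.sum_congr rfl fun l _ => by rw [smul_br, E_D, smul_neg]] at h
  simp only [smul_ite, smul_zero, Finset.sum_neg_distrib, Finset.sum_ite_eq, Finset.mem_univ,
    if_true, neg_eq_zero] at h
  exact (smul_eq_zero.1 h).resolve_right (D_ne_zero k)

/-- The n elements h_a span a space that contains the n independent elements E_ll. -/
theorem linearIndependent_hW : LinearIndependent K (hW K (m := m)) := by
  rw [linearIndependent_iff_card_le_finrank_span]
  have h1 := finrank_span_eq_card (linearIndependent_E (K := K) (m := m))
  rw [← h1]
  have : FiniteDimensional K (Submodule.span K (Set.range (hW K (m := m)))) :=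
    FiniteDimensional.span_of_finite K (Set.finite_range _)
  exact Submodule.finrank_mono (Submodule.span_le.2 (by rintro _ ⟨l, rfl⟩; exact E_mem_span l))

/-- The f_{0i} with i ≥ 2 give the differences of the θ_0 E_ll and f_{00} gives their sum over l ≥
1. Hence f_{01} is not needed, provided n - 1 is invertible. -/
theorem T_mem_of_gW {P : Submodule K (cartanW K (m + 2)).carrier}
    (hg : ∀ a, a ≠ 1 → gW K a ∈ P) (l : Fin (m + 1)) : T K 0 l.succ l.succ ∈ P := by
  have hsub : ∀ l : Fin (m + 1),
      T K (0 : Fin (m + 2)) (Fin.succ 0) (Fin.succ 0) - T K 0 l.succ l.succ ∈ P := by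
    intro l
    induction l using Fin.induction with
    | zero => rw [sub_self]; exact zero_mem _
    | succ i ih =>
      have h1 : i.succ.succ ≠ (1 : Fin (m + 2)) := fun e => by
        rw [← Fin.succ_zero_eq_one, Fin.succ_inj] at e
        exact Fin.succ_ne_zero _ e
      have := add_mem ih (hg _ h1)
      rwa [gW_succ, ← Fin.succ_castSucc, sub_add_sub_cancel] at this
  have hT1 : T K (0 : Fin (m + 2)) (Fin.succ 0) (Fin.succ 0) ∈ P := by
    have h1 := add_mem (hg 0 Fin.zero_ne_one) (Submodule.sum_mem _ fun i (_ : i ∈ Finset.univ) => hsub i)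
    rw [Finset.sum_sub_distrib, gW_zero, add_sub_cancel, Finset.sum_const, Finset.card_univ,
      Fintype.card_fin, ← Nat.cast_smul_eq_nsmul K] at h1
    exact (Submodule.smul_mem_iff _ (by exact_mod_cast Nat.succ_ne_zero m)).1 h1
  have := sub_mem hT1 (hsub l)
  rwa [sub_sub_cancel] at this

/-- A subspace of `W(n)` that contains the generators and is closed under brackets of homogeneous
elements is everything. -/
theorem eq_top_of_closed {P : Submodule K (cartanW K (m + 2)).carrier}
    (hP : ∀ p q, ∀ x ∈ P, x ∈ (cartanW K (m + 2)).part p → ∀ y ∈ P,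
      y ∈ (cartanW K (m + 2)).part q → ⁅x, y⁆ ∈ P)
    (he : ∀ a, eW K a ∈ P) (hf : ∀ i : Fin (m + 1), fW K i.succ ∈ P) (hh : ∀ a, hW K a ∈ P)
    (hg : ∀ a, a ≠ 1 → gW K a ∈ P) : P = ⊤ := by
  have hD : ∀ l : Fin (m + 2), D K l ∈ P := by
    intro l
    induction l using Fin.induction with
    | zero => exact he 0
    | succ i ih =>
      have := hP 0 1 _ (he i.succ) (E_mem _ _) _ ih (D_mem _)
      rw [eW_succ, E_D, if_pos rfl, neg_mem_iff] at this
      exact this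
  have hEd : ∀ l : Fin (m + 2), E K l l ∈ P := fun l =>
    (Submodule.span_le.2 (by rintro _ ⟨a, rfl⟩; exact hh a) :
      Submodule.span K (Set.range (hW K (m := m))) ≤ P) (E_mem_span l)
  have hE : ∀ a b : Fin (m + 2), E K a b ∈ P := by
    have up : ∀ d : ℕ, ∀ a b : Fin (m + 2), a.val + d = b.val → E K a b ∈ P ∧ E K b a ∈ P := by
      intro d
      induction d with
      | zero =>
        intro a b h
        obtain rfl : a = b := Fin.ext (by omega)
        exact ⟨hEd a, hEd a⟩
      | succ d ih =>
        intro a b h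
        obtain ⟨i, rfl⟩ : ∃ i : Fin (m + 1), b = i.succ := Fin.eq_succ_of_ne_zero (by
          rintro rfl; simp at h)
        rw [Fin.val_succ] at h
        obtain ⟨h1, h2⟩ := ih a i.castSucc (by rw [Fin.val_castSucc]; omega)
        have hne : i.succ ≠ a := fun e => by rw [← e, Fin.val_succ] at h; omega
        constructor
        · have := hP 0 0 _ h1 (E_mem _ _) _ (he i.succ) (E_mem _ _)
          rwa [eW_succ, E_E, if_pos rfl, if_neg hne, sub_zero] at this
        · have := hP 0 0 _ (hf i) (E_mem _ _) _ h2 (E_mem _ _)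
          rwa [fW_succ, E_E, if_pos rfl, if_neg hne.symm, sub_zero] at this
    intro a b
    rcases le_total a b with h | h
    · exact (up (b.val - a.val) a b (by have := Fin.le_def.1 h; omega)).1
    · exact (up (a.val - b.val) b a (by have := Fin.le_def.1 h; omega)).2
  have hT2 : ∀ l : Fin (m + 2), l ≠ 0 → T K 0 l l ∈ P := by
    intro l hl
    obtain ⟨i, rfl⟩ := Fin.exists_succ_eq.2 hl
    exact T_mem_of_gW hg i
  have act : ∀ p q a b c : Fin (m + 2), T K a b c ∈ P → ⁅E K p q, T K a b c⁆ ∈ P :=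
    fun p q a b c h => hP 0 1 _ (hE p q) (E_mem _ _) _ h (T_mem _ _ _)
  have hT3 : ∀ a b : Fin (m + 2), a ≠ 0 → b ≠ 0 → T K 0 a b ∈ P := by
    intro a b ha hb
    rcases eq_or_ne a b with rfl | hne
    · exact hT2 a ha
    · have := act a b 0 b b (hT2 b hb)
      rwa [E_T, if_neg hb, if_pos rfl, if_neg hne.symm, zero_add, sub_zero] at this
  have hT4 : ∀ a : Fin (m + 2), T K 0 a 0 ∈ P := by
    intro a
    rcases eq_or_ne a 0 with rfl | ha
    · rw [T_self]; exact zero_mem _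
    · have := act a 0 0 a a (hT2 a ha)
      rwa [E_T, if_pos rfl, if_neg ha.symm, if_pos rfl, T_self, zero_add, zero_sub,
        neg_mem_iff] at this
  have hT5 : ∀ a b : Fin (m + 2), T K 0 a b ∈ P := by
    intro a b
    rcases eq_or_ne a 0 with rfl | ha
    · rw [T_self]; exact zero_mem _
    · rcases eq_or_ne b 0 with rfl | hb
      · exact hT4 a
      · exact hT3 a b ha hb
  have hT : ∀ a b c : Fin (m + 2), T K a b c ∈ P := by
    intro a b c
    rcases eq_or_ne b 0 with rfl | hb
    · rw [T_swap, neg_mem_iff]; exact hT5 a c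
    · have := act a 0 0 b c (hT5 b c)
      rw [E_T, if_pos rfl, if_neg hb.symm, add_zero] at this
      have h2 : (if c = a then T K 0 b 0 else 0) ∈ P := by
        split_ifs
        · exact hT5 _ _
        · exact zero_mem _
      have := add_mem this h2
      rwa [sub_add_cancel] at this
  have heul : ∀ i : Fin (m + 2), eul K i ∈ P := fun i => Submodule.sum_mem _ fun l _ => hT _ _ _
  have heul' : ∀ i : Fin (m + 2), eul K i ∈ (cartanW K (m + 2)).part 1 :=
    fun i => Submodule.sum_mem _ fun l _ => T_mem _ _ _
  -- Monomials of degree at most two are already available. A monomial v of degree at least three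
  -- has an index i ≠ j, and [θ_i 𝓔, ∂_i(v) ∂_j] is a nonzero multiple of v ∂_j.
  have main : ∀ k : ℕ, ∀ (R : Finset (Fin (m + 2))) (v : Lam K (m + 2)) (j : Fin (m + 2)), R.card = k → IsMon R v →
      der j v ∈ P := by
    intro k
    induction k using Nat.strong_induction_on with
    | _ k ih =>
      intro R v j hk hv
      have hc0 : ∀ w : Lam K (m + 2), IsMon ∅ w → ∃ c : K, w = c • 1 := fun w hw =>
        exists_smul_one fun l => hw.off l (Finset.notMem_empty l)
      rcases R.eq_empty_or_nonempty with rfl | ⟨a, ha⟩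
      · obtain ⟨c, rfl⟩ := hc0 v hv
        rw [map_smul]
        exact Submodule.smul_mem _ _ (hD j)
      by_cases hR1 : R.erase a = ∅
      · have := hv.pd ha
        rw [hR1] at this
        obtain ⟨c, hc⟩ := hc0 _ this
        rw [← hv.on a ha, hc, mul_smul_comm, mul_one, map_smul]
        exact Submodule.smul_mem _ _ (hE a j)
      obtain ⟨b, hb⟩ := Finset.nonempty_iff_ne_empty.2 hR1
      by_cases hR2 : (R.erase a).erase b = ∅
      · have hva := hv.pd ha
        have := hva.pd hb
        rw [hR2] at this
        obtain ⟨c, hc⟩ := hc0 _ this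
        rw [← hv.on a ha, ← hva.on b hb, hc, mul_smul_comm, mul_one, mul_smul_comm, map_smul]
        exact Submodule.smul_mem _ _ (hT a b j)
      obtain ⟨d, hd⟩ := Finset.nonempty_iff_ne_empty.2 hR2
      obtain ⟨i, hi, hij⟩ : ∃ i ∈ R, j ≠ i := by
        rcases eq_or_ne j a with rfl | h
        · exact ⟨b, Finset.mem_of_mem_erase hb, (Finset.ne_of_mem_erase hb).symm⟩
        · exact ⟨a, ha, h⟩
      have hc : (R.erase i).card + 1 = R.card := Finset.card_erase_add_one hi
      have hc2 : 2 ≤ (R.erase i).card := by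
        have e1 := Finset.card_erase_add_one ha
        have e2 := Finset.card_erase_add_one hb
        have e3 := Finset.card_erase_add_one hd
        omega
      have h1 := ih _ (by omega) (R.erase i) (pd i v) j rfl (hv.pd hi)
      have h2 := hP 1 _ _ (heul i) (heul' i) _ h1 (der_mem_part (hv.pd hi).mem j)
      rw [eul_der (hv.pd hi) hij, hv.on i hi] at h2
      refine (Submodule.smul_mem_iff _ ?_).1 h2
      rw [sub_ne_zero]
      exact_mod_cast (by omega : (R.erase i).card ≠ 1)
  rw [eq_top_iff, ← cartanW_eq_span, Submodule.span_le]
  rintro _ ⟨R, v, j, hv, rfl⟩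
  exact main _ R v j rfl hv

/-- A subspace of `W(n)` that contains the generators and is stable under them is everything. -/
theorem eq_top_of_stable {N : Submodule K (cartanW K (m + 2)).carrier}
    (he : ∀ a, eW K a ∈ N) (hf : ∀ i : Fin (m + 1), fW K i.succ ∈ N) (hh : ∀ a, hW K a ∈ N)
    (hg : ∀ a, a ≠ 1 → gW K a ∈ N)
    (he' : ∀ a : Fin (m + 2), ∀ x ∈ N, ⁅eW K a, x⁆ ∈ N) (hf' : ∀ i : Fin (m + 1), ∀ x ∈ N, ⁅fW K i.succ, x⁆ ∈ N)
    (hh' : ∀ a : Fin (m + 2), ∀ x ∈ N, ⁅hW K a, x⁆ ∈ N) (hg' : ∀ a : Fin (m + 2), a ≠ 1 → ∀ x ∈ N, ⁅gW K a, x⁆ ∈ N) :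
    N = ⊤ := by
  -- The elements of `N` whose adjoint action preserves `N`: by the Jacobi identity they are closed
  -- under brackets, so it suffices that they include the generators.
  let P : Submodule K (cartanW K (m + 2)).carrier :=
    { carrier := {x | x ∈ N ∧ ∀ y ∈ N, ⁅x, y⁆ ∈ N}
      zero_mem' := ⟨zero_mem _, fun y _ => by rw [zero_br]; exact zero_mem _⟩
      add_mem' := fun ha hb => ⟨add_mem ha.1 hb.1, fun y hy => by
        rw [add_br]; exact add_mem (ha.2 y hy) (hb.2 y hy)⟩
      smul_mem' := fun c x hx => ⟨Submodule.smul_mem _ _ hx.1, fun y hy => by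
        rw [smul_br]; exact Submodule.smul_mem _ _ (hx.2 y hy)⟩ }
  have : P = ⊤ := by
    refine eq_top_of_closed ?_ (fun a => ⟨he a, he' a⟩) (fun i => ⟨hf i, hf' i⟩)
      (fun a => ⟨hh a, hh' a⟩) (fun a ha => ⟨hg a ha, hg' a ha⟩)
    rintro p q x ⟨hx, hx'⟩ hp y ⟨hy, hy'⟩ hq
    refine ⟨hx' y hy, fun z hz => ?_⟩
    have e := br_br hp hq z
    rw [← sub_eq_iff_eq_add] at e
    rw [← e]
    exact sub_mem (hx' _ (hy' z hz)) (Submodule.smul_mem _ _ (hy' _ (hx' z hz)))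
  rw [eq_top_iff]
  exact fun x _ => (this ▸ Submodule.mem_top : x ∈ P).1

end Gen

end Grassmann

end

section

open Grassmann LieSuperalgebra

namespace WSys

variable {K : Type u} [Field K] {m : ℕ} {L : LieSuperalgebra.{u, u} K}

/-! ### Systems from presentations -/

/-- The system of generators given by a surjection from the free Lie superalgebra. -/
def ofHom (π : (freeW K (m + 2)).Hom L) (hπ : Function.Surjective π.toLin)
    (hrel : ∀ x, WTildeRel K (cartanMatrixA (m + 2)) x → π.toLin x = 0)
    (φ : L.Hom (cartanW K (m + 2))) (hφ : ∀ x, φ.toLin (π.toLin x) = (freeToW K m).toLin x) :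
    WSys K m L where
  φ := φ
  e0 := π.toLin (eGen K 0)
  e i := π.toLin (eGen K i.succ)
  f i := π.toLin (fGen K i.succ (by simp))
  h a := π.toLin (hGen K a)
  -- Default value 0 at the index 1, for which there is no generator.
  g a := if ha : a.val ≠ 1 then π.toLin (f0Gen K a ha) else 0
  e0_mem := π.map_part 1 _ (freeLieSuperalgebra.of_mem_part WGen.parity (.e 0))
  e_mem i := π.map_part 0 _ (freeLieSuperalgebra.of_mem_part WGen.parity (.e i.succ))
  f_mem i := π.map_part 0 _ (freeLieSuperalgebra.of_mem_part WGen.parity (.f i.succ (by simp)))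
  h_mem a := π.map_part 0 _ (freeLieSuperalgebra.of_mem_part WGen.parity (.h a))
  g_mem a := by
    split_ifs with ha
    · exact π.map_part 1 _ (freeLieSuperalgebra.of_mem_part WGen.parity (.f0 a ha))
    · exact zero_mem _
  h_e0 a := by
    have := hrel _ (.h_e a 0)
    rw [map_sub, π.map_bracket, map_zsmul, sub_eq_zero, ← hpair_sroot] at this
    rw [this, Int.cast_smul_eq_zsmul]
  h_e a i := by
    have := hrel _ (.h_e a i.succ)
    rw [map_sub, π.map_bracket, map_zsmul, sub_eq_zero, ← hpair_sroot] at this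
    rw [this, Int.cast_smul_eq_zsmul]
    rfl
  h_f a i := by
    have := hrel _ (.h_f a i.succ (by simp))
    rw [map_add, π.map_bracket, map_zsmul, ← hpair_sroot] at this
    rw [eq_neg_of_add_eq_zero_left this, Int.cast_smul_eq_zsmul, hpair_neg, neg_smul]
    rfl
  h_g a b := by
    split_ifs with hb
    · have := hrel _ (.h_f0 0 a b hb rfl)
      rw [map_add, π.map_bracket, map_zsmul] at this
      rw [eq_neg_of_add_eq_zero_left this, Int.cast_smul_eq_zsmul, hpair_single_zero, neg_smul]
    · simp
  e_f i := by
    have := hrel _ (.e_f_eq i.succ (by simp))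
    rwa [map_sub, π.map_bracket, sub_eq_zero] at this
  e_f_ne i j h := by
    have := hrel _ (.e_f_ne i.succ j.succ (by simp) (by simpa using h))
    rwa [π.map_bracket] at this
  e0_f i := by
    have := hrel _ (.e_f_ne 0 i.succ (by simp) (Fin.succ_ne_zero i).symm)
    rwa [π.map_bracket] at this
  e0_e0 := by
    have := hrel _ (.serre_e 0 0 cartan_zero_zero.le)
    rw [map_iterate_bracket, cartan_zero_zero] at this
    exact this
  e_e0 i h := by
    have hc : cartanMatrixA (m + 2) i.succ 0 = 0 := by rw [cartan_succ_zero, if_neg h]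
    have := hrel _ (.serre_e i.succ 0 hc.le)
    rw [map_iterate_bracket, hc] at this
    exact this
  e_e_e0 i := by
    have hc : cartanMatrixA (m + 2) i.succ 0 = if i = 0 then -1 else 0 := cartan_succ_zero i
    rcases eq_or_ne i 0 with rfl | h
    · rw [if_pos rfl] at hc
      have := hrel _ (.serre_e _ 0 (by rw [hc]; decide))
      rw [map_iterate_bracket, hc] at this
      exact this
    · rw [if_neg h] at hc
      have := hrel _ (.serre_e i.succ 0 hc.le)
      rw [map_iterate_bracket, hc] at this
      have h' : ⁅π.toLin (eGen K i.succ), π.toLin (eGen K 0)⁆ = 0 := this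
      rw [h', br_zero]
  e_e_e i j h := by
    have hc := cartan_succ_succ i j
    rw [if_neg h] at hc
    split_ifs at hc
    · have := hrel _ (.serre_e i.succ j.succ (by rw [hc]; decide))
      rw [map_iterate_bracket, hc] at this
      exact this
    · have := hrel _ (.serre_e i.succ j.succ hc.le)
      rw [map_iterate_bracket, hc] at this
      have h' : ⁅π.toLin (eGen K i.succ), π.toLin (eGen K j.succ)⁆ = 0 := this
      rw [h', br_zero]
  f_f_f i j h := by
    have hc := cartan_succ_succ i j
    rw [if_neg h] at hc
    split_ifs at hc
    · have := hrel _ (.serre_f i.succ j.succ (by simp) (by simp) (by rw [hc]; decide))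
      rw [map_iterate_bracket, hc] at this
      exact this
    · have := hrel _ (.serre_f i.succ j.succ (by simp) (by simp) hc.le)
      rw [map_iterate_bracket, hc] at this
      have h' : ⁅π.toLin (fGen K i.succ (by simp)), π.toLin (fGen K j.succ (by simp))⁆ = 0 := this
      rw [h', br_zero]
  g_one := dif_neg (by simp)
  e0_g a ha := by
    have ha' : a.val ≠ 1 := fun e => ha (Fin.ext e)
    have := hrel _ (.e0_f0 0 a ha' rfl)
    rw [map_sub, π.map_bracket, sub_eq_zero] at this
    rw [dif_pos ha', this]
  e_g a := by
    split_ifs with ha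
    · have := hrel _ (.e1_f0 (Fin.succ 0) a ha rfl)
      rwa [π.map_bracket] at this
    · exact br_zero _
  e_e_g i a := by
    split_ifs with ha
    · have := hrel _ (.e_e_f0 i.succ a ha)
      rwa [π.map_bracket, π.map_bracket] at this
    · rw [br_zero, br_zero]
  f_f_g i a := by
    split_ifs with ha
    · have := hrel _ (.f_f_f0 i.succ a (by simp) ha)
      rwa [π.map_bracket, π.map_bracket] at this
    · rw [br_zero, br_zero]
  e_f_g i j a hi hj := by
    split_ifs with ha
    · rcases eq_or_ne i j with rfl | h
      · have hj' : i.succ.val ≠ 1 := by rw [Fin.val_succ]; omega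
        have := hrel _ (.e_f_f0_eq i.succ a (by simp) ha hj' (by rw [Fin.val_succ]; omega))
        rw [map_sub, π.map_bracket, π.map_bracket, map_zsmul, sub_eq_zero] at this
        rw [this]
        refine zsmul_mem (Submodule.subset_span ?_) _
        exact ⟨i.succ, dif_pos hj'⟩
      · have := hrel _ (.e_f_f0_ne i.succ j.succ a (by simp) ha (by rw [Fin.val_succ]; omega)
          (by rw [Fin.val_succ]; omega) (by simpa using h))
        rw [π.map_bracket, π.map_bracket] at this
        rw [this]
        exact zero_mem _
    · rw [br_zero, br_zero]
      exact zero_mem _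
  gen N m0 me mf mh mg s0 se sf sh sg := by
    have key : N.comap π.toLin = ⊤ := by
      refine freeLieSuperalgebra.eq_top WGen.parity _ (fun x => ?_) (fun x y hy => ?_)
      · cases x with
        | e a => exact Fin.cases m0 (fun i => me i) a
        | f i hi =>
          obtain ⟨j, rfl⟩ := exists_succ_of_val_ne hi
          exact mf j
        | h a => exact mh a
        | f0 a ha =>
          have := mg a
          rw [dif_pos ha] at this
          exact this
      · have hy : π.toLin y ∈ N := hy
        refine (congrArg (· ∈ N) (π.map_bracket _ y)).mpr ?_
        cases x with
        | e a => exact Fin.cases (s0 _ hy) (fun i => se i _ hy) a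
        | f i hi =>
          obtain ⟨j, rfl⟩ := exists_succ_of_val_ne hi
          exact sf j _ hy
        | h a => exact sh a _ hy
        | f0 a ha =>
          have := sg a _ hy
          rw [dif_pos ha] at this
          exact this
    rw [eq_top_iff]
    rintro x -
    obtain ⟨y, rfl⟩ := hπ x
    exact (key ▸ Submodule.mem_top : y ∈ N.comap π.toLin)
  φ_e0 := by rw [hφ, freeToW_e, eW_zero]
  φ_e i := by rw [hφ, freeToW_e, eW_succ]
  φ_f i := by rw [hφ, freeToW_f, fW_succ]
  φ_h a := by rw [hφ, freeToW_h]
  φ_g a ha := by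
    have ha' : a.val ≠ 1 := fun e => ha (Fin.ext e)
    rw [dif_pos ha', hφ, freeToW_f0]

variable [CharZero K]

theorem _root_.Grassmann.freeToW_surjective : Function.Surjective (freeToW K m).toLin := by
  rw [← LinearMap.range_eq_top]
  have key : ∀ (y : (freeW K (m + 2)).carrier) {z}, (freeToW K m).toLin y = z →
      ∀ x ∈ LinearMap.range (freeToW K m).toLin, ⁅z, x⁆ ∈ LinearMap.range (freeToW K m).toLin := by
    rintro y _ rfl _ ⟨x, rfl⟩
    exact ⟨⁅y, x⁆, (freeToW K m).map_bracket y x⟩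
  have hv : ∀ a : Fin (m + 2), a ≠ 1 → a.val ≠ 1 := fun a ha e => ha (Fin.ext e)
  exact eq_top_of_stable (fun a => ⟨_, freeToW_e a⟩) (fun i => ⟨_, freeToW_f i.succ (by simp)⟩)
    (fun a => ⟨_, freeToW_h a⟩) (fun a ha => ⟨_, freeToW_f0 a (hv a ha)⟩)
    (fun a => key _ (freeToW_e a)) (fun i => key _ (freeToW_f i.succ (by simp)))
    (fun a => key _ (freeToW_h a)) (fun a ha => key _ (freeToW_f0 a (hv a ha)))

variable (K m) in
/-- The system of standard generators of `W(n)`. -/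
def std : WSys K m (cartanW K (m + 2)) :=
  ofHom (freeToW K m) freeToW_surjective (fun _ => freeToW_rel)
    { toLin := LinearMap.id, map_bracket := fun _ _ => rfl, map_part := fun _ _ h => h }
    fun _ => rfl

theorem std_h (a : Fin (m + 2)) : (std K m).h a = hW K a := freeToW_h a

variable (S : WSys K m L)

theorem φ_wt {μ : Fin (m + 2) → ℤ} {x : L.carrier} (hx : x ∈ S.wt μ) :
    S.φ.toLin x ∈ (std K m).wt μ := by
  refine ⟨S.φ.map_part _ _ hx.1, fun a => ?_⟩
  rw [std_h, ← S.φ_h, ← S.φ.map_bracket, hx.2, map_smul]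

theorem mon_wt {R : Finset (Fin (m + 2))} {v : Lam K (m + 2)} (h : IsMon R v) (j : Fin (m + 2)) :
    der j v ∈ (std K m).wt (monWt R j) := by
  refine ⟨?_, fun a => by rw [std_h, hW_mon h]⟩
  convert der_mem_part h.mem j using 2
  simp only [monWt, Finset.sum_sub_distrib, Finset.sum_ite_mem, Finset.univ_inter,
    Finset.sum_const, Finset.sum_ite_eq', Finset.mem_univ, if_true]
  push_cast
  rw [show (1 : ZMod 2) + (R.card : ZMod 2) = (R.card : ZMod 2) - 1 by
    rw [add_comm, sub_eq_add_neg]; rfl]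
  simp

/-- The weights of `W(n)` are those of the monomials. -/
theorem exists_monWt {μ : Fin (m + 2) → ℤ} {w : (cartanW K (m + 2)).carrier}
    (hw : w ∈ (std K m).wt μ) (hne : w ≠ 0) : ∃ R j, μ = monWt R j := by
  by_contra hc
  push Not at hc
  refine hne ?_
  rw [← (std K m).toSl.proj_self μ w hw]
  have : w ∈ Submodule.span K {x : (cartanW K (m + 2)).carrier | ∃ S v j, IsMon S v ∧ x = der j v} :=
    (cartanW_eq_span (K := K) (n := m + 2)) ▸ Submodule.mem_top
  clear hw hne
  induction this using Submodule.span_induction with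
  | mem x h =>
    obtain ⟨R, v, j, hv, rfl⟩ := h
    exact (std K m).toSl.proj_ne _ _ (hc R j) _ (mon_wt hv j)
  | zero => exact map_zero _
  | add x y _ _ hx hy => rw [map_add, hx, hy, add_zero]
  | smul c x _ hx => rw [map_smul, hx, smul_zero]

theorem φ_surjective : Function.Surjective S.φ.toLin := by
  rw [← LinearMap.range_eq_top]
  have key : ∀ (y : L.carrier) {z}, S.φ.toLin y = z →
      ∀ x ∈ LinearMap.range S.φ.toLin, ⁅z, x⁆ ∈ LinearMap.range S.φ.toLin := by
    rintro y _ rfl _ ⟨x, rfl⟩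
    exact ⟨⁅y, x⁆, S.φ.map_bracket y x⟩
  have he : ∀ a : Fin (m + 2), ∃ y, S.φ.toLin y = eW K a := fun a =>
    Fin.cases ⟨_, S.φ_e0⟩ (fun i => ⟨_, S.φ_e i⟩) a
  exact eq_top_of_stable he (fun i => ⟨_, S.φ_f i⟩)
    (fun a => ⟨_, S.φ_h a⟩) (fun a ha => ⟨_, S.φ_g a ha⟩)
    (fun a => key _ (he a).choose_spec) (fun i => key _ (S.φ_f i))
    (fun a => key _ (S.φ_h a)) (fun a ha => key _ (S.φ_g a ha))

theorem φ_proj (μ : Fin (m + 2) → ℤ) (x : L.carrier) :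
    S.φ.toLin (S.toSl.proj μ x) = (std K m).toSl.proj μ (S.φ.toLin x) := by
  refine (SlMod.graded_top (S := S.toSl)).induction
    (p := fun x => S.φ.toLin (S.toSl.proj μ x) = (std K m).toSl.proj μ (S.φ.toLin x))
    (by simp) ?_ ?_ ?_ (Submodule.mem_top (x := x))
  · intro ν x _ hx
    rcases eq_or_ne μ ν with rfl | h
    · rw [S.toSl.proj_self _ _ hx, (std K m).toSl.proj_self _ _ (S.φ_wt hx)]
    · rw [S.toSl.proj_ne _ _ h _ hx, (std K m).toSl.proj_ne _ _ h _ (S.φ_wt hx), map_zero]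
  · intro x y hx hy; simp only [map_add, hx, hy]
  · intro c x hx; simp only [map_smul, hx]

end WSys

end

/-! ### Construction of the grading and injectivity on the local part -/

section

open Grassmann LieSuperalgebra

namespace WSys

variable {K : Type u} [Field K] [CharZero K] {m : ℕ} {L : LieSuperalgebra.{u, u} K}
  (S : WSys K m L)

/-! ### Stable subspaces -/

/-- Subspaces stable under the even generators. -/
structure Stable (N : Submodule K L.carrier) : Prop where
  e : ∀ i, ∀ x ∈ N, ⁅S.e i, x⁆ ∈ N
  f : ∀ i, ∀ x ∈ N, ⁅S.f i, x⁆ ∈ N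
  h : ∀ a, ∀ x ∈ N, ⁅S.h a, x⁆ ∈ N

variable {S}

theorem Stable.graded {N : Submodule K L.carrier} (hN : S.Stable N) : S.toSl.Graded N :=
  S.graded_of_stable hN.h

theorem h_mem_of_graded {N : Submodule K L.carrier} (hN : S.toSl.Graded N) (a : Fin (m + 2))
    {x : L.carrier} (hx : x ∈ N) : ⁅S.h a, x⁆ ∈ N := by
  refine hN.induction (p := fun x => ⁅S.h a, x⁆ ∈ N) (by simp) ?_ ?_ ?_ hx
  · intro μ x hx hμ
    rw [hμ.2]
    exact Submodule.smul_mem _ _ hx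
  · intro x y hx hy; rw [br_add]; exact add_mem hx hy
  · intro c x hx; rw [br_smul]; exact Submodule.smul_mem _ _ hx

theorem Stable.map₂ {N P : Submodule K L.carrier} (hN : S.Stable N) (hP : S.Stable P) :
    S.Stable (Submodule.map₂ L.bracket N P) := by
  have key : ∀ z ∈ L.part 0, (∀ x ∈ N, ⁅z, x⁆ ∈ N) → (∀ x ∈ P, ⁅z, x⁆ ∈ P) →
      ∀ x ∈ Submodule.map₂ L.bracket N P, ⁅z, x⁆ ∈ Submodule.map₂ L.bracket N P := by
    intro z hz h1 h2 x hx
    have : Submodule.map₂ L.bracket N P ≤ (Submodule.map₂ L.bracket N P).comap (L.bracket z) := by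
      rw [Submodule.map₂_le]
      intro a ha b hb
      rw [Submodule.mem_comap, ← br_def, ← br_def, br_br_even hz]
      exact add_mem (Submodule.apply_mem_map₂ _ (h1 a ha) hb)
        (Submodule.apply_mem_map₂ _ ha (h2 b hb))
    exact this hx
  exact ⟨fun i => key _ (S.e_mem i) (hN.e i) (hP.e i), fun i => key _ (S.f_mem i) (hN.f i) (hP.f i),
    fun a => key _ (S.h_mem a) (hN.h a) (hP.h a)⟩

variable (S)

theorem f_e_same (i : Fin (m + 1)) (x : L.carrier) :
    ⁅S.f i, ⁅S.e i, x⁆⁆ = ⁅S.e i, ⁅S.f i, x⁆⁆ - ⁅S.h i.succ, x⁆ := by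
  rw [br_br_even (S.e_mem i) (S.f i), S.e_f]
  abel

theorem f_e_ne {i j : Fin (m + 1)} (h : i ≠ j) (x : L.carrier) :
    ⁅S.f j, ⁅S.e i, x⁆⁆ = ⁅S.e i, ⁅S.f j, x⁆⁆ := by
  rw [br_br_even (S.e_mem i) (S.f j), S.e_f_ne i j h, zero_br, zero_add]

/-! ### The subalgebra `gl_n` -/

/-- The span of the Cartan elements. -/
def hs : Submodule K L.carrier := Submodule.span K (Set.range S.h)

theorem hs_le : S.hs ≤ S.wt 0 := Submodule.span_le.2 (by rintro _ ⟨a, rfl⟩; exact S.h_wt a)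

theorem hs_ker {x : L.carrier} (hx : x ∈ S.hs) (h : x ∈ S.kerφ) : x = 0 := by
  obtain ⟨c, rfl⟩ := (Submodule.mem_span_range_iff_exists_fun K).1 hx
  rw [LinearMap.mem_ker, map_sum] at h
  simp only [map_smul, S.φ_h] at h
  have := Fintype.linearIndependent_iff.1 (linearIndependent_hW (K := K) (m := m)) c h
  simp [this]

theorem hs_mem (a : Fin (m + 2)) : S.h a ∈ S.hs := Submodule.subset_span ⟨a, rfl⟩

theorem hs_map {T : L.carrier →ₗ[K] L.carrier} (h : ∀ a, T (S.h a) ∈ S.hs) :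
    ∀ x ∈ S.hs, T x ∈ S.hs := fun _ hx =>
  (Submodule.span_le.2 (by rintro _ ⟨a, rfl⟩; exact h a) : S.hs ≤ S.hs.comap T) hx

theorem hs_dn_up (i j : Fin (m + 1)) : ∀ x ∈ S.hs, ⁅S.f j, ⁅S.e i, x⁆⁆ ∈ S.hs := by
  refine S.hs_map (T := L.bracket (S.f j) ∘ₗ L.bracket (S.e i)) fun a => ?_
  change ⁅S.f j, ⁅S.e i, S.h a⁆⁆ ∈ S.hs
  rw [S.e_h, br_smul, S.f_e]
  refine Submodule.smul_mem _ _ (neg_mem ?_)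
  rcases eq_or_ne i j with rfl | h
  · rw [S.e_f]; exact S.hs_mem _
  · rw [S.e_f_ne i j h]; exact zero_mem _

theorem hs_up_dn (i j : Fin (m + 1)) : ∀ x ∈ S.hs, ⁅S.e j, ⁅S.f i, x⁆⁆ ∈ S.hs := by
  refine S.hs_map (T := L.bracket (S.e j) ∘ₗ L.bracket (S.f i)) fun a => ?_
  change ⁅S.e j, ⁅S.f i, S.h a⁆⁆ ∈ S.hs
  rw [S.f_h, br_smul]
  refine Submodule.smul_mem _ _ ?_
  rcases eq_or_ne j i with rfl | h
  · rw [S.e_f]; exact S.hs_mem _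
  · rw [S.e_f_ne j i h]; exact zero_mem _

/-- The span of `h`, `e_i`, `f_i` and their brackets. -/
def gl : Submodule K L.carrier := S.toSl.bicone 0 S.hs

theorem graded_hs : S.toSl.Graded S.hs := SlMod.graded_of_le_wt (S := S.toSl) S.hs_le

theorem gl_stable : S.Stable S.gl :=
  ⟨fun i _ hx => SlMod.up_mem_bicone S.graded_hs (fun i j _ _ => S.hs_up_dn i j) (Nat.zero_le _) hx,
    fun i _ hx => SlMod.dn_mem_bicone S.graded_hs (fun i j _ _ => S.hs_dn_up i j) (Nat.zero_le _) hx,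
    fun a _ hx => h_mem_of_graded (SlMod.graded_bicone S.graded_hs) a hx⟩

/-- The bicone principle with s = 0 over the weight 0 reduces this to the linear independence of the
images of the h_a. -/
theorem gl_ker {x : L.carrier} (hx : x ∈ S.gl) (h : x ∈ S.kerφ) : x = 0 := by
  have := SlMod.bicone_inf_eq_bot (S := S.toSl) (s := 0) S.hs_le (fun _ _ => rfl)
    (tail_eq_zero fun _ _ => rfl) (fun i j _ _ => S.hs_dn_up i j) (fun i j _ _ => S.hs_up_dn i j)
    S.graded_ker (fun i x hx => S.br_mem_ker _ hx) (fun i x hx => S.br_mem_ker _ hx)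
    (fun x hx h => S.hs_ker hx h)
  exact (Submodule.mem_bot K).1 (this ▸ ⟨hx, h⟩)

theorem hs_le_gl : S.hs ≤ S.gl := le_sup_of_le_left SlMod.le_cone

theorem h_mem_gl (a : Fin (m + 2)) : S.h a ∈ S.gl := S.hs_le_gl (S.hs_mem a)

theorem hpair_root_self (i : Fin (m + 1)) : hpair (root i) i.succ = 2 := by
  rw [hpair_succ, root_castSucc, root_succ]
  rfl

theorem e_mem_gl (i : Fin (m + 1)) : S.e i ∈ S.gl := by
  have := S.gl_stable.e i _ (S.h_mem_gl i.succ)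
  rw [S.e_h, hpair_root_self] at this
  exact (Submodule.smul_mem_iff _ (by norm_num)).1 this

theorem f_mem_gl (i : Fin (m + 1)) : S.f i ∈ S.gl := by
  have := S.gl_stable.f i _ (S.h_mem_gl i.succ)
  rw [S.f_h, hpair_root_self] at this
  exact (Submodule.smul_mem_iff _ (by norm_num)).1 this

theorem gl_induction {p : L.carrier → Prop} (mem : ∀ a, p (S.h a)) (zero : p 0)
    (add : ∀ x y, p x → p y → p (x + y)) (smul : ∀ (c : K) x, p x → p (c • x))
    (e : ∀ i, ∀ x, p x → p ⁅S.e i, x⁆) (f : ∀ i, ∀ x, p x → p ⁅S.f i, x⁆) {x : L.carrier}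
    (hx : x ∈ S.gl) : p x := by
  have h0 : ∀ x ∈ S.hs, p x := by
    intro x hx
    induction hx using Submodule.span_induction with
    | mem x h => obtain ⟨a, rfl⟩ := h; exact mem a
    | zero => exact zero
    | add x y _ _ hx hy => exact add _ _ hx hy
    | smul c x _ hx => exact smul _ _ hx
  obtain ⟨a, ha, b, hb, rfl⟩ := Submodule.mem_sup.1 hx
  refine add _ _ ?_ ?_
  · refine clos_induction h0 add smul ?_ ha
    rintro _ ⟨i, -, rfl⟩ x - hx
    exact e i x hx
  · refine clos_induction h0 add smul ?_ hb
    rintro _ ⟨i, -, rfl⟩ x - hx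
    exact f i x hx

theorem gl_bracket {N : Submodule K L.carrier} (hN : S.Stable N) {y : L.carrier} (hy : y ∈ S.gl) :
    ∀ x ∈ N, ⁅y, x⁆ ∈ N := by
  refine S.gl_induction (p := fun y => ∀ x ∈ N, ⁅y, x⁆ ∈ N) hN.h (by simp) ?_ ?_ ?_ ?_ hy
  · intro y z hy hz x hx; rw [add_br]; exact add_mem (hy x hx) (hz x hx)
  · intro c y hy x hx; rw [smul_br]; exact Submodule.smul_mem _ _ (hy x hx)
  · intro i y hy x hx
    have := br_br_even (S.e_mem i) y x
    rw [← sub_eq_iff_eq_add] at this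
    rw [← this]
    exact sub_mem (hN.e i _ (hy x hx)) (hy _ (hN.e i x hx))
  · intro i y hy x hx
    have := br_br_even (S.f_mem i) y x
    rw [← sub_eq_iff_eq_add] at this
    rw [← this]
    exact sub_mem (hN.f i _ (hy x hx)) (hy _ (hN.f i x hx))

theorem gl_le_part : S.gl ≤ L.part 0 := fun x hx => by
  refine S.gl_induction (p := fun x => x ∈ L.part 0) S.h_mem (zero_mem _)
    (fun _ _ => add_mem) (fun c _ => Submodule.smul_mem _ c) ?_ ?_ hx
  · exact fun i x hx => by simpa using br_mem_part (S.e_mem i) hx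
  · exact fun i x hx => by simpa using br_mem_part (S.f_mem i) hx

/-! ### The span of the `∂_j` -/

theorem single_zero_of_pos (l : Fin (m + 2)) (hl : 1 ≤ l.val) :
    (Pi.single 0 1 : Fin (m + 2) → ℤ) l = 0 :=
  Pi.single_eq_of_ne (fun e => by simp [e] at hl) _

/-- The space generated by `e_0`. -/
def V1 : Submodule K L.carrier := S.toSl.cone 0 (Submodule.span K {S.e0})

theorem span_e0_le : Submodule.span K {S.e0} ≤ S.toSl.wt (sroot 0) :=
  Submodule.span_le.2 (by rintro _ rfl; exact S.e0_wt)

theorem e0_mem_V1 : S.e0 ∈ S.V1 := SlMod.le_cone (Submodule.mem_span_singleton_self _)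

theorem V1_induction {p : L.carrier → Prop} (mem : p S.e0)
    (add : ∀ x y, p x → p y → p (x + y)) (smul : ∀ (c : K) x, p x → p (c • x))
    (e : ∀ i, ∀ x ∈ S.V1, p x → p ⁅S.e i, x⁆) {x : L.carrier} (hx : x ∈ S.V1) : p x := by
  refine clos_induction (fun x hx => ?_) add smul ?_ hx
  · obtain ⟨c, rfl⟩ := Submodule.mem_span_singleton.1 hx
    exact smul c _ mem
  · rintro _ ⟨i, -, rfl⟩ x hx hp
    exact e i x hx hp

theorem V1_stable : S.Stable S.V1 := by
  have hg : S.toSl.Graded S.V1 :=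
    SlMod.graded_cone (SlMod.graded_of_le_wt (S := S.toSl) S.span_e0_le)
  have he : ∀ i, ∀ x ∈ S.V1, ⁅S.e i, x⁆ ∈ S.V1 := fun i x hx =>
    SlMod.up_mem_cone (S := S.toSl) (i := i) (Nat.zero_le _) hx
  refine ⟨he, fun j x hx => ?_, fun a x hx => h_mem_of_graded hg a hx⟩
  refine S.V1_induction (p := fun x => ⁅S.f j, x⁆ ∈ S.V1) ?_ ?_ ?_ ?_ hx
  · rw [S.f_e0]; exact zero_mem _
  · intro x y hx hy; rw [br_add]; exact add_mem hx hy
  · intro c x hx; rw [br_smul]; exact Submodule.smul_mem _ _ hx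
  · intro i x hx hp
    rcases eq_or_ne i j with rfl | h
    · rw [f_e_same]
      exact sub_mem (he _ _ hp) (h_mem_of_graded hg _ hx)
    · rw [f_e_ne _ h]
      exact he _ _ hp

/-- The lowest weight principle with s = 0 over the weight -ε_0, whose total is exactly the
permitted bound -1; on the line of e_0 the map is injective because ∂_0 ≠ 0. -/
theorem V1_ker {x : L.carrier} (hx : x ∈ S.V1) (h : x ∈ S.kerφ) : x = 0 := by
  have h0 : tail (sroot (0 : Fin (m + 2))) 0 = -1 := by
    rw [sroot_zero, tail_neg, tail_single, if_pos (Nat.zero_le _)]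
  have := SlMod.cone_inf_eq_bot (S := S.toSl) (s := 0) S.span_e0_le
    (fun l hl => by
      rw [sroot_zero, Pi.neg_apply, single_zero_of_pos l hl, neg_zero])
    h0.ge (fun i j _ _ t ht => ?_) S.graded_ker (fun i x hx => S.br_mem_ker _ hx) ?_
  · exact (Submodule.mem_bot K).1 (this ▸ ⟨hx, h⟩)
  · obtain ⟨c, rfl⟩ := Submodule.mem_span_singleton.1 ht
    change ⁅S.f j, ⁅S.e i, c • S.e0⁆⁆ ∈ _
    rw [br_smul, br_smul]
    refine Submodule.smul_mem _ _ ?_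
    rcases eq_or_ne i j with rfl | hne
    · rw [f_e_same, S.f_e0, br_zero, zero_sub, S.h_e0]
      exact neg_mem (Submodule.smul_mem _ _ (Submodule.mem_span_singleton_self _))
    · rw [f_e_ne _ hne, S.f_e0, br_zero]
      exact zero_mem _
  · intro x hx h
    obtain ⟨c, rfl⟩ := Submodule.mem_span_singleton.1 hx
    rw [LinearMap.mem_ker, map_smul, S.φ_e0] at h
    rw [(smul_eq_zero.1 h).resolve_right (D_ne_zero 0), zero_smul]

theorem V1_bracket {N P : Submodule K L.carrier} (hN : S.Stable N) (hP : S.Stable P)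
    (h : ∀ x ∈ N, ⁅S.e0, x⁆ ∈ P) {y : L.carrier} (hy : y ∈ S.V1) : ∀ x ∈ N, ⁅y, x⁆ ∈ P := by
  refine S.V1_induction (p := fun y => ∀ x ∈ N, ⁅y, x⁆ ∈ P) h ?_ ?_ ?_ hy
  · intro y z hy hz x hx; rw [add_br]; exact add_mem (hy x hx) (hz x hx)
  · intro c y hy x hx; rw [smul_br]; exact Submodule.smul_mem _ _ (hy x hx)
  · intro i y _ hy x hx
    have := br_br_even (S.e_mem i) y x
    rw [← sub_eq_iff_eq_add] at this
    rw [← this]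
    exact sub_mem (hP.e i _ (hy x hx)) (hy _ (hN.e i x hx))

theorem V1_le_part : S.V1 ≤ L.part 1 := fun x hx => by
  refine S.V1_induction (p := fun x => x ∈ L.part 1) S.e0_mem
    (fun _ _ => add_mem) (fun c _ => Submodule.smul_mem _ c) ?_ hx
  exact fun i x _ hx => by simpa using br_mem_part (S.e_mem i) hx

theorem φ_V1 {x : L.carrier} (hx : x ∈ S.V1) :
    S.φ.toLin x ∈ Submodule.span K (Set.range (D K (n := m + 2))) := by
  refine S.V1_induction (p := fun x => S.φ.toLin x ∈ Submodule.span K (Set.range (D K (n := m + 2))))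
    ?_ ?_ ?_ ?_ hx
  · rw [S.φ_e0]; exact Submodule.subset_span ⟨0, rfl⟩
  · intro x y hx hy; rw [map_add]; exact add_mem hx hy
  · intro c x hx; rw [map_smul]; exact Submodule.smul_mem _ _ hx
  · intro i x _ hx
    rw [S.φ.map_bracket, S.φ_e]
    have : Submodule.span K (Set.range (D K (n := m + 2))) ≤
        (Submodule.span K (Set.range (D K (n := m + 2)))).comap
          ((cartanW K (m + 2)).bracket (E K i.castSucc i.succ)) := by
      rw [Submodule.span_le]
      rintro _ ⟨l, rfl⟩
      change ⁅E K i.castSucc i.succ, D K l⁆ ∈ Submodule.span K (Set.range (D K (n := m + 2)))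
      rw [E_D, neg_mem_iff]
      split_ifs
      · exact Submodule.subset_span ⟨_, rfl⟩
      · exact zero_mem _
    exact this hx

/-- The space `V1` embeds into the span of the ∂_j, on which ad E_01 has rank one. -/
theorem e_zero_V1 {x : L.carrier} (hx : x ∈ S.V1) : ∃ c : K, ⁅S.e 0, x⁆ = c • ⁅S.e 0, S.e0⁆ := by
  obtain ⟨c, hc⟩ := (Submodule.mem_span_range_iff_exists_fun K).1 (S.φ_V1 hx)
  refine ⟨c 0, ?_⟩
  rw [← sub_eq_zero]
  refine S.V1_ker (sub_mem (S.V1_stable.e 0 _ hx)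
    (Submodule.smul_mem _ _ (S.V1_stable.e 0 _ S.e0_mem_V1))) ?_
  rw [LinearMap.mem_ker, map_sub, map_smul, S.φ.map_bracket, S.φ.map_bracket, S.φ_e0, S.φ_e, ← hc,
    br_sum, E_D, Fin.castSucc_zero, if_pos rfl]
  simp only [br_smul, E_D]
  simp

/-- Raising operators other than the first commute with e_0. The first one yields only multiples of
[e_1, e_0], and 2 [e_0, [e_1, e_0]] = [e_1, [e_0, e_0]] = 0. -/
theorem e0_V1 {x : L.carrier} (hx : x ∈ S.V1) : ⁅S.e0, x⁆ = 0 := by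
  have h1 : ⁅S.e0, ⁅S.e 0, S.e0⁆⁆ = 0 := by
    have h := br_br_even (S.e_mem 0) S.e0 S.e0
    have ho : ⁅S.e 0, S.e0⁆ ∈ L.part 1 := by simpa using br_mem_part (S.e_mem 0) S.e0_mem
    rw [S.e0_e0, br_zero, br_comm_odd ho S.e0_mem, ← two_smul K] at h
    exact (smul_eq_zero.1 h.symm).resolve_left two_ne_zero
  refine S.V1_induction (p := fun x => ⁅S.e0, x⁆ = 0) S.e0_e0 ?_ ?_ ?_ hx
  · intro x y hx hy; rw [br_add, hx, hy, add_zero]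
  · intro c x hx; rw [br_smul, hx, smul_zero]
  · intro i x hx hp
    rcases eq_or_ne i 0 with rfl | hi
    · obtain ⟨c, hc⟩ := S.e_zero_V1 hx
      rw [hc, br_smul, h1, smul_zero]
    · have := br_br_even (S.e_mem i) S.e0 x
      rw [hp, br_zero, S.e_e0 i hi, zero_br, zero_add] at this
      exact this.symm

/-! ### The module generated by the `f_{0a}` -/

/-- The span of the `f_{0a}`. -/
def gs : Submodule K L.carrier := Submodule.span K (Set.range S.g)

theorem gs_le : S.gs ≤ S.toSl.wt (Pi.single 0 1) :=
  Submodule.span_le.2 (by rintro _ ⟨a, rfl⟩; exact S.g_wt a)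

theorem gs_mem (a : Fin (m + 2)) : S.g a ∈ S.gs := Submodule.subset_span ⟨a, rfl⟩

/-- Bracketing with e_0 turns a combination of the f_{0a} into the same combination of the h_a, and
these have independent images. -/
theorem gs_ker {x : L.carrier} (hx : x ∈ S.gs) (h : x ∈ S.kerφ) : x = 0 := by
  obtain ⟨c, rfl⟩ := (Submodule.mem_span_range_iff_exists_fun K).1 hx
  have h1 := S.br_mem_ker S.e0 h
  let c' : Fin (m + 2) → K := fun a => if a = 1 then 0 else c a
  have h2 : ⁅S.e0, ∑ a, c a • S.g a⁆ = ∑ a, c' a • S.h a := by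
    rw [br_sum]
    refine Finset.sum_congr rfl fun a _ => ?_
    rcases eq_or_ne a 1 with rfl | ha
    · simp [c', S.g_one]
    · simp [c', ha, S.e0_g a ha]
  rw [h2, LinearMap.mem_ker, map_sum] at h1
  simp only [map_smul, S.φ_h] at h1
  have h3 := Fintype.linearIndependent_iff.1 (linearIndependent_hW (K := K) (m := m)) c' h1
  refine Finset.sum_eq_zero fun a _ => ?_
  rcases eq_or_ne a 1 with rfl | ha
  · rw [S.g_one, smul_zero]
  · have := h3 a
    simp only [c', if_neg ha] at this
    rw [this, zero_smul]

theorem gs_map {T : L.carrier →ₗ[K] L.carrier} (h : ∀ a, T (S.g a) ∈ S.gs) :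
    ∀ x ∈ S.gs, T x ∈ S.gs := fun _ hx =>
  (Submodule.span_le.2 (by rintro _ ⟨a, rfl⟩; exact h a) : S.gs ≤ S.gs.comap T) hx

theorem gs_up_dn (i j : Fin (m + 1)) (hi : 1 ≤ i.val) (hj : 1 ≤ j.val) :
    ∀ x ∈ S.gs, ⁅S.e j, ⁅S.f i, x⁆⁆ ∈ S.gs :=
  S.gs_map (T := L.bracket (S.e j) ∘ₗ L.bracket (S.f i)) fun a => S.e_f_g j i a hj hi

theorem gs_dn_up (i j : Fin (m + 1)) (hi : 1 ≤ i.val) (hj : 1 ≤ j.val) :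
    ∀ x ∈ S.gs, ⁅S.f j, ⁅S.e i, x⁆⁆ ∈ S.gs := by
  intro x hx
  have h := S.gs_up_dn j i hj hi x hx
  rcases eq_or_ne i j with rfl | hne
  · rw [f_e_same, (S.gs_le hx).2]
    exact sub_mem h (Submodule.smul_mem _ _ hx)
  · rwa [f_e_ne _ hne]

theorem graded_gs : S.toSl.Graded S.gs := SlMod.graded_of_le_wt (S := S.toSl) S.gs_le

/-- The module generated by the `f_{0a}` under the `e_i`, `f_i` with `i ≥ 2`. -/
def M1 : Submodule K L.carrier := S.toSl.bicone 1 S.gs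

/-- The bicone principle with s = 1: the relations for [e_i, [f_j, f_{0a}]] with i, j ≥ 2 keep the
span of the f_{0a} stable, as that principle requires. -/
theorem M1_ker {x : L.carrier} (hx : x ∈ S.M1) (h : x ∈ S.kerφ) : x = 0 := by
  have := SlMod.bicone_inf_eq_bot (S := S.toSl) (s := 1) S.gs_le
    (fun l hl => single_zero_of_pos l hl.le) (tail_eq_zero single_zero_of_pos)
    S.gs_dn_up S.gs_up_dn S.graded_ker (fun i x hx => S.br_mem_ker _ hx)
    (fun i x hx => S.br_mem_ker _ hx) (fun x hx h => S.gs_ker hx h)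
  exact (Submodule.mem_bot K).1 (this ▸ ⟨hx, h⟩)

theorem M1_graded : S.toSl.Graded S.M1 := SlMod.graded_bicone S.graded_gs

theorem M1_e {i : Fin (m + 1)} (hi : 1 ≤ i.val) {x : L.carrier} (hx : x ∈ S.M1) :
    ⁅S.e i, x⁆ ∈ S.M1 := SlMod.up_mem_bicone S.graded_gs S.gs_up_dn hi hx

theorem M1_f {i : Fin (m + 1)} (hi : 1 ≤ i.val) {x : L.carrier} (hx : x ∈ S.M1) :
    ⁅S.f i, x⁆ ∈ S.M1 := SlMod.dn_mem_bicone S.graded_gs S.gs_dn_up hi hx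

theorem e_zero_gs {x : L.carrier} (hx : x ∈ S.gs) : ⁅S.e 0, x⁆ = 0 := by
  have : S.gs ≤ LinearMap.ker (L.bracket (S.e 0)) :=
    Submodule.span_le.2 (by rintro _ ⟨a, rfl⟩; exact S.e_g a)
  exact this hx

/-- On the part obtained by lowering, e_1 commutes with the f_i, i ≥ 2. On the part obtained by
raising it does not commute with the operators used, and `cone_killed` is needed. -/
theorem e_zero_M1 {x : L.carrier} (hx : x ∈ S.M1) : ⁅S.e 0, x⁆ = 0 := by
  obtain ⟨a, ha, b, hb, rfl⟩ := Submodule.mem_sup.1 hx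
  have hne : ∀ i : Fin (m + 1), 1 ≤ i.val → (0 : Fin (m + 1)) ≠ i := fun i hi e => by
    rw [← e] at hi; simp at hi
  rw [br_add]
  have h1 : ⁅S.e 0, a⁆ = 0 := by
    refine SlMod.cone_killed (S := S.toSl) (s := 1) (Z := L.bracket (S.e 0)) (α := root 0) S.gs_le
      (fun l hl => single_zero_of_pos l hl.le) S.gs_dn_up (S.toSl.up_mem 0) ?_ ?_ ?_
      (fun x hx => S.e_zero_gs hx) ha
    · intro l hl
      have h1 : l ≠ Fin.castSucc 0 := fun e => by simp [e] at hl
      have h2 : l ≠ Fin.succ 0 := fun e => by simp [e] at hl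
      rw [root, Pi.sub_apply, Pi.single_eq_of_ne h1, Pi.single_eq_of_ne h2, sub_zero]
    · rw [tail_eq_zero single_zero_of_pos, tail_root, if_pos (by simp)]
      norm_num
    · intro i hi x
      exact S.toSl.comm 0 i (hne i hi) x
  have h2 : ⁅S.e 0, b⁆ = 0 := by
    refine clos_induction (p := fun b => ⁅S.e 0, b⁆ = 0) (fun x hx => S.e_zero_gs hx) ?_ ?_ ?_ hb
    · intro x y hx hy; rw [br_add, hx, hy, add_zero]
    · intro c x hx; rw [br_smul, hx, smul_zero]
    · rintro _ ⟨i, hi, rfl⟩ x - hx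
      change ⁅S.e 0, ⁅S.f i, x⁆⁆ = 0
      rw [← f_e_ne _ (hne i hi), hx, br_zero]
  rw [h1, h2, add_zero]

/-- The module generated by the `f_{0a}`. -/
def M : Submodule K L.carrier := clos (Set.range fun i => L.bracket (S.f i)) S.M1

theorem M1_le_M : S.M1 ≤ S.M := le_clos _ _

theorem g_mem_M1 (a : Fin (m + 2)) : S.g a ∈ S.M1 :=
  Submodule.mem_sup_left (SlMod.le_cone (S.gs_mem a))

theorem g_mem_M (a : Fin (m + 2)) : S.g a ∈ S.M := S.M1_le_M (S.g_mem_M1 a)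

/-- `M1` is stable under every raising operator, the first one included because it kills `M1`;
commuting past the lowering operators extends this to `M`. -/
theorem M_stable : S.Stable S.M := by
  have hg : S.toSl.Graded S.M := by
    refine SlMod.graded_clos S.M1_graded ?_
    rintro _ ⟨i, rfl⟩
    exact ⟨-root i, S.bracket_shift (S.f_wt i)⟩
  have hf : ∀ i, ∀ x ∈ S.M, ⁅S.f i, x⁆ ∈ S.M := fun i x hx =>
    clos_step (A := Set.range fun i => L.bracket (S.f i)) ⟨i, rfl⟩ hx
  refine ⟨fun i x hx => ?_, hf, fun a x hx => h_mem_of_graded hg a hx⟩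
  refine clos_induction (p := fun x => ⁅S.e i, x⁆ ∈ S.M) ?_ ?_ ?_ ?_ hx
  · intro x hx
    by_cases hi : 1 ≤ i.val
    · exact S.M1_le_M (S.M1_e hi hx)
    · obtain rfl : i = 0 := by
        apply Fin.ext
        rw [Fin.val_zero]
        omega
      rw [S.e_zero_M1 hx]
      exact zero_mem _
  · intro x y hx hy; rw [br_add]; exact add_mem hx hy
  · intro c x hx; rw [br_smul]; exact Submodule.smul_mem _ _ hx
  · rintro _ ⟨j, rfl⟩ x hx hp
    change ⁅S.e i, ⁅S.f j, x⁆⁆ ∈ S.M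
    rcases eq_or_ne i j with rfl | h
    · rw [← sub_add_cancel ⁅S.e i, ⁅S.f i, x⁆⁆ ⁅S.h i.succ, x⁆, ← f_e_same]
      exact add_mem (hf _ _ hp) (h_mem_of_graded hg _ hx)
    · rw [← f_e_ne _ h]
      exact hf _ _ hp

theorem M_le_part : S.M ≤ L.part 1 := by
  have he : ∀ i, ∀ x ∈ L.part 1, ⁅S.e i, x⁆ ∈ L.part 1 := fun i x hx => by
    simpa using br_mem_part (S.e_mem i) hx
  have hf : ∀ i, ∀ x ∈ L.part 1, ⁅S.f i, x⁆ ∈ L.part 1 := fun i x hx => by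
    simpa using br_mem_part (S.f_mem i) hx
  have hg : S.gs ≤ L.part 1 := Submodule.span_le.2 (by rintro _ ⟨a, rfl⟩; exact S.g_mem a)
  refine clos_le (sup_le (clos_le hg ?_) (clos_le hg ?_)) ?_
  · rintro _ ⟨i, -, rfl⟩; exact he i
  · rintro _ ⟨i, -, rfl⟩; exact hf i
  · rintro _ ⟨i, rfl⟩; exact hf i

/-- `M` is built from the f_{0a} by f_1, …, f_{n-1} and e_2, …, e_{n-1}, all of which commute with
e_0. So [e_0, M] is generated in the same way from the h_a. -/
theorem e0_M {x : L.carrier} (hx : x ∈ S.M) : ⁅S.e0, x⁆ ∈ S.gl := by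
  have hf : ∀ i, ∀ x ∈ S.gl.comap (L.bracket S.e0), ⁅S.f i, x⁆ ∈ S.gl.comap (L.bracket S.e0) := by
    intro i x hx
    rw [Submodule.mem_comap, ← br_def, br_br_even' (S.f_mem i), S.e0_f, zero_br, zero_add]
    exact S.gl_stable.f i _ hx
  have he : ∀ i : Fin (m + 1), 1 ≤ i.val → ∀ x ∈ S.gl.comap (L.bracket S.e0),
      ⁅S.e i, x⁆ ∈ S.gl.comap (L.bracket S.e0) := by
    intro i hi x hx
    have hi0 : i ≠ 0 := fun e => by simp [e] at hi
    rw [Submodule.mem_comap, ← br_def, br_br_even' (S.e_mem i), br_skew_even' (S.e_mem i),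
      S.e_e0 i hi0, neg_zero, zero_br, zero_add]
    exact S.gl_stable.e i _ hx
  have hg : S.gs ≤ S.gl.comap (L.bracket S.e0) := by
    refine Submodule.span_le.2 ?_
    rintro _ ⟨a, rfl⟩
    change ⁅S.e0, S.g a⁆ ∈ S.gl
    rcases eq_or_ne a 1 with rfl | ha
    · rw [S.g_one, br_zero]; exact zero_mem _
    · rw [S.e0_g a ha]; exact S.h_mem_gl a
  have : S.M ≤ S.gl.comap (L.bracket S.e0) := by
    refine clos_le (sup_le (clos_le hg ?_) (clos_le hg ?_)) ?_
    · rintro _ ⟨i, hi, rfl⟩; exact he i hi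
    · rintro _ ⟨i, -, rfl⟩; exact hf i
    · rintro _ ⟨i, rfl⟩; exact hf i
  exact this hx

/-! ### Higher levels -/

/-- The span of the `k`-fold brackets of elements of `M`. -/
def R : ℕ → Submodule K L.carrier
  | 0 => S.M
  | k + 1 => Submodule.map₂ L.bracket S.M (R k)

theorem R_stable (k : ℕ) : S.Stable (S.R k) := by
  induction k with
  | zero => exact S.M_stable
  | succ k ih => exact S.M_stable.map₂ ih

theorem M_R {k : ℕ} {x y : L.carrier} (hx : x ∈ S.M) (hy : y ∈ S.R k) : ⁅x, y⁆ ∈ S.R (k + 1) :=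
  Submodule.apply_mem_map₂ _ hx hy

theorem M_gl {x y : L.carrier} (hx : x ∈ S.M) (hy : y ∈ S.gl) : ⁅x, y⁆ ∈ S.M := by
  rw [br_skew_even' (S.gl_le_part hy), neg_mem_iff]
  exact S.gl_bracket S.M_stable hy _ hx

theorem e0_R (k : ℕ) : ∀ x ∈ S.R (k + 1), ⁅S.e0, x⁆ ∈ S.R k := by
  induction k with
  | zero =>
    have : S.R 1 ≤ (S.R 0).comap (L.bracket S.e0) := by
      refine Submodule.map₂_le.2 fun x hx y hy => ?_
      rw [Submodule.mem_comap, ← br_def, ← br_def, br_br_odd S.e0_mem (S.M_le_part hx)]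
      exact sub_mem (S.gl_bracket (S.R_stable 0) (S.e0_M hx) _ hy) (S.M_gl hx (S.e0_M hy))
    exact fun x hx => this hx
  | succ k ih =>
    have : S.R (k + 2) ≤ (S.R (k + 1)).comap (L.bracket S.e0) := by
      refine Submodule.map₂_le.2 fun x hx y hy => ?_
      rw [Submodule.mem_comap, ← br_def, ← br_def, br_br_odd S.e0_mem (S.M_le_part hx)]
      exact sub_mem (S.gl_bracket (S.R_stable (k + 1)) (S.e0_M hx) _ hy) (S.M_R hx (ih y hy))
    exact fun x hx => this hx

/-- The components of the `ℤ`-grading. -/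
def lev : ℤ → Submodule K L.carrier
  | Int.ofNat 0 => S.gl
  | Int.ofNat (k + 1) => S.R k
  | Int.negSucc 0 => S.V1
  | Int.negSucc (_ + 1) => ⊥

theorem lev_stable (k : ℤ) : S.Stable (S.lev k) := by
  rcases k with (_ | k) | (_ | k)
  · exact S.gl_stable
  · exact S.R_stable k
  · exact S.V1_stable
  · refine ⟨?_, ?_, ?_⟩ <;>
    · intro _ x hx
      rw [(Submodule.mem_bot K).1 hx, br_zero]
      exact zero_mem _

theorem e0_lev (k : ℤ) : ∀ x ∈ S.lev k, ⁅S.e0, x⁆ ∈ S.lev (k - 1) := by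
  rcases k with (_ | _ | k) | (_ | k)
  · intro x hx
    change ⁅S.e0, x⁆ ∈ S.V1
    rw [br_skew_even' (S.gl_le_part hx), neg_mem_iff]
    exact S.gl_bracket S.V1_stable hx _ S.e0_mem_V1
  · intro x hx
    exact S.e0_M hx
  · have e : Int.ofNat (k + 1 + 1) - 1 = Int.ofNat (k + 1) := by simp
    rw [e]
    exact S.e0_R k
  · intro x hx
    rw [S.e0_V1 hx]
    exact zero_mem _
  · intro x hx
    rw [(Submodule.mem_bot K).1 hx, br_zero]
    exact zero_mem _

theorem M_lev (k : ℤ) {y : L.carrier} (hy : y ∈ S.M) : ∀ x ∈ S.lev k, ⁅y, x⁆ ∈ S.lev (k + 1) := by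
  rcases k with (_ | k) | (_ | k)
  · intro x hx
    exact S.M_gl hy hx
  · intro x hx
    exact S.M_R hy hx
  · intro x hx
    change ⁅y, x⁆ ∈ S.gl
    rw [br_comm_odd (S.M_le_part hy) (S.V1_le_part hx)]
    exact S.V1_bracket S.M_stable S.gl_stable (fun x hx => S.e0_M hx) hx y hy
  · intro x hx
    rw [(Submodule.mem_bot K).1 hx, br_zero]
    exact zero_mem _

/-- The sum of the levels contains the generators and is stable under each of them, since e_0 and
the f_{0a} shift the level by one. -/
theorem iSup_lev : ⨆ k, S.lev k = ⊤ := by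
  have key : ∀ (y : L.carrier) (d : ℤ), (∀ k, ∀ x ∈ S.lev k, ⁅y, x⁆ ∈ S.lev (k + d)) →
      ∀ x ∈ ⨆ k, S.lev k, ⁅y, x⁆ ∈ ⨆ k, S.lev k := by
    intro y d h x hx
    induction hx using Submodule.iSup_induction' with
    | mem k x hx => exact Submodule.mem_iSup_of_mem (k + d) (h k x hx)
    | zero => simp
    | add a b _ _ ha hb => rw [br_add]; exact add_mem ha hb
  refine S.gen _ ?_ ?_ ?_ ?_ ?_ (key _ (-1) S.e0_lev) (fun i => key _ 0 fun k => ?_)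
    (fun i => key _ 0 fun k => ?_) (fun a => key _ 0 fun k => ?_)
    (fun a => key _ 1 fun k => S.M_lev k (S.g_mem_M a))
  · exact Submodule.mem_iSup_of_mem (Int.negSucc 0) S.e0_mem_V1
  · exact fun i => Submodule.mem_iSup_of_mem 0 (S.e_mem_gl i)
  · exact fun i => Submodule.mem_iSup_of_mem 0 (S.f_mem_gl i)
  · exact fun i => Submodule.mem_iSup_of_mem 0 (S.h_mem_gl i)
  · exact fun i => Submodule.mem_iSup_of_mem 1 (S.g_mem_M i)
  · rw [add_zero]; exact (S.lev_stable k).e i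
  · rw [add_zero]; exact (S.lev_stable k).f i
  · rw [add_zero]; exact (S.lev_stable k).h a

end WSys

end

section

open Grassmann LieSuperalgebra

namespace WSys

variable {K : Type u} [Field K] [CharZero K] {m : ℕ} {L : LieSuperalgebra.{u, u} K}
  (S : WSys K m L)

/-! ### Levels and weights -/

/-- The elements whose weight components have weights with sum `k`. -/
def wlev (k : ℤ) : Submodule K L.carrier where
  carrier := {x | ∀ μ, ∑ l, μ l ≠ k → S.toSl.proj μ x = 0}
  zero_mem' _ _ := map_zero _
  add_mem' hx hy μ hμ := by rw [map_add, hx μ hμ, hy μ hμ, add_zero]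
  smul_mem' c x hx μ hμ := by rw [map_smul, hx μ hμ, smul_zero]

theorem wt_le_wlev (μ : Fin (m + 2) → ℤ) : S.wt μ ≤ S.wlev (∑ l, μ l) := fun x hx ν hν =>
  S.toSl.proj_ne _ _ (fun e => hν (by rw [e])) x hx

theorem sum_eq_of_mem_wlev {μ : Fin (m + 2) → ℤ} {k : ℤ} {x : L.carrier} (hx : x ∈ S.wt μ)
    (hk : x ∈ S.wlev k) (hne : x ≠ 0) : ∑ l, μ l = k := by
  by_contra h
  exact hne (by rw [← S.toSl.proj_self μ x hx, hk μ h])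

theorem bracket_wlev {α : Fin (m + 2) → ℤ} {k : ℤ} {x y : L.carrier} (hy : y ∈ S.wt α)
    (hx : x ∈ S.wlev k) : ⁅y, x⁆ ∈ S.wlev (k + ∑ l, α l) := by
  intro μ hμ
  have h := SlMod.proj_apply (S.bracket_shift hy) μ x
  rw [hx (μ - α), map_zero] at h
  · exact h
  · intro e
    apply hμ
    rw [← e]
    simp [Finset.sum_sub_distrib]

theorem wlev_eq_of_sum {k d : ℤ} {α : Fin (m + 2) → ℤ} (h : ∑ l, α l = d) {x y : L.carrier}
    (hy : y ∈ S.wt α) (hx : x ∈ S.wlev k) : ⁅y, x⁆ ∈ S.wlev (k + d) := h ▸ S.bracket_wlev hy hx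

theorem e_wlev (i : Fin (m + 1)) {k : ℤ} {x : L.carrier} (hx : x ∈ S.wlev k) :
    ⁅S.e i, x⁆ ∈ S.wlev k := by
  have := S.wlev_eq_of_sum (sum_root i) (S.e_wt i) hx
  rwa [add_zero] at this

theorem f_wlev (i : Fin (m + 1)) {k : ℤ} {x : L.carrier} (hx : x ∈ S.wlev k) :
    ⁅S.f i, x⁆ ∈ S.wlev k := by
  have := S.wlev_eq_of_sum (d := 0) (by simp [sum_root]) (S.f_wt i) hx
  rwa [add_zero] at this

theorem sum_single_zero : ∑ l, (Pi.single 0 1 : Fin (m + 2) → ℤ) l = 1 := by simp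

theorem gl_le_wlev : S.gl ≤ S.wlev 0 := fun x hx => by
  refine S.gl_induction (p := fun x => x ∈ S.wlev 0) (fun a => ?_) (zero_mem _)
    (fun _ _ => add_mem) (fun c _ => Submodule.smul_mem _ c) ?_ ?_ hx
  · simpa using S.wt_le_wlev 0 (S.h_wt a)
  · exact fun i x hx => S.e_wlev i hx
  · exact fun i x hx => S.f_wlev i hx

theorem V1_le_wlev : S.V1 ≤ S.wlev (-1) := fun x hx => by
  refine S.V1_induction (p := fun x => x ∈ S.wlev (-1)) ?_
    (fun _ _ => add_mem) (fun c _ => Submodule.smul_mem _ c) ?_ hx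
  · simpa using S.wt_le_wlev _ S.e0_wt
  · exact fun i x _ hx => S.e_wlev i hx

theorem M_le_wlev : S.M ≤ S.wlev 1 := by
  have hg : S.gs ≤ S.wlev 1 := by
    intro x hx
    have := S.wt_le_wlev _ (S.gs_le hx)
    rwa [sum_single_zero] at this
  refine clos_le (sup_le (clos_le hg ?_) (clos_le hg ?_)) ?_
  · rintro _ ⟨i, -, rfl⟩ x hx; exact S.e_wlev i hx
  · rintro _ ⟨i, -, rfl⟩ x hx; exact S.f_wlev i hx
  · rintro _ ⟨i, rfl⟩ x hx; exact S.f_wlev i hx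

theorem R_le_wlev (k : ℕ) : S.R k ≤ S.wlev (k + 1) := by
  induction k with
  | zero =>
    have h := S.M_le_wlev
    change S.M ≤ _
    simpa using h
  | succ k ih =>
    refine Submodule.map₂_le.2 fun x hx y hy => ?_
    refine S.M_stable.graded.induction (p := fun x => L.bracket x y ∈ S.wlev ((k + 1 : ℕ) + 1))
      (by simp) ?_ ?_ ?_ hx
    · intro μ x hx hμ
      rcases eq_or_ne x 0 with rfl | hne
      · simp
      · exact S.wlev_eq_of_sum (k := k + 1) (S.sum_eq_of_mem_wlev hμ (S.M_le_wlev hx) hne) hμ (ih hy)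
    · intro a b ha hb; rw [map_add, LinearMap.add_apply]; exact add_mem ha hb
    · intro c a ha; rw [map_smul, LinearMap.smul_apply]; exact Submodule.smul_mem _ _ ha

theorem lev_le_wlev (k : ℤ) : S.lev k ≤ S.wlev k := by
  rcases k with (_ | k) | (_ | k)
  · exact S.gl_le_wlev
  · exact S.R_le_wlev k
  · exact S.V1_le_wlev
  · exact bot_le

theorem proj_mem_lev (μ : Fin (m + 2) → ℤ) (x : L.carrier) : S.toSl.proj μ x ∈ S.lev (∑ l, μ l) := by
  have : x ∈ ⨆ k, S.lev k := S.iSup_lev ▸ Submodule.mem_top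
  induction this using Submodule.iSup_induction' with
  | mem k x hx =>
    rcases eq_or_ne (∑ l, μ l) k with rfl | h
    · exact (S.lev_stable _).graded μ x hx
    · rw [S.lev_le_wlev k hx μ h]; exact zero_mem _
  | zero => rw [map_zero]; exact zero_mem _
  | add a b _ _ ha hb => rw [map_add]; exact add_mem ha hb

theorem wt_le_lev (μ : Fin (m + 2) → ℤ) : S.wt μ ≤ S.lev (∑ l, μ l) := fun x hx => by
  rw [← S.toSl.proj_self μ x hx]
  exact S.proj_mem_lev μ x

/-- The level of a weight vector is the sum of the entries of its weight. Hence the levels form a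
genuine grading, compatible with brackets and with φ. -/
theorem lev_eq_wlev (k : ℤ) : S.lev k = S.wlev k := by
  refine le_antisymm (S.lev_le_wlev k) fun x hx => ?_
  have hs : Submodule.span K (Set.range fun μ => S.toSl.proj μ x) ≤ S.lev k := by
    rw [Submodule.span_le]
    rintro _ ⟨μ, rfl⟩
    rcases eq_or_ne (∑ l, μ l) k with rfl | h
    · exact S.proj_mem_lev μ x
    · change S.toSl.proj μ x ∈ S.lev k
      rw [hx μ h]; exact zero_mem _
  exact hs (S.toSl.mem_span_proj x)

theorem lev_graded (k : ℤ) : S.toSl.Graded (S.lev k) := (S.lev_stable k).graded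

theorem sum_eq_of_mem_lev {μ : Fin (m + 2) → ℤ} {k : ℤ} {x : L.carrier} (hx : x ∈ S.wt μ)
    (hk : x ∈ S.lev k) (hne : x ≠ 0) : ∑ l, μ l = k :=
  S.sum_eq_of_mem_wlev hx (S.lev_le_wlev k hk) hne

theorem bracket_lev {a b : ℤ} {x y : L.carrier} (hx : x ∈ S.lev a) (hy : y ∈ S.lev b) :
    ⁅x, y⁆ ∈ S.lev (a + b) := by
  rw [lev_eq_wlev, add_comm]
  refine (S.lev_graded a).induction (p := fun x => ⁅x, y⁆ ∈ S.wlev (b + a)) (by simp) ?_ ?_ ?_ hx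
  · intro μ x hx hμ
    rcases eq_or_ne x 0 with rfl | hne
    · simp
    · exact S.wlev_eq_of_sum (S.sum_eq_of_mem_lev hμ hx hne) hμ (S.lev_le_wlev b hy)
  · intro a b ha hb; rw [add_br]; exact add_mem ha hb
  · intro c a ha; rw [smul_br]; exact Submodule.smul_mem _ _ ha

theorem lev_le_part (k : ℤ) : S.lev k ≤ L.part (k : ZMod 2) := fun x hx => by
  refine (S.lev_graded k).induction (p := fun x => x ∈ L.part (k : ZMod 2)) (zero_mem _) ?_
    (fun _ _ => add_mem) (fun c _ => Submodule.smul_mem _ c) hx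
  intro μ x hx hμ
  rcases eq_or_ne x 0 with rfl | hne
  · exact zero_mem _
  · rw [← S.sum_eq_of_mem_lev hμ hx hne]
    exact hμ.1

theorem lev_eq_bot {k : ℤ} (hk : k < -1) : S.lev k = ⊥ := by
  rcases k with k | (_ | k)
  · simp only [Int.ofNat_eq_natCast] at hk; omega
  · exact absurd hk (by decide)
  · rfl

theorem φ_lev {k : ℤ} {x : L.carrier} (hx : x ∈ S.lev k) : S.φ.toLin x ∈ (std K m).lev k := by
  rw [lev_eq_wlev] at hx ⊢
  intro μ hμ
  rw [← S.φ_proj, hx μ hμ, map_zero]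

/-! ### Injectivity at level one -/

theorem tail_monWt (R : Finset (Fin (m + 2))) (a : Fin (m + 2)) (j : ℕ) : -1 ≤ tail (monWt R a) j := by
  have e : monWt R a = (fun l => if l ∈ R then 1 else 0) - Pi.single a 1 := by
    ext l; simp [monWt, Pi.single_apply]
  rw [e, tail_sub, tail_single]
  have : 0 ≤ tail (fun l => if l ∈ R then (1 : ℤ) else 0) j :=
    Finset.sum_nonneg fun l _ => by dsimp only; split_ifs <;> norm_num
  split_ifs <;> omega

theorem monWt_le_one (R : Finset (Fin (m + 2))) (a l : Fin (m + 2)) : monWt R a l ≤ 1 := by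
  unfold monWt
  split_ifs <;> simp

theorem exists_monWt_of_M1 {x : L.carrier} (hx : x ∈ S.M1) {μ : Fin (m + 2) → ℤ}
    (h : S.toSl.proj μ x ≠ 0) : ∃ R j, μ = monWt R j := by
  refine exists_monWt (S.φ_wt (S.toSl.proj_mem μ x)) fun h0 => h ?_
  exact S.M1_ker (S.M1_graded μ x hx) h0

/-- In `M1` the map φ is injective, so its weights are weights of monomials: μ_0 ≤ 1 and tail sums
at least -1. Passing to `M` uses only lowering operators, which never decrease tail sums. The first
of them decreases μ_0 and the others do not change it, so components with μ_0 ≥ 1 come from `M1` by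
the latter alone and stay in it. -/
theorem proj_M {x : L.carrier} (hx : x ∈ S.M) (μ : Fin (m + 2) → ℤ) :
    (1 ≤ μ 0 → S.toSl.proj μ x ∈ S.M1) ∧ (2 ≤ μ 0 → S.toSl.proj μ x = 0) ∧
      (∀ j, tail μ j < -1 → S.toSl.proj μ x = 0) := by
  revert μ
  refine clos_induction (p := fun x => ∀ μ : Fin (m + 2) → ℤ,
    (1 ≤ μ 0 → S.toSl.proj μ x ∈ S.M1) ∧ (2 ≤ μ 0 → S.toSl.proj μ x = 0) ∧
      (∀ j, tail μ j < -1 → S.toSl.proj μ x = 0)) ?_ ?_ ?_ ?_ hx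
  · intro x hx μ
    refine ⟨fun _ => S.M1_graded μ x hx, fun h => ?_, fun j h => ?_⟩
    · by_contra hne
      obtain ⟨R, a, rfl⟩ := S.exists_monWt_of_M1 hx hne
      have := monWt_le_one R a 0
      omega
    · by_contra hne
      obtain ⟨R, a, rfl⟩ := S.exists_monWt_of_M1 hx hne
      have := tail_monWt R a j
      omega
  · intro x y hx hy μ
    simp only [map_add]
    exact ⟨fun h => add_mem ((hx μ).1 h) ((hy μ).1 h),
      fun h => by rw [(hx μ).2.1 h, (hy μ).2.1 h, add_zero],
      fun j h => by rw [(hx μ).2.2 j h, (hy μ).2.2 j h, add_zero]⟩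
  · intro c x hx μ
    simp only [map_smul]
    exact ⟨fun h => Submodule.smul_mem _ _ ((hx μ).1 h),
      fun h => by rw [(hx μ).2.1 h, smul_zero], fun j h => by rw [(hx μ).2.2 j h, smul_zero]⟩
  · rintro _ ⟨i, rfl⟩ x - hx μ
    have e : S.toSl.proj μ (L.bracket (S.f i) x) = ⁅S.f i, S.toSl.proj (μ + root i) x⁆ :=
      SlMod.proj_dn (S := S.toSl) i μ x
    rw [e]
    obtain ⟨h1, h2, h3⟩ := hx (μ + root i)
    have h0 : (μ + root i) 0 = if i = 0 then μ 0 + 1 else μ 0 := by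
      rw [Pi.add_apply]
      split_ifs with hi
      · subst hi
        have := root_castSucc (0 : Fin (m + 1))
        rw [Fin.castSucc_zero] at this
        rw [this]
      · rw [root_of_lt, add_zero]
        exact Nat.pos_of_ne_zero fun e => hi (Fin.ext e)
    refine ⟨fun h => ?_, fun h => ?_, fun j h => ?_⟩
    · rcases eq_or_ne i 0 with rfl | hi
      · rw [h2 (by rw [h0, if_pos rfl]; omega), br_zero]
        exact zero_mem _
      · rw [if_neg hi] at h0
        exact S.M1_f (Nat.pos_of_ne_zero fun e => hi (Fin.ext e)) (h1 (by omega))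
    · rw [h2, br_zero]
      rw [h0]
      split_ifs <;> omega
    · rw [h3 j, br_zero]
      rw [tail_add, tail_root]
      split_ifs <;> omega

/-- A dominant weight with positive sum has positive first entry. -/
theorem one_le_of_dominant {μ : Fin (m + 2) → ℤ} (h : ∀ i : Fin (m + 1), μ i.succ ≤ μ i.castSucc)
    (hs : 0 < ∑ l, μ l) : 1 ≤ μ 0 := by
  by_contra hc
  have : ∀ l, μ l ≤ 0 := fun l => by
    induction l using Fin.induction with
    | zero => omega
    | succ i ih => exact (h i).trans ih
  have := Finset.sum_nonpos (s := Finset.univ) fun l _ => this l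
  omega

/-- A highest weight vector in the kernel has a dominant weight with sum 1, so μ_0 ≥ 1 and the
vector lies in `M1`, where the kernel is trivial. -/
theorem M_ker {x : L.carrier} (hx : x ∈ S.M) (h : x ∈ S.kerφ) : x = 0 := by
  have : S.M ⊓ S.kerφ = ⊥ := by
    refine SlMod.eq_bot_of_highest (S := S.toSl) (S.M_stable.graded.inf S.graded_ker)
      (∑ _j ∈ Finset.range (m + 2), -1) ?_ ?_ ?_
    · intro μ x hx hμ hne
      refine Finset.sum_le_sum fun j _ => ?_
      by_contra hj
      refine hne ?_
      rw [← S.toSl.proj_self μ x hμ]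
      exact (S.proj_M hx.1 μ).2.2 j (by omega)
    · exact fun i x hx => ⟨S.M_stable.e i x hx.1, S.br_mem_ker _ hx.2⟩
    · intro μ hd x hx hμ
      by_contra hne
      have hs := S.sum_eq_of_mem_wlev hμ (S.M_le_wlev hx.1) hne
      have h1 := (S.proj_M hx.1 μ).1 (one_le_of_dominant hd (by omega))
      rw [S.toSl.proj_self μ x hμ] at h1
      exact hne (S.M1_ker h1 hx.2)
  exact (Submodule.mem_bot K).1 (this ▸ ⟨hx, h⟩)

/-- Injectivity of the homomorphism to `W(n)` at level `k`. -/
def Inj (k : ℤ) : Prop := ∀ x ∈ S.lev k, S.φ.toLin x = 0 → x = 0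

theorem inj_of_le_one {k : ℤ} (hk : k ≤ 1) : S.Inj k := by
  intro x hx h
  rcases k with (_ | _ | k) | (_ | k)
  · exact S.gl_ker hx h
  · exact S.M_ker hx h
  · simp only [Int.ofNat_eq_natCast] at hk; omega
  · exact S.V1_ker hx h
  · exact (Submodule.mem_bot K).1 hx

/-! ### A homogeneous section -/

/-- Any linear section becomes homogeneous when its values on a weight space are projected to the
same weight; φ commutes with these projections. -/
theorem exists_section : ∃ σ : (cartanW K (m + 2)).carrier →ₗ[K] L.carrier,
    (∀ w, S.φ.toLin (σ w) = w) ∧ ∀ μ, ∀ w ∈ (std K m).wt μ, σ w ∈ S.wt μ := by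
  classical
  obtain ⟨s, hs⟩ := LinearMap.exists_rightInverse_of_surjective S.φ.toLin
    (LinearMap.range_eq_top.2 S.φ_surjective)
  let σ : (cartanW K (m + 2)).carrier →ₗ[K] L.carrier :=
    DirectSum.toModule K _ L.carrier (fun μ => S.proj μ ∘ₗ s ∘ₗ ((std K m).wt μ).subtype) ∘ₗ
      (std K m).decomp.symm.toLinearMap
  have hσ : ∀ μ, ∀ w ∈ (std K m).wt μ, σ w = S.toSl.proj μ (s w) := by
    intro μ w hw
    change DirectSum.toModule K _ L.carrier _ ((std K m).decomp.symm w) = _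
    rw [(std K m).decomp_symm hw, DirectSum.toModule_lof]
    rfl
  refine ⟨σ, fun w => ?_, fun μ w hw => by rw [hσ μ w hw]; exact S.toSl.proj_mem _ _⟩
  refine (SlMod.graded_top (S := (std K m).toSl)).induction (p := fun w => S.φ.toLin (σ w) = w)
    (by simp) ?_ ?_ ?_ (Submodule.mem_top (x := w))
  · intro μ w _ hw
    have hsw : S.φ.toLin (s w) = w := LinearMap.congr_fun hs w
    rw [hσ μ w hw, S.φ_proj, hsw]
    exact (std K m).toSl.proj_self μ w hw
  · intro x y hx hy; simp only [map_add, hx, hy]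
  · intro c x hx; simp only [map_smul, hx]

/-- A linear section of the homomorphism to `W(n)` that preserves weights. -/
def σ : (cartanW K (m + 2)).carrier →ₗ[K] L.carrier := S.exists_section.choose

theorem φ_σ (w : (cartanW K (m + 2)).carrier) : S.φ.toLin (S.σ w) = w :=
  S.exists_section.choose_spec.1 w

theorem σ_wt {μ : Fin (m + 2) → ℤ} {w : (cartanW K (m + 2)).carrier} (hw : w ∈ (std K m).wt μ) :
    S.σ w ∈ S.wt μ := S.exists_section.choose_spec.2 μ w hw

theorem σ_lev {k : ℤ} {w : (cartanW K (m + 2)).carrier} (hw : w ∈ (std K m).lev k) :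
    S.σ w ∈ S.lev k := by
  refine ((std K m).lev_graded k).induction (p := fun w => S.σ w ∈ S.lev k) (by simp) ?_ ?_ ?_ hw
  · intro μ w hw hμ
    rcases eq_or_ne w 0 with rfl | hne
    · rw [map_zero]; exact zero_mem _
    · rw [← (std K m).sum_eq_of_mem_lev hμ hw hne]
      exact S.wt_le_lev μ (S.σ_wt hμ)
  · intro x y hx hy; rw [map_add]; exact add_mem hx hy
  · intro c x hx; rw [map_smul]; exact Submodule.smul_mem _ _ hx

theorem σ_φ {k : ℤ} (hk : S.Inj k) {x : L.carrier} (hx : x ∈ S.lev k) : S.σ (S.φ.toLin x) = x := by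
  rw [← sub_eq_zero]
  refine hk _ (sub_mem (S.σ_lev (S.φ_lev hx)) hx) ?_
  rw [map_sub, S.φ_σ, sub_self]

/-- The section need not be a homomorphism, but it respects brackets that land in a level where φ is
injective. This is how injectivity at lower levels enters the calculations above them. -/
theorem σ_bracket {a b : ℤ} (hab : S.Inj (a + b)) {x y : (cartanW K (m + 2)).carrier}
    (hx : x ∈ (std K m).lev a) (hy : y ∈ (std K m).lev b) : S.σ ⁅x, y⁆ = ⁅S.σ x, S.σ y⁆ := by
  rw [← S.σ_φ hab (S.bracket_lev (S.σ_lev hx) (S.σ_lev hy)), S.φ.map_bracket, S.φ_σ, S.φ_σ]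

theorem sum_monWt (R : Finset (Fin (m + 2))) (j : Fin (m + 2)) : ∑ l, monWt R j l = R.card - 1 := by
  simp only [monWt, Finset.sum_sub_distrib, Finset.sum_ite_mem, Finset.univ_inter,
    Finset.sum_const, Finset.sum_ite_eq', Finset.mem_univ, if_true]
  simp

theorem mon_lev {R : Finset (Fin (m + 2))} {v : Lam K (m + 2)} (h : IsMon R v) (j : Fin (m + 2)) :
    der j v ∈ (std K m).lev (R.card - 1) := by
  rw [← sum_monWt R j]
  exact (std K m).wt_le_lev _ (mon_wt h j)

theorem mon_lev' {R : Finset (Fin (m + 2))} {v : Lam K (m + 2)} (h : IsMon R v) (j : Fin (m + 2))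
    {k : ℤ} (hk : (R.card : ℤ) = k + 1) : der j v ∈ (std K m).lev k := by
  have := mon_lev h j
  rwa [hk, add_sub_cancel_right] at this

theorem E_lev (a b : Fin (m + 2)) : E K a b ∈ (std K m).lev 0 := mon_lev' IsMon.th b (by simp)

theorem D_lev (a : Fin (m + 2)) : D K a ∈ (std K m).lev (-1) := mon_lev' IsMon.one a (by simp)

theorem T_lev (a b c : Fin (m + 2)) : T K a b c ∈ (std K m).lev 1 := by
  rcases eq_or_ne a b with rfl | h
  · rw [T_self]; exact zero_mem _
  · exact mon_lev' (IsMon.th_th h) c (by rw [Finset.card_pair h]; rfl)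

end WSys

end

section

open Grassmann LieSuperalgebra

/-! ### A system of linear equations -/

/-- The equations satisfied by the obstructions at level two have only the zero solution. -/
theorem tensor_eq_zero {ι : Type*} [Fintype ι] [DecidableEq ι] {K : Type*} [Field K] [CharZero K]
    {N : Type*} [AddCommGroup N] [Module K N] (o : ι) (b : ι → ι → ι → ι → ι → N)
    (g : ι → ι → ι → N) (z : ι → ι → N →ₗ[K] N)
    (hA : ∀ j a a' c d, b j a a' c d = -b j c d a a')
    (hT : ∀ j a a', ∑ l, b j a a' l l = 0)
    (hJ : ∀ j a a' c, b j a a' j c = -if c = j then g a a' j else 0)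
    (hS : ∀ j a a' c d, b j a a' c d + (if d = j then g a a' c else 0) =
      -b c a a' j d - if d = c then g a a' j else 0)
    (hZ : ∀ p q j a a' c d, z p q (b j a a' c d) =
      (if q = a then b j p a' c d else 0) - (if a' = p then b j a q c d else 0) +
      (if q = j then b p a a' c d else 0) + (if q = c then b j a a' p d else 0) -
      if d = p then b j a a' c q else 0)
    (hR : ∀ l k, l ≠ o → k ≠ o → b o l l k k = 0) :
    (∀ j a a' c d, b j a a' c d = 0) ∧ ∀ a a' c, g a a' c = 0 := by
  have two : ∀ x : N, x = -x → x = 0 := fun x hx => by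
    have h2 : (2 : K) • x = 0 := by rw [two_smul]; nth_rewrite 1 [hx]; exact neg_add_cancel x
    exact (smul_eq_zero.1 h2).resolve_left two_ne_zero
  have dd : ∀ j a c, b j a c a c = 0 := fun j a c => two _ (hA j a c a c)
  -- In the trace condition all terms except the one at the index o vanish by the last hypothesis.
  have o1 : ∀ l, l ≠ o → b o l l o o = 0 := fun l hl => by
    have := hT o l l
    rwa [Finset.sum_eq_single o (fun k _ hk => hR l k hl hk) (by simp)] at this
  have o2 : ∀ l k, b o l l k k = 0 := by
    intro l k
    rcases eq_or_ne l o with rfl | hl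
    · rcases eq_or_ne k l with rfl | hk
      · exact dd _ _ _
      · rw [hA, o1 k hk, neg_zero]
    · rcases eq_or_ne k o with rfl | hk
      · exact o1 l hl
      · exact hR l k hl hk
  have key : ∀ p q j l k, z p q (b j l l k k) =
      ((if q = l then 1 else 0 : K) - if l = p then 1 else 0) • b j p q k k +
      (if q = j then b p l l k k else 0) +
      ((if q = k then 1 else 0 : K) - if k = p then 1 else 0) • b j l l p q := by
    intro p q j l k
    have e1 : (if q = l then b j p l k k else 0) = (if q = l then 1 else 0 : K) • b j p q k k := by
      split_ifs with h
      · rw [h, one_smul]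
      · rw [zero_smul]
    have e2 : (if l = p then b j l q k k else 0) = (if l = p then 1 else 0 : K) • b j p q k k := by
      split_ifs with h
      · rw [h, one_smul]
      · rw [zero_smul]
    have e3 : (if q = k then b j l l p k else 0) = (if q = k then 1 else 0 : K) • b j l l p q := by
      split_ifs with h
      · rw [h, one_smul]
      · rw [zero_smul]
    have e4 : (if k = p then b j l l k q else 0) = (if k = p then 1 else 0 : K) • b j l l p q := by
      split_ifs with h
      · rw [h, one_smul]
      · rw [zero_smul]
    rw [hZ, e1, e2, e3, e4]
    module
  have diag : ∀ a l k, b a l l k k = 0 := by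
    intro a
    rcases eq_or_ne a o with rfl | hao
    · exact o2
    let t : ι → K := fun l => (if o = l then 1 else 0 : K) - if l = a then 1 else 0
    have hto : t o = 1 := by simp [t, hao.symm]
    have hta : t a = -1 := by simp [t, hao.symm]
    -- Equivariance under the operator (a, o), applied to the vanishing entries b o l l k k.
    have e : ∀ l k, b a l l k k = t k • b o a o l l - t l • b o a o k k := by
      intro l k
      have h := key a o o l k
      rw [o2, map_zero, if_pos rfl, hA o l l a o, eq_comm] at h
      rw [← sub_eq_zero, ← h]
      simp only [t]
      module
    -- The swap rule and the rule for equal indices give b o a o l l = b a l l o o - b a l l a a;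
    -- now insert `e`. The cases l = o and l = a then kill the two constants.
    have c0 : ∀ l, b o a o l l = t l • (b o a o o o - b o a o a a) := by
      intro l
      have h1 := hS o l l a o
      rw [if_pos rfl, if_neg hao.symm, hA, sub_zero] at h1
      have h2 := hJ a l l a
      rw [if_pos rfl, eq_comm, neg_eq_iff_eq_neg] at h2
      rw [h2, e l o, e l a, hto, hta] at h1
      rw [← sub_eq_zero] at h1 ⊢
      rw [← h1]
      module
    have ca : b o a o a a = 0 := by
      have := c0 o
      rw [hto, one_smul, eq_comm, sub_eq_self] at this
      exact this
    have co : b o a o o o = 0 := by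
      have := c0 a
      rw [hta, ca, sub_zero, neg_one_smul, eq_comm, neg_eq_zero] at this
      exact this
    intro l k
    rw [e, c0 l, c0 k, ca, co]
    simp
  have g0 : ∀ l a, g l l a = 0 := fun l a => by
    have h := hJ a l l a
    rwa [if_pos rfl, diag, eq_comm, neg_eq_zero] at h
  -- Equivariance under (p, q), applied to the entries b j q q k k, which vanish by `diag`.
  have off : ∀ j p q k, p ≠ q → b j p q k k =
      ((if q = k then 1 else 0 : K) - if k = p then 1 else 0) • b j p q q q := by
    intro j p q k hpq
    have h := key p q j q k
    rw [diag, map_zero, diag, ite_self, if_pos rfl, if_neg hpq.symm, sub_zero, one_smul, add_zero,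
      hA j q q p q, eq_comm] at h
    rw [← sub_eq_zero, ← h]
    module
  have offz : ∀ j p q, p ≠ q → b j p q p p = 0 := by
    intro j p q hpq
    have h := hS j p p p q
    rw [g0, ite_self, g0, ite_self, add_zero, sub_zero, hA, neg_inj] at h
    rw [h]
    rcases eq_or_ne j q with rfl | hq
    · exact diag _ _ _
    rcases eq_or_ne j p with rfl | hp
    · rw [hJ, if_neg hpq.symm, neg_zero]
    · rw [hA, off p j q p hq, if_neg hpq.symm, if_neg hp.symm, sub_zero, zero_smul, neg_zero]
  have line : ∀ j l c d, b j l l c d = 0 := by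
    intro j l c d
    rcases eq_or_ne c d with rfl | hcd
    · exact diag _ _ _
    -- With k = p, `off` relates the entry that vanishes by `offz` to the one with k = q. So that
    -- one vanishes too, and with it all the b j p q k k.
    · have h := off j c d c hcd
      rw [offz j c d hcd, if_neg hcd.symm, if_pos rfl, zero_sub, neg_one_smul, eq_comm,
        neg_eq_zero] at h
      rw [hA, off j c d l hcd, h, smul_zero, neg_zero]
  have all : ∀ j a a' c d, b j a a' c d = 0 := by
    intro j a a' c d
    rcases eq_or_ne a a' with rfl | ha
    · exact line _ _ _ _
    -- Applying the operator (a, a') to a vanishing entry with repeated pair a, a leaves only the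
    -- wanted entry, up to sign.
    · have h := hZ a a' j a a c d
      simp only [line, map_zero, ite_self, if_neg ha.symm, if_true, zero_sub, add_zero,
        sub_zero] at h
      exact neg_eq_zero.1 h.symm
  refine ⟨all, fun a a' c => ?_⟩
  have h := hJ c a a' c
  rwa [if_pos rfl, all, eq_comm, neg_eq_zero] at h

end

section

open Grassmann LieSuperalgebra

namespace WSys

variable {K : Type u} [Field K] [CharZero K] {m : ℕ} {L : LieSuperalgebra.{u, u} K}
  (S : WSys K m L)

/-! ### Spanning sets of the levels -/

theorem std_lev_induction {k : ℤ} {p : (cartanW K (m + 2)).carrier → Prop}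
    (mon : ∀ R v j, IsMon R v → (R.card : ℤ) = k + 1 → p (der j v)) (zero : p 0)
    (add : ∀ x y, p x → p y → p (x + y)) (smul : ∀ (c : K) x, p x → p (c • x))
    {w : (cartanW K (m + 2)).carrier} (hw : w ∈ (std K m).lev k) : p w := by
  refine ((std K m).lev_graded k).induction zero ?_ add smul hw
  intro μ w hw hμ
  rcases eq_or_ne w 0 with rfl | hne
  · exact zero
  have hs := (std K m).sum_eq_of_mem_lev hμ hw hne
  have key : ∀ w, (std K m).toSl.proj μ w ∈ Submodule.span K
      {x : (cartanW K (m + 2)).carrier | ∃ R v j, IsMon R v ∧ monWt R j = μ ∧ x = der j v} := by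
    intro w
    have : w ∈ Submodule.span K {x : (cartanW K (m + 2)).carrier | ∃ S v j, IsMon S v ∧ x = der j v} :=
      (cartanW_eq_span (K := K) (n := m + 2)) ▸ Submodule.mem_top
    induction this using Submodule.span_induction with
    | mem x h =>
      obtain ⟨R, v, j, hv, rfl⟩ := h
      rcases eq_or_ne μ (monWt R j) with rfl | h
      · rw [(std K m).toSl.proj_self _ _ (mon_wt hv j)]
        exact Submodule.subset_span ⟨R, v, j, hv, rfl, rfl⟩
      · rw [(std K m).toSl.proj_ne _ _ h _ (mon_wt hv j)]
        exact zero_mem _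
    | zero => rw [map_zero]; exact zero_mem _
    | add x y _ _ hx hy => rw [map_add]; exact add_mem hx hy
    | smul c x _ hx => rw [map_smul]; exact Submodule.smul_mem _ _ hx
  have h := key w
  rw [(std K m).toSl.proj_self _ _ hμ] at h
  clear hw hμ hne
  induction h using Submodule.span_induction with
  | mem x h =>
    obtain ⟨R, v, j, hv, rfl, rfl⟩ := h
    refine mon R v j hv ?_
    rw [sum_monWt] at hs
    omega
  | zero => exact zero
  | add x y _ _ hx hy =>
    exact add _ _ hx hy
  | smul c x _ hx => exact smul _ _ hx

theorem _root_.Grassmann.IsMon.exists_th_th {R : Finset (Fin (m + 2))} {v : Lam K (m + 2)}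
    (h : IsMon R v) (hc : R.card = 2) : ∃ (a b : Fin (m + 2)) (c : K), a ≠ b ∧ R = {a, b} ∧
      v = c • (th a * th b) := by
  obtain ⟨a, b, hab, rfl⟩ := Finset.card_eq_two.1 hc
  have ha := h.pd (l := a) (by simp)
  have hb := ha.pd (l := b) (by simp [hab.symm])
  obtain ⟨c, hc⟩ := exists_smul_one (v := pd b (pd a v)) fun l => hb.off l (by simp; tauto)
  refine ⟨a, b, c, hab, rfl, ?_⟩
  rw [← h.on a (by simp), ← ha.on b (by simp [hab.symm]), hc, mul_smul_comm, mul_smul_comm, mul_one]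

theorem std_lev_one_induction {p : (cartanW K (m + 2)).carrier → Prop}
    (mon : ∀ a b c, a ≠ b → p (T K a b c)) (zero : p 0)
    (add : ∀ x y, p x → p y → p (x + y)) (smul : ∀ (c : K) x, p x → p (c • x))
    {w : (cartanW K (m + 2)).carrier} (hw : w ∈ (std K m).lev 1) : p w := by
  refine std_lev_induction ?_ zero add smul hw
  intro R v j hv hc
  obtain ⟨a, b, c, hab, -, rfl⟩ := hv.exists_th_th (by omega)
  rw [map_smul]
  exact smul _ _ (mon a b j hab)

/-! ### Brackets of lifted elements -/

/-- The bracket of the lifts of two elements of `W(n)`. -/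
def β : (cartanW K (m + 2)).carrier →ₗ[K] (cartanW K (m + 2)).carrier →ₗ[K] L.carrier :=
  L.bracket.compl₁₂ S.σ S.σ

theorem β_apply (x y : (cartanW K (m + 2)).carrier) : S.β x y = ⁅S.σ x, S.σ y⁆ := rfl

theorem φ_β (x y : (cartanW K (m + 2)).carrier) : S.φ.toLin (S.β x y) = ⁅x, y⁆ := by
  rw [β_apply, S.φ.map_bracket, S.φ_σ, S.φ_σ]

theorem σ_E_mem (p q : Fin (m + 2)) : S.σ (E K p q) ∈ L.part 0 := by
  simpa using S.lev_le_part 0 (S.σ_lev (E_lev p q))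

theorem σ_one_mem {x : (cartanW K (m + 2)).carrier} (hx : x ∈ (std K m).lev 1) :
    S.σ x ∈ L.part 1 := by
  simpa using S.lev_le_part 1 (S.σ_lev hx)

theorem β_comm {x y : (cartanW K (m + 2)).carrier} (hx : x ∈ (std K m).lev 1)
    (hy : y ∈ (std K m).lev 1) : S.β x y = S.β y x :=
  br_comm_odd (S.σ_one_mem hx) (S.σ_one_mem hy)

theorem E_σ {a : ℤ} (ha : S.Inj a) (p q : Fin (m + 2)) {x : (cartanW K (m + 2)).carrier}
    (hx : x ∈ (std K m).lev a) : ⁅S.σ (E K p q), S.σ x⁆ = S.σ ⁅E K p q, x⁆ :=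
  (S.σ_bracket (a := 0) (by rwa [zero_add]) (E_lev p q) hx).symm

theorem E_β {a b : ℤ} (ha : S.Inj a) (hb : S.Inj b) (p q : Fin (m + 2))
    {x y : (cartanW K (m + 2)).carrier} (hx : x ∈ (std K m).lev a) (hy : y ∈ (std K m).lev b) :
    ⁅S.σ (E K p q), S.β x y⁆ = S.β ⁅E K p q, x⁆ y + S.β x ⁅E K p q, y⁆ := by
  rw [β_apply, br_br_even (S.σ_E_mem p q), S.E_σ ha p q hx, S.E_σ hb p q hy, β_apply, β_apply]

theorem E_β_one (p q : Fin (m + 2)) {x y : (cartanW K (m + 2)).carrier}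
    (hx : x ∈ (std K m).lev 1) (hy : y ∈ (std K m).lev 1) :
    ⁅S.σ (E K p q), S.β x y⁆ = S.β ⁅E K p q, x⁆ y + S.β x ⁅E K p q, y⁆ :=
  S.E_β (S.inj_of_le_one le_rfl) (S.inj_of_le_one le_rfl) p q hx hy

/-- Level k + 2 is spanned by brackets of levels 1 and k + 1. Where φ is injective these factors are
lifts of monomials, so only injectivity below the level in question is used. -/
theorem lev_induction {k : ℕ} (hk : S.Inj (k + 1)) {p : L.carrier → Prop}
    (mem : ∀ a b c R v j, a ≠ b → IsMon R v → R.card = k + 2 → p (S.β (T K a b c) (der j v)))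
    (zero : p 0) (add : ∀ x y, p x → p y → p (x + y)) (smul : ∀ (c : K) x, p x → p (c • x))
    {x : L.carrier} (hx : x ∈ S.lev (k + 2)) : p x := by
  let Q : Submodule K L.carrier :=
    { carrier := {x | p x}, zero_mem' := zero, add_mem' := add _ _, smul_mem' := smul }
  have h : S.R (k + 1) ≤ Q := by
    refine Submodule.map₂_le.2 fun x hx y hy => ?_
    have hx1 : x ∈ S.lev 1 := hx
    have hy1 : y ∈ S.lev (k + 1) := hy
    rw [← S.σ_φ (S.inj_of_le_one le_rfl) hx1, ← S.σ_φ hk hy1]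
    have e1 := S.φ_lev hx1
    have e2 := S.φ_lev hy1
    generalize S.φ.toLin x = x at e1
    generalize S.φ.toLin y = y at e2
    change S.β x y ∈ Q
    refine std_lev_one_induction (p := fun x => S.β x y ∈ Q) ?_ (by simp) ?_ ?_ e1
    · intro a b c hab
      refine std_lev_induction (p := fun y => S.β (T K a b c) y ∈ Q) ?_ (by simp) ?_ ?_ e2
      · intro R v j hv hc
        exact mem a b c R v j hab hv (by omega)
      · intro x y hx hy; rw [map_add]; exact add_mem hx hy
      · intro c x hx; rw [map_smul]; exact Submodule.smul_mem _ _ hx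
    · intro x y hx hy; rw [map_add, LinearMap.add_apply]; exact add_mem hx hy
    · intro c x hx; rw [map_smul, LinearMap.smul_apply]; exact Submodule.smul_mem _ _ hx
  exact h hx

/-! ### The additional relations -/

/-- The relations that generate the maximal ideal. -/
structure JSys : Prop where
  g_g : ∀ a b, ⁅S.g a, S.g b⁆ = 0
  g_g_f : ∀ i j : Fin (m + 2), 3 ≤ i.val → 3 ≤ j.val → ⁅S.g i, ⁅S.g j, S.f 0⁆⁆ = 0
  sub_g_f : ∀ t j : Fin (m + 2), t.val = 2 → 3 ≤ j.val → ⁅S.g t - S.g 0, ⁅S.g j, S.f 0⁆⁆ = 0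

theorem σ_gW {a : Fin (m + 2)} (ha : a ≠ 1) : S.σ (gW K a) = S.g a := by
  rw [← S.φ_g a ha]
  exact S.σ_φ (k := 1) (S.inj_of_le_one le_rfl) (S.g_mem_M a)

theorem σ_f_zero : S.σ (E K 1 0) = S.f 0 := by
  have := S.φ_f 0
  rw [Fin.castSucc_zero, Fin.succ_zero_eq_one] at this
  rw [← this]
  exact S.σ_φ (k := 0) (S.inj_of_le_one (by norm_num)) (S.f_mem_gl 0)

theorem gW_lev (a : Fin (m + 2)) : gW K a ∈ (std K m).lev 1 :=
  gW_induction _ (fun _ => T_lev _ _ _) a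

theorem E_T_zero (p q a b : Fin (m + 1)) :
    (⁅E K p.succ q.succ, T K 0 a.succ b.succ⁆ : (cartanW K (m + 2)).carrier) =
      (if q = a then T K 0 p.succ b.succ else 0) - if b = p then T K 0 a.succ q.succ else 0 := by
  rw [E_T, if_neg (Fin.succ_ne_zero q), zero_add]
  simp only [Fin.succ_inj]

theorem E_T_succ (p q j c d : Fin (m + 1)) :
    (⁅E K p.succ q.succ, T K j.succ c.succ d.succ⁆ : (cartanW K (m + 2)).carrier) =
      (if q = j then T K p.succ c.succ d.succ else 0) + (if q = c then T K j.succ p.succ d.succ else 0) -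
        if d = p then T K j.succ c.succ q.succ else 0 := by
  rw [E_T]
  simp only [Fin.succ_inj]

theorem E_T_V (p q c : Fin (m + 1)) :
    (⁅E K p.succ q.succ, T K 0 c.succ 0⁆ : (cartanW K (m + 2)).carrier) =
      if q = c then T K 0 p.succ 0 else 0 := by
  rw [E_T, if_neg (Fin.succ_ne_zero q), zero_add, if_neg (Fin.succ_ne_zero p).symm, sub_zero]
  simp only [Fin.succ_inj]

theorem E_zero_T (j c d : Fin (m + 1)) :
    (⁅E K j.succ 0, T K 0 c.succ d.succ⁆ : (cartanW K (m + 2)).carrier) =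
      T K j.succ c.succ d.succ - if d = j then T K 0 c.succ 0 else 0 := by
  rw [E_T, if_pos rfl, if_neg (Fin.succ_ne_zero c).symm, add_zero]
  simp only [Fin.succ_inj]

theorem eul_zero : (eul K (0 : Fin (m + 2))) = ∑ l : Fin (m + 1), T K 0 l.succ l.succ := by
  rw [eul, Fin.sum_univ_succ, T_self, zero_add]

theorem eul_succ (a : Fin (m + 1)) :
    eul K a.succ = ∑ l : Fin (m + 1), T K a.succ l.succ l.succ - T K 0 a.succ 0 := by
  rw [eul, Fin.sum_univ_succ, T_swap, neg_add_eq_sub]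

theorem eul_lev (a : Fin (m + 2)) : eul K a ∈ (std K m).lev 1 :=
  Submodule.sum_mem _ fun _ _ => T_lev _ _ _

theorem E_eul (p q : Fin (m + 1)) : ⁅E K p.succ q.succ, eul K (0 : Fin (m + 2))⁆ = 0 := by
  rw [eul_zero, br_sum]
  simp only [E_T_zero, Finset.sum_sub_distrib, Finset.sum_ite_eq, Finset.sum_ite_eq', Finset.mem_univ,
    if_true, sub_self]

theorem E_eul_zero (j : Fin (m + 1)) : ⁅E K j.succ 0, eul K 0⁆ = eul K j.succ := by
  rw [eul_zero, br_sum, eul_succ]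
  simp only [E_zero_T, Finset.sum_sub_distrib, Finset.sum_ite_eq', Finset.mem_univ, if_true]

end WSys

end

section

open Grassmann LieSuperalgebra

namespace WSys

variable {K : Type u} [Field K] [CharZero K] {m : ℕ} {L : LieSuperalgebra.{u, u} K}

/-! ### Level two -/

theorem eq_zero_of_add_self {x : L.carrier} (h : x + x = 0) : x = 0 := by
  rw [← two_smul K] at h
  exact (smul_eq_zero.1 h).resolve_left two_ne_zero

variable {S : WSys K m L}

theorem β_diag (hJ : S.JSys) (l k : Fin (m + 1)) :
    S.β (T K 0 l.succ l.succ) (T K 0 k.succ k.succ) = 0 := by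
  have h1 : ∀ a, a ≠ 1 → S.β (gW K a) (T K 0 k.succ k.succ) = 0 := fun a ha =>
    T_mem_of_gW (P := LinearMap.ker (S.β (gW K a))) (fun b hb => by
      rw [LinearMap.mem_ker, β_apply, S.σ_gW ha, S.σ_gW hb, hJ.g_g]) k
  exact T_mem_of_gW (P := LinearMap.ker (S.β.flip (T K 0 k.succ k.succ))) h1 l

/-- The relations [f_{0a}, f_{0b}] = 0 give the case of two diagonal factors. Applying E_pq with p,
q ≥ 1 moves first one factor and then the other off the diagonal. -/
theorem β_T_zero (hJ : S.JSys) (a b c d : Fin (m + 1)) :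
    S.β (T K 0 a.succ b.succ) (T K 0 c.succ d.succ) = 0 := by
  have act := fun (p q a b c d : Fin (m + 1)) =>
    S.E_β_one p.succ q.succ (T_lev 0 a.succ b.succ) (T_lev 0 c.succ d.succ)
  have h1 : ∀ a b : Fin (m + 1), a ≠ b → S.β (T K 0 a.succ b.succ) (T K 0 b.succ b.succ) = 0 := by
    intro a b hab
    have h := act a b b b b b
    rw [β_diag hJ, br_zero, E_T_zero, if_pos rfl, if_neg hab.symm, sub_zero,
      S.β_comm (T_lev 0 b.succ b.succ) (T_lev _ _ _)] at h
    exact eq_zero_of_add_self h.symm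
  have h2 : ∀ a b k : Fin (m + 1), S.β (T K 0 a.succ b.succ) (T K 0 k.succ k.succ) = 0 := by
    intro a b k
    rcases eq_or_ne a b with rfl | hab
    · exact β_diag hJ _ _
    have h := act a b b b k k
    rw [β_diag hJ, br_zero, E_T_zero, if_pos rfl, if_neg hab.symm, sub_zero, E_T_zero] at h
    have h' : S.β (T K 0 b.succ b.succ) (T K 0 a.succ b.succ) = 0 := by
      rw [S.β_comm (T_lev _ _ _) (T_lev _ _ _), h1 a b hab]
    have e : S.β (T K 0 b.succ b.succ) ((if b = k then T K 0 a.succ k.succ else 0) -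
        if k = a then T K 0 k.succ b.succ else 0) = 0 := by
      rw [map_sub]
      split_ifs with h3 h4 h4
      · exact absurd (h4.symm.trans h3.symm) hab
      · rw [← h3, h', map_zero, sub_zero]
      · rw [h4, h', map_zero, sub_zero]
      · rw [map_zero, sub_zero]
    rw [e, add_zero] at h
    exact h.symm
  rcases eq_or_ne a b with rfl | hab
  · rw [S.β_comm (T_lev _ _ _) (T_lev _ _ _), h2]
  have h := act a b b b c d
  have h3 : ∀ k c d : Fin (m + 1), S.β (T K 0 k.succ k.succ) (T K 0 c.succ d.succ) = 0 := fun k c d => by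
    rw [S.β_comm (T_lev _ _ _) (T_lev _ _ _), h2]
  rw [h3, br_zero, E_T_zero, if_pos rfl, if_neg hab.symm, sub_zero, E_T_zero, map_sub] at h
  have e1 : S.β (T K 0 b.succ b.succ) (if b = c then T K 0 a.succ d.succ else 0) = 0 := by
    split_ifs
    · exact h3 _ _ _
    · exact map_zero _
  have e2 : S.β (T K 0 b.succ b.succ) (if d = a then T K 0 c.succ b.succ else 0) = 0 := by
    split_ifs
    · exact h3 _ _ _
    · exact map_zero _
  rw [e1, e2, sub_zero, add_zero] at h
  exact h.symm

/-- Apply E_j0 to β(θ_0 𝓔, θ_0 𝓔) = 0: both terms are equal, because odd elements commute under the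
bracket. -/
theorem β_eul (hJ : S.JSys) (j : Fin (m + 1)) : S.β (eul K 0) (eul K j.succ) = 0 := by
  have h0 : S.β (eul K 0) (eul K 0) = 0 := by
    rw [eul_zero, map_sum]
    refine Finset.sum_eq_zero fun l _ => ?_
    rw [map_sum, LinearMap.sum_apply]
    exact Finset.sum_eq_zero fun k _ => β_T_zero hJ _ _ _ _
  have h := S.E_β_one j.succ 0 (eul_lev 0) (eul_lev 0)
  rw [h0, br_zero, E_eul_zero, S.β_comm (eul_lev j.succ) (eul_lev 0)] at h
  exact eq_zero_of_add_self h.symm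

variable (S) in
/-- The deviation of `{θ_0 E_{aa'}, x}` from `{θ_0 𝓔, [E_{aa'}, x]}`. -/
def dev (a a' : Fin (m + 1)) : (cartanW K (m + 2)).carrier →ₗ[K] L.carrier :=
  S.β (T K 0 a.succ a'.succ) - S.β (eul K 0) ∘ₗ (cartanW K (m + 2)).bracket (E K a.succ a'.succ)

theorem dev_apply (a a' : Fin (m + 1)) (x : (cartanW K (m + 2)).carrier) :
    S.dev a a' x = S.β (T K 0 a.succ a'.succ) x - S.β (eul K 0) ⁅E K a.succ a'.succ, x⁆ := rfl

variable (S) in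
/-- The deviation of `{θ_0 E_{aa'}, θ_0 θ_c ∂_0}` from `{θ_0 𝓔, θ_c E_{aa'}}`. -/
def devV (a a' c : Fin (m + 1)) : L.carrier :=
  S.β (T K 0 a.succ a'.succ) (T K 0 c.succ 0) - S.β (eul K 0) (T K c.succ a.succ a'.succ)

variable (S) in
/-- The obstructions at level two. -/
def obs (j a a' c d : Fin (m + 1)) : L.carrier :=
  S.dev a a' (T K j.succ c.succ d.succ) - if d = j then S.devV a a' c else 0

/-- Apply E_j0 to β(θ_0 E_aa', θ_0 E_cd) = 0. The correction in `obs` is there because [E_j0, θ_0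
E_cd] = θ_j E_cd - δ_dj θ_0 θ_c ∂_0; the terms with θ_0 𝓔 cancel. -/
theorem obs_antisymm (hJ : S.JSys) (j a a' c d : Fin (m + 1)) :
    S.obs j a a' c d = -S.obs j c d a a' := by
  have h := S.E_β_one j.succ 0 (T_lev 0 a.succ a'.succ) (T_lev 0 c.succ d.succ)
  rw [β_T_zero hJ, br_zero, E_zero_T, E_zero_T, S.β_comm (sub_mem (T_lev _ _ _) (by
    split_ifs; exacts [T_lev _ _ _, zero_mem _])) (T_lev 0 c.succ d.succ)] at h
  rw [← sub_eq_zero, sub_neg_eq_add, h]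
  simp only [obs, dev_apply, devV, E_T_succ]
  split_ifs <;> simp only [map_sub, map_add, map_zero, LinearMap.sub_apply] <;> abel

theorem E_dev (p q a a' : Fin (m + 1)) {x : (cartanW K (m + 2)).carrier}
    (hx : x ∈ (std K m).lev 1) : ⁅S.σ (E K p.succ q.succ), S.dev a a' x⁆ =
      (if q = a then S.dev p a' x else 0) - (if a' = p then S.dev a q x else 0) +
        S.dev a a' ⁅E K p.succ q.succ, x⁆ := by
  have hE : ⁅E K a.succ a'.succ, x⁆ ∈ (std K m).lev 1 := by
    simpa using (std K m).bracket_lev (E_lev a.succ a'.succ) hx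
  rw [dev_apply, br_sub, S.E_β_one _ _ (T_lev _ _ _) hx, S.E_β_one _ _ (eul_lev _) hE, E_eul,
    map_zero, LinearMap.zero_apply, zero_add, br_br_even (E_mem _ _), E_E, E_T_zero]
  simp only [dev_apply, Fin.succ_inj]
  split_ifs <;> simp <;> abel

theorem E_devV (p q a a' c : Fin (m + 1)) : ⁅S.σ (E K p.succ q.succ), S.devV a a' c⁆ =
      (if q = a then S.devV p a' c else 0) - (if a' = p then S.devV a q c else 0) +
        if q = c then S.devV a a' p else 0 := by
  rw [devV, br_sub, S.E_β_one _ _ (T_lev _ _ _) (T_lev _ _ _),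
    S.E_β_one _ _ (eul_lev _) (T_lev _ _ _), E_eul,
    map_zero, LinearMap.zero_apply, zero_add, E_T_succ, E_T_V, E_T_zero]
  simp only [devV]
  split_ifs <;> simp <;> abel

/-- For p, q ≥ 1 the element E_pq commutes with θ_0 𝓔, so the obstructions transform as a tensor
over gl_{n-1}; the δ_dj in the correction is invariant. -/
theorem E_obs (p q j a a' c d : Fin (m + 1)) :
    ⁅S.σ (E K p.succ q.succ), S.obs j a a' c d⁆ =
      (if q = a then S.obs j p a' c d else 0) - (if a' = p then S.obs j a q c d else 0) +
      (if q = j then S.obs p a a' c d else 0) + (if q = c then S.obs j a a' p d else 0) -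
      if d = p then S.obs j a a' c q else 0 := by
  rw [obs, br_sub, E_dev p q a a' (T_lev _ _ _), E_T_succ]
  have e : ⁅S.σ (E K p.succ q.succ), if d = j then S.devV a a' c else 0⁆ = if d = j then
      ⁅S.σ (E K p.succ q.succ), S.devV a a' c⁆ else 0 := by split_ifs <;> simp
  rw [e, E_devV]
  simp only [obs, map_sub, map_add]
  by_cases h1 : d = j <;> by_cases h2 : d = p <;> by_cases h3 : q = j <;>
    simp only [h1, h2, h3, if_true, if_false] <;> split_ifs <;> simp_all <;> abel

/-- By antisymmetry the trace may be taken over the first pair. Since ∑ θ_0 E_ll = θ_0 𝓔 and ∑_{l≥1}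
E_ll acts as the identity on θ_j θ_a ∂_a', the trace of `dev` vanishes; that of `devV` vanishes by
`β_eul`. -/
theorem sum_obs (hJ : S.JSys) (j a a' : Fin (m + 1)) : ∑ l, S.obs j a a' l l = 0 := by
  rw [Finset.sum_congr rfl fun l _ => obs_antisymm hJ j a a' l l, Finset.sum_neg_distrib, neg_eq_zero]
  have h1 : ∑ l, S.dev l l (T K j.succ a.succ a'.succ) = 0 := by
    simp only [dev_apply, Finset.sum_sub_distrib]
    rw [← map_sum, ← LinearMap.sum_apply, ← map_sum, ← eul_zero, sub_eq_zero]
    congr 1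
    simp only [E_T_succ, Finset.sum_sub_distrib, Finset.sum_add_distrib, Finset.sum_ite_eq,
      Finset.sum_ite_eq', Finset.mem_univ, if_true]
    abel
  have h2 : ∑ l, S.devV l l a = 0 := by
    simp only [devV, Finset.sum_sub_distrib]
    rw [← map_sum, ← LinearMap.sum_apply, ← map_sum, ← eul_zero, ← map_sub, ← neg_eq_zero, ← map_neg,
      neg_sub, ← eul_succ, β_eul hJ]
  simp only [obs, Finset.sum_sub_distrib, h1, zero_sub, neg_eq_zero]
  split_ifs
  · exact h2
  · exact Finset.sum_const_zero

theorem obs_same (j a a' c : Fin (m + 1)) :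
    S.obs j a a' j c = -if c = j then S.devV a a' j else 0 := by
  rw [obs, T_self, map_zero, zero_sub]

theorem obs_swap (j a a' c d : Fin (m + 1)) :
    S.obs j a a' c d + (if d = j then S.devV a a' c else 0) =
      -S.obs c a a' j d - if d = c then S.devV a a' j else 0 := by
  rw [obs, obs, T_swap c.succ, map_neg]
  abel

end WSys

end

/-! ### Vanishing of the obstructions and injectivity at level two -/

section

open Grassmann LieSuperalgebra

namespace WSys

section

variable {K : Type u} [Field K] [CharZero K] {m : ℕ} {L : LieSuperalgebra.{u, u} K}
  {S : WSys K m L}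

theorem β_E_gW (hJ : S.JSys) {x : (cartanW K (m + 2)).carrier} {j : Fin (m + 2)} (hj : 3 ≤ j.val)
    (hx : ⁅S.σ x, ⁅S.g j, S.f 0⁆⁆ = 0) : S.β x ⁅E K (1 : Fin (m + 2)) 0, gW K j⁆ = 0 := by
  have h1 : j ≠ 1 := fun e => by rw [e] at hj; simp at hj
  rw [β_apply, ← S.E_σ (S.inj_of_le_one le_rfl) 1 0 (gW_lev j), S.σ_f_zero, S.σ_gW h1,
    br_skew_even (S.f_mem 0), br_neg, hx, neg_zero]

end

section

variable {K : Type u} [Field K] [CharZero K] {m : ℕ} {L : LieSuperalgebra.{u, u} K}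
  {S : WSys K (m + 1) L}

/-- Let y = [f_1, f_{0j}] with j = k + 3 denote the second factor. The relations with f_{0i}, i ≥ 3,
make β(θ_0 E_ll, y) independent of l ≥ 2. The relation with f_{02} - f_{00} then makes a nonzero
multiple of the common value vanish. -/
theorem β_T_one_sub (hJ : S.JSys) (l : Fin (m + 1)) (k : Fin m) :
    S.β (T K 0 l.succ.succ l.succ.succ)
      (T K 1 k.castSucc.succ.succ k.castSucc.succ.succ - T K 1 k.succ.succ.succ k.succ.succ.succ) = 0 := by
  set y := T K 1 k.castSucc.succ.succ k.castSucc.succ.succ - T K 1 k.succ.succ.succ k.succ.succ.succ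
    with hy
  have hE : ⁅E K (1 : Fin (m + 3)) 0, gW K k.succ.succ.succ⁆ = y := by
    rw [hy]
    have h := fun c d => E_zero_T (K := K) (m := m + 1) 0 c d
    simp only [Fin.succ_zero_eq_one] at h
    rw [gW_succ, ← Fin.succ_castSucc, br_sub, h, h, if_neg (Fin.succ_ne_zero _), ← Fin.succ_castSucc,
      if_neg (Fin.succ_ne_zero _), sub_zero, sub_zero]
  clear_value y
  have h3 : 3 ≤ (k.succ.succ.succ : Fin (m + 3)).val := by simp
  have hne : ∀ i : Fin (m + 1), i.succ.succ ≠ (1 : Fin (m + 3)) := fun i e => by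
    have := congrArg Fin.val e; simp at this
  have hstep : ∀ i : Fin m, S.β (T K 0 i.castSucc.succ.succ i.castSucc.succ.succ) y =
      S.β (T K 0 i.succ.succ.succ i.succ.succ.succ) y := by
    intro i
    have h := β_E_gW (x := gW K i.succ.succ.succ) (j := k.succ.succ.succ) hJ h3 (by
      rw [S.σ_gW (hne _)]
      exact hJ.g_g_f _ _ (by simp) h3)
    rwa [hE, gW_succ, ← Fin.succ_castSucc, ← Fin.succ_castSucc, map_sub, LinearMap.sub_apply,
      sub_eq_zero] at h
  have hconst : ∀ i : Fin (m + 1), S.β (T K 0 i.succ.succ i.succ.succ) y =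
      S.β (T K 0 (Fin.succ (Fin.succ 0)) (Fin.succ (Fin.succ 0))) y := by
    intro i
    induction i using Fin.induction with
    | zero => rfl
    | succ i ih => rw [← hstep, ih]
  have h := β_E_gW (x := gW K (Fin.succ (Fin.succ 0)) - gW K 0) (j := k.succ.succ.succ) hJ h3 (by
      rw [map_sub, S.σ_gW (hne _), S.σ_gW (Fin.zero_ne_one)]
      exact hJ.sub_g_f _ _ (by simp) h3)
  have e : ∀ a b c : (cartanW K (m + 3)).carrier, a - b - (a + c) = -(b + c) := fun a b c => by abel
  rw [hE, gW_succ, gW_zero, Fin.sum_univ_succ, ← Fin.succ_castSucc, Fin.castSucc_zero, e, map_neg,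
    LinearMap.neg_apply, neg_eq_zero, map_add, map_sum, LinearMap.add_apply, LinearMap.sum_apply,
    Finset.sum_congr rfl fun i _ => hconst i, Finset.sum_const, Finset.card_univ, Fintype.card_fin,
    ← Nat.cast_smul_eq_nsmul K, ← one_smul K (S.β (T K 0 (Fin.succ (Fin.succ 0)) _) y), smul_smul,
    ← add_smul] at h
  rw [hconst]
  -- Up to sign, f_{02} - f_{00} is θ_0 E_22 plus the sum of the θ_0 E_ll over the m + 1 indices l ≥
  -- 2, so the factor is m + 2.
  refine (smul_eq_zero.1 h).resolve_left ?_
  rw [mul_one]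
  exact_mod_cast (by omega : 1 + (m + 1) ≠ 0)

end

variable {K : Type u} [Field K] [CharZero K] {m : ℕ} {L : LieSuperalgebra.{u, u} K}
  {S : WSys K m L}

/-- These entries do not depend on k ≠ 0 by `β_T_one_sub`, so each equals the one with k = l, which
is its own negative by antisymmetry. -/
theorem obs_zero_diag (hJ : S.JSys) (l k : Fin (m + 1)) (hl : l ≠ 0) (hk : k ≠ 0) :
    S.obs 0 l l k k = 0 := by
  rcases m with _ | m
  · exact absurd (Fin.ext (by omega)) hl
  obtain ⟨l, rfl⟩ := Fin.exists_succ_eq.2 hl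
  have e : ∀ k : Fin (m + 1), S.obs 0 l.succ l.succ k.succ k.succ =
      S.β (T K 0 l.succ.succ l.succ.succ) (T K 1 k.succ.succ k.succ.succ) := by
    intro k
    rw [obs, if_neg (Fin.succ_ne_zero _), dev_apply, E_T_succ, if_neg (Fin.succ_ne_zero _),
      Fin.succ_zero_eq_one]
    rcases eq_or_ne l k with rfl | h
    · simp
    · simp [h, h.symm]
  have hc : ∀ k : Fin (m + 1), S.obs 0 l.succ l.succ k.succ k.succ =
      S.obs 0 l.succ l.succ (Fin.succ 0) (Fin.succ 0) := by
    intro k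
    induction k using Fin.induction with
    | zero => rfl
    | succ k ih =>
      have := β_T_one_sub hJ l k
      rw [map_sub, sub_eq_zero, ← e, ← e] at this
      rw [← this, ih]
  obtain ⟨k, rfl⟩ := Fin.exists_succ_eq.2 hk
  rw [hc k, ← hc l]
  refine eq_zero_of_add_self ?_
  nth_rewrite 1 [obs_antisymm hJ]
  exact neg_add_cancel _

theorem obs_eq_zero (hJ : S.JSys) : (∀ j a a' c d, S.obs j a a' c d = 0) ∧
    ∀ a a' c, S.devV a a' c = 0 :=
  tensor_eq_zero (K := K) 0 S.obs S.devV (fun p q => L.bracket (S.σ (E K p.succ q.succ)))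
    (obs_antisymm hJ) (sum_obs hJ) obs_same obs_swap E_obs (obs_zero_diag hJ)

theorem β_T_T_succ (hJ : S.JSys) (a a' j c d : Fin (m + 1)) :
    S.β (T K 0 a.succ a'.succ) (T K j.succ c.succ d.succ) =
      S.β (eul K 0) ⁅E K a.succ a'.succ, T K j.succ c.succ d.succ⁆ := by
  obtain ⟨h1, h2⟩ := obs_eq_zero hJ
  have := h1 j a a' c d
  rwa [obs, h2, ite_self, sub_zero, dev_apply, sub_eq_zero] at this

theorem β_T_T_V (hJ : S.JSys) (a a' c : Fin (m + 1)) :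
    S.β (T K 0 a.succ a'.succ) (T K 0 c.succ 0) = S.β (eul K 0) (T K c.succ a.succ a'.succ) :=
  sub_eq_zero.1 ((obs_eq_zero hJ).2 a a' c)

/-! ### Injectivity at level two -/

variable (K m) in
/-- The span of the `θ_a θ_b ∂_c` with `a, b, c ≠ 0`. -/
def free1 : Submodule K (cartanW K (m + 2)).carrier :=
  Submodule.span K (Set.range fun x : Fin (m + 1) × Fin (m + 1) × Fin (m + 1) =>
    T K x.1.succ x.2.1.succ x.2.2.succ)

theorem T_mem_free1 (a b c : Fin (m + 1)) : T K a.succ b.succ c.succ ∈ free1 K m :=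
  Submodule.subset_span ⟨(a, b, c), rfl⟩

/-- In degree two [θ_0 𝓔, x] = θ_0 x when the index 0 does not occur in x, and ∂_0 undoes the
multiplication. -/
theorem free1_D_eul {x : (cartanW K (m + 2)).carrier} (hx : x ∈ free1 K m) :
    ⁅D K (0 : Fin (m + 2)), ⁅eul K (0 : Fin (m + 2)), x⁆⁆ = x := by
  induction hx using Submodule.span_induction with
  | mem x h =>
    obtain ⟨⟨a, b, c⟩, rfl⟩ := h
    rcases eq_or_ne a b with rfl | hab
    · simp
    · have hab' : a.succ ≠ b.succ := fun e => hab (Fin.succ_injective _ e)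
      have h := eul_der (IsMon.th_th (K := K) hab') (Fin.succ_ne_zero c)
      rw [Finset.card_pair hab'] at h
      change ⁅D K (0 : Fin (m + 2)), ⁅eul K (0 : Fin (m + 2)), der c.succ (th a.succ * th b.succ)⁆⁆ = _
      rw [h, br_smul, D_der, pd_th_mul_self, pd_th_th, if_neg (Fin.succ_ne_zero _).symm,
        if_neg (Fin.succ_ne_zero _).symm, sub_zero, mul_zero, sub_zero]
      norm_num
      rfl
  | zero => simp
  | add x y _ _ hx hy => rw [br_add, br_add, hx, hy]
  | smul c x _ hx => rw [br_smul, br_smul, hx]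

/-- The cases are those of weight 1, 0 and -1 at the index 0. -/
theorem T_cases (a b c : Fin (m + 2)) (hab : a ≠ b) :
    (∃ (x y : Fin (m + 1)) (s : K), T K a b c = s • T K 0 x.succ y.succ) ∨
    (monWt {a, b} c 0 ≤ 0 ∧ T K a b c ∈ free1 K m ⊔ Submodule.span K
      (Set.range fun c : Fin (m + 1) => T K 0 c.succ 0)) ∨ monWt {a, b} c 0 ≤ -1 := by
  rcases Fin.eq_zero_or_eq_succ a with rfl | ⟨a, rfl⟩
  · rcases Fin.eq_zero_or_eq_succ b with rfl | ⟨b, rfl⟩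
    · exact absurd rfl hab
    rcases Fin.eq_zero_or_eq_succ c with rfl | ⟨c, rfl⟩
    · refine Or.inr (Or.inl ⟨by simp [monWt], Submodule.mem_sup_right (Submodule.subset_span ⟨b, rfl⟩)⟩)
    · exact Or.inl ⟨b, c, 1, by rw [one_smul]⟩
  · rcases Fin.eq_zero_or_eq_succ b with rfl | ⟨b, rfl⟩
    · rw [T_swap]
      rcases Fin.eq_zero_or_eq_succ c with rfl | ⟨c, rfl⟩
      · refine Or.inr (Or.inl ⟨by simp [monWt], neg_mem (Submodule.mem_sup_right (Submodule.subset_span ⟨a, rfl⟩))⟩)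
      · exact Or.inl ⟨a, c, -1, by rw [neg_one_smul]⟩
    · rcases Fin.eq_zero_or_eq_succ c with rfl | ⟨c, rfl⟩
      · exact Or.inr (Or.inr (by simp [monWt, (Fin.succ_ne_zero _).symm]))
      · exact Or.inr (Or.inl ⟨by simp [monWt, (Fin.succ_ne_zero _).symm],
          Submodule.mem_sup_left (T_mem_free1 _ _ _)⟩)

theorem β_T_mem (hJ : S.JSys) (x y : Fin (m + 1)) {w : (cartanW K (m + 2)).carrier}
    (hw : w ∈ free1 K m ⊔ Submodule.span K (Set.range fun c : Fin (m + 1) => T K 0 c.succ 0)) :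
    S.β (T K 0 x.succ y.succ) w ∈ (free1 K m).map (S.β (eul K 0)) := by
  have : free1 K m ⊔ Submodule.span K (Set.range fun c : Fin (m + 1) => T K 0 c.succ 0) ≤
      ((free1 K m).map (S.β (eul K 0))).comap (S.β (T K 0 x.succ y.succ)) := by
    refine sup_le (Submodule.span_le.2 ?_) (Submodule.span_le.2 ?_)
    · rintro _ ⟨⟨a, b, c⟩, rfl⟩
      change S.β (T K 0 x.succ y.succ) (T K a.succ b.succ c.succ) ∈ (free1 K m).map (S.β (eul K 0))
      rw [β_T_T_succ hJ]
      refine Submodule.mem_map_of_mem ?_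
      rw [E_T_succ]
      refine sub_mem (add_mem ?_ ?_) ?_ <;>
      · split_ifs
        · exact T_mem_free1 _ _ _
        · exact zero_mem _
    · rintro _ ⟨c, rfl⟩
      change S.β (T K 0 x.succ y.succ) (T K 0 c.succ 0) ∈ (free1 K m).map (S.β (eul K 0))
      rw [β_T_T_V hJ]
      exact Submodule.mem_map_of_mem (T_mem_free1 _ _ _)
  exact this hw

/-- A bracket of two monomials of level one has weight at least 1 at the index 0 only if one factor
has weight 1 and the other 0 or 1. Two factors of weight 1 give zero by `β_T_zero`; in the mixed
case the bracket has the form β(θ_0 𝓔, ·). -/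
theorem proj_lev_two (hJ : S.JSys) {x : L.carrier} (hx : x ∈ S.lev 2) : ∀ μ : Fin (m + 2) → ℤ,
    (1 ≤ μ 0 → S.toSl.proj μ x ∈ (free1 K m).map (S.β (eul K 0))) ∧
      ∀ j, tail μ j < -2 → S.toSl.proj μ x = 0 := by
  refine S.lev_induction (k := 0) (p := fun x => ∀ μ : Fin (m + 2) → ℤ,
    (1 ≤ μ 0 → S.toSl.proj μ x ∈ (free1 K m).map (S.β (eul K 0))) ∧
      ∀ j, tail μ j < -2 → S.toSl.proj μ x = 0) (S.inj_of_le_one (by norm_num)) ?_ ?_ ?_ ?_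
    (by simpa using hx)
  · intro a b c R v j hab hv hR μ
    obtain ⟨a', b', r, hab', rfl, rfl⟩ := hv.exists_th_th hR
    have hT : ∀ {a b c : Fin (m + 2)}, a ≠ b → monWt {a, b} c 0 ≤ 1 := fun _ => monWt_le_one _ _ _
    have hw : S.β (T K a b c) (der j (r • (th a' * th b'))) ∈ S.wt (monWt {a, b} c + monWt {a', b'} j) :=
      S.bracket_mem_wt (S.σ_wt (mon_wt (IsMon.th_th hab) c)) (S.σ_wt (mon_wt hv j))
    rcases eq_or_ne μ (monWt {a, b} c + monWt {a', b'} j) with rfl | hne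
    · rw [S.toSl.proj_self _ _ hw]
      refine ⟨fun h => ?_, fun i hi => ?_⟩
      · rw [map_smul, map_smul]
        refine Submodule.smul_mem _ _ ?_
        change S.β (T K a b c) (T K a' b' j) ∈ (free1 K m).map (S.β (eul K 0))
        rw [Pi.add_apply] at h
        have m1 := monWt_le_one {a, b} c 0
        have m2 := monWt_le_one {a', b'} j 0
        rcases T_cases (K := K) a b c hab with ⟨x, y, s, e⟩ | h1
        · rw [e, map_smul, LinearMap.smul_apply]
          refine Submodule.smul_mem _ _ ?_
          rcases T_cases (K := K) a' b' j hab' with ⟨x', y', s', e'⟩ | ⟨-, h2⟩ | h2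
          · rw [e', map_smul, β_T_zero hJ, smul_zero]
            exact zero_mem _
          · exact β_T_mem hJ x y h2
          · omega
        · rcases T_cases (K := K) a' b' j hab' with ⟨x', y', s', e'⟩ | h2
          · rw [e', map_smul]
            refine Submodule.smul_mem _ _ ?_
            rcases h1 with ⟨-, h1⟩ | h1
            · rw [S.β_comm (T_lev _ _ _) (T_lev _ _ _)]
              exact β_T_mem hJ x' y' h1
            · omega
          · have h1' : monWt {a, b} c 0 ≤ 0 := by rcases h1 with h1 | h1 <;> omega
            have h2' : monWt {a', b'} j 0 ≤ 0 := by rcases h2 with h2 | h2 <;> omega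
            omega
      · rw [tail_add] at hi
        have := tail_monWt {a, b} c i
        have := tail_monWt {a', b'} j i
        omega
    · rw [S.toSl.proj_ne _ _ hne _ hw]
      exact ⟨fun _ => zero_mem _, fun _ _ => rfl⟩
  · intro μ
    rw [map_zero]
    exact ⟨fun _ => zero_mem _, fun _ _ => rfl⟩
  · intro x y hx hy μ
    rw [map_add]
    exact ⟨fun h => add_mem ((hx μ).1 h) ((hy μ).1 h),
      fun j h => by rw [(hx μ).2 j h, (hy μ).2 j h, add_zero]⟩
  · intro c x hx μ
    rw [map_smul]
    exact ⟨fun h => Submodule.smul_mem _ _ ((hx μ).1 h), fun j h => by rw [(hx μ).2 j h, smul_zero]⟩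

/-- A highest weight vector of level two has μ_0 ≥ 1, hence equals β(θ_0 𝓔, u) with u free of the
index 0. If it lies in the kernel, [θ_0 𝓔, u] = 0, and `free1_D_eul` gives u = 0. -/
theorem inj_two (hJ : S.JSys) : S.Inj 2 := by
  have : S.lev 2 ⊓ S.kerφ = ⊥ := by
    refine SlMod.eq_bot_of_highest (S := S.toSl) ((S.lev_graded 2).inf S.graded_ker)
      (∑ _j ∈ Finset.range (m + 2), -2) ?_ ?_ ?_
    · intro μ x hx hμ hne
      refine Finset.sum_le_sum fun j _ => ?_
      by_contra hj
      refine hne ?_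
      rw [← S.toSl.proj_self μ x hμ]
      exact (proj_lev_two hJ hx.1 μ).2 j (by omega)
    · exact fun i x hx => ⟨(S.lev_stable 2).e i x hx.1, S.br_mem_ker _ hx.2⟩
    · intro μ hd x hx hμ
      by_contra hne
      have hs := S.sum_eq_of_mem_lev hμ hx.1 hne
      have h1 := (proj_lev_two hJ hx.1 μ).1 (one_le_of_dominant hd (by omega))
      rw [S.toSl.proj_self μ x hμ] at h1
      obtain ⟨u, hu, rfl⟩ := h1
      have h2 : S.φ.toLin (S.β (eul K 0) u) = 0 := hx.2
      rw [S.φ_β] at h2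
      have h3 := free1_D_eul hu
      rw [h2, br_zero] at h3
      rw [← h3, map_zero] at hne
      exact hne rfl
  intro x hx h
  exact (Submodule.mem_bot K).1 (this ▸ ⟨hx, h⟩)

end WSys

end

/-! ### Bracket formulas for θ_i E_bc and θ_i 𝓔, and first consequences for β -/

section

open LieSuperalgebra

namespace Grassmann

variable {K : Type u} [Field K] {n : ℕ}

theorem T_der {p : ZMod 2} {v : Lam K n} (hv : v ∈ par K n p) {i d : Fin n} (hd : d ≠ i)
    (b c : Fin n) : ⁅T K i b c, der d v⁆ = der d (th i * (th b * pd c v)) -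
      if d = b then der c (th i * v) else 0 := by
  rw [T, der_bracket (th_th_mem i b) hv, pd_th_th, if_neg hd, zero_sub, add_zero, mul_assoc]
  congr 1
  split_ifs with h
  · rw [mul_neg, map_neg, mul_comm_super hv (th_mem i), map_smul, smul_neg, smul_smul,
      superSign_comm _ 1, ← superSign_add_right, add_assoc, show ∀ a : ZMod 2, a + a = 0 by decide,
      add_zero, superSign_one_one, neg_smul, one_smul, neg_neg]
  · rw [neg_zero, mul_zero, map_zero, smul_zero]

theorem T_mon {R : Finset (Fin n)} {v : Lam K n} (h : IsMon R v) {i d : Fin n} (hd : d ≠ i)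
    (l : Fin n) : ⁅T K i l l, der d v⁆ = (monWt R d l : K) • der d (th i * v) := by
  rw [T_der h.mem hd, monWt]
  by_cases hl : l ∈ R
  · rw [h.on l hl, if_pos hl]
    rcases eq_or_ne d l with rfl | hdl
    · simp
    · simp [hdl, hdl.symm]
  · rw [h.off l hl, if_neg hl]
    rcases eq_or_ne d l with rfl | hdl
    · simp
    · simp [hdl, hdl.symm]

theorem IsMon.th_mul_cases {R : Finset (Fin n)} {v : Lam K n} (h : IsMon R v) (b : Fin n) :
    Grassmann.th b * v = 0 ∨ b ∉ R ∧ IsMon (insert b R) (Grassmann.th b * v) := by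
  by_cases hb : b ∈ R
  · exact Or.inl (h.th_mul_eq_zero hb)
  · exact Or.inr ⟨hb, h.th_mul hb⟩

theorem opr_eul {R : Finset (Fin n)} {v : Lam K n} (h : IsMon R v) (i : Fin n) :
    opr (eul K i) v = (R.card : K) • (th i * v) := by
  rw [eul, map_sum, LinearMap.sum_apply, Finset.sum_congr rfl fun l _ => by
    rw [T, opr_der, mul_assoc], ← Finset.mul_sum, h.sum_th_pd, mul_smul_comm]

theorem eul_mem (i : Fin n) : eul K i ∈ (cartanW K n).part 1 :=
  Submodule.sum_mem _ fun _ _ => T_mem _ _ _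

/-- On generators θ_i 𝓔 after θ_j 𝓔 sends θ_l to 2 θ_i θ_j θ_l, which is antisymmetric in i and j,
while the bracket of odd elements is the anticommutator. -/
theorem eul_eul (i j : Fin n) : (⁅eul K i, eul K j⁆ : (cartanW K n).carrier) = 0 := by
  refine cartanW_ext fun l => ?_
  have key : ∀ i j l : Fin n, opr (eul K i) (opr (eul K j) (th l : Lam K n)) =
      (2 : K) • (th i * (th j * th l)) := by
    intro i j l
    rw [opr_eul IsMon.th, Finset.card_singleton, Nat.cast_one, one_smul]
    rcases eq_or_ne j l with rfl | h
    · have : (th j * th j : Lam K n) = 0 := by simp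
      simp [this]
    · rw [opr_eul (IsMon.th_th h), Finset.card_pair h, Nat.cast_ofNat]
  rw [opr_bracket (eul_mem i) (eul_mem j), key, key, superSign_one_one, th_mul_left_comm j i]
  simp

/-- Bracketing with E_bc preserves the degree, and θ_j times the result is the bracket with θ_j
E_bc; then `eul_der` applies. -/
theorem eul_E_br {R : Finset (Fin n)} {v : Lam K n} (h : IsMon R v) {j b c d : Fin n}
    (hc : c ≠ j) (hd : d ≠ j) :
    ⁅eul K j, ⁅E K b c, der d v⁆⁆ = ((R.card : K) - 1) • ⁅T K j b c, der d v⁆ := by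
  rw [E_der, T_der h.mem hd, br_sub, smul_sub]
  congr 1
  · by_cases hcR : c ∈ R
    · rcases (h.pd hcR).th_mul_cases b with h0 | ⟨hb, h1⟩
      · rw [h0]; simp
      · rw [eul_der h1 hd, Finset.card_insert_of_notMem hb, Finset.card_erase_add_one hcR]
    · rw [h.off c hcR]; simp
  · split_ifs
    · rw [eul_der h hc]
    · simp

end Grassmann

open Grassmann

namespace WSys

variable {K : Type u} [Field K] [CharZero K] {m : ℕ} {L : LieSuperalgebra.{u, u} K}
  {S : WSys K m L}

/-! ### Brackets at the higher levels -/

/-- The Jacobi identity in L, read through σ: the inner brackets lie in levels 2 and q + 1, where φ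
is already injective. -/
theorem β_br {q : ℕ} (hq : 1 ≤ q) (hI : ∀ j : ℤ, j ≤ q + 1 → S.Inj j)
    {a x : (cartanW K (m + 2)).carrier} (ha : a ∈ (std K m).lev 1) (hx : x ∈ (std K m).lev q)
    {y : (cartanW K (m + 2)).carrier} (hy : y ∈ (std K m).lev 1) :
    S.β a ⁅x, y⁆ = S.β ⁅a, x⁆ y + superSign K 1 q • S.β x ⁅a, y⁆ := by
  have hx' : S.σ x ∈ L.part (q : ZMod 2) := by simpa using S.lev_le_part q (S.σ_lev hx)
  rw [β_apply, S.σ_bracket (hI _ (by omega)) hx hy, br_br (S.σ_one_mem ha) hx',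
    ← S.σ_bracket (hI _ (by omega)) ha hx, ← S.σ_bracket (hI _ (by omega)) ha hy, β_apply, β_apply]

theorem β_br_one {q : ℕ} (hq : 1 ≤ q) (hI : ∀ j : ℤ, j ≤ q + 1 → S.Inj j)
    {a b : (cartanW K (m + 2)).carrier} (ha : a ∈ (std K m).lev 1) (hb : b ∈ (std K m).lev 1)
    {x : (cartanW K (m + 2)).carrier} (hx : x ∈ (std K m).lev q) :
    S.β a ⁅b, x⁆ = S.β ⁅a, b⁆ x - S.β b ⁅a, x⁆ := by
  rw [β_apply, S.σ_bracket (hI _ (by omega)) hb hx, br_br_odd (S.σ_one_mem ha) (S.σ_one_mem hb),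
    ← S.σ_bracket (hI _ (by omega)) ha hb, ← S.σ_bracket (hI _ (by omega)) ha hx, β_apply, β_apply]

theorem β_eul_eul {q : ℕ} (hq : 1 ≤ q) (hI : ∀ j : ℤ, j ≤ q + 1 → S.Inj j) (j : Fin (m + 2))
    {x : (cartanW K (m + 2)).carrier} (hx : x ∈ (std K m).lev q) :
    S.β (eul K j) ⁅eul K j, x⁆ = 0 := by
  have h := β_br_one hq hI (eul_lev j) (eul_lev j) hx
  rw [eul_eul, map_zero, LinearMap.zero_apply, zero_sub] at h
  refine eq_zero_of_add_self ?_
  nth_rewrite 1 [h]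
  exact neg_add_cancel _

theorem mon_lev_nat {R : Finset (Fin (m + 2))} {v : Lam K (m + 2)} (h : IsMon R v) {q : ℕ}
    (hR : R.card = q + 1) (d : Fin (m + 2)) : der d v ∈ (std K m).lev q :=
  mon_lev' h d (by rw [hR]; push_cast; ring)

/-- Two elements divisible by the same `θ_j` commute. -/
theorem β_same {q : ℕ} (hq : 1 ≤ q) (hI : ∀ j : ℤ, j ≤ q + 1 → S.Inj j) {j b c d : Fin (m + 2)}
    (hb : b ≠ j) (hc : c ≠ j) (hd : d ≠ j) {R : Finset (Fin (m + 2))} {v : Lam K (m + 2)}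
    (h : IsMon R v) (hR : R.card = q + 1) : S.β (T K j b c) (der d (th j * v)) = 0 := by
  have hq0 : (q : K) ≠ 0 := by exact_mod_cast (by omega : q ≠ 0)
  have hR1 : (R.card : K) - 1 = q := by rw [hR]; push_cast; ring
  have hX := mon_lev_nat h hR d
  have e1 : ⁅eul K j, der d v⁆ = (q : K) • der d (th j * v) := by rw [eul_der h hd, hR1]
  have e2 : ⁅T K j b c, eul K j⁆ = 0 := by
    rw [br_comm_odd (T_mem _ _ _) (eul_mem _), T, eul_der (IsMon.th_th hb.symm) hc, th_mul_self_mul,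
      map_zero, smul_zero]
  -- The inner bracket is, up to the factor q, itself of the form [θ_j 𝓔, ·], and ad (θ_j 𝓔) has
  -- square zero.
  have e3 : S.β (eul K j) ⁅T K j b c, der d v⁆ = 0 := by
    have hE : ⁅E K b c, der d v⁆ ∈ (std K m).lev q := by
      simpa using (std K m).bracket_lev (E_lev b c) hX
    have h' := β_eul_eul hq hI j hE
    rw [eul_E_br h hc hd, hR1, map_smul] at h'
    exact (smul_eq_zero.1 h').resolve_left hq0
  have h := β_br_one hq hI (T_lev j b c) (eul_lev j) hX
  rw [e1, e2, e3, map_smul, map_zero, LinearMap.zero_apply, sub_zero] at h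
  exact (smul_eq_zero.1 h).resolve_left hq0

/-- Let X and Y be the two factors. Both θ_i E_ll and θ_i 𝓔 send [X, Y] to combinations of β(θ_i X,
Y) and β(X, θ_i Y), the first with the weights at l as coefficients and the second with the levels q
and 1. Eliminating β(X, θ_i Y) gives the formula. -/
theorem β_T_br {q : ℕ} (hq : 1 ≤ q) (hI : ∀ j : ℤ, j ≤ q + 1 → S.Inj j) {i d a b c : Fin (m + 2)}
    (hd : d ≠ i) (hab : a ≠ b) (hc : c ≠ i) {P : Finset (Fin (m + 2))} {x : Lam K (m + 2)}
    (h : IsMon P x) (hP : P.card = q + 1) (l : Fin (m + 2)) :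
    S.β (T K i l l) ⁅der d x, T K a b c⁆ =
      ((monWt P d l : K) - q * (monWt {a, b} c l : K)) • S.β (der d (th i * x)) (T K a b c) +
        (monWt {a, b} c l : K) • S.β (eul K i) ⁅der d x, T K a b c⁆ := by
  have hX := mon_lev_nat h hP d
  have hY := T_lev (K := K) a b c
  have e1 : ⁅eul K i, der d x⁆ = (q : K) • der d (th i * x) := by
    rw [eul_der h hd, hP]; push_cast; congr 1; ring
  have e2 : ⁅eul K i, T K a b c⁆ = der c (th i * (th a * th b)) := by
    rw [T, eul_der (IsMon.th_th hab) hc, Finset.card_pair hab]; norm_num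
  have e3 : ⁅T K i l l, T K a b c⁆ = (monWt {a, b} c l : K) • der c (th i * (th a * th b)) :=
    T_mon (IsMon.th_th hab) hc l
  rw [β_br hq hI (T_lev i l l) hX hY, β_br hq hI (eul_lev i) hX hY, T_mon h hd, e1, e2, e3]
  simp only [map_smul, LinearMap.smul_apply]
  module

end WSys

end

/-! ### Comparison of θ_i E_ll with θ_i 𝓔 -/

section

open Grassmann LieSuperalgebra

namespace WSys

variable {K : Type u} [Field K] [CharZero K] {m : ℕ} {L : LieSuperalgebra.{u, u} K}
  {S : WSys K m L}

theorem superSign_ne_zero (i j : ZMod 2) : superSign K i j ≠ 0 := fun h => by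
  have := superSign_mul_self (K := K) i j
  rw [h, zero_mul] at this
  exact zero_ne_one this

theorem monWt_pair {r s : Fin (m + 2)} (hrs : r ≠ s) (l : Fin (m + 2)) :
    monWt {r, s} s l = if l = r then 1 else 0 := by
  rcases eq_or_ne l r with rfl | h1
  · simp [monWt, hrs]
  · rcases eq_or_ne l s with rfl | h2
    · simp [monWt, h1]
    · simp [monWt, h1, h2]

theorem monWt_erase {R : Finset (Fin (m + 2))} {r : Fin (m + 2)} (hr : r ∈ R) (e l : Fin (m + 2)) :
    monWt (R.erase r) e l = monWt R e l - if l = r then 1 else 0 := by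
  rcases eq_or_ne l r with rfl | h1
  · simp [monWt, hr]
  · simp [monWt, h1]

/-- The relations between the `{θ_i E_ll, U}` for a monomial `U = θ_R ∂_e` that result from a
decomposition of `U` as a bracket. -/
theorem exists_β_T {q : ℕ} (hq : 1 ≤ q) (hI : ∀ j : ℤ, j ≤ q + 1 → S.Inj j) {i e r s : Fin (m + 2)}
    {R : Finset (Fin (m + 2))} {v : Lam K (m + 2)} (h : IsMon R v) (hR : R.card = q + 2)
    (hi : i ∉ R) (he : e ≠ i) (hr : r ∈ R) (hs : s ∈ R) (hrs : r ≠ s) (hre : r ≠ e) (hse : s ≠ e) :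
    ∃ z : L.carrier, ∀ l, S.β (T K i l l) (der e v) =
      ((monWt R e l : K) - (q + 1) * (if l = r then 1 else 0)) • z +
        (if l = r then 1 else 0 : K) • S.β (eul K i) (der e v) := by
  have hsi : s ≠ i := fun e => hi (e ▸ hs)
  have hx := h.pd hr
  have hc : (R.erase r).card = q + 1 := by rw [Finset.card_erase_of_mem hr, hR]; rfl
  -- The decomposition used: θ_r can be split off a monomial by bracketing with θ_r θ_s ∂_s, because
  -- s still occurs in it and neither r nor s is the index e.
  obtain ⟨c, hc0, hU⟩ : ∃ c : K, c ≠ 0 ∧ ⁅der e (pd r v), T K r s s⁆ = c • der e v := by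
    refine ⟨-superSign K (1 + ((R.erase r).card : ZMod 2)) (1 + 0),
      neg_ne_zero.2 (superSign_ne_zero _ _), ?_⟩
    rw [T, der_bracket hx.mem (th_th_mem r s), pd_th_th, if_neg hre.symm, if_neg hse.symm, sub_zero,
      mul_zero, map_zero, zero_sub, mul_assoc, hx.on s (Finset.mem_erase.2 ⟨hrs.symm, hs⟩),
      h.on r hr, neg_smul]
  refine ⟨c⁻¹ • S.β (der e (th i * pd r v)) (T K r s s), fun l => ?_⟩
  have key := β_T_br hq hI he hrs hsi hx hc l
  rw [hU, map_smul, map_smul, monWt_pair hrs, monWt_erase hr] at key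
  have key' := congrArg (c⁻¹ • ·) key
  simp only [smul_smul, inv_mul_cancel₀ hc0, one_smul, smul_add] at key'
  rw [key']
  push_cast
  have e1 : c⁻¹ * ((if l = r then (1 : K) else 0) * c) = if l = r then 1 else 0 := by
    field_simp
  rw [e1]
  congr 1
  rw [smul_smul]
  congr 1
  ring

/-- By `exists_β_T` all the values β(θ_i E_ll, U) are known once (q+1) z = β(θ_i 𝓔, U) is shown for
one of the vectors z occurring there. Different decompositions of U provide linear equations for z.
-/
theorem β_T_eq {q : ℕ} (hq : 1 ≤ q) (hI : ∀ j : ℤ, j ≤ q + 1 → S.Inj j) {i e : Fin (m + 2)}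
    {R : Finset (Fin (m + 2))} {v : Lam K (m + 2)} (h : IsMon R v) (hR : R.card = q + 2)
    (hi : i ∉ R) (he : e ≠ i) (l : Fin (m + 2)) :
    ((q : K) + 1) • S.β (T K i l l) (der e v) = (monWt R e l : K) • S.β (eul K i) (der e v) := by
  set b := S.β (eul K i) (der e v) with hb
  have pair := fun {r s : Fin (m + 2)} => exists_β_T (S := S) hq hI (r := r) (s := s) h hR hi he
  suffices hz : ∃ (r : Fin (m + 2)) (z : L.carrier), ((q : K) + 1) • z = b ∧
      ∀ l, S.β (T K i l l) (der e v) =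
        ((monWt R e l : K) - (q + 1) * (if l = r then 1 else 0)) • z + (if l = r then 1 else 0 : K) • b by
    obtain ⟨r, z, hz, hl⟩ := hz
    rw [hl, smul_add, smul_comm, hz]
    module
  have hone : ∀ {r}, r ∈ R → r ≠ e → monWt R e r = 1 := fun hr hre => by simp [monWt, hr, hre]
  have h2 : 1 < (R.erase e).card := by
    have := Finset.pred_card_le_card_erase (s := R) (a := e)
    omega
  obtain ⟨r, hr, s, hs, hrs⟩ := Finset.one_lt_card.1 h2
  obtain ⟨hre, hr⟩ := Finset.mem_erase.1 hr
  obtain ⟨hse, hs⟩ := Finset.mem_erase.1 hs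
  have val : ∀ {r s}, r ∈ R → s ∈ R → r ≠ s → r ≠ e → s ≠ e → ∃ z : L.carrier,
      (∀ l, S.β (T K i l l) (der e v) =
        ((monWt R e l : K) - (q + 1) * (if l = r then 1 else 0)) • z + (if l = r then 1 else 0 : K) • b) ∧
      S.β (T K i s s) (der e v) = z ∧ S.β (T K i r r) (der e v) = b - (q : K) • z := by
    intro r s hr hs hrs hre hse
    obtain ⟨z, hz⟩ := pair hr hs hrs hre hse
    refine ⟨z, hz, ?_, ?_⟩
    · rw [hz, hone hs hse, if_neg hrs.symm]
      simp
    · rw [hz, hone hr hre, if_pos rfl]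
      push_cast
      module
  obtain ⟨z, hz, hz1, hz2⟩ := val hr hs hrs hre hse
  refine ⟨r, z, ?_, hz⟩
  -- With x_l = β(θ_i E_ll, U) this reads x_r = b - q x_s. Together with its mirror image it gives
  -- (q-1)((q+1) x_s - b) = 0, which is conclusive unless q = 1.
  have rel : ∀ {r s}, r ∈ R → s ∈ R → r ≠ s → r ≠ e → s ≠ e →
      S.β (T K i r r) (der e v) = b - (q : K) • S.β (T K i s s) (der e v) := by
    intro r s hr hs hrs hre hse
    obtain ⟨z, -, h1, h2⟩ := val hr hs hrs hre hse
    rw [h2, h1]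
  have e1 := rel hr hs hrs hre hse
  have e2 := rel hs hr hrs.symm hse hre
  rw [← hz1]
  rcases Nat.lt_or_ge 1 q with hq1 | hq1
  · rw [e1, ← sub_eq_zero] at e2
    have e3 : ((q : K) - 1) • (((q : K) + 1) • S.β (T K i s s) (der e v) - b) = 0 := by
      rw [← neg_eq_zero, ← e2]
      module
    refine sub_eq_zero.1 ((smul_eq_zero.1 e3).resolve_left ?_)
    refine sub_ne_zero.2 ?_
    exact_mod_cast (by omega : q ≠ 1)
  obtain rfl : q = 1 := by omega
  rw [Nat.cast_one, one_smul] at e1 e2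
  have two : ((1 : ℕ) : K) + 1 = 2 := by norm_num
  rw [two, two_smul]
  -- For q = 1 only x_r + x_s = b is known and x_r = x_s is missing. If e occurs in U, a
  -- decomposition of a different kind, [θ_e θ_r ∂_r, θ_r θ_s ∂_e] = θ_e θ_r θ_s ∂_e, supplies the
  -- needed equation. Otherwise R has a third usable index t and x_r = b - x_t = x_s.
  by_cases heR : e ∈ R
  · have hReq : R = {e, r, s} := by
      refine (Finset.eq_of_subset_of_card_le ?_ ?_).symm
      · intro x hx
        simp only [Finset.mem_insert, Finset.mem_singleton] at hx
        rcases hx with rfl | rfl | rfl <;> assumption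
      · rw [hR, Finset.card_insert_of_notMem (by simp [hre.symm, hse.symm]), Finset.card_pair hrs]
    have hv1 := h.pd heR
    have hv2 := hv1.pd (Finset.mem_erase.2 ⟨hre, hr⟩)
    have hs2 : s ∈ (R.erase e).erase r := Finset.mem_erase.2 ⟨hrs.symm, Finset.mem_erase.2 ⟨hse, hs⟩⟩
    have hv3 := hv2.pd hs2
    obtain ⟨c, hc⟩ := exists_smul_one (v := pd s (pd r (pd e v))) fun l => hv3.off l (by
      rw [hReq]; simp only [Finset.mem_erase, Finset.mem_insert, Finset.mem_singleton]; tauto)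
    have hv : v = c • (th e * th r * th s) := by
      rw [← h.on e heR, ← hv1.on r (Finset.mem_erase.2 ⟨hre, hr⟩), ← hv2.on s hs2, hc]
      simp [mul_assoc]
    have hU : ⁅der r (th e * th r : Lam K (m + 2)), T K r s e⁆ = der e (th e * th r * th s : Lam K (m + 2)) := by
      rw [T, der_der_even (th_th_mem _ _) (th_th_mem _ _), pd_th_th, pd_th_th, if_pos rfl, if_neg hrs,
        if_pos rfl, if_neg hre.symm, sub_zero, sub_zero, mul_assoc (th r), th_mul_comm s r, mul_neg,
        th_mul_self_mul, neg_zero, map_zero, add_zero]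
    have hri : r ≠ i := fun e => hi (e ▸ hr)
    have key := β_T_br (S := S) hq hI (i := i) (d := r) hri hrs he (IsMon.th_th (K := K) hre.symm)
      (Finset.card_pair hre.symm)
    have key' : ∀ l, S.β (T K i l l) (der e v) = ((monWt {e, r} r l : K) - ((1 : ℕ) : K) * (monWt {r, s} e l : K)) •
        c • S.β (der r (th i * (th e * th r))) (T K r s e) + (monWt {r, s} e l : K) • b := by
      intro l
      rw [hb, hv, map_smul, map_smul, map_smul, ← hU, key l]
      module
    have k1 := key' e
    have k2 := key' s
    have k3 := hz e
    rw [monWt_pair hre.symm, if_pos rfl] at k1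
    rw [monWt_pair hre.symm, if_neg hse] at k2
    have m1 : monWt R e e = 0 := by simp [monWt, heR]
    have m2 : monWt {r, s} e e = -1 := by simp [monWt, hre.symm, hse.symm]
    have m3 : monWt {r, s} e s = 1 := by simp [monWt, hse]
    rw [m1, if_neg hre.symm] at k3
    rw [m2, k3] at k1
    rw [m3] at k2
    rw [k2, ← sub_eq_zero]
    rw [← sub_eq_zero] at k1
    rw [← k1]
    push_cast
    module
  · obtain ⟨t, ht⟩ : ((R.erase r).erase s).Nonempty := by
      rw [← Finset.card_pos, Finset.card_erase_of_mem (Finset.mem_erase.2 ⟨hrs.symm, hs⟩),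
        Finset.card_erase_of_mem hr, hR]
      norm_num
    obtain ⟨hts, ht⟩ := Finset.mem_erase.1 ht
    obtain ⟨htr, ht⟩ := Finset.mem_erase.1 ht
    have hte : t ≠ e := fun h => heR (h ▸ ht)
    have e3 := rel hr ht htr.symm hre hte
    have e4 := rel hs ht hts.symm hse hte
    have e5 : S.β (T K i r r) (der e v) = S.β (T K i s s) (der e v) := e3.trans e4.symm
    nth_rewrite 2 [← e5]
    rw [e1]
    abel

end WSys

end

/-! ### Spanning the higher levels by brackets with θ_i 𝓔 -/

section

open Grassmann LieSuperalgebra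

namespace WSys

variable {K : Type u} [Field K] [CharZero K] {m : ℕ} {L : LieSuperalgebra.{u, u} K}
  {S : WSys K m L}

variable (K) in
/-- The span of the monomials of level `q + 1` that do not involve the index `i`. -/
def freeAt (q : ℕ) (i : Fin (m + 2)) : Submodule K (cartanW K (m + 2)).carrier :=
  Submodule.span K {x | ∃ (R : Finset (Fin (m + 2))) (v : Lam K (m + 2)) (e : Fin (m + 2)),
    IsMon R v ∧ R.card = q + 2 ∧ i ∉ R ∧ e ≠ i ∧ x = der e v}

theorem β_T_freeAt {q : ℕ} (hq : 1 ≤ q) (hI : ∀ j : ℤ, j ≤ q + 1 → S.Inj j) {i : Fin (m + 2)}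
    {w : (cartanW K (m + 2)).carrier} (hw : w ∈ freeAt K q i) (l : Fin (m + 2)) :
    ((q : K) + 1) • S.β (T K i l l) w = S.β (eul K i) ⁅E K l l, w⁆ := by
  induction hw using Submodule.span_induction with
  | mem x h =>
    obtain ⟨R, v, e, h, hR, hi, he, rfl⟩ := h
    rw [β_T_eq hq hI h hR hi he, E_mon h, map_smul]
  | zero => simp
  | add x y _ _ hx hy => rw [map_add, smul_add, hx, hy, br_add, map_add]
  | smul c x _ hx => rw [map_smul, smul_comm, hx, br_smul, map_smul]

theorem der_mem_freeAt {q : ℕ} {i e : Fin (m + 2)} (he : e ≠ i) {R : Finset (Fin (m + 2))}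
    {v : Lam K (m + 2)} (h : IsMon R v) (hR : R.card = q + 2) (hi : i ∉ R) : der e v ∈ freeAt K q i :=
  Submodule.subset_span ⟨R, v, e, h, hR, hi, he, rfl⟩

theorem der_th_mem_freeAt {q : ℕ} {i b e : Fin (m + 2)} (hb : b ≠ i) (he : e ≠ i)
    {R : Finset (Fin (m + 2))} {v : Lam K (m + 2)} (h : IsMon R v) (hR : R.card = q + 1)
    (hi : i ∉ R) : der e (th b * v) ∈ freeAt K q i := by
  rcases h.th_mul_cases b with h0 | ⟨hbR, h1⟩
  · rw [h0, map_zero]; exact zero_mem _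
  · exact der_mem_freeAt he h1 (by rw [Finset.card_insert_of_notMem hbR, hR]) (by
      simp [hi, hb.symm])

theorem br_mem_freeAt {q : ℕ} {i a b c d : Fin (m + 2)} (ha : a ≠ i) (hb : b ≠ i) (hc : c ≠ i)
    (hd : d ≠ i) {P : Finset (Fin (m + 2))} {x : Lam K (m + 2)} (h : IsMon P x)
    (hP : P.card = q + 1) (hi : i ∉ P) : ⁅der d x, T K a b c⁆ ∈ freeAt K q i := by
  rw [T, der_bracket h.mem (th_th_mem a b)]
  refine sub_mem ?_ (Submodule.smul_mem _ _ ?_)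
  · have key : ∀ b : Fin (m + 2), b ≠ i → der c (x * th b) ∈ freeAt K q i := by
      intro b hb
      rw [mul_comm_super h.mem (th_mem b), map_smul]
      exact Submodule.smul_mem _ _ (der_th_mem_freeAt hb hc h hP hi)
    rw [pd_th_th, mul_sub, map_sub]
    refine sub_mem ?_ ?_
    · split_ifs
      · exact key b hb
      · simp
    · split_ifs
      · exact key a ha
      · simp
  · rw [mul_assoc]
    by_cases hcP : c ∈ P
    · rcases (h.pd hcP).th_mul_cases b with h0 | ⟨hbR, h1⟩
      · rw [h0]; simp
      · refine der_th_mem_freeAt ha hd h1 ?_ ?_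
        · rw [Finset.card_insert_of_notMem hbR, Finset.card_erase_add_one hcP, hP]
        · simp [hb.symm, hi]
    · rw [h.off c hcP]; simp

variable (S) in
/-- The span of the `{θ_i 𝓔, w}` with `w` free of the index `i`. -/
def eulSpan (q : ℕ) : Submodule K L.carrier :=
  Submodule.span K {x | ∃ (R : Finset (Fin (m + 2))) (v : Lam K (m + 2)) (i e : Fin (m + 2)),
    IsMon R v ∧ R.card = q + 2 ∧ i ∉ R ∧ e ≠ i ∧ x = S.β (eul K i) (der e v)}

theorem β_eul_mem {q : ℕ} {i : Fin (m + 2)} {w : (cartanW K (m + 2)).carrier}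
    (hw : w ∈ freeAt K q i) : S.β (eul K i) w ∈ S.eulSpan q := by
  have : freeAt K q i ≤ (S.eulSpan q).comap (S.β (eul K i)) := by
    refine Submodule.span_le.2 ?_
    rintro _ ⟨R, v, e, h, hR, hi, he, rfl⟩
    exact Submodule.subset_span ⟨R, v, i, e, h, hR, hi, he, rfl⟩
  exact this hw

/-- Unless `β_same` makes the bracket vanish, some index i of the large factor is different from a,
b, c, d. Splitting off θ_i presents the bracket as β(θ_i X, Y) with X and Y free of i. Then `β_T_br`
and `β_T_freeAt` express it by β(θ_i 𝓔, [X, Y]). -/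
theorem β_mem_eulSpan {q : ℕ} (hq : 1 ≤ q) (hI : ∀ j : ℤ, j ≤ q + 1 → S.Inj j)
    {a b c d : Fin (m + 2)} (hab : a ≠ b) {R : Finset (Fin (m + 2))} {v : Lam K (m + 2)}
    (h : IsMon R v) (hR : R.card = q + 2) : S.β (T K a b c) (der d v) ∈ S.eulSpan q := by
  have split : ∀ {i}, i ∈ R → IsMon (R.erase i) (pd i v) ∧ (R.erase i).card = q + 1 ∧
      v = th i * pd i v := fun {i} hi =>
    ⟨h.pd hi, by rw [Finset.card_erase_of_mem hi, hR]; rfl, (h.on i hi).symm⟩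
  have same : ∀ {i b}, i ∈ R → i ≠ b → i ≠ c → i ≠ d → S.β (T K i b c) (der d v) = 0 := by
    intro i b hi hb hc hd
    obtain ⟨h1, h2, h3⟩ := split hi
    rw [h3]
    exact β_same hq hI hb.symm hc.symm hd.symm h1 h2
  by_cases ha : a ∈ R ∧ a ≠ c ∧ a ≠ d
  · rw [same ha.1 hab ha.2.1 ha.2.2]; exact zero_mem _
  by_cases hb : b ∈ R ∧ b ≠ c ∧ b ≠ d
  · rw [T_swap, map_neg, LinearMap.neg_apply, same hb.1 hab.symm hb.2.1 hb.2.2, neg_zero]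
    exact zero_mem _
  obtain ⟨i, hi⟩ : ((R.erase c).erase d).Nonempty := by
    have h1 := Finset.pred_card_le_card_erase (s := R) (a := c)
    have h2 := Finset.pred_card_le_card_erase (s := R.erase c) (a := d)
    rw [← Finset.card_pos]
    omega
  obtain ⟨hid, hi⟩ := Finset.mem_erase.1 hi
  obtain ⟨hic, hi⟩ := Finset.mem_erase.1 hi
  obtain ⟨h1, h2, h3⟩ := split hi
  -- The index l is chosen so that X has weight 1 at l. The weight y of Y at l is then nonpositive,
  -- because a and b, if they occur in R, are among c and d.
  obtain ⟨l, hl⟩ : ((R.erase i).erase d).Nonempty := by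
    have h2 := Finset.pred_card_le_card_erase (s := R.erase i) (a := d)
    rw [← Finset.card_pos]
    omega
  obtain ⟨hld, hl⟩ := Finset.mem_erase.1 hl
  have hlR := Finset.mem_of_mem_erase hl
  have hai : a ≠ i := by rintro rfl; exact ha ⟨hi, hic, hid⟩
  have hbi : b ≠ i := by rintro rfl; exact hb ⟨hi, hic, hid⟩
  have hU := br_mem_freeAt (q := q) hai hbi hic.symm hid.symm h1 h2 (Finset.notMem_erase i R)
  have key := β_T_freeAt hq hI hU l
  have hx : monWt (R.erase i) d l = 1 := by simp only [monWt, if_pos hl, if_neg hld, sub_zero]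
  have hy : monWt {a, b} c l ≤ 0 := by
    by_cases hlc : l = c
    · simp only [monWt, if_pos hlc]; split_ifs <;> norm_num
    · have hlab : l ∉ ({a, b} : Finset (Fin (m + 2))) := by
        simp only [Finset.mem_insert, Finset.mem_singleton, not_or]
        constructor
        · rintro rfl; exact ha ⟨hlR, hlc, hld⟩
        · rintro rfl; exact hb ⟨hlR, hlc, hld⟩
      simp only [monWt, if_neg hlab, if_neg hlc, sub_zero, le_refl]
  have hwt : ⁅E K l l, ⁅der d (pd i v), T K a b c⁆⁆ =
      ((1 : K) + (monWt {a, b} c l : K)) • ⁅der d (pd i v), T K a b c⁆ := by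
    have e2 : ⁅E K l l, T K a b c⁆ = (monWt {a, b} c l : K) • T K a b c := E_mon (IsMon.th_th hab) l c
    rw [br_br_even (E_mem l l), E_mon h1, e2, hx, smul_br, br_smul]
    push_cast
    module
  rw [hwt, β_T_br hq hI hid.symm hab hic.symm h1 h2 l, hx, map_smul, ← h3] at key
  set z := S.β (der d v) (T K a b c)
  -- Comparing the two formulas for (q+1) β(θ_i E_ll, [X, Y]) leaves the common factor 1 - q y,
  -- which is positive because y ≤ 0.
  have hz : ((q : K) + 1) • z = S.β (eul K i) ⁅der d (pd i v), T K a b c⁆ := by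
    have e : ((1 : K) - q * (monWt {a, b} c l : K)) •
        (((q : K) + 1) • z - S.β (eul K i) ⁅der d (pd i v), T K a b c⁆) = 0 := by
      rw [← sub_eq_zero] at key
      rw [← key]
      push_cast
      module
    refine sub_eq_zero.1 ((smul_eq_zero.1 e).resolve_left ?_)
    have : (1 : ℤ) - q * monWt {a, b} c l ≠ 0 := by nlinarith [hy, (Nat.cast_nonneg q : (0 : ℤ) ≤ q)]
    exact_mod_cast this
  have hzm : z ∈ S.eulSpan q := by
    refine (Submodule.smul_mem_iff _ (s := (q : K) + 1) ?_).1 ?_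
    · exact_mod_cast Nat.succ_ne_zero q
    · rw [hz]; exact β_eul_mem hU
  have hd : S.σ (der d v) ∈ L.part ((q + 1 : ℤ) : ZMod 2) :=
    S.lev_le_part _ (S.σ_lev (mon_lev' h d (by rw [hR]; push_cast; ring)))
  rw [β_apply, br_skew (S.σ_one_mem (T_lev a b c)) hd, neg_mem_iff]
  exact Submodule.smul_mem _ _ hzm

theorem lev_le_eulSpan {q : ℕ} (hq : 1 ≤ q) (hI : ∀ j : ℤ, j ≤ q + 1 → S.Inj j) :
    S.lev (q + 2) ≤ S.eulSpan q := fun x hx =>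
  S.lev_induction (p := fun x => x ∈ S.eulSpan q) (hI _ le_rfl)
    (fun _ _ _ _ _ _ hab h hR => β_mem_eulSpan hq hI hab h hR) (zero_mem _) (fun _ _ => add_mem)
    (fun c _ => Submodule.smul_mem _ c) hx

/-! ### Reconstruction -/

/-- A consequence of [θ_i 𝓔, θ_l 𝓔] = 0: the element β(θ_i 𝓔, θ_l v ∂_e) is antisymmetric in i and
l, as is its image θ_i θ_l v ∂_e in W(n) up to a scalar. -/
theorem β_eul_swap {q : ℕ} (hq : 1 ≤ q) (hI : ∀ j : ℤ, j ≤ q + 1 → S.Inj j) {i l e : Fin (m + 2)}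
    (hi : e ≠ i) (hl : e ≠ l) {R : Finset (Fin (m + 2))} {v : Lam K (m + 2)} (h : IsMon R v)
    (hR : R.card = q + 1) : S.β (eul K i) (der e (th l * v)) = -S.β (eul K l) (der e (th i * v)) := by
  have hq0 : (q : K) ≠ 0 := by exact_mod_cast (by omega : q ≠ 0)
  have hR1 : (R.card : K) - 1 = q := by rw [hR]; push_cast; ring
  have h1 := β_br_one hq hI (eul_lev i) (eul_lev l) (mon_lev_nat h hR e)
  rw [eul_eul, map_zero, LinearMap.zero_apply, zero_sub, eul_der h hl, eul_der h hi, hR1, map_smul,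
    map_smul, ← smul_neg] at h1
  exact smul_right_injective _ hq0 h1

variable (S) in
/-- A map that recovers the elements of level `q + 2` from their images in `W(n)`. -/
def recon (q : ℕ) : (cartanW K (m + 2)).carrier →ₗ[K] L.carrier :=
  -- The operators ∂_e θ_e and θ_e ∂_e project onto the monomials without and with θ_e. A monomial
  -- of degree q + 3 has q + 3 or q + 2 indices different from e accordingly, and the coefficients
  -- average over them.
  ∑ e, ∑ l ∈ Finset.univ.erase e, S.β (eul K l) ∘ₗ der e ∘ₗ pd l ∘ₗ
    (((q : K) + 3)⁻¹ • (pd e ∘ₗ LinearMap.mulLeft K (th e)) +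
      ((q : K) + 2)⁻¹ • (LinearMap.mulLeft K (th e) ∘ₗ pd e)) ∘ₗ LinearMap.applyₗ (th e) ∘ₗ opr

theorem recon_der (q : ℕ) (e : Fin (m + 2)) (w : Lam K (m + 2)) : S.recon q (der e w) =
    ∑ l ∈ Finset.univ.erase e, S.β (eul K l) (der e (pd l
      (((q : K) + 3)⁻¹ • pd e (th e * w) + ((q : K) + 2)⁻¹ • (th e * pd e w)))) := by
  rw [recon, LinearMap.sum_apply, Finset.sum_eq_single e]
  · rw [LinearMap.sum_apply]
    refine Finset.sum_congr rfl fun l _ => ?_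
    have : LinearMap.applyₗ (th e) (opr (der e w)) = w := by
      change opr (der e w) (th e) = w
      rw [opr_der, pd_th, if_pos rfl, mul_one]
    simp only [LinearMap.comp_apply, this]
    rfl
  · intro e' _ he
    rw [LinearMap.sum_apply]
    refine Finset.sum_eq_zero fun l _ => ?_
    have : LinearMap.applyₗ (th e') (opr (der e w)) = 0 := by
      change opr (der e w) (th e') = 0
      rw [opr_der, pd_th, if_neg he.symm, mul_zero]
    simp only [LinearMap.comp_apply, this, map_zero]
  · simp

/-- An element β(θ_i 𝓔, v ∂_e) has image (q+1) θ_i v ∂_e. Stripping any θ_l with l ≠ e from θ_i v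
and bracketing with θ_l 𝓔 returns the same element, by `β_eul_swap`; so the average does as well. -/
theorem recon_φ {q : ℕ} (hq : 1 ≤ q) (hI : ∀ j : ℤ, j ≤ q + 1 → S.Inj j) {x : L.carrier}
    (hx : x ∈ S.eulSpan q) : S.recon q (S.φ.toLin x) = ((q : K) + 1) • x := by
  induction hx using Submodule.span_induction with
  | mem x h =>
    obtain ⟨R, v, i, e, h, hR, hi, he, rfl⟩ := h
    have hR1 : (R.card : K) - 1 = q + 1 := by rw [hR]; push_cast; ring
    rw [S.φ_β, eul_der h he, hR1, map_smul, recon_der]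
    congr 1
    have hw := h.th_mul hi
    set w := th i * v with hw'
    set P := insert i R with hP
    have hPc : P.card = q + 3 := by rw [hP, Finset.card_insert_of_notMem hi, hR]
    have hval : ∀ l ∈ P, l ≠ e → S.β (eul K l) (der e (pd l w)) = S.β (eul K i) (der e v) := by
      intro l hl hle
      rcases eq_or_ne l i with rfl | hli
      · rw [hw', pd_th_mul_self, h.off l hi, mul_zero, sub_zero]
      · have hlR : l ∈ R := (Finset.mem_insert.1 hl).resolve_left hli
        rw [hw', pd_th_mul_ne hli, map_neg, map_neg]
        conv_rhs => rw [← h.on l hlR]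
        rw [β_eul_swap hq hI he hle.symm (h.pd hlR) (by rw [Finset.card_erase_of_mem hlR, hR]; rfl)]
    have hsum : ∀ c : K, ∑ l ∈ Finset.univ.erase e, S.β (eul K l) (der e (pd l (c • w))) =
        (c * ((P.erase e).card : K)) • S.β (eul K i) (der e v) := by
      intro c
      rw [← Finset.sum_subset (Finset.erase_subset_erase e (Finset.subset_univ P))]
      · rw [Finset.sum_congr rfl fun l hl => show _ = c • S.β (eul K i) (der e v) by
          obtain ⟨h1, h2⟩ := Finset.mem_erase.1 hl
          rw [map_smul, map_smul, map_smul, hval l h2 h1], Finset.sum_const, ← Nat.cast_smul_eq_nsmul K,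
          smul_smul, mul_comm]
      · intro l hl hlP
        have hlP' : l ∉ P := fun h => hlP (Finset.mem_erase.2 ⟨Finset.ne_of_mem_erase hl, h⟩)
        rw [map_smul, hw.off l hlP']
        simp
    by_cases heP : e ∈ P
    · rw [hw.th_mul_eq_zero heP, hw.on e heP, map_zero, smul_zero, zero_add, hsum,
        Finset.card_erase_of_mem heP, hPc, Nat.add_sub_cancel (q + 2) 1]
      push_cast
      rw [inv_mul_cancel₀, one_smul]
      exact_mod_cast (by omega : q + 2 ≠ 0)
    · rw [hw.off e heP, mul_zero, smul_zero, add_zero, pd_th_mul_self, hw.off e heP, mul_zero,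
        sub_zero, hsum, Finset.erase_eq_of_notMem heP, hPc]
      push_cast
      rw [inv_mul_cancel₀, one_smul]
      exact_mod_cast (by omega : q + 3 ≠ 0)
  | zero => simp
  | add x y _ _ hx hy => rw [map_add, map_add, hx, hy, smul_add]
  | smul c x _ hx => rw [map_smul, map_smul, hx, smul_comm]

theorem inj_succ {q : ℕ} (hq : 1 ≤ q) (hI : ∀ j : ℤ, j ≤ q + 1 → S.Inj j) : S.Inj (q + 2) := by
  intro x hx h
  have e := recon_φ hq hI (lev_le_eulSpan hq hI hx)
  rw [h, map_zero] at e
  exact (smul_eq_zero.1 e.symm).resolve_left (by exact_mod_cast Nat.succ_ne_zero q)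

/-- The additional relations enter only at level two; from level three on injectivity is inherited.
-/
theorem inj_all (hJ : S.JSys) : ∀ k : ℤ, S.Inj k := by
  have key : ∀ q : ℕ, ∀ j : ℤ, j ≤ q + 1 → S.Inj j := by
    intro q
    induction q with
    | zero => exact fun j hj => S.inj_of_le_one (by simpa using hj)
    | succ q ih =>
      intro j hj
      rcases lt_or_eq_of_le hj with h | rfl
      · exact ih j (by push_cast at h; omega)
      · rcases Nat.eq_zero_or_pos q with rfl | hq
        · exact inj_two hJ
        · have := inj_succ hq ih
          convert this using 1
          push_cast; ring
  exact fun k => key k.toNat k (by omega)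

theorem φ_injective (hJ : S.JSys) : Function.Injective S.φ.toLin := by
  rw [← LinearMap.ker_eq_bot]
  exact S.graded_ker.eq_bot fun μ x hx hμ => inj_all hJ _ x (S.wt_le_lev μ hμ) hx

end WSys

end

section

open Grassmann LieSuperalgebra

/-! ### Levels of words -/

theorem freeLieSuperalgebra.level_le {K : Type u} [Field K] {X : Type v} (p : X → ZMod 2)
    (d : X → ℤ) {L : LieSuperalgebra.{u, w} K} (π : (freeLieSuperalgebra K p).Hom L)
    (N : ℤ → Submodule K L.carrier) (hN : ∀ x, π.toLin (freeLieSuperalgebra.of K p x) ∈ N (d x))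
    (hb : ∀ i j, ∀ x ∈ N i, ∀ y ∈ N j, ⁅x, y⁆ ∈ N (i + j)) (k : ℤ) :
    (freeLieSuperalgebra.level K p d k).map π.toLin ≤ N k := by
  have key : ∀ a : FreeMagma X, π.toLin ((freeLieSuperIdeal K p).mkQ
      (MonoidAlgebra.ofMagma K (FreeMagma X) a)) ∈ N (wordDegree d a) := by
    intro a
    induction a with
    | ih1 x => exact hN x
    | ih2 a b ha hb' =>
      have e : (freeLieSuperIdeal K p).mkQ (MonoidAlgebra.ofMagma K (FreeMagma X)
          (a * b)) = (freeLieSuperalgebra K p).bracket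
          ((freeLieSuperIdeal K p).mkQ (MonoidAlgebra.ofMagma K (FreeMagma X) a))
          ((freeLieSuperIdeal K p).mkQ (MonoidAlgebra.ofMagma K (FreeMagma X) b)) :=
        congrArg _ (map_mul (MonoidAlgebra.ofMagma K (FreeMagma X)) a b)
      rw [e]
      refine (congrArg (· ∈ N (wordDegree d (a * b))) (π.map_bracket _ _)).mpr ?_
      exact hb _ _ _ ha _ hb'
  rintro _ ⟨_, ⟨x, hx, rfl⟩, rfl⟩
  have hs : wordPart K d k ≤
      ((N k).comap π.toLin).comap (freeLieSuperIdeal K p).mkQ := by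
    refine Submodule.span_le.2 ?_
    rintro _ ⟨a, ha, rfl⟩
    have := key a
    rwa [show wordDegree d a = k from ha] at this
  exact hs hx

theorem of_mem_WTildeLevel {K : Type u} [Field K] {n : ℕ} (x : WGen n) :
    toWTilde K n (freeLieSuperalgebra.of K WGen.parity x) ∈ WTildeLevel K n (WGen.level x) :=
  ⟨_, ⟨_, Submodule.subset_span ⟨FreeMagma.of x, rfl, rfl⟩, rfl⟩, rfl⟩

theorem bracket_mem_WTildeLevel {K : Type u} [Field K] {n : ℕ} {i j : ℤ}
    {x y : (WTilde K n).carrier} (hx : x ∈ WTildeLevel K n i) (hy : y ∈ WTildeLevel K n j) :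
    ⁅x, y⁆ ∈ WTildeLevel K n (i + j) := by
  obtain ⟨_, ⟨x, hx, rfl⟩, rfl⟩ := hx
  obtain ⟨_, ⟨y, hy, rfl⟩, rfl⟩ := hy
  exact ⟨_, ⟨_, wordPart_mul _ _ _ hx hy, rfl⟩, rfl⟩

/-! ### Transitivity of W(n), maximality of the kernel, and the presentation -/

namespace WSys

variable {K : Type u} [Field K] [CharZero K] {m : ℕ} {L : LieSuperalgebra.{u, u} K}

/-- Transitivity of W(n): if w commutes with all ∂_j, its coefficients are constants, so w has level
-1 as well as level k ≥ 0. -/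
theorem eq_zero_of_D {k : ℤ} (hk : 0 ≤ k) {w : (cartanW K (m + 2)).carrier}
    (hw : w ∈ (std K m).lev k) (h : ∀ j : Fin (m + 2), ⁅D K j, w⁆ = 0) : w = 0 := by
  have hc : ∀ i, ∃ c : K, opr w (th i) = c • 1 := by
    intro i
    refine exists_smul_one fun j => ?_
    have e : ⁅D K j, w⁆ = ∑ l, der l (pd j (opr w (th l))) := by
      nth_rewrite 1 [eq_sum_der w]
      rw [br_sum]
      simp only [D_der]
    have := congrArg (fun z => opr z (th i)) e
    simpa [h, opr_der, pd_th] using this.symm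
  have hm : w ∈ (std K m).lev (-1) := by
    rw [eq_sum_der w]
    refine Submodule.sum_mem _ fun i _ => ?_
    obtain ⟨c, hc⟩ := hc i
    rw [hc, map_smul]
    exact Submodule.smul_mem _ _ (D_lev i)
  rw [lev_eq_wlev] at hw hm
  refine (std K m).toSl.eq_zero_of_proj fun μ => ?_
  by_cases hμ : ∑ l, μ l = k
  · exact hm μ (by omega)
  · exact hw μ hμ

variable (S : WSys K m L)

/-- An ideal without elements of levels up to one lies in the kernel. -/
theorem le_ker {I : L.Ideal} (h : ∀ k : ℤ, k ≤ 1 → ∀ x ∈ I.toSubmodule, x ∈ S.lev k → x = 0) :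
    I ≤ S.φ.ker := by
  have key : ∀ q : ℕ, ∀ k : ℤ, k ≤ q + 1 → ∀ x ∈ I.toSubmodule, x ∈ S.lev k →
      S.φ.toLin x = 0 := by
    intro q
    induction q with
    | zero =>
      intro k hk x hx hxk
      rw [h k (by simpa using hk) x hx hxk, map_zero]
    | succ q ih =>
      intro k hk x hx hxk
      rcases lt_or_ge k 0 with h0 | h0
      · rw [h k (by omega) x hx hxk, map_zero]
      -- Bracketing with a lift of ∂_j stays in the ideal and lowers the level by one, so the
      -- induction hypothesis applies.
      · refine eq_zero_of_D h0 (S.φ_lev hxk) fun j => ?_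
        rw [← S.φ_σ (D K j), ← S.φ.map_bracket]
        exact ih (-1 + k) (by push_cast at hk; omega) _ (I.bracket_mem _ _ hx)
          (S.bracket_lev (S.σ_lev (D_lev j)) hxk)
  intro x hx
  have hI : S.toSl.Graded I.toSubmodule := S.graded_of_stable fun a => I.bracket_mem _
  change S.φ.toLin x = 0
  refine hI.induction (p := fun x => S.φ.toLin x = 0) (map_zero _) ?_ ?_ ?_ hx
  · intro μ x hx hμ
    exact key (∑ l, μ l).toNat _ (by omega) x hx (S.wt_le_lev μ hμ)
  · intro x y hx hy; rw [map_add, hx, hy, add_zero]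
  · intro c x hx; rw [map_smul, hx, smul_zero]

/-- The homomorphism to `W(n)` is injective on sums of elements of levels `1`, `0`, `-1`. -/
theorem inj_local {x y z : L.carrier} (hx : x ∈ S.lev 1) (hy : y ∈ S.lev 0) (hz : z ∈ S.lev (-1))
    (h : S.φ.toLin (x + y + z) = 0) : x + y + z = 0 := by
  rw [lev_eq_wlev] at hx hy hz
  refine S.toSl.eq_zero_of_proj fun μ => ?_
  by_cases hμ : ∑ l, μ l ≤ 1
  · refine S.inj_of_le_one hμ _ (S.proj_mem_lev μ _) ?_
    rw [S.φ_proj, h, map_zero]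
  · rw [map_add, map_add, hx μ (by omega), hy μ (by omega), hz μ (by omega), add_zero, add_zero]

theorem jsys_ofHom (π : (freeW K (m + 2)).Hom L) (hπ : Function.Surjective π.toLin)
    (hrel : ∀ x, WTildeRel K (cartanMatrixA (m + 2)) x → π.toLin x = 0)
    (φ : L.Hom (cartanW K (m + 2))) (hφ : ∀ x, φ.toLin (π.toLin x) = (freeToW K m).toLin x)
    (hJ : ∀ x, JRel K x → π.toLin x = 0) : (ofHom π hπ hrel φ hφ).JSys := by
  have hg : ∀ a (ha : a.val ≠ 1), (ofHom π hπ hrel φ hφ).g a = π.toLin (f0Gen K a ha) :=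
    fun a ha => dif_pos ha
  have hf : (ofHom π hπ hrel φ hφ).f 0 = π.toLin (fGen K (Fin.succ 0) (by simp)) := rfl
  refine ⟨fun a b => ?_, fun i j hi hj => ?_, fun t j ht hj => ?_⟩
  · by_cases ha : a.val = 1
    · rw [show a = 1 from Fin.ext ha, g_one, zero_br]
    by_cases hb : b.val = 1
    · rw [show b = 1 from Fin.ext hb, g_one, br_zero]
    rw [hg a ha, hg b hb, ← π.map_bracket]
    exact hJ _ (.f0_f0 a b ha hb)
  · rw [hg i (by omega), hg j (by omega), hf, ← π.map_bracket, ← π.map_bracket]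
    exact hJ _ (.f0_f0_f1 i j _ _ _ _ hi hj rfl)
  · rw [hg t (by omega), hg 0 (by simp), hg j (by omega), hf, ← map_sub, ← π.map_bracket,
      ← π.map_bracket]
    exact hJ _ (.f02_f00 t 0 j _ _ _ _ _ ht rfl hj rfl)

theorem ofHom_bijective (π : (freeW K (m + 2)).Hom L) (hπ : Function.Surjective π.toLin)
    (hrel : ∀ x, WTildeRel K (cartanMatrixA (m + 2)) x → π.toLin x = 0)
    (φ : L.Hom (cartanW K (m + 2))) (hφ : ∀ x, φ.toLin (π.toLin x) = (freeToW K m).toLin x)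
    (hJ : ∀ x, JRel K x → π.toLin x = 0) : Function.Bijective φ.toLin :=
  ⟨φ_injective (jsys_ofHom π hπ hrel φ hφ hJ), (ofHom π hπ hrel φ hφ).φ_surjective⟩

/-! ### The system of generators of `W̃` -/

variable (K m)

/-- The projection onto `W̃`. -/
def tildeProj : (freeW K (m + 2)).Hom (WTilde K (m + 2)) := (freeW K (m + 2)).quotientHom _

theorem tildeProj_surjective : Function.Surjective (tildeProj K m).toLin :=
  quotientHom_surjective _ _

variable {K} in
theorem tildeProj_rel {x : (freeW K (m + 2)).carrier}
    (hx : WTildeRel K (cartanMatrixA (m + 2)) x) : (tildeProj K m).toLin x = 0 :=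
  (quotientHom_eq_zero _ _).2 (subset_idealSpan _ _ hx)

/-- The homomorphism from `W̃` to `W(n)`. -/
def tildeToW : (WTilde K (m + 2)).Hom (cartanW K (m + 2)) :=
  quotientLift _ (freeToW K m) (idealSpan_le _ fun _ hx => freeToW_rel hx)

/-- The standard generators of `W̃`. -/
def tilde : WSys K m (WTilde K (m + 2)) :=
  ofHom (tildeProj K m) (tildeProj_surjective K m) (fun _ => tildeProj_rel m) (tildeToW K m)
    fun _ => rfl

/-- The sign reconciles the two conventions: e_0 has level 1 in W̃ but maps to ∂_0, of degree -1 in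
W(n). -/
theorem WTildeLevel_le_lev (k : ℤ) : WTildeLevel K (m + 2) k ≤ (tilde K m).lev (-k) := by
  refine freeLieSuperalgebra.level_le WGen.parity WGen.level (tildeProj K m)
    (fun k => (tilde K m).lev (-k)) (fun x => ?_) (fun i j x hx y hy => ?_) k
  · cases x with
    | e a =>
      refine Fin.cases ?_ (fun i => ?_) a
      · exact (tilde K m).e0_mem_V1
      · have := (tilde K m).wt_le_lev _ ((tilde K m).e_wt i)
        rwa [sum_root] at this
    | f i hi =>
      obtain ⟨j, rfl⟩ := exists_succ_of_val_ne hi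
      have := (tilde K m).wt_le_lev _ ((tilde K m).f_wt j)
      simp only [Pi.neg_apply, Finset.sum_neg_distrib, sum_root] at this
      exact this
    | h a =>
      have := (tilde K m).wt_le_lev _ ((tilde K m).h_wt a)
      simp only [Pi.zero_apply, Finset.sum_const_zero] at this
      exact this
    | f0 a ha =>
      have := (tilde K m).wt_le_lev _ ((tilde K m).g_wt a)
      rw [sum_single_zero] at this
      have e : (tilde K m).g a = (tildeProj K m).toLin (f0Gen K a ha) := dif_pos ha
      rw [e] at this
      exact this
  · rw [neg_add]
    exact (tilde K m).bracket_lev hx hy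

theorem e_mem_WTildeLevel (i : Fin (m + 1)) : (tilde K m).e i ∈ WTildeLevel K (m + 2) 0 :=
  of_mem_WTildeLevel (.e i.succ)

theorem f_mem_WTildeLevel (i : Fin (m + 1)) : (tilde K m).f i ∈ WTildeLevel K (m + 2) 0 :=
  of_mem_WTildeLevel (.f i.succ (by simp))

variable {K m} in
theorem zero_bracket_mem_WTildeLevel {k : ℤ} {x y : (WTilde K (m + 2)).carrier}
    (hx : x ∈ WTildeLevel K (m + 2) 0) (hy : y ∈ WTildeLevel K (m + 2) k) :
    ⁅x, y⁆ ∈ WTildeLevel K (m + 2) k := by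
  simpa using bracket_mem_WTildeLevel hx hy

theorem gl_le_WTildeLevel : (tilde K m).lev 0 ≤ WTildeLevel K (m + 2) 0 := fun x hx => by
  refine (tilde K m).gl_induction (p := fun x => x ∈ WTildeLevel K (m + 2) 0) (fun a => ?_)
    (zero_mem _) (fun _ _ => add_mem) (fun c _ => Submodule.smul_mem _ c) ?_ ?_ hx
  · exact of_mem_WTildeLevel (.h a)
  · exact fun i x hx => zero_bracket_mem_WTildeLevel (e_mem_WTildeLevel K m i) hx
  · exact fun i x hx => zero_bracket_mem_WTildeLevel (f_mem_WTildeLevel K m i) hx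

theorem V1_le_WTildeLevel : (tilde K m).lev (-1) ≤ WTildeLevel K (m + 2) 1 := fun x hx => by
  refine (tilde K m).V1_induction (p := fun x => x ∈ WTildeLevel K (m + 2) 1) ?_
    (fun _ _ => add_mem) (fun c _ => Submodule.smul_mem _ c) ?_ hx
  · exact of_mem_WTildeLevel (.e 0)
  · exact fun i x _ hx => zero_bracket_mem_WTildeLevel (e_mem_WTildeLevel K m i) hx

theorem M_le_WTildeLevel : (tilde K m).lev 1 ≤ WTildeLevel K (m + 2) (-1) := by
  have hg : (tilde K m).gs ≤ WTildeLevel K (m + 2) (-1) := by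
    refine Submodule.span_le.2 ?_
    rintro _ ⟨a, rfl⟩
    change (if ha : a.val ≠ 1 then (tildeProj K m).toLin (f0Gen K a ha) else 0) ∈ _
    split_ifs with ha
    · exact of_mem_WTildeLevel (.f0 a ha)
    · exact zero_mem _
  refine clos_le (sup_le (clos_le hg ?_) (clos_le hg ?_)) ?_
  · rintro _ ⟨i, -, rfl⟩ x hx
    exact zero_bracket_mem_WTildeLevel (e_mem_WTildeLevel K m i) hx
  · rintro _ ⟨i, -, rfl⟩ x hx
    exact zero_bracket_mem_WTildeLevel (f_mem_WTildeLevel K m i) hx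
  · rintro _ ⟨i, rfl⟩ x hx
    exact zero_bracket_mem_WTildeLevel (f_mem_WTildeLevel K m i) hx

theorem lev_le_WTildeLocal {k : ℤ} (hk : k ≤ 1) : (tilde K m).lev k ≤ WTildeLocal K (m + 2) := by
  rcases lt_or_ge k (-1) with h | h
  · rw [lev_eq_bot _ h]; exact bot_le
  obtain rfl | rfl | rfl : k = 1 ∨ k = 0 ∨ k = -1 := by omega
  · exact (M_le_WTildeLevel K m).trans (le_sup_left.trans le_sup_left)
  · exact (gl_le_WTildeLevel K m).trans (le_sup_right.trans le_sup_left)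
  · exact (V1_le_WTildeLevel K m).trans le_sup_right

theorem ker_inf_WTildeLocal : (tildeToW K m).ker.toSubmodule ⊓ WTildeLocal K (m + 2) = ⊥ := by
  refine eq_bot_iff.2 ?_
  rintro x ⟨hx, hl⟩
  obtain ⟨_, h, z, hz, rfl⟩ := Submodule.mem_sup.1 hl
  obtain ⟨x, hx', y, hy, rfl⟩ := Submodule.mem_sup.1 h
  exact (Submodule.mem_bot K).2 ((tilde K m).inj_local (WTildeLevel_le_lev K m _ hx')
    (WTildeLevel_le_lev K m _ hy) (WTildeLevel_le_lev K m _ hz) hx)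

/-- The kernel misses the local part by `inj_local`. Conversely, an ideal missing the local part has
no nonzero element of `lev k` with k ≤ 1, and `le_ker` places it in the kernel. -/
theorem isGreatest_ker : IsGreatest {I : (WTilde K (m + 2)).Ideal |
    I.toSubmodule ⊓ WTildeLocal K (m + 2) = ⊥} (tildeToW K m).ker := by
  refine ⟨ker_inf_WTildeLocal K m, fun I hI => (tilde K m).le_ker fun k hk x hx hxk => ?_⟩
  have : x ∈ I.toSubmodule ⊓ WTildeLocal K (m + 2) := ⟨hx, lev_le_WTildeLocal K m hk hxk⟩
  rwa [show _ = _ from hI, Submodule.mem_bot] at this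

/-- The ideal of `W̃` generated by the additional relations. -/
def jIdeal : (WTilde K (m + 2)).Ideal :=
  (WTilde K (m + 2)).idealSpan (toWTilde K (m + 2) '' {x | JRel K x})

theorem jIdeal_le : jIdeal K m ≤ (tildeToW K m).ker := by
  refine idealSpan_le _ ?_
  rintro _ ⟨x, hx, rfl⟩
  exact freeToW_jrel hx

theorem quotientLift_jIdeal_bijective :
    Function.Bijective (quotientLift (jIdeal K m) (tildeToW K m) (jIdeal_le K m)).toLin := by
  refine ofHom_bijective (((WTilde K (m + 2)).quotientHom (jIdeal K m)).comp (tildeProj K m)) ?_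
    (fun x hx => ?_) _ (fun _ => rfl) fun x hx => ?_
  · exact (quotientHom_surjective _ _).comp (tildeProj_surjective K m)
  · change ((WTilde K (m + 2)).quotientHom (jIdeal K m)).toLin ((tildeProj K m).toLin x) = 0
    rw [tildeProj_rel m hx, map_zero]
  · exact (quotientHom_eq_zero _ _).2 (subset_idealSpan _ _ ⟨x, hx, rfl⟩)

/-- The quotient of W̃ by the ideal of the additional relations already maps injectively to W(n), so
nothing else is in the kernel. -/
theorem ker_eq_jIdeal : (tildeToW K m).ker = jIdeal K m := by
  refine le_antisymm (fun x hx => ?_) (jIdeal_le K m)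
  refine (quotientHom_eq_zero _ _).1 ((quotientLift_jIdeal_bijective K m).1 ?_)
  rw [map_zero, quotientLift_apply]
  exact hx

theorem nonempty_iso_presentedW : Nonempty ((presentedW K
    ({x : (freeW K (m + 2)).carrier | WTildeRel K (cartanMatrixA (m + 2)) x} ∪ {x | JRel K x})).Iso
      (cartanW K (m + 2))) := by
  have hle : (freeW K (m + 2)).idealSpan
      ({x : (freeW K (m + 2)).carrier | WTildeRel K (cartanMatrixA (m + 2)) x} ∪
        {x | JRel K x}) ≤ (freeToW K m).ker :=
    idealSpan_le _ (Set.union_subset (fun _ hx => freeToW_rel hx) fun _ hx => freeToW_jrel hx)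
  refine ⟨(quotientLift _ (freeToW K m) hle).toIso (ofHom_bijective
    ((freeW K (m + 2)).quotientHom _) (quotientHom_surjective _ _)
    (fun x hx => ?_) _ (fun _ => rfl) fun x hx => ?_)⟩
  · exact (quotientHom_eq_zero _ _).2 (subset_idealSpan _ _ (Or.inl hx))
  · exact (quotientHom_eq_zero _ _).2 (subset_idealSpan _ _ (Or.inr hx))

end WSys

end

end

/-- `J` is the largest ideal of `W̃(A_{n-1})` that intersects the local part trivially, it is
generated by the additional relations, and `W(A_{n-1}) = W̃(A_{n-1})/J` is isomorphic to `W(n)`.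
Thus `W(n)` is presented by the generators `e_a, f_i, h_a, f_{0a}` and all the relations. -/
theorem mainTheorem1 {K : Type*} [Field K] [IsAlgClosed K] [CharZero K] (n : ℕ) (hn : 2 ≤ n) :
    ∃ J : (WTilde K n).Ideal,
      IsGreatest {I : (WTilde K n).Ideal | I.toSubmodule ⊓ WTildeLocal K n = ⊥} J ∧
      Nonempty (((WTilde K n).quotient J).Iso (cartanW K n)) ∧
      J = (WTilde K n).idealSpan (toWTilde K n '' {x | JRel K x}) ∧
      Nonempty ((presentedW K
        ({x : (freeW K n).carrier | WTildeRel K (cartanMatrixA n) x} ∪ {x | JRel K x})).Iso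
          (cartanW K n)) := by
  obtain ⟨m, rfl⟩ : ∃ m, n = m + 2 := ⟨n - 2, by omega⟩
  have h := WSys.isGreatest_ker K m
  rw [WSys.ker_eq_jIdeal] at h
  exact ⟨WSys.jIdeal K m, h, ⟨LieSuperalgebra.Hom.toIso _ (WSys.quotientLift_jIdeal_bijective K m)⟩,
    rfl, WSys.nonempty_iso_presentedW K m⟩
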